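/- Let $\alpha_0,c_0>0$. For $\varepsilon>0$ put $\alpha=\varepsilon^2\alpha_0$, $c=\varepsilon c_0$. For $l\in\mathbb R$ and $m\in\mathbb N$ let $H^l(\mathbb C^m)$ be the space of $U(p)=\sum_{n\in\mathbb Z}U_ne^{inp}$ with $U_n\in\mathbb C^m$ and $\|U\|_{H^l}^2=\sum_{n\in\mathbb Z}(1+n^2)^l|U_n|^2<\infty$, and let $\mathcal E_{l_1,l_2}=H^{l_1}(\mathbb C^4)\times H^{l_2}(\mathbb C^2)$, $\mathcal E_l=\mathcal E_{l,l}$. Consider $$\partial_\xi (U,W)=L(U,W)+\mathcal N(U,W) \qquad (1)$$ on $\mathcal E_l$, where $L:\mathcal E_{l+4,l+2}\to\mathcal E_l$ acts on the $n$-th Fourier coefficients $(U_n,W_n)=(U_{n0},U_{n1},U_{n2},U_{n3},W_{n0},W_{n1})$ as the block-diagonal matrix $L_n=\operatorname{diag}(L_n^{\rm SH},L_n^{\rm con})$, $$L_n^{\rm SH}=\begin{pmatrix}0&1&0&0\\0&0&1&0\\0&0&0&1\\-(1-n^2)^2+\alpha&-4in(1-n^2)+c&6n^2-2&-4in\end{pmatrix},\qquad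 L_n^{\rm con}=\begin{pmatrix}0&1\\n^2&-2in-c\end{pmatrix},$$ and $$\mathcal N_n(U,W)=\Big(0,0,0,\sum_{p+q=n}U_{p0}W_{q0}-(1+\gamma)\sum_{p+q+r=n}U_{p0}U_{q0}U_{r0},\,0,\,2c\gamma\sum_{p+q=n}U_{p0}U_{q1}\Big).$$ (This is the first-order form in $\xi$ of $-c\partial_\xi\mathcal U=-(1+(\partial_\xi+\partial_p)^2)^2\mathcal U+\alpha\,\mathcal U+\mathcal U\mathcal W-(1+\gamma)\mathcal U^3$, $-c\partial_\xi\mathcal W=(\partial_\xi+\partial_p)^2\mathcal W-\gamma c\,\partial_\xi(\mathcal U^2)$ for functions $2\pi$-periodic in $p$.) Let $\mathcal P_c$ act on the $n$-th coefficients by the Dunford integral $P_{n,c}=\frac1{2\pi i}\oint_{|\lambda|=1/2}(\lambda-L_n)^{-1}d\lambda$, which for small $\varepsilon$ is the spectral projection of $L_n$ onto its central eigenvalues, those with real part $\mathcal O(\varepsilon)$; let $\mathcal P_h=1-\mathcal P_c$, $\mathcal E_c=\mathcal P_c\mathcal E_l$, $\mathcal E_h=\mathcal P_h\mathcal E_l$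 and $L_c=\mathcal P_cL$. As $L_n$ is block-diagonal, $\mathcal E_c$ is the product of a subspace of $H^l(\mathbb C^4)$ and a subspace of $H^l(\mathbb C^2)$, and so is $\mathcal E_h$. A solution of (1) on an interval $I$ is a map $X:I\to\mathcal E_l$ with values in $\mathcal E_{l+4,l+2}$, differentiable in $\mathcal E_l$ with $\partial_\xi X=LX+\mathcal N(X)$ at every $\xi\in I$. **Theorem.** Let $l>1/2$, $\delta\in(0,1/3)$ and $\gamma\in\mathbb R$. There are $r,R,\varepsilon_0>0$ such that for every $\varepsilon\in(0,\varepsilon_0)$ the space $\mathcal E_c$ has complex dimension $6$, and there are an open neighbourhood $O_c=O_u\times O_w\subset\mathcal E_c$ of the origin and a $C^1$ map $h=(h_u,h_w):O_c\to\mathcal E_h$ with $h(0)=0$ and $Dh(0)=0$ such that: * $O_u$ contains the ball of radius $r\varepsilon^{2/3+\delta}$ about $0$ and is contained in the ball of radius $R\varepsilon^{2/3+\delta}$; $O_w$ contains the ball of radius $r\varepsilon^{4/3}$ about $0$ and is contained in the ball of radius $R\varepsilon^{4/3}$ (balls in the $H^l$-norm within the respective factor of $\mathcal E_c$). * The center manifold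 $\mathcal M_c=\{(U_c,W_c)+h(U_c,W_c):(U_c,W_c)\in O_c\}$ contains all small bounded solutions: if $(U,W)$ solves (1) on $\mathbb R$ and $\|U(\xi)\|_{H^l}<r\varepsilon^{2/3+\delta}$, $\|W(\xi)\|_{H^l}<r\varepsilon^{4/3}$ for all $\xi\in\mathbb R$, then $(U,W)(\xi)\in\mathcal M_c$ for all $\xi\in\mathbb R$. * If $I$ is an interval and $(U_c,W_c):I\to O_c$ is differentiable and solves the reduced system $$\partial_\xi(U_c,W_c)=L_c(U_c,W_c)+\mathcal P_c\,\mathcal N\big(U_c+h_u(U_c,W_c),\,W_c+h_w(U_c,W_c)\big)$$ on $I$, then $(U,W)=(U_c,W_c)+h(U_c,W_c)$ is a solution of (1) on $I$. -/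

import Mathlib

open Set Filter Topology Matrix

noncomputable section

namespace ModFront

/-! ### The spaces `H^l(ℂ^m)` of `2π`-periodic functions, through their Fourier coefficients -/

/-- A sequence of Fourier coefficients in `ℂ^m` (with the Euclidean norm). -/
abbrev Coeffs (m : ℕ) : Type := ℤ → EuclideanSpace ℂ (Fin m)

/-- `u ∈ H^l(ℂ^m)`, i.e. `∑ (1 + n²)^l |u_n|² < ∞`. -/
def MemH (l : ℝ) {m : ℕ} (u : Coeffs m) : Prop :=
  Summable fun n : ℤ => (1 + (n : ℝ) ^ 2) ^ l * ‖u n‖ ^ 2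

/-- The weighted coefficients `(1 + n²)^(l/2) u_n`. -/
def weighted (l : ℝ) {m : ℕ} (u : Coeffs m) : Coeffs m :=
  fun n => (((1 + (n : ℝ) ^ 2) ^ (l / 2) : ℝ) : ℂ) • u n

theorem norm_weighted_sq (l : ℝ) {m : ℕ} (u : Coeffs m) (n : ℤ) :
    ‖weighted l u n‖ ^ 2 = (1 + (n : ℝ) ^ 2) ^ l * ‖u n‖ ^ 2 := by
  have h : (0 : ℝ) < 1 + (n : ℝ) ^ 2 := by positivity
  rw [weighted, norm_smul, mul_pow, Complex.norm_real, Real.norm_eq_abs, sq_abs,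
    ← Real.rpow_natCast, ← Real.rpow_mul h.le]
  norm_num

theorem memH_iff (l : ℝ) {m : ℕ} (u : Coeffs m) :
    MemH l u ↔ Memℓp (weighted l u) 2 := by
  rw [memℓp_gen_iff (by norm_num)]
  simp only [ENNReal.toReal_ofNat, Real.rpow_ofNat, norm_weighted_sq]
  rfl

theorem weighted_add (l : ℝ) {m : ℕ} (u v : Coeffs m) :
    weighted l (u + v) = weighted l u + weighted l v := by
  funext n; simp [weighted]

theorem weighted_smul (l : ℝ) {m : ℕ} (a : ℂ) (u : Coeffs m) :
    weighted l (a • u) = a • weighted l u := by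
  funext n
  simp only [weighted, Pi.smul_apply]
  exact smul_comm _ _ _

/-- `H^l(ℂ^m)` as a linear subspace of all coefficient sequences. -/
def hsSubmodule (l : ℝ) (m : ℕ) : Submodule ℂ (Coeffs m) where
  carrier := {u | MemH l u}
  zero_mem' := by simp [MemH, summable_zero]
  add_mem' := by
    intro u v hu hv
    simp only [mem_ofPred_eq, memH_iff, weighted_add] at *
    exact hu.add hv
  smul_mem' := by
    intro a u hu
    simp only [mem_ofPred_eq, memH_iff, weighted_smul] at *
    exact hu.const_smul a

/-- The space `H^l(ℂ^m)`. -/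
def Hs (l : ℝ) (m : ℕ) : Type := hsSubmodule l m

instance (l : ℝ) (m : ℕ) : AddCommGroup (Hs l m) := inferInstanceAs (AddCommGroup (hsSubmodule l m))

instance (l : ℝ) (m : ℕ) : Module ℂ (Hs l m) := inferInstanceAs (Module ℂ (hsSubmodule l m))

/-- The Fourier coefficients of an element of `H^l(ℂ^m)`. -/
def Hs.coeff {l : ℝ} {m : ℕ} (u : Hs l m) : Coeffs m := Subtype.val u

theorem Hs.coeff_add {l : ℝ} {m : ℕ} (u v : Hs l m) : (u + v).coeff = u.coeff + v.coeff := rfl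

theorem Hs.coeff_smul {l : ℝ} {m : ℕ} (a : ℂ) (u : Hs l m) : (a • u).coeff = a • u.coeff := rfl

/-- `u ↦ ((1 + n²)^(l/2) u_n)_n` as a linear map into `ℓ²`. -/
def Hs.toEll2 (l : ℝ) (m : ℕ) :
    Hs l m →ₗ[ℂ] lp (fun _ : ℤ => EuclideanSpace ℂ (Fin m)) 2 where
  toFun u := ⟨weighted l u.coeff, (memH_iff l _).1 u.2⟩
  map_add' u v := by
    apply Subtype.ext
    exact weighted_add l u.coeff v.coeff
  map_smul' a u := by
    apply Subtype.ext
    exact weighted_smul l a u.coeff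

theorem Hs.toEll2_injective (l : ℝ) (m : ℕ) : Function.Injective (Hs.toEll2 l m) := by
  intro u v huv
  apply Subtype.ext
  funext n
  have h : weighted l u.coeff n = weighted l v.coeff n := congrFun (congrArg Subtype.val huv) n
  have hw : (((1 + (n : ℝ) ^ 2) ^ (l / 2) : ℝ) : ℂ) ≠ 0 := by
    have : (0 : ℝ) < 1 + (n : ℝ) ^ 2 := by positivity
    exact_mod_cast (Real.rpow_pos_of_pos this _).ne'
  exact smul_right_injective _ hw h

/-- The norm of `H^l(ℂ^m)`; see `Hs.norm_sq` for its formula. -/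
instance (l : ℝ) (m : ℕ) : NormedAddCommGroup (Hs l m) :=
  NormedAddCommGroup.induced _ _ (Hs.toEll2 l m) (Hs.toEll2_injective l m)

instance (l : ℝ) (m : ℕ) : NormedSpace ℂ (Hs l m) :=
  NormedSpace.induced ℂ _ _ (Hs.toEll2 l m)

theorem Hs.norm_sq {l : ℝ} {m : ℕ} (u : Hs l m) :
    ‖u‖ ^ 2 = ∑' n : ℤ, (1 + (n : ℝ) ^ 2) ^ l * ‖u.coeff n‖ ^ 2 := by
  have h := lp.norm_rpow_eq_tsum (p := 2) (by norm_num) (Hs.toEll2 l m u)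
  simp only [ENNReal.toReal_ofNat, Real.rpow_ofNat] at h
  have h' : ‖u‖ = ‖Hs.toEll2 l m u‖ := rfl
  rw [h', h]
  exact tsum_congr fun n => norm_weighted_sq l u.coeff n

/-- The phase space `E_l = H^l(ℂ⁴) × H^l(ℂ²)`. -/
abbrev Phase (l : ℝ) : Type := Hs l 4 × Hs l 2

/-! ### The spatial dynamics system, with `α` the control parameter and `c` the front speed

`U_n = (U_{n0}, …, U_{n3})` holds the `ξ`-derivatives of order `0, …, 3` of the `n`-th Fourier
coefficient of `𝒰`, and `W_n = (W_{n0}, W_{n1})` those of order `0, 1` of `𝒲`. -/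

/-- The Swift–Hohenberg block of the block-diagonal matrix `L_n`: the companion matrix of
`(1 + (λ + in)²)² = α + cλ`. -/
def LSH (α c : ℝ) (n : ℤ) : Matrix (Fin 4) (Fin 4) ℂ :=
  !![0, 1, 0, 0;
     0, 0, 1, 0;
     0, 0, 0, 1;
     -(1 - (n : ℂ) ^ 2) ^ 2 + (α : ℂ), -4 * Complex.I * n * (1 - (n : ℂ) ^ 2) + (c : ℂ),
       6 * (n : ℂ) ^ 2 - 2, -4 * Complex.I * n]

/-- The conservation-law block of `L_n`: the companion matrix of `(λ + in)² = -cλ`. -/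
def Lcon (c : ℝ) (n : ℤ) : Matrix (Fin 2) (Fin 2) ℂ :=
  !![0, 1;
     (n : ℂ) ^ 2, -2 * Complex.I * n - (c : ℂ)]

/-- Application of a matrix to a vector of `ℂ^m`. -/
def act {m : ℕ} (M : Matrix (Fin m) (Fin m) ℂ) (v : EuclideanSpace ℂ (Fin m)) :
    EuclideanSpace ℂ (Fin m) :=
  WithLp.toLp 2 (M *ᵥ v.ofLp)

/-- The convolution `n ↦ ∑_{p+q=n} a_p b_q`. -/
def convol (a b : ℤ → ℂ) (n : ℤ) : ℂ := ∑' p : ℤ, a p * b (n - p)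

/-- The scalar sequence of the `j`-th components. -/
def component {m : ℕ} (u : Coeffs m) (j : Fin m) : ℤ → ℂ := fun n => u n j

/-- The first four components of the nonlinearity `𝒩_n(U, W)`. -/
def nonlinU (γ : ℝ) (U : Coeffs 4) (W : Coeffs 2) (n : ℤ) : EuclideanSpace ℂ (Fin 4) :=
  !₂[0, 0, 0, convol (component U 0) (component W 0) n
    - (1 + (γ : ℂ)) * convol (convol (component U 0) (component U 0)) (component U 0) n]

/-- The last two components of the nonlinearity `𝒩_n(U, W)`. -/
def nonlinW (c γ : ℝ) (U : Coeffs 4) (n : ℤ) : EuclideanSpace ℂ (Fin 2) :=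
  !₂[0, 2 * (c : ℂ) * (γ : ℂ) * convol (component U 0) (component U 1) n]

/-- `X` solves `∂_ξ X = L X + 𝒩(X)` on the set `I` (an interval): for every `ξ ∈ I` the value
`X ξ` lies in `H^{l+4}(ℂ⁴) × H^{l+2}(ℂ²)`, on which `L` is defined, and `X` has, in `E_l`, the
derivative `L (X ξ) + 𝒩(X ξ)` at `ξ`. -/
def IsSolutionOn (α c γ : ℝ) {l : ℝ} (I : Set ℝ) (X : ℝ → Phase l) : Prop :=
  ∀ ξ ∈ I, MemH (l + 4) (X ξ).1.coeff ∧ MemH (l + 2) (X ξ).2.coeff ∧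
    ∃ Y : Phase l,
      (∀ n, Y.1.coeff n = act (LSH α c n) ((X ξ).1.coeff n)
        + nonlinU γ (X ξ).1.coeff (X ξ).2.coeff n) ∧
      (∀ n, Y.2.coeff n = act (Lcon c n) ((X ξ).2.coeff n) + nonlinW c γ (X ξ).1.coeff n) ∧
      HasDerivWithinAt X Y I ξ

/-! ### Central and hyperbolic subspaces -/

/-- The Dunford integral `(2πi)⁻¹ ∮ (λ - M)⁻¹ dλ` (entrywise) over the circle `|λ| = 1/2`. -/
def centralProj {m : ℕ} (M : Matrix (Fin m) (Fin m) ℂ) : Matrix (Fin m) (Fin m) ℂ :=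
  Matrix.of fun i j =>
    (2 * (Real.pi : ℂ) * Complex.I)⁻¹ *
      ∮ z in C(0, 1 / 2), ((z • (1 : Matrix (Fin m) (Fin m) ℂ) - M)⁻¹) i j

/-- The image of `H^l(ℂ^m)` under the multiplier `u_n ↦ Q_n u_n`. -/
def multiplierRange {m : ℕ} (l : ℝ) (Q : ℤ → Matrix (Fin m) (Fin m) ℂ) :
    Submodule ℂ (Hs l m) where
  carrier := {x | ∃ y : Hs l m, ∀ n, x.coeff n = act (Q n) (y.coeff n)}
  zero_mem' := ⟨0, fun n => by
    have h : (0 : Hs l m).coeff n = 0 := rfl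
    simp [h, act]⟩
  add_mem' := by
    rintro x x' ⟨y, hy⟩ ⟨y', hy'⟩
    refine ⟨y + y', fun n => ?_⟩
    simp [Hs.coeff_add, hy n, hy' n, act, Matrix.mulVec_add]
  smul_mem' := by
    rintro a x ⟨y, hy⟩
    refine ⟨a • y, fun n => ?_⟩
    simp [Hs.coeff_smul, hy n, act, Matrix.mulVec_smul]

/-- The `U`-part of the central subspace `E_c = P_c E_l`. -/
abbrev CentU (l α c : ℝ) : Submodule ℂ (Hs l 4) :=
  multiplierRange l fun n => centralProj (LSH α c n)

/-- The `W`-part of the central subspace `E_c = P_c E_l`. -/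
abbrev CentW (l c : ℝ) : Submodule ℂ (Hs l 2) :=
  multiplierRange l fun n => centralProj (Lcon c n)

/-- The `U`-part of the hyperbolic subspace `E_h = (1 - P_c) E_l`. -/
abbrev HypU (l α c : ℝ) : Submodule ℂ (Hs l 4) :=
  multiplierRange l fun n => 1 - centralProj (LSH α c n)

/-- The `W`-part of the hyperbolic subspace `E_h = (1 - P_c) E_l`. -/
abbrev HypW (l c : ℝ) : Submodule ℂ (Hs l 2) :=
  multiplierRange l fun n => 1 - centralProj (Lcon c n)

/-- The central subspace `E_c`. -/
abbrev Cent (l α c : ℝ) : Type := CentU l α c × CentW l c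

/-- The hyperbolic subspace `E_h`. -/
abbrev Hyp (l α c : ℝ) : Type := HypU l α c × HypW l c

/-- The point `x + h(x)` of the graph of `h` over `x`. -/
def graphPt {l α c : ℝ} (h : Cent l α c → Hyp l α c) (x : Cent l α c) : Phase l :=
  ((x.1 : Hs l 4) + ((h x).1 : Hs l 4), (x.2 : Hs l 2) + ((h x).2 : Hs l 2))

/-- `x` solves the reduced system `∂_ξ x = L_c x + P_c 𝒩(x + h(x))` on `I`, where
`L_c = P_c L`. -/
def IsReducedSolutionOn (γ : ℝ) {l α c : ℝ} (h : Cent l α c → Hyp l α c) (I : Set ℝ)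
    (x : ℝ → Cent l α c) : Prop :=
  ∀ ξ ∈ I, ∃ y : Cent l α c,
    (∀ n, (y.1 : Hs l 4).coeff n
      = act (centralProj (LSH α c n)) (act (LSH α c n) (((x ξ).1 : Hs l 4).coeff n))
        + act (centralProj (LSH α c n))
            (nonlinU γ (graphPt h (x ξ)).1.coeff (graphPt h (x ξ)).2.coeff n)) ∧
    (∀ n, (y.2 : Hs l 2).coeff n
      = act (centralProj (Lcon c n)) (act (Lcon c n) (((x ξ).2 : Hs l 2).coeff n))
        + act (centralProj (Lcon c n)) (nonlinW c γ (graphPt h (x ξ)).1.coeff n)) ∧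
    HasDerivWithinAt x y I ξ

end ModFront

end

open ModFront

/-! The difficulty is that the spectral gap closes as ε → 0. Put `h = √c`. Every central eigenvalue
has modulus at most `h / 128`, while the others only satisfy `|Re λ| ≥ h / 16`. A Lyapunov–Perron
construction is therefore run on paths growing at most like `exp (θ |ξ|)` with `θ = h / 64`, and
everything depends on the size of its solution operator.

The nonlinearity enters only the highest derivative of each mode, that is, in the direction of the
last basis vector `e` of a companion matrix. For a simple root `λ` of the characteristic polynomial
`p`, the spectral projection sends `e` to the vector with components `λ ^ j / p'(λ)`. The dispersion
relations give `|Re λ| |p'(λ)| ≥ h² (1 + |n|) / 6` and `|λ| ≤ 3 (1 + |n|)` (`sh_root_cases`,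
`sh_root_norm_le`, `con_root_cases`). Hence the `j`-th component of the response of mode `n` is at
most `C (1 + |n|) ^ (j - 1) / h²`, uniformly in `n` and ε: inverting the linear part costs `1 / c`
and gains one order of decay in `n`. A central block has two small roots, possibly merging, and
costs `θ⁻²`, which is again of order `1 / c`.

At amplitudes `σU = ε ^ (2/3 + δ)` and `σW = ε ^ (4/3)` the nonlinear terms have relative size `σW`
and `σU²` in the equation for `U`, and `c σU² / σW = c ε ^ (2δ)` in that for `W`. All are small
compared with `c`, so the fixed point problem contracts.

The fixed point is not sought in `H^l` but among modes with `|X_{n,j}| ≲ σ (1 + |n|) ^ (j - s)`, `s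
= l + 9`. In this supremum norm a cutoff applied to each coordinate separately is harmless, and such
sequences are stable under convolution. The derivative in `U₀ U₁` costs one power of `n`, which the
gain in the `W` blocks restores. The superposition operator is differentiable only from the weight
`θ` into the weight `2θ`; both lie inside the gap, and `exists_fixedPoint_family` extracts a C¹
dependence on the central data from this. The result is a graph consisting of the initial values of
all mode solutions of controlled growth (`ModeSystem.exists_invariant_graph`).

Two bridges lead back to `H^l`. A small bounded solution in `H^l` gains decay by repeated use of the
linear bounds (`SmallModes.exists_modeBound`), so the cutoff does not act on it and uniqueness puts
it on the graph. Conversely, the reduced vector field of the cutoff system is globally Lipschitz, so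
a reduced solution coincides with the central coordinates of a global mode solution, whose modes
decay fast enough to be differentiated in `H^l` (`FrontData.isSolutionOn_of_state`). -/

namespace ModFront

/-! ### A parametrised fixed point, differentiable in a weaker norm -/

section FixedPoint

variable {E 𝔹 𝔾 : Type*} [NormedAddCommGroup E] [NormedSpace ℝ E]
  [NormedAddCommGroup 𝔹] [NormedSpace ℝ 𝔹] [CompleteSpace 𝔹]
  [NormedAddCommGroup 𝔾] [NormedSpace ℝ 𝔾]

/-- Formally differentiating `z = S x + K₁ F(z)` gives `V = S + A V` with `A = K₁ D(z)`; the Neumann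
series inverts `1 - A`. -/
theorem exists_affine_inverse (S : E →L[ℝ] 𝔹) (A : 𝔹 →L[ℝ] 𝔹) (hA : ‖A‖ ≤ 1 / 2) :
    ∃ V : E →L[ℝ] 𝔹, ∀ y, V y = S y + A (V y) := by
  have h1 : ‖A‖ < 1 := by linarith
  let u := Units.oneSub A h1
  refine ⟨(↑u⁻¹ : 𝔹 →L[ℝ] 𝔹) ∘L S, fun y => ?_⟩
  have h2 : (u : 𝔹 →L[ℝ] 𝔹) * (↑u⁻¹ : 𝔹 →L[ℝ] 𝔹) = 1 := u.mul_inv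
  have h3 := DFunLike.congr_fun h2 (S y)
  have h4 : (u : 𝔹 →L[ℝ] 𝔹) = 1 - A := rfl
  rw [h4] at h3
  have h5 : (↑u⁻¹ : 𝔹 →L[ℝ] 𝔹) (S y) - A ((↑u⁻¹ : 𝔹 →L[ℝ] 𝔹) (S y)) = S y := h3
  exact sub_eq_iff_eq_add.1 h5

/-- The solutions `Z x` of `z = S x + K₁ F(z)` depend continuously differentiably on `x` in the
seminorm `‖J ·‖`, when `F` has the derivative `D` with a quadratic remainder in that seminorm. -/
theorem exists_fixedPoint_family (S : E →L[ℝ] 𝔹) (K₁ K₂ : 𝔾 →L[ℝ] 𝔹) (J : 𝔹 →L[ℝ] 𝔹)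
    (J' : 𝔾 →L[ℝ] 𝔾) (F : 𝔹 → 𝔾) (D : 𝔹 → 𝔹 →L[ℝ] 𝔾) {κ L C : ℝ}
    (hκ : 0 ≤ κ) (hC : 0 ≤ C) (hκL : κ * L ≤ 1 / 2)
    (hK₁ : ∀ g, ‖K₁ g‖ ≤ κ * ‖g‖) (hK₂ : ∀ g, ‖K₂ g‖ ≤ κ * ‖g‖)
    (hJK : ∀ g, J (K₁ g) = K₂ (J' g)) (hJD : ∀ z v, J' (D z v) = D z (J v))
    (hF : ∀ z z', ‖F z - F z'‖ ≤ L * ‖z - z'‖) (hD : ∀ z v, ‖D z v‖ ≤ L * ‖v‖)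
    (hrem : ∀ z d, ‖J' (F (z + d) - F z - D z d)‖ ≤ C * ‖d‖ ^ 2)
    (hlip : ∀ z z' v, ‖J' (D z v - D z' v)‖ ≤ C * ‖z - z'‖ * ‖v‖) :
    ∃ Z : E → 𝔹, (∀ x, Z x = S x + K₁ (F (Z x))) ∧ (∀ x z, z = S x + K₁ (F z) → z = Z x) ∧
      (∀ x x', ‖Z x - Z x'‖ ≤ 2 * ‖S‖ * ‖x - x'‖) ∧ ContDiff ℝ 1 (fun x => J (Z x)) ∧
      ∀ x, D (Z x) = 0 → HasFDerivAt (fun x => J (Z x)) (J ∘L S) x := by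
  have hKF : ∀ z z', ‖K₁ (F z) - K₁ (F z')‖ ≤ 1 / 2 * ‖z - z'‖ := fun z z' => by
    rw [← map_sub]
    calc _ ≤ κ * ‖F z - F z'‖ := hK₁ _
      _ ≤ κ * (L * ‖z - z'‖) := by gcongr; exact hF z z'
      _ = (κ * L) * ‖z - z'‖ := by ring
      _ ≤ _ := by gcongr
  have hcontr : ∀ x, ContractingWith (1 / 2) (fun z => S x + K₁ (F z)) := fun x => by
    refine ⟨by rw [← NNReal.coe_lt_coe]; norm_num, LipschitzWith.of_dist_le_mul fun z z' => ?_⟩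
    rw [dist_eq_norm, dist_eq_norm, add_sub_add_left_eq_sub]
    simpa using hKF z z'
  let Z : E → 𝔹 := fun x => (hcontr x).fixedPoint
  have hZ : ∀ x, Z x = S x + K₁ (F (Z x)) := fun x => ((hcontr x).fixedPoint_isFixedPt).symm
  have hLip : ∀ x x', ‖Z x - Z x'‖ ≤ 2 * ‖S‖ * ‖x - x'‖ := fun x x' => by
    have h1 : Z x - Z x' = S (x - x') + (K₁ (F (Z x)) - K₁ (F (Z x'))) := by
      conv_lhs => rw [hZ x, hZ x']
      rw [map_sub]; abel
    have h2 : ‖Z x - Z x'‖ ≤ ‖S‖ * ‖x - x'‖ + 1 / 2 * ‖Z x - Z x'‖ := by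
      calc _ = _ := by rw [h1]
        _ ≤ _ := (norm_add_le _ _).trans (add_le_add (S.le_opNorm _) (hKF _ _))
    linarith
  have hA : ∀ z, ‖K₁ ∘L D z‖ ≤ 1 / 2 := fun z => by
    refine ContinuousLinearMap.opNorm_le_bound _ (by norm_num) fun v => ?_
    calc _ ≤ κ * ‖D z v‖ := hK₁ _
      _ ≤ κ * (L * ‖v‖) := by gcongr; exact hD z v
      _ = (κ * L) * ‖v‖ := by ring
      _ ≤ _ := by gcongr
  -- `V x` is the formal derivative of `Z` at `x`. It exists in the strong norm, but it approximates
  -- increments of `Z` only in the seminorm given by `J`.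
  choose V hV using fun x => exists_affine_inverse S (K₁ ∘L D (Z x)) (hA (Z x))
  simp only [ContinuousLinearMap.comp_apply] at hV
  have hVn : ∀ x y, ‖V x y‖ ≤ 2 * ‖S‖ * ‖y‖ := fun x y => by
    have h2 : ‖V x y‖ ≤ ‖S‖ * ‖y‖ + 1 / 2 * ‖V x y‖ := by
      calc ‖V x y‖ = ‖S y + K₁ (D (Z x) (V x y))‖ := by rw [← hV]
        _ ≤ _ := (norm_add_le _ _).trans (add_le_add (S.le_opNorm _)
          (((K₁ ∘L D (Z x)).le_opNorm _).trans (by gcongr; exact hA _)))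
    linarith
  -- solutions of `w = K₁ (e + D z w)` are controlled in the weak norm
  have hweak : ∀ z w e B, w = K₁ (e + D z w) → ‖J' e‖ ≤ B → ‖J w‖ ≤ 2 * κ * B := by
    intro z w e B hw he
    have h1 : J w = K₂ (J' e + D z (J w)) := by
      conv_lhs => rw [hw]
      rw [hJK, map_add, hJD]
    have h2 : ‖J w‖ ≤ κ * B + 1 / 2 * ‖J w‖ := by
      calc ‖J w‖ = ‖K₂ (J' e + D z (J w))‖ := by rw [← h1]
        _ ≤ κ * (B + L * ‖J w‖) :=
          (hK₂ _).trans (by gcongr; exact (norm_add_le _ _).trans (add_le_add he (hD _ _)))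
        _ = κ * B + (κ * L) * ‖J w‖ := by ring
        _ ≤ _ := by gcongr
    linarith
  have hder : ∀ x, HasFDerivAt (fun x => J (Z x)) (J ∘L V x) x := fun x => by
    rw [hasFDerivAt_iff_isLittleO_nhds_zero]
    have hbig : (fun y => J (Z (x + y)) - J (Z x) - (J ∘L V x) y) =O[𝓝 0]
        fun y => ‖y‖ ^ 2 := by
      refine Asymptotics.IsBigO.of_bound (2 * κ * (C * (2 * ‖S‖) ^ 2)) (Eventually.of_forall ?_)
      intro y
      set d := Z (x + y) - Z x with hd
      -- The error `d - V x y` solves the linearised equation with the Taylor remainder of `F` as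
      -- source. That remainder is quadratic in the strong norm of `d`, which is `O(‖y‖)`, but only
      -- when measured after `J'`.
      have h1 : d - V x y = K₁ ((F (Z x + d) - F (Z x) - D (Z x) d) + D (Z x) (d - V x y)) := by
        have e1 : Z x + d = Z (x + y) := by rw [hd]; abel
        rw [e1]
        conv_lhs => rw [hd, hZ (x + y), hZ x, hV x y]
        simp only [map_add, map_sub]; abel
      have h2 := hweak (Z x) (d - V x y) _ _ h1 (hrem _ _)
      have h3 : J (Z (x + y)) - J (Z x) - (J ∘L V x) y = J (d - V x y) := by
        simp [hd, map_sub]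
      rw [h3]
      have h4 : ‖d‖ ≤ 2 * ‖S‖ * ‖y‖ := by simpa using hLip (x + y) x
      refine h2.trans ?_
      rw [norm_pow, norm_norm]
      calc 2 * κ * (C * ‖d‖ ^ 2) ≤ 2 * κ * (C * (2 * ‖S‖ * ‖y‖) ^ 2) := by gcongr
        _ = _ := by ring
    exact hbig.trans_isLittleO (Asymptotics.isLittleO_norm_pow_id one_lt_two)
  refine ⟨Z, hZ, fun x z hz => ?_, hLip, ?_, fun x hx => ?_⟩
  · exact (hcontr x).fixedPoint_unique (x := z) hz.symm
  · rw [contDiff_one_iff_hasFDerivAt]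
    refine ⟨fun x => J ∘L V x, ?_, hder⟩
    -- The difference of two formal derivatives solves a linear equation whose source is the
    -- variation of `D`, so the derivative is even Lipschitz in `x`.
    have hb : ∀ x x', ‖J ∘L V x - J ∘L V x'‖ ≤
        (2 * κ * (C * (2 * ‖S‖) * (2 * ‖S‖))) * ‖x - x'‖ := fun x x' => by
      refine ContinuousLinearMap.opNorm_le_bound _ (by positivity) fun y => ?_
      have h1 : V x y - V x' y = K₁ ((D (Z x) (V x' y) - D (Z x') (V x' y)) +
          D (Z x) (V x y - V x' y)) := by
        conv_lhs => rw [hV x y, hV x' y]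
        simp only [map_add, map_sub]; abel
      have h2 := hweak _ _ _ _ h1 (hlip _ _ _)
      have h3 : (J ∘L V x - J ∘L V x') y = J (V x y - V x' y) := by simp
      rw [h3]
      refine h2.trans ?_
      calc 2 * κ * (C * ‖Z x - Z x'‖ * ‖V x' y‖)
          ≤ 2 * κ * (C * (2 * ‖S‖ * ‖x - x'‖) * (2 * ‖S‖ * ‖y‖)) := by
            gcongr
            · exact hLip _ _
            · exact hVn _ _
        _ = _ := by ring
    exact (LipschitzWith.of_dist_le_mul (K := ⟨2 * κ * (C * (2 * ‖S‖) * (2 * ‖S‖)), by positivity⟩)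
      fun x x' => by rw [dist_eq_norm, dist_eq_norm]; exact hb x x').continuous
  · have h1 : V x = S := by
      ext y; rw [hV x y, hx]; simp
    rw [← h1]; exact hder x

end FixedPoint

/-! ### Polynomially decaying sequences and convolution -/

/-- The weight `1 + |n|`. -/
noncomputable def wt (n : ℤ) : ℝ := 1 + |(n : ℝ)|

theorem one_le_wt (n : ℤ) : 1 ≤ wt n := by simp [wt]

theorem wt_pos (n : ℤ) : 0 < wt n := by linarith [one_le_wt n]

theorem wt_add_le (p q : ℤ) : wt (p + q) ≤ wt p + wt q := by
  have := abs_add_le (p : ℝ) q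
  simp only [wt, Int.cast_add]; linarith

theorem wt_rpow_pos (n : ℤ) (t : ℝ) : 0 < wt n ^ t := Real.rpow_pos_of_pos (wt_pos n) t

theorem wt_rpow_anti (n : ℤ) {s t : ℝ} (h : s ≤ t) : wt n ^ s ≤ wt n ^ t :=
  Real.rpow_le_rpow_of_exponent_le (one_le_wt n) h

theorem summable_wt_rpow {a : ℝ} (ha : 1 < a) : Summable fun n : ℤ => wt n ^ (-a) := by
  refine Summable.of_norm_bounded_eventually (Real.summable_abs_int_rpow ha) ?_
  have : ∀ᶠ n : ℤ in cofinite, n ≠ 0 := by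
    rw [eventually_cofinite]; simp
  filter_upwards [this] with n hn
  rw [Real.norm_of_nonneg (wt_rpow_pos n _).le]
  have h1 : 0 < |(n : ℝ)| := by simpa using hn
  exact Real.rpow_le_rpow_of_nonpos h1 (by simp [wt]) (by linarith)

/-- The larger of the two weights is at least half of `wt (p + q)`, so its factor supplies the decay
`wt (p + q) ^ (-b)` and the smaller weight keeps the summable power `-a`. -/
theorem wt_mul_wt_le {a b : ℝ} (hb : 0 ≤ b) (hab : b ≤ a) (p q : ℤ) :
    wt p ^ (-a) * wt q ^ (-b) ≤
      2 ^ b * wt (p + q) ^ (-b) * (wt p ^ (-a) + wt q ^ (-a)) := by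
  have key : ∀ x y : ℤ, wt x ≤ wt y → wt (x + y) = wt (p + q) →
      wt y ^ (-b) ≤ 2 ^ b * wt (p + q) ^ (-b) := by
    intro x y hxy he
    have h1 : wt (p + q) ≤ 2 * wt y := by rw [← he]; linarith [wt_add_le x y]
    have h2 : (2 * wt y) ^ (-b) ≤ wt (p + q) ^ (-b) :=
      Real.rpow_le_rpow_of_nonpos (wt_pos _) h1 (by linarith)
    rw [Real.mul_rpow (by norm_num) (wt_pos y).le] at h2
    calc wt y ^ (-b) = 2 ^ b * (2 ^ (-b) * wt y ^ (-b)) := by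
          rw [← mul_assoc, ← Real.rpow_add (by norm_num)]; simp
      _ ≤ _ := by gcongr
  have hp := wt_rpow_pos p (-a)
  have hq := wt_rpow_pos q (-a)
  have hpb := wt_rpow_pos p (-b)
  have hqb := wt_rpow_pos q (-b)
  have hR : 0 < 2 ^ b * wt (p + q) ^ (-b) := by have := wt_rpow_pos (p + q) (-b); positivity
  rcases le_total (wt p) (wt q) with h | h
  · have := key p q h rfl
    calc _ ≤ wt p ^ (-a) * (2 ^ b * wt (p + q) ^ (-b)) := by gcongr
      _ ≤ _ := by nlinarith
  · have h1 := key q p h (by rw [add_comm])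
    -- When `p` carries the larger weight, the surplus decay `a - b` is first moved to the smaller
    -- weight.
    have h2 : wt p ^ (-a) * wt q ^ (-b) ≤ wt p ^ (-b) * wt q ^ (-a) := by
      have e1 : wt p ^ (-a) = wt p ^ (-b) * wt p ^ (-(a - b)) := by
        rw [← Real.rpow_add (wt_pos p)]; ring_nf
      have e2 : wt q ^ (-a) = wt q ^ (-b) * wt q ^ (-(a - b)) := by
        rw [← Real.rpow_add (wt_pos q)]; ring_nf
      have e3 : wt p ^ (-(a - b)) ≤ wt q ^ (-(a - b)) :=
        Real.rpow_le_rpow_of_nonpos (wt_pos q) h (by linarith)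
      rw [e1, e2]
      calc wt p ^ (-b) * wt p ^ (-(a - b)) * wt q ^ (-b)
          = wt p ^ (-b) * wt q ^ (-b) * wt p ^ (-(a - b)) := by ring
        _ ≤ wt p ^ (-b) * wt q ^ (-b) * wt q ^ (-(a - b)) := by gcongr
        _ = _ := by ring
    calc _ ≤ wt p ^ (-b) * wt q ^ (-a) := h2
      _ ≤ 2 ^ b * wt (p + q) ^ (-b) * wt q ^ (-a) := by gcongr
      _ ≤ _ := by nlinarith

/-- The weights `τ₁`, `τ₂` have a convolution dominated by `K τ₃`. -/
structure ConvWeight (K : ℝ) (τ₁ τ₂ τ₃ : ℤ → ℝ) : Prop where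
  nonneg₁ : ∀ n, 0 ≤ τ₁ n
  nonneg₂ : ∀ n, 0 ≤ τ₂ n
  summable : ∀ n, Summable fun p => τ₁ p * τ₂ (n - p)
  tsum_le : ∀ n, ∑' p, τ₁ p * τ₂ (n - p) ≤ K * τ₃ n

/-- Only the factor with the better decay has to be summable. The case `b < a` is needed for the
product `U₀ U₁`, whose second factor decays one order less. -/
theorem exists_convWeight {a b : ℝ} (ha : 1 < a) (hb : 0 ≤ b) (hab : b ≤ a) :
    ∃ K, 0 < K ∧ ConvWeight K (fun n => wt n ^ (-a)) (fun n => wt n ^ (-b))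
      (fun n => wt n ^ (-b)) := by
  have hs := summable_wt_rpow ha
  have hs2 : ∀ n : ℤ, Summable fun p : ℤ => wt (n - p) ^ (-a) := fun n =>
    ((Equiv.subLeft n).summable_iff (f := fun p : ℤ => wt p ^ (-a))).2 hs
  have hle : ∀ n p : ℤ, wt p ^ (-a) * wt (n - p) ^ (-b) ≤
      2 ^ b * wt n ^ (-b) * (wt p ^ (-a) + wt (n - p) ^ (-a)) := fun n p => by
    have := wt_mul_wt_le hb hab p (n - p)
    rwa [add_sub_cancel] at this
  have hsum : ∀ n : ℤ, Summable fun p : ℤ => wt p ^ (-a) * wt (n - p) ^ (-b) := fun n =>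
    Summable.of_nonneg_of_le (fun p => (mul_pos (wt_rpow_pos _ _) (wt_rpow_pos _ _)).le)
      (hle n) ((hs.add (hs2 n)).mul_left _)
  have hpos : 0 < ∑' p : ℤ, wt p ^ (-a) :=
    hs.tsum_pos (fun p => (wt_rpow_pos _ _).le) 0 (wt_rpow_pos _ _)
  refine ⟨2 ^ b * (2 * ∑' p : ℤ, wt p ^ (-a)), by positivity, fun n => (wt_rpow_pos _ _).le,
    fun n => (wt_rpow_pos _ _).le, hsum, fun n => ?_⟩
  calc _ ≤ ∑' p : ℤ, 2 ^ b * wt n ^ (-b) * (wt p ^ (-a) + wt (n - p) ^ (-a)) :=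
        (hsum n).tsum_le_tsum (hle n) ((hs.add (hs2 n)).mul_left _)
    _ = 2 ^ b * wt n ^ (-b) * (∑' p : ℤ, wt p ^ (-a) + ∑' p : ℤ, wt (n - p) ^ (-a)) := by
        rw [tsum_mul_left, hs.tsum_add (hs2 n)]
    _ = _ := by
        have : ∑' p : ℤ, wt (n - p) ^ (-a) = ∑' p : ℤ, wt p ^ (-a) :=
          (Equiv.subLeft n).tsum_eq (fun p : ℤ => wt p ^ (-a))
        rw [this]; ring

namespace ConvWeight

variable {K : ℝ} {τ₁ τ₂ τ₃ : ℤ → ℝ}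

theorem norm_term_le {a b : ℤ → ℂ} {A B : ℝ} (ha : ∀ n, ‖a n‖ ≤ A * τ₁ n)
    (hb : ∀ n, ‖b n‖ ≤ B * τ₂ n) (n p : ℤ) :
    ‖a p * b (n - p)‖ ≤ A * B * (τ₁ p * τ₂ (n - p)) := by
  rw [norm_mul]
  calc _ ≤ (A * τ₁ p) * (B * τ₂ (n - p)) :=
        mul_le_mul (ha p) (hb _) (norm_nonneg _) ((norm_nonneg _).trans (ha p))
    _ = _ := by ring

variable (h : ConvWeight K τ₁ τ₂ τ₃)
include h

theorem summable_mul {a b : ℤ → ℂ} {A B : ℝ} (ha : ∀ n, ‖a n‖ ≤ A * τ₁ n)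
    (hb : ∀ n, ‖b n‖ ≤ B * τ₂ n) (n : ℤ) : Summable fun p => a p * b (n - p) :=
  Summable.of_norm_bounded ((h.summable n).mul_left (A * B)) (norm_term_le ha hb n)

theorem norm_convol_le {a b : ℤ → ℂ} {A B : ℝ} (hA : 0 ≤ A) (hB : 0 ≤ B)
    (ha : ∀ n, ‖a n‖ ≤ A * τ₁ n)
    (hb : ∀ n, ‖b n‖ ≤ B * τ₂ n) (n : ℤ) : ‖convol a b n‖ ≤ A * B * (K * τ₃ n) := by
  refine (tsum_of_norm_bounded ((h.summable n).hasSum.mul_left (A * B))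
    (norm_term_le ha hb n)).trans ?_
  exact mul_le_mul_of_nonneg_left (h.tsum_le n) (mul_nonneg hA hB)

theorem convol_add_left {a a' b : ℤ → ℂ} {A A' B : ℝ} (ha : ∀ n, ‖a n‖ ≤ A * τ₁ n)
    (ha' : ∀ n, ‖a' n‖ ≤ A' * τ₁ n) (hb : ∀ n, ‖b n‖ ≤ B * τ₂ n) (n : ℤ) :
    convol (a + a') b n = convol a b n + convol a' b n := by
  rw [convol, convol, convol, ← (h.summable_mul ha hb n).tsum_add (h.summable_mul ha' hb n)]
  exact tsum_congr fun p => by rw [Pi.add_apply]; ring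

theorem convol_add_right {a b b' : ℤ → ℂ} {A B B' : ℝ} (ha : ∀ n, ‖a n‖ ≤ A * τ₁ n)
    (hb : ∀ n, ‖b n‖ ≤ B * τ₂ n) (hb' : ∀ n, ‖b' n‖ ≤ B' * τ₂ n) (n : ℤ) :
    convol a (b + b') n = convol a b n + convol a b' n := by
  rw [convol, convol, convol, ← (h.summable_mul ha hb n).tsum_add (h.summable_mul ha hb' n)]
  exact tsum_congr fun p => by rw [Pi.add_apply]; ring

end ConvWeight

theorem convol_smul_left (c : ℂ) (a b : ℤ → ℂ) (n : ℤ) :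
    convol (c • a) b n = c * convol a b n := by
  rw [convol, convol, ← tsum_mul_left]
  exact tsum_congr fun p => by simp [mul_assoc]

theorem convol_smul_right (c : ℂ) (a b : ℤ → ℂ) (n : ℤ) :
    convol a (c • b) n = c * convol a b n := by
  rw [convol, convol, ← tsum_mul_left]
  exact tsum_congr fun p => by simp; ring

/-! ### Maps of sequences with Lipschitz derivative -/

/-- `Φ` is a bounded map of sequences with derivative `D`; all bounds are in terms of the supremum
norm of the argument and of the weights `τ` on the side of the values. -/
structure SmoothSeq {ι 𝔫 : Type*} (m : ℝ) (τ : 𝔫 → ℝ) (Φ : (ι → ℂ) → 𝔫 → ℂ)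
    (D : (ι → ℂ) → (ι → ℂ) → 𝔫 → ℂ) : Prop where
  bound : ∀ y k, ‖Φ y k‖ ≤ m * τ k
  lip : ∀ y y' d, 0 ≤ d → (∀ i, ‖y i - y' i‖ ≤ d) → ∀ k, ‖Φ y k - Φ y' k‖ ≤ m * d * τ k
  add : ∀ y v v' d d', 0 ≤ d → 0 ≤ d' → (∀ i, ‖v i‖ ≤ d) → (∀ i, ‖v' i‖ ≤ d') →
    ∀ k, D y (v + v') k = D y v k + D y v' k
  smul : ∀ y v (a : ℝ) k, D y ((a : ℂ) • v) k = a * D y v k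
  dbound : ∀ y v d, 0 ≤ d → (∀ i, ‖v i‖ ≤ d) → ∀ k, ‖D y v k‖ ≤ m * d * τ k
  dlip : ∀ y y' v d d', 0 ≤ d → 0 ≤ d' → (∀ i, ‖y i - y' i‖ ≤ d) → (∀ i, ‖v i‖ ≤ d') →
    ∀ k, ‖D y v k - D y' v k‖ ≤ m * d * d' * τ k
  rem : ∀ y v d, 0 ≤ d → (∀ i, ‖v i‖ ≤ d) →
    ∀ k, ‖Φ (y + v) k - Φ y k - D y v k‖ ≤ m * d ^ 2 * τ k
  cont : ∀ y : ℝ → ι → ℂ, (∀ i, Continuous fun ξ => y ξ i) →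
    ∀ k, Continuous fun ξ => Φ (y ξ) k
  dcont : ∀ (y v : ℝ → ι → ℂ) (d : ℝ), 0 ≤ d → (∀ i, Continuous fun ξ => y ξ i) →
    (∀ i, Continuous fun ξ => v ξ i) → (∀ ξ i, ‖v ξ i‖ ≤ d) →
    ∀ k, Continuous fun ξ => D (y ξ) (v ξ) k

namespace SmoothSeq

variable {ι 𝔫 : Type*}

theorem mono {m m' : ℝ} {τ τ' : 𝔫 → ℝ} {Φ D} (h : SmoothSeq (ι := ι) m τ Φ D)
    (hm : ∀ k, m * τ k ≤ m' * τ' k) : SmoothSeq m' τ' Φ D := by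
  have aux : ∀ x k, 0 ≤ x → m * x * τ k ≤ m' * x * τ' k := fun x k hx => by
    have := mul_le_mul_of_nonneg_right (hm k) hx
    linarith
  exact
  { bound := fun y k => (h.bound y k).trans (hm k)
    lip := fun y y' d hd hy k => (h.lip y y' d hd hy k).trans (aux _ _ hd)
    add := h.add
    smul := h.smul
    dbound := fun y v d hd hv k => (h.dbound y v d hd hv k).trans (aux _ _ hd)
    dlip := fun y y' v d d' hd hd' hy hv k => (h.dlip y y' v d d' hd hd' hy hv k).trans (by
      have := aux _ k (mul_nonneg hd hd'); linarith)
    rem := fun y v d hd hv k => (h.rem y v d hd hv k).trans (aux _ _ (by positivity))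
    cont := h.cont
    dcont := h.dcont }

theorem sum_elim {𝔫' : Type*} {m : ℝ} {τ : 𝔫 → ℝ} {τ' : 𝔫' → ℝ} {Φ D Φ' D'}
    (h : SmoothSeq (ι := ι) m τ Φ D) (h' : SmoothSeq (ι := ι) m τ' Φ' D') :
    SmoothSeq m (Sum.elim τ τ') (fun y => Sum.elim (Φ y) (Φ' y))
      (fun y v => Sum.elim (D y v) (D' y v)) where
  bound y := Sum.rec (h.bound y) (h'.bound y)
  lip y y' d hd hy := Sum.rec (h.lip y y' d hd hy) (h'.lip y y' d hd hy)
  add y v v' d d' hd hd' hv hv' :=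
    Sum.rec (h.add y v v' d d' hd hd' hv hv') (h'.add y v v' d d' hd hd' hv hv')
  smul y v a := Sum.rec (h.smul y v a) (h'.smul y v a)
  dbound y v d hd hv := Sum.rec (h.dbound y v d hd hv) (h'.dbound y v d hd hv)
  dlip y y' v d d' hd hd' hy hv :=
    Sum.rec (h.dlip y y' v d d' hd hd' hy hv) (h'.dlip y y' v d d' hd hd' hy hv)
  rem y v d hd hv := Sum.rec (h.rem y v d hd hv) (h'.rem y v d hd hv)
  cont y hy := Sum.rec (h.cont y hy) (h'.cont y hy)
  dcont y v d hd hy hv hb := Sum.rec (h.dcont y v d hd hy hv hb) (h'.dcont y v d hd hy hv hb)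

theorem const_mul {m : ℝ} {τ : 𝔫 → ℝ} {Φ D} (h : SmoothSeq (ι := ι) m τ Φ D) (c : ℂ) :
    SmoothSeq (‖c‖ * m) τ (fun y k => c * Φ y k) (fun y v k => c * D y v k) where
  bound y k := by
    rw [norm_mul, mul_assoc]; gcongr; exact h.bound y k
  lip y y' d hd hy k := by
    rw [← mul_sub, norm_mul, mul_assoc, mul_assoc]; gcongr
    exact (h.lip y y' d hd hy k).trans_eq (by ring)
  add y v v' d d' hd hd' hv hv' k := by rw [h.add y v v' d d' hd hd' hv hv' k]; ring
  smul y v a k := by rw [h.smul y v a k]; ring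
  dbound y v d hd hv k := by
    rw [norm_mul, mul_assoc, mul_assoc]; gcongr
    exact (h.dbound y v d hd hv k).trans_eq (by ring)
  dlip y y' v d d' hd hd' hy hv k := by
    rw [← mul_sub, norm_mul, mul_assoc, mul_assoc, mul_assoc]; gcongr
    exact (h.dlip y y' v d d' hd hd' hy hv k).trans_eq (by ring)
  rem y v d hd hv k := by
    rw [← mul_sub, ← mul_sub, norm_mul, mul_assoc, mul_assoc]; gcongr
    exact (h.rem y v d hd hv k).trans_eq (by ring)
  cont y hy k := continuous_const.mul (h.cont y hy k)
  dcont y v d hd hy hv hb k := continuous_const.mul (h.dcont y v d hd hy hv hb k)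

theorem add_map {m m' : ℝ} {τ : 𝔫 → ℝ} {Φ D Φ' D'} (h : SmoothSeq (ι := ι) m τ Φ D)
    (h' : SmoothSeq (ι := ι) m' τ Φ' D') :
    SmoothSeq (m + m') τ (fun y k => Φ y k + Φ' y k) (fun y v k => D y v k + D' y v k) where
  bound y k := (norm_add_le_of_le (h.bound y k) (h'.bound y k)).trans_eq (by ring)
  lip y y' d hd hy k := by
    rw [add_sub_add_comm]
    exact (norm_add_le_of_le (h.lip y y' d hd hy k) (h'.lip y y' d hd hy k)).trans_eq (by ring)
  add y v v' d d' hd hd' hv hv' k := by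
    rw [h.add y v v' d d' hd hd' hv hv' k, h'.add y v v' d d' hd hd' hv hv' k]; ring
  smul y v a k := by rw [h.smul y v a k, h'.smul y v a k]; ring
  dbound y v d hd hv k :=
    (norm_add_le_of_le (h.dbound y v d hd hv k) (h'.dbound y v d hd hv k)).trans_eq (by ring)
  dlip y y' v d d' hd hd' hy hv k := by
    rw [add_sub_add_comm]
    exact (norm_add_le_of_le (h.dlip y y' v d d' hd hd' hy hv k)
      (h'.dlip y y' v d d' hd hd' hy hv k)).trans_eq (by ring)
  rem y v d hd hv k := by
    rw [add_sub_add_comm, add_sub_add_comm]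
    exact (norm_add_le_of_le (h.rem y v d hd hv k) (h'.rem y v d hd hv k)).trans_eq (by ring)
  cont y hy k := (h.cont y hy k).add (h'.cont y hy k)
  dcont y v d hd hy hv hb k := (h.dcont y v d hd hy hv hb k).add (h'.dcont y v d hd hy hv hb k)

/-- Convolutions of `SmoothSeq` maps are `SmoothSeq`. -/
theorem convol_map {m₁ m₂ K : ℝ} {τ₁ τ₂ τ₃ : ℤ → ℝ} {Φ₁ D₁ Φ₂ D₂} (hm₁ : 0 ≤ m₁) (hm₂ : 0 ≤ m₂)
    (hw : ConvWeight K τ₁ τ₂ τ₃) (hτ : ∀ n, 0 ≤ K * τ₃ n)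
    (h₁ : SmoothSeq (ι := ι) m₁ τ₁ Φ₁ D₁) (h₂ : SmoothSeq (ι := ι) m₂ τ₂ Φ₂ D₂) :
    SmoothSeq (4 * m₁ * m₂ * K) τ₃ (fun y => convol (Φ₁ y) (Φ₂ y))
      (fun y v n => convol (D₁ y v) (Φ₂ y) n + convol (Φ₁ y) (D₂ y v) n) := by
  -- Telescoping of a bilinear expression; all estimates of differences below reduce to it.
  have conv_sub : ∀ (a a' b b' : ℤ → ℂ) (A A' B B' : ℝ), (∀ n, ‖a n‖ ≤ A * τ₁ n) →
      (∀ n, ‖a' n‖ ≤ A' * τ₁ n) → (∀ n, ‖b n‖ ≤ B * τ₂ n) → (∀ n, ‖b' n‖ ≤ B' * τ₂ n) → ∀ n,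
      convol a b n - convol a' b' n = convol (a - a') b n + convol a' (b - b') n := by
    intro a a' b b' A A' B B' ha ha' hb hb' n
    rw [sub_eq_add_neg a, sub_eq_add_neg b, hw.convol_add_left ha (A' := A') (by simpa using ha') hb,
      hw.convol_add_right ha' hb (B' := B') (by simpa using hb')]
    have e1 : convol (-a') b n = -convol a' b n := by
      have := convol_smul_left (-1) a' b n
      simpa using this
    have e2 : convol a' (-b') n = -convol a' b' n := by
      have := convol_smul_right (-1) a' b' n
      simpa using this
    rw [e1, e2]; ring
  have hb₁ := h₁.bound
  have hb₂ := h₂.bound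
  exact
  { bound := fun y n => (hw.norm_convol_le hm₁ hm₂ (hb₁ y) (hb₂ y) n).trans (by
      have := mul_nonneg (mul_nonneg hm₁ hm₂) (hτ n); nlinarith)
    lip := fun y y' d hd hy n => by
      rw [conv_sub _ _ _ _ _ _ _ _ (hb₁ y) (hb₁ y') (hb₂ y) (hb₂ y')]
      refine (norm_add_le_of_le
        (hw.norm_convol_le (mul_nonneg hm₁ hd) hm₂ (h₁.lip y y' d hd hy) (hb₂ y) n)
        (hw.norm_convol_le hm₁ (mul_nonneg hm₂ hd) (hb₁ y') (h₂.lip y y' d hd hy) n)).trans ?_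
      have := mul_nonneg (mul_nonneg (mul_nonneg hm₁ hm₂) hd) (hτ n)
      nlinarith
    add := fun y v v' d d' hd hd' hv hv' n => by
      have e1 : D₁ y (v + v') = D₁ y v + D₁ y v' := funext (h₁.add y v v' d d' hd hd' hv hv')
      have e2 : D₂ y (v + v') = D₂ y v + D₂ y v' := funext (h₂.add y v v' d d' hd hd' hv hv')
      rw [e1, e2, hw.convol_add_left (h₁.dbound y v d hd hv) (h₁.dbound y v' d' hd' hv') (hb₂ y),
        hw.convol_add_right (hb₁ y) (h₂.dbound y v d hd hv) (h₂.dbound y v' d' hd' hv')]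
      ring
    smul := fun y v a n => by
      have e1 : D₁ y ((a : ℂ) • v) = (a : ℂ) • D₁ y v := funext (h₁.smul y v a)
      have e2 : D₂ y ((a : ℂ) • v) = (a : ℂ) • D₂ y v := funext (h₂.smul y v a)
      rw [e1, e2, convol_smul_left, convol_smul_right]; ring
    dbound := fun y v d hd hv n => by
      refine (norm_add_le_of_le
        (hw.norm_convol_le (mul_nonneg hm₁ hd) hm₂ (h₁.dbound y v d hd hv) (hb₂ y) n)
        (hw.norm_convol_le hm₁ (mul_nonneg hm₂ hd) (hb₁ y) (h₂.dbound y v d hd hv) n)).trans ?_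
      have := mul_nonneg (mul_nonneg (mul_nonneg hm₁ hm₂) hd) (hτ n)
      nlinarith
    -- Two product rule terms, each telescoped into two, give exactly four contributions `m₁ m₂ K`.
    -- This is the origin of the factor 4; the other bounds need fewer.
    dlip := fun y y' v d d' hd hd' hy hv n => by
      rw [add_sub_add_comm, conv_sub _ _ _ _ _ _ _ _ (h₁.dbound y v d' hd' hv)
        (h₁.dbound y' v d' hd' hv) (hb₂ y) (hb₂ y'), conv_sub _ _ _ _ _ _ _ _ (hb₁ y) (hb₁ y')
        (h₂.dbound y v d' hd' hv) (h₂.dbound y' v d' hd' hv)]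
      refine (norm_add_le_of_le (norm_add_le_of_le
        (hw.norm_convol_le (by positivity) hm₂ (h₁.dlip y y' v d d' hd hd' hy hv) (hb₂ y) n)
        (hw.norm_convol_le (by positivity) (by positivity) (h₁.dbound y' v d' hd' hv)
          (h₂.lip y y' d hd hy) n)) (norm_add_le_of_le
        (hw.norm_convol_le (by positivity) (by positivity) (h₁.lip y y' d hd hy)
          (h₂.dbound y v d' hd' hv) n)
        (hw.norm_convol_le hm₁ (by positivity) (hb₁ y')
          (h₂.dlip y y' v d d' hd hd' hy hv) n))).trans_eq ?_
      ring
    rem := fun y v d hd hv n => by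
      have hlip₁ := h₁.lip (y + v) y d hd (by simpa using hv)
      have hlip₂ := h₂.lip (y + v) y d hd (by simpa using hv)
      have hd₁ := h₁.dbound y v d hd hv
      have hd₂ := h₂.dbound y v d hd hv
      -- The Taylor remainder of a product is remainder times factor, increment times increment, and
      -- factor times remainder, each of which is quadratic.
      have e : convol (Φ₁ (y + v)) (Φ₂ (y + v)) n - convol (Φ₁ y) (Φ₂ y) n -
          (convol (D₁ y v) (Φ₂ y) n + convol (Φ₁ y) (D₂ y v) n) =
          convol (Φ₁ (y + v) - Φ₁ y - D₁ y v) (Φ₂ y) n +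
          convol (Φ₁ (y + v) - Φ₁ y) (Φ₂ (y + v) - Φ₂ y) n +
          convol (Φ₁ y) (Φ₂ (y + v) - Φ₂ y - D₂ y v) n := by
        have c1 := conv_sub _ _ _ _ _ _ _ _ (hb₁ (y + v)) (hb₁ y) (hb₂ (y + v)) (hb₂ y) n
        have c2 := conv_sub (Φ₁ (y + v) - Φ₁ y) (D₁ y v) (Φ₂ y) (Φ₂ y) _ _ _ _ hlip₁ hd₁
          (hb₂ y) (hb₂ y) n
        have c3 := conv_sub (Φ₁ y) (Φ₁ y) (Φ₂ (y + v) - Φ₂ y) (D₂ y v) _ _ _ _ (hb₁ y) (hb₁ y)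
          hlip₂ hd₂ n
        have c4 := conv_sub (Φ₁ (y + v) - Φ₁ y) (Φ₁ (y + v) - Φ₁ y) (Φ₂ (y + v)) (Φ₂ y) _ _ _ _
          hlip₁ hlip₁ (hb₂ _) (hb₂ _) n
        have z1 : ∀ b : ℤ → ℂ, convol 0 b n = 0 := fun b => by simp [convol]
        have z2 : ∀ a : ℤ → ℂ, convol a 0 n = 0 := fun a => by simp [convol]
        simp only [sub_self, z1, z2] at c2 c3 c4
        linear_combination c1 + c2 + c4 + c3
      rw [e]
      refine (norm_add_le_of_le (norm_add_le_of_le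
        (hw.norm_convol_le (by positivity) hm₂ (h₁.rem y v d hd hv) (hb₂ y) n)
        (hw.norm_convol_le (by positivity) (by positivity) hlip₁ hlip₂ n))
        (hw.norm_convol_le hm₁ (by positivity) (hb₁ y) (h₂.rem y v d hd hv) n)).trans ?_
      have := mul_nonneg (mul_nonneg (mul_nonneg hm₁ hm₂) (sq_nonneg d)) (hτ n)
      nlinarith
    cont := fun y hy n => continuous_tsum
      (fun p => (h₁.cont y hy p).mul (h₂.cont y hy (n - p)))
      ((hw.summable n).mul_left (m₁ * m₂))
      (fun p ξ => ConvWeight.norm_term_le (hb₁ (y ξ)) (hb₂ (y ξ)) n p)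
    dcont := fun y v d hd hy hv hb n => (continuous_tsum
      (fun p => (h₁.dcont y v d hd hy hv hb p).mul (h₂.cont y hy (n - p)))
      ((hw.summable n).mul_left (m₁ * d * m₂))
      (fun p ξ => ConvWeight.norm_term_le (h₁.dbound (y ξ) (v ξ) d hd (hb ξ)) (hb₂ (y ξ)) n p)).add
      (continuous_tsum
      (fun p => (h₁.cont y hy p).mul (h₂.dcont y v d hd hy hv hb (n - p)))
      ((hw.summable n).mul_left (m₁ * (m₂ * d)))
      (fun p ξ => ConvWeight.norm_term_le (hb₁ (y ξ)) (h₂.dbound (y ξ) (v ξ) d hd (hb ξ)) n p)) }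

end SmoothSeq

/-! ### A smooth cutoff of the identity of `ℂ` -/

/-- A smooth bounded map `ρ` of `ℂ` that is the identity on the unit disc. -/
structure Cutoff (m : ℝ) (ρ : ℂ → ℂ) : Prop where
  pos : 0 < m
  eq_self : ∀ z, ‖z‖ ≤ 1 → ρ z = z
  bound : ∀ z, ‖ρ z‖ ≤ m
  contDiff : ContDiff ℝ 1 ρ
  lip : ∀ z z', ‖ρ z - ρ z'‖ ≤ m * ‖z - z'‖
  dbound : ∀ z v, ‖fderiv ℝ ρ z v‖ ≤ m * ‖v‖
  dlip : ∀ z z' v, ‖fderiv ℝ ρ z v - fderiv ℝ ρ z' v‖ ≤ m * ‖z - z'‖ * ‖v‖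
  rem : ∀ z v, ‖ρ (z + v) - ρ z - fderiv ℝ ρ z v‖ ≤ m * ‖v‖ ^ 2

/-- The identity times a smooth bump function. Compact support bounds the map, its derivative and
the Lipschitz constant of the derivative, and `m` is the largest of these. -/
theorem exists_cutoff : ∃ m ρ, Cutoff m ρ := by
  let f : ContDiffBump (0 : ℂ) := ⟨1, 2, by norm_num, by norm_num⟩
  let ρ : ℂ → ℂ := fun z => f z • z
  have hρ : ContDiff ℝ 2 ρ := f.contDiff.smul contDiff_id
  have hsupp : HasCompactSupport ρ := f.hasCompactSupport.smul_right
  obtain ⟨m₁, h₁⟩ := hρ.continuous.bounded_above_of_compact_support hsupp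
  obtain ⟨m₂, h₂⟩ := (hρ.continuous_fderiv (by norm_num)).bounded_above_of_compact_support
    (hsupp.fderiv (𝕜 := ℝ))
  have hd : ContDiff ℝ 1 (fderiv ℝ ρ) := hρ.fderiv_right (by norm_num)
  obtain ⟨m₃, h₃⟩ := hd.lipschitzWith_of_hasCompactSupport (hsupp.fderiv (𝕜 := ℝ)) (by norm_num)
  have hdiff : ∀ z, DifferentiableAt ℝ ρ z := fun z => hρ.differentiable (by norm_num) z
  set m : ℝ := max 1 (max m₁ (max m₂ m₃)) with hm
  have l₁ : m₁ ≤ m := by simp [hm]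
  have l₂ : m₂ ≤ m := by simp [hm]
  have l₃ : (m₃ : ℝ) ≤ m := by simp [hm]
  have l₀ : 0 < m := lt_of_lt_of_le one_pos (by simp [hm])
  have hop : ∀ z z', ‖fderiv ℝ ρ z - fderiv ℝ ρ z'‖ ≤ m * ‖z - z'‖ := fun z z' => by
    have := h₃.dist_le_mul z z'
    rw [dist_eq_norm, dist_eq_norm] at this
    exact this.trans (by gcongr)
  refine ⟨m, ρ, l₀, fun z hz => ?_, fun z => (h₁ z).trans l₁, hρ.of_le (by norm_num),
    fun z z' => ?_, fun z v => ?_, fun z z' v => ?_, fun z v => ?_⟩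
  · have : f z = 1 := f.one_of_mem_closedBall (by simpa using hz)
    simp [ρ, this]
  · exact Convex.norm_image_sub_le_of_norm_fderiv_le (s := univ) (fun x _ => hdiff x)
      (fun x _ => (h₂ x).trans l₂) convex_univ (mem_univ z') (mem_univ z)
  · exact ((fderiv ℝ ρ z).le_opNorm v).trans (by gcongr; exact (h₂ z).trans l₂)
  · exact ((fderiv ℝ ρ z - fderiv ℝ ρ z').le_opNorm v).trans (by gcongr; exact hop z z')
  -- Mean value inequality for `ρ` minus its linearisation at `z`, on the ball of radius `‖v‖`,
  -- where the derivative has changed by at most `m ‖v‖`.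
  · have := (convex_closedBall z ‖v‖).norm_image_sub_le_of_norm_hasFDerivWithin_le'
      (f := ρ) (f' := fderiv ℝ ρ) (φ := fderiv ℝ ρ z) (C := m * ‖v‖) (x := z) (y := z + v)
      (fun x _ => (hdiff x).hasFDerivAt.hasFDerivWithinAt)
      (fun x hx => (hop x z).trans (by
        gcongr; simpa [dist_eq_norm] using hx))
      (by simp) (by simp)
    rw [add_sub_cancel_left] at this
    exact this.trans_eq (by ring)

/-- Cutting off every coordinate by itself, rather than a norm of the whole sequence, preserves
differentiability with constants that do not depend on the number of coordinates, because all
arguments are measured in the supremum norm. -/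
theorem Cutoff.smoothSeq {ι 𝔫 : Type*} {m : ℝ} {ρ : ℂ → ℂ} (h : Cutoff m ρ) (i : 𝔫 → ι)
    {τ : 𝔫 → ℝ} (hτ : ∀ k, 0 ≤ τ k) :
    SmoothSeq m τ (fun (y : ι → ℂ) k => (τ k : ℂ) * ρ (y (i k)))
      (fun y v k => (τ k : ℂ) * fderiv ℝ ρ (y (i k)) (v (i k))) := by
  have hm := h.pos.le
  have aux : ∀ k (x : ℂ) b, ‖x‖ ≤ b → ‖(τ k : ℂ) * x‖ ≤ b * τ k := fun k x b hx => by
    rw [norm_mul, Complex.norm_real, Real.norm_of_nonneg (hτ k), mul_comm]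
    exact mul_le_mul_of_nonneg_right hx (hτ k)
  have hc : Continuous (fderiv ℝ ρ) := h.contDiff.continuous_fderiv (by norm_num)
  exact
  { bound := fun y k => aux _ _ _ (h.bound _)
    lip := fun y y' d hd hy k => by
      rw [← mul_sub]
      exact aux _ _ _ ((h.lip _ _).trans (by gcongr; exact hy _))
    add := fun y v v' d d' _ _ _ _ k => by simp [mul_add]
    smul := fun y v a k => by
      have : (a : ℂ) • v (i k) = a • v (i k) := by simp
      simp only [Pi.smul_apply]
      rw [this, map_smul]
      simp; ring
    dbound := fun y v d hd hv k => aux _ _ _ ((h.dbound _ _).trans (by gcongr; exact hv _))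
    dlip := fun y y' v d d' hd hd' hy hv k => by
      rw [← mul_sub]
      refine aux _ _ _ ((h.dlip _ _ _).trans ?_)
      gcongr
      exacts [hy _, hv _]
    rem := fun y v d hd hv k => by
      rw [← mul_sub, ← mul_sub]
      refine aux _ _ _ ((h.rem _ _).trans ?_)
      gcongr
      exact hv _
    cont := fun y hy k => continuous_const.mul (h.contDiff.continuous.comp (hy _))
    dcont := fun y v d _ hy hv _ k =>
      continuous_const.mul ((hc.comp (hy _)).clm_apply (hv _)) }

/-! ### Scalar linear equations on the line, with exponential weights -/

theorem hasDerivAt_cexp_mul (l : ℂ) (ξ : ℝ) :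
    HasDerivAt (fun t : ℝ => Complex.exp (l * t)) (l * Complex.exp (l * ξ)) ξ := by
  have h1 : HasDerivAt (fun t : ℝ => l * (t : ℂ)) (l * 1) ξ :=
    (Complex.ofRealCLM.hasDerivAt (x := ξ)).const_mul l
  have := h1.cexp
  rwa [mul_one, mul_comm] at this

theorem eq_mul_cexp {l : ℂ} {y : ℝ → ℂ} (hy : ∀ ξ, HasDerivAt y (l * y ξ) ξ) (ξ : ℝ) :
    y ξ = y 0 * Complex.exp (l * ξ) := by
  have h1 : ∀ t : ℝ, HasDerivAt (fun t : ℝ => y t * Complex.exp (-l * t)) 0 t := fun t => by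
    exact ((hy t).mul (hasDerivAt_cexp_mul (-l) t)).congr_deriv (by ring)
  have h2 := is_const_of_deriv_eq_zero (fun t => (h1 t).differentiableAt)
    (fun t => (h1 t).deriv) ξ 0
  simp only [Complex.ofReal_zero, mul_zero, Complex.exp_zero, mul_one] at h2
  rw [← h2, mul_assoc, ← Complex.exp_add]
  simp

/-- A nonzero multiple of `exp (l ξ)` grows at the rate `|Re l|` in one of the two directions of
time. -/
theorem eq_zero_of_growth {l : ℂ} {y : ℝ → ℂ} (hy : ∀ ξ, HasDerivAt y (l * y ξ) ξ)
    {C θ : ℝ} (hθ : θ < |l.re|) (hb : ∀ ξ, ‖y ξ‖ ≤ C * Real.exp (θ * |ξ|)) (ξ : ℝ) : y ξ = 0 := by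
  have h0 : y 0 = 0 := by
    by_contra hne
    have hpos : 0 < ‖y 0‖ := norm_pos_iff.2 hne
    have h1 : ∀ t : ℝ, 0 ≤ t → ‖y 0‖ * Real.exp ((|l.re| - θ) * t) ≤ C := fun t ht => by
      -- The sign of `s` selects the direction in which the exponential grows.
      obtain ⟨s, hs, hs'⟩ : ∃ s : ℝ, |s| = t ∧ l.re * s = |l.re| * t := by
        rcases le_total 0 l.re with h | h
        · exact ⟨t, abs_of_nonneg ht, by rw [abs_of_nonneg h]⟩
        · exact ⟨-t, by rw [abs_neg, abs_of_nonneg ht], by rw [abs_of_nonpos h]; ring⟩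
      have h2 := hb s
      rw [eq_mul_cexp hy s, norm_mul, Complex.norm_exp, hs] at h2
      have h3 : (l * (s : ℂ)).re = |l.re| * t := by simp [hs']
      rw [h3] at h2
      have h4 : Real.exp ((|l.re| - θ) * t) = Real.exp (|l.re| * t) * (Real.exp (θ * t))⁻¹ := by
        rw [← Real.exp_neg, ← Real.exp_add]; ring_nf
      rw [h4, ← mul_assoc]
      exact mul_inv_le_of_le_mul₀ (Real.exp_pos _).le (by
        have := (norm_nonneg (y 0)).trans (by simpa using hb 0); exact this) h2
    have h2 : Tendsto (fun t : ℝ => ‖y 0‖ * Real.exp ((|l.re| - θ) * t)) atTop atTop :=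
      (Real.tendsto_exp_atTop.comp (tendsto_id.const_mul_atTop (by linarith))).const_mul_atTop hpos
    obtain ⟨t, ht0, ht⟩ := ((eventually_ge_atTop 0).and (h2.eventually_gt_atTop C)).exists
    exact absurd (h1 t ht0) (not_le.2 ht)
  rw [eq_mul_cexp hy ξ, h0, zero_mul]

/-- The constant `c` stays free: it is 0 for central eigenvalues, and the integral over the negative
half line for stable ones, which turns the formula into an integral from `-∞`. -/
theorem hasDerivAt_duhamel (l c : ℂ) {f : ℝ → ℂ} (hf : Continuous f) (ξ : ℝ) :
    HasDerivAt (fun t : ℝ => Complex.exp (l * t) *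
        (c + ∫ s in (0 : ℝ)..t, Complex.exp (-l * s) * f s))
      (l * (Complex.exp (l * ξ) * (c + ∫ s in (0 : ℝ)..ξ, Complex.exp (-l * s) * f s)) + f ξ)
      ξ := by
  have hc : Continuous fun s : ℝ => Complex.exp (-l * s) * f s := by fun_prop
  have h1 := (intervalIntegral.integral_hasDerivAt_right (hc.intervalIntegrable 0 ξ)
    (hc.stronglyMeasurableAtFilter _ _) hc.continuousAt).const_add c
  have h2 := (hasDerivAt_cexp_mul l ξ).mul h1
  refine h2.congr_deriv ?_
  have : Complex.exp (l * ξ) * Complex.exp (-l * ξ) = 1 := by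
    rw [← Complex.exp_add]; simp
  linear_combination f ξ * this

/-- Comparison with the barrier `(2 / θ * D + κ) exp (θ ξ)`: since `‖l‖ ≤ θ / 2`, one half of its
growth rate absorbs the linear term and the other half the forcing, with the strict margin `θ κ /
2`. Then `κ` tends to 0. -/
theorem norm_le_of_hasDerivAt_right {l : ℂ} {y f : ℝ → ℂ} {D θ : ℝ} (hθ : 0 < θ)
    (hD : 0 ≤ D) (hl : ‖l‖ ≤ θ / 2)
    (hy : ∀ ξ, HasDerivAt y (l * y ξ + f ξ) ξ) (h0 : y 0 = 0)
    (hf : ∀ ξ, ‖f ξ‖ ≤ D * Real.exp (θ * |ξ|)) {ξ : ℝ} (hξ : 0 ≤ ξ) :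
    ‖y ξ‖ ≤ 2 / θ * D * Real.exp (θ * ξ) := by
  have key : ∀ κ > 0, ‖y ξ‖ ≤ (2 / θ * D + κ) * Real.exp (θ * ξ) := fun κ hκ => by
    have hB : ∀ x : ℝ, HasDerivAt (fun t => (2 / θ * D + κ) * Real.exp (θ * t))
        ((2 / θ * D + κ) * (θ * Real.exp (θ * x))) x := fun x => by
      have h1 : HasDerivAt (fun t : ℝ => θ * t) (θ * 1) x := (hasDerivAt_id x).const_mul θ
      have := h1.exp
      rw [mul_one, mul_comm] at this
      exact this.const_mul _
    refine image_norm_le_of_norm_deriv_right_lt_deriv_boundary (a := 0) (b := ξ)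
      (f' := fun x => l * y x + f x) (fun x _ => (hy x).continuousAt.continuousWithinAt)
      (fun x _ => (hy x).hasDerivWithinAt) (by rw [h0]; simp; positivity) hB
      (fun x hx hxe => ?_) ⟨hξ, le_rfl⟩
    have hE := Real.exp_pos (θ * x)
    have h1 : ‖l * y x + f x‖ ≤ θ / 2 * ((2 / θ * D + κ) * Real.exp (θ * x)) +
        D * Real.exp (θ * x) := by
      refine norm_add_le_of_le ?_ ?_
      · rw [norm_mul, hxe]; gcongr
      · simpa [abs_of_nonneg hx.1] using hf x
    refine h1.trans_lt ?_
    have h2 : (2 / θ * D + κ) * (θ * Real.exp (θ * x)) =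
        θ / 2 * ((2 / θ * D + κ) * Real.exp (θ * x)) + D * Real.exp (θ * x) +
          θ / 2 * κ * Real.exp (θ * x) := by field_simp; ring
    rw [h2]
    have : 0 < θ / 2 * κ * Real.exp (θ * x) := by positivity
    linarith
  have h1 : Tendsto (fun κ : ℝ => (2 / θ * D + κ) * Real.exp (θ * ξ)) (𝓝[>] 0)
      (𝓝 ((2 / θ * D + 0) * Real.exp (θ * ξ))) :=
    ((tendsto_const_nhds.add tendsto_id).mul_const _).mono_left nhdsWithin_le_nhds
  rw [add_zero] at h1
  exact ge_of_tendsto h1 (eventually_mem_nhdsWithin.mono fun κ hκ => key κ hκ)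

theorem hasDerivAt_reflect {l : ℂ} {y f : ℝ → ℂ} (hy : ∀ ξ, HasDerivAt y (l * y ξ + f ξ) ξ)
    (ξ : ℝ) : HasDerivAt (fun t => y (-t)) (-l * y (-ξ) + -f (-ξ)) ξ := by
  have := (hy (-ξ)).scomp ξ (hasDerivAt_neg ξ)
  exact this.congr_deriv (by simp)

/-- The solution with zero initial value of an equation with a weakly growing propagator. -/
theorem exists_central_solution {l : ℂ} {f : ℝ → ℂ} {D θ : ℝ} (hθ : 0 < θ) (hl : ‖l‖ ≤ θ / 2)
    (hf : Continuous f) (hfb : ∀ ξ, ‖f ξ‖ ≤ D * Real.exp (θ * |ξ|)) :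
    ∃ y : ℝ → ℂ, (∀ ξ, HasDerivAt y (l * y ξ + f ξ) ξ) ∧ y 0 = 0 ∧
      ∀ ξ, ‖y ξ‖ ≤ 2 / θ * D * Real.exp (θ * |ξ|) := by
  have hD : 0 ≤ D := by simpa using (norm_nonneg _).trans (hfb 0)
  refine ⟨_, hasDerivAt_duhamel l 0 hf, by simp, fun ξ => ?_⟩
  rcases le_total 0 ξ with h | h
  · rw [abs_of_nonneg h]
    exact norm_le_of_hasDerivAt_right hθ hD hl (hasDerivAt_duhamel l 0 hf) (by simp) hfb h
  · have := norm_le_of_hasDerivAt_right (ξ := -ξ) hθ hD (by rwa [norm_neg])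
      (hasDerivAt_reflect (hasDerivAt_duhamel l 0 hf)) (by simp)
      (fun t => by simpa using hfb (-t)) (by linarith)
    rw [abs_of_nonpos h]
    simpa only [neg_neg] using this

/-- Integration from `-∞` converges because `|s| ≤ |ξ| + (ξ - s)` for `s ≤ ξ`: the growth of the
forcing costs only `θ` of the decay rate `-Re l`. -/
theorem exists_hyperbolic_solution_neg {l : ℂ} {f : ℝ → ℂ} {D θ : ℝ} (hθ : 0 ≤ θ)
    (hl : l.re + θ < 0) (hf : Continuous f) (hfb : ∀ ξ, ‖f ξ‖ ≤ D * Real.exp (θ * |ξ|)) :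
    ∃ y : ℝ → ℂ, (∀ ξ, HasDerivAt y (l * y ξ + f ξ) ξ) ∧
      ∀ ξ, ‖y ξ‖ ≤ (-l.re - θ)⁻¹ * D * Real.exp (θ * |ξ|) := by
  have hD : 0 ≤ D := by simpa using (norm_nonneg _).trans (hfb 0)
  set b := -l.re - θ with hb
  have hbpos : 0 < b := by linarith
  have hle : ∀ ξ s : ℝ, s ≤ ξ → ‖Complex.exp (-l * s) * f s‖ ≤
      D * Real.exp (θ * |ξ| + θ * ξ) * Real.exp (b * s) := fun ξ s hs => by
    rw [norm_mul, Complex.norm_exp]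
    have h1 : (-l * (s : ℂ)).re = -l.re * s := by simp
    have h2 : |s| ≤ |ξ| + (ξ - s) := by
      have := abs_sub_abs_le_abs_sub s ξ
      rw [abs_sub_comm, abs_of_nonneg (sub_nonneg.2 hs)] at this
      linarith
    rw [h1]
    calc Real.exp (-l.re * s) * ‖f s‖
        ≤ Real.exp (-l.re * s) * (D * Real.exp (θ * (|ξ| + (ξ - s)))) := by
          gcongr; exact (hfb s).trans (by gcongr)
      _ = _ := by
          rw [mul_left_comm, ← Real.exp_add, mul_assoc, ← Real.exp_add, hb]; ring_nf
  have hc : Continuous fun s : ℝ => Complex.exp (-l * s) * f s := by fun_prop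
  have hexp : ∀ ξ : ℝ, MeasureTheory.IntegrableOn (fun s : ℝ => Real.exp (b * s)) (Iic ξ) :=
    fun ξ => integrableOn_exp_mul_Iic hbpos ξ
  have hint : ∀ ξ : ℝ, MeasureTheory.IntegrableOn
      (fun s : ℝ => Complex.exp (-l * s) * f s) (Iic ξ) := fun ξ => by
    refine ((hexp ξ).const_mul (D * Real.exp (θ * |ξ| + θ * ξ))).mono'
      hc.aestronglyMeasurable ?_
    filter_upwards [MeasureTheory.ae_restrict_mem measurableSet_Iic] with s hs
    exact hle ξ s hs
  refine ⟨_, hasDerivAt_duhamel l (∫ s in Iic (0 : ℝ), Complex.exp (-l * s) * f s) hf,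
    fun ξ => ?_⟩
  have h1 : (∫ s in Iic (0 : ℝ), Complex.exp (-l * s) * f s) +
      (∫ s in (0 : ℝ)..ξ, Complex.exp (-l * s) * f s) =
      ∫ s in Iic ξ, Complex.exp (-l * s) * f s := by
    rw [← intervalIntegral.integral_Iic_sub_Iic (hint 0) (hint ξ)]; ring
  rw [h1, norm_mul, Complex.norm_exp]
  have h2 : ‖∫ s in Iic ξ, Complex.exp (-l * s) * f s‖ ≤
      ∫ s in Iic ξ, D * Real.exp (θ * |ξ| + θ * ξ) * Real.exp (b * s) := by
    refine MeasureTheory.norm_integral_le_of_norm_le ((hexp ξ).const_mul _) ?_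
    filter_upwards [MeasureTheory.ae_restrict_mem measurableSet_Iic] with s hs
    exact hle ξ s hs
  rw [MeasureTheory.integral_const_mul, integral_exp_mul_Iic hbpos] at h2
  have h3 : (l * (ξ : ℂ)).re = l.re * ξ := by simp
  rw [h3]
  calc _ ≤ Real.exp (l.re * ξ) * (D * Real.exp (θ * |ξ| + θ * ξ) * (Real.exp (b * ξ) / b)) := by
        gcongr
    _ = b⁻¹ * D * (Real.exp (l.re * ξ) * Real.exp (θ * |ξ| + θ * ξ) * Real.exp (b * ξ)) := by
        field_simp
    _ = _ := by
        rw [← Real.exp_add, ← Real.exp_add, hb]; ring_nf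

/-- The bounded solution of an equation with an exponential dichotomy. -/
theorem exists_hyperbolic_solution {l : ℂ} {f : ℝ → ℂ} {D θ : ℝ} (hθ : 0 ≤ θ)
    (hl : θ < |l.re|) (hf : Continuous f) (hfb : ∀ ξ, ‖f ξ‖ ≤ D * Real.exp (θ * |ξ|)) :
    ∃ y : ℝ → ℂ, (∀ ξ, HasDerivAt y (l * y ξ + f ξ) ξ) ∧
      ∀ ξ, ‖y ξ‖ ≤ (|l.re| - θ)⁻¹ * D * Real.exp (θ * |ξ|) := by
  rcases le_total l.re 0 with h | h
  · rw [abs_of_nonpos h] at hl ⊢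
    exact exists_hyperbolic_solution_neg hθ (by linarith) hf hfb
  -- Reversing time turns an unstable eigenvalue into a stable one.
  · rw [abs_of_nonneg h] at hl ⊢
    obtain ⟨y, hy, hyb⟩ := exists_hyperbolic_solution_neg (l := -l) (f := fun ξ => -f (-ξ)) hθ
      (by rw [Complex.neg_re]; linarith) (by fun_prop) (fun ξ => by simpa using hfb (-ξ))
    refine ⟨fun t => y (-t), fun ξ => ?_, fun ξ => ?_⟩
    · simpa using hasDerivAt_reflect hy ξ
    · simpa using hyb (-ξ)

/-! ### Linear systems with a spectral splitting -/

/-- The forced linear system `X' = M X + f e`, for forces of exponential growth between `θ` and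
`2θ`: there is a solution with vanishing central part at `0`, bounded in terms of `β`, it is
unique, and central initial values have solutions of exponential growth at most `θ`. -/
structure Solvable {m : ℕ} (M P : Matrix (Fin m) (Fin m) ℂ) (e : Fin m → ℂ) (θ : ℝ)
    (β : Fin m → ℝ) : Prop where
  exists_forced : ∀ η, θ ≤ η → η ≤ 2 * θ → ∀ (f : ℝ → ℂ) (D : ℝ), Continuous f →
    (∀ ξ, ‖f ξ‖ ≤ D * Real.exp (η * |ξ|)) → ∃ X : ℝ → Fin m → ℂ,
      (∀ ξ, HasDerivAt X (M *ᵥ X ξ + f ξ • e) ξ) ∧ P *ᵥ X 0 = 0 ∧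
      ∀ ξ j, ‖X ξ j‖ ≤ β j * D * Real.exp (η * |ξ|)
  unique : ∀ (X : ℝ → Fin m → ℂ) (C : Fin m → ℝ), (∀ ξ, HasDerivAt X (M *ᵥ X ξ) ξ) →
    P *ᵥ X 0 = 0 →
    (∀ ξ j, ‖X ξ j‖ ≤ C j * Real.exp (2 * θ * |ξ|)) → ∀ ξ, X ξ = 0
  exists_central : ∃ C, 0 ≤ C ∧ ∀ x, P *ᵥ x = x → ∃ X : ℝ → Fin m → ℂ,
    (∀ ξ, HasDerivAt X (M *ᵥ X ξ) ξ) ∧ X 0 = x ∧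
    ∀ ξ j, ‖X ξ j‖ ≤ C * (∑ i, ‖x i‖) * Real.exp (θ * |ξ|)

/-- A splitting of `ℂ^m` into the range of `P`, on which the spectrum `{l₁, l₂}` of `M` is small,
and eigenspaces of `M` with projections `π i`, whose eigenvalues are away from the imaginary
axis. -/
structure ModeSplit {m : ℕ} (M P : Matrix (Fin m) (Fin m) ℂ) (e : Fin m → ℂ) (θ : ℝ)
    (β : Fin m → ℝ) (H : Finset (Fin m)) (lam : Fin m → ℂ)
    (π : Fin m → Matrix (Fin m) (Fin m) ℂ) (l₁ l₂ : ℂ) : Prop where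
  sum_eq : P + ∑ i ∈ H, π i = 1
  comm : M * P = P * M
  idem : P * P = P
  mul_proj : ∀ i ∈ H, M * π i = lam i • π i
  proj_mul : ∀ i ∈ H, π i * M = lam i • π i
  orth : ∀ i ∈ H, P * π i = 0
  central : (M - l₂ • (1 : Matrix (Fin m) (Fin m) ℂ)) * ((M - l₁ • (1 : Matrix (Fin m) (Fin m) ℂ)) * P) = 0
  norm_l₁ : ‖l₁‖ ≤ θ / 2
  norm_l₂ : ‖l₂‖ ≤ θ / 2
  gap : ∀ i ∈ H, 4 * θ ≤ |(lam i).re|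
  bound : ∀ i ∈ H, ∀ j, ‖(π i *ᵥ e) j‖ ≤ β j * |(lam i).re|
  central_bound : ∀ j, 2 / θ * ‖(P *ᵥ e) j‖ +
    (2 / θ) ^ 2 * ‖(((M - l₁ • (1 : Matrix (Fin m) (Fin m) ℂ)) * P) *ᵥ e) j‖ ≤ β j

theorem hasDerivAt_mulVec {m k : ℕ} (A : Matrix (Fin k) (Fin m) ℂ) {X : ℝ → Fin m → ℂ}
    {X' : Fin m → ℂ} {ξ : ℝ} (h : HasDerivAt X X' ξ) :
    HasDerivAt (fun t => A *ᵥ X t) (A *ᵥ X') ξ := by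
  rw [hasDerivAt_pi] at h ⊢
  intro i
  have := HasDerivAt.sum (u := Finset.univ) (fun j _ => (h j).const_mul (A i j))
  rw [show (fun t => (A *ᵥ X t) i) = ∑ j, fun t => A i j * X t j by
    ext t; simp [Matrix.mulVec, dotProduct]]
  exact this

namespace ModeSplit

variable {m : ℕ} {M P : Matrix (Fin m) (Fin m) ℂ} {e : Fin m → ℂ} {θ : ℝ} {β : Fin m → ℝ}
  {H : Finset (Fin m)} {lam : Fin m → ℂ} {π : Fin m → Matrix (Fin m) (Fin m) ℂ} {l₁ l₂ : ℂ}
  (S : ModeSplit M P e θ β H lam π l₁ l₂)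
include S

/-- On the range of `P` one has `(M - l₂)(M - l₁) = 0`, so the block reduces to a cascade of two
scalar equations, the first driving the second. This triangular form stays valid when `l₁ = l₂`,
where individual eigenprojections would blow up. -/
theorem hasDerivAt_chain {y₁ y₂ f : ℝ → ℂ} {x : Fin m → ℂ} (hx : P *ᵥ x = x) {ξ : ℝ}
    (h₁ : HasDerivAt y₁ (l₁ * y₁ ξ + f ξ) ξ) (h₂ : HasDerivAt y₂ (l₂ * y₂ ξ + y₁ ξ) ξ) :
    HasDerivAt (fun t => y₁ t • x + y₂ t • ((M - l₁ • (1 : Matrix (Fin m) (Fin m) ℂ)) *ᵥ x))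
      (M *ᵥ (y₁ ξ • x + y₂ ξ • ((M - l₁ • (1 : Matrix (Fin m) (Fin m) ℂ)) *ᵥ x)) + f ξ • x) ξ := by
  have h := (h₁.smul_const x).add
    (h₂.smul_const ((M - l₁ • (1 : Matrix (Fin m) (Fin m) ℂ)) *ᵥ x))
  refine h.congr_deriv ?_
  have h3 : M *ᵥ ((M - l₁ • (1 : Matrix (Fin m) (Fin m) ℂ)) *ᵥ x) =
      l₂ • ((M - l₁ • (1 : Matrix (Fin m) (Fin m) ℂ)) *ᵥ x) := by
    have h4 : ((M - l₂ • (1 : Matrix (Fin m) (Fin m) ℂ)) *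
        ((M - l₁ • (1 : Matrix (Fin m) (Fin m) ℂ)) * P)) *ᵥ x = 0 := by
      rw [S.central, Matrix.zero_mulVec]
    rw [← Matrix.mulVec_mulVec, ← Matrix.mulVec_mulVec, hx, Matrix.sub_mulVec,
      Matrix.smul_mulVec, Matrix.one_mulVec, sub_eq_zero] at h4
    exact h4
  rw [Matrix.mulVec_add, Matrix.mulVec_smul, Matrix.mulVec_smul, h3, Matrix.sub_mulVec,
    Matrix.smul_mulVec, Matrix.one_mulVec]
  module

/-- Each hyperbolic component solves a scalar equation and vanishes because its rate is at least
`4θ`, more than the permitted `2θ`. Then `(M - l₁) P X`, and after it `P X`, solve homogeneous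
scalar equations with zero initial value; these need no growth condition. -/
theorem unique (hθ : 0 < θ) (X : ℝ → Fin m → ℂ) (C : Fin m → ℝ)
    (hX : ∀ ξ, HasDerivAt X (M *ᵥ X ξ) ξ)
    (h0 : P *ᵥ X 0 = 0) (hb : ∀ ξ j, ‖X ξ j‖ ≤ C j * Real.exp (2 * θ * |ξ|)) (ξ : ℝ) : X ξ = 0 := by
  have scal : ∀ (A : Matrix (Fin m) (Fin m) ℂ) (l : ℂ), A * M = l • A → ∀ j ξ,
      HasDerivAt (fun t => (A *ᵥ X t) j) (l * (A *ᵥ X ξ) j) ξ := fun A l hA j ξ => by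
    have := (hasDerivAt_pi.1 (hasDerivAt_mulVec A (hX ξ))) j
    rw [Matrix.mulVec_mulVec, hA, Matrix.smul_mulVec] at this
    simpa using this
  have scal0 : ∀ (A : Matrix (Fin m) (Fin m) ℂ) (l : ℂ), (∀ ξ, A *ᵥ (M *ᵥ X ξ) = l • (A *ᵥ X ξ)) →
      A *ᵥ X 0 = 0 → ∀ ξ, A *ᵥ X ξ = 0 := fun A l hA hA0 ξ => by
    ext j
    have h1 : ∀ ξ, HasDerivAt (fun t => (A *ᵥ X t) j) (l * (A *ᵥ X ξ) j) ξ := fun ξ => by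
      have := (hasDerivAt_pi.1 (hasDerivAt_mulVec A (hX ξ))) j
      rw [hA] at this
      simpa using this
    have h2 := eq_mul_cexp h1 ξ
    simp only [hA0] at h2
    simpa using h2
  have hhyp : ∀ i ∈ H, ∀ ξ, π i *ᵥ X ξ = 0 := fun i hi ξ => by
    ext j
    refine eq_zero_of_growth (C := ∑ k, ‖π i j k‖ * C k) (θ := 2 * θ)
      (scal (π i) (lam i) (S.proj_mul i hi) j)
      (by have := S.gap i hi; linarith) (fun t => ?_) ξ
    rw [Finset.sum_mul]
    refine (norm_sum_le Finset.univ fun k => π i j k * X t k).trans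
      (Finset.sum_le_sum fun k _ => ?_)
    rw [norm_mul, mul_assoc]
    exact mul_le_mul_of_nonneg_left (hb t k) (norm_nonneg _)
  have hQ : ∀ ξ, ((M - l₁ • (1 : Matrix (Fin m) (Fin m) ℂ)) * P) *ᵥ X ξ = 0 := by
    refine scal0 _ l₂ (fun ξ => ?_) ?_
    · have hc : ((M - l₁ • (1 : Matrix (Fin m) (Fin m) ℂ)) * P) * M =
          l₂ • ((M - l₁ • (1 : Matrix (Fin m) (Fin m) ℂ)) * P) := by
        have h1 := S.central
        rw [Matrix.sub_mul, Matrix.smul_mul, Matrix.one_mul, sub_eq_zero] at h1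
        rw [← h1, Matrix.mul_assoc, ← S.comm, ← Matrix.mul_assoc, ← Matrix.mul_assoc]
        congr 1
        simp [Matrix.sub_mul, Matrix.mul_sub]
      rw [Matrix.mulVec_mulVec, hc, Matrix.smul_mulVec]
    · rw [← Matrix.mulVec_mulVec, h0, Matrix.mulVec_zero]
  have hP : ∀ ξ, P *ᵥ X ξ = 0 := by
    refine scal0 _ l₁ (fun ξ => ?_) h0
    have h1 := hQ ξ
    rw [Matrix.sub_mul, Matrix.smul_mul, Matrix.one_mul, Matrix.sub_mulVec, sub_eq_zero,
      Matrix.smul_mulVec] at h1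
    rw [Matrix.mulVec_mulVec, ← S.comm, h1]
  have h1 : (P + ∑ i ∈ H, π i) *ᵥ X ξ = 0 := by
    rw [Matrix.add_mulVec, hP, Matrix.sum_mulVec, Finset.sum_eq_zero fun i hi => hhyp i hi ξ,
      add_zero]
  rwa [S.sum_eq, Matrix.one_mulVec] at h1

/-- Superposition of the central cascade, started from zero, and the hyperbolic solutions. The
factor `2 * m + 1` counts 1 for the central part and 2 for each of at most `m` hyperbolic
eigenvalues. -/
theorem exists_forced (hθ : 0 < θ) (η : ℝ) (h₁ : θ ≤ η) (h₂ : η ≤ 2 * θ) (f : ℝ → ℂ) (D : ℝ)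
    (hf : Continuous f) (hfb : ∀ ξ, ‖f ξ‖ ≤ D * Real.exp (η * |ξ|)) : ∃ X : ℝ → Fin m → ℂ,
      (∀ ξ, HasDerivAt X (M *ᵥ X ξ + f ξ • e) ξ) ∧ P *ᵥ X 0 = 0 ∧
      ∀ ξ j, ‖X ξ j‖ ≤ (2 * m + 1) * β j * D * Real.exp (η * |ξ|) := by
  have hη : 0 < η := hθ.trans_le h₁
  have hD : 0 ≤ D := by simpa using (norm_nonneg _).trans (hfb 0)
  obtain ⟨y₁, hy₁, hy₁0, hy₁b⟩ := exists_central_solution hη (S.norm_l₁.trans (by linarith)) hf hfb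
  obtain ⟨y₂, hy₂, hy₂0, hy₂b⟩ := exists_central_solution (l := l₂) hη
    (S.norm_l₂.trans (by linarith))
    (continuous_iff_continuousAt.2 fun ξ => (hy₁ ξ).continuousAt) hy₁b
  -- As `η ≤ 2θ ≤ |Re λ| / 2`, the constant `(|Re λ| - η)⁻¹` is at most `2 / |Re λ|`, whatever the
  -- weight.
  have hhyp : ∀ i : Fin m, ∃ y : ℝ → ℂ, i ∈ H → (∀ ξ, HasDerivAt y (lam i * y ξ + f ξ) ξ) ∧
      ∀ ξ, ‖y ξ‖ ≤ 2 / |(lam i).re| * D * Real.exp (η * |ξ|) := fun i => by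
    by_cases hi : i ∈ H
    · have hg := S.gap i hi
      obtain ⟨y, hy, hyb⟩ := exists_hyperbolic_solution hη.le (l := lam i) (by linarith) hf hfb
      refine ⟨y, fun _ => ⟨hy, fun ξ => (hyb ξ).trans ?_⟩⟩
      gcongr
      rw [inv_le_comm₀ (by linarith) (by have : 0 < |(lam i).re| := by linarith
                                         positivity), inv_div]
      linarith
    · exact ⟨0, fun h => absurd h hi⟩
  choose y hy using hhyp
  have hPe : P *ᵥ (P *ᵥ e) = P *ᵥ e := by rw [Matrix.mulVec_mulVec, S.idem]
  refine ⟨fun t => (y₁ t • (P *ᵥ e) + y₂ t • ((M - l₁ • (1 : Matrix (Fin m) (Fin m) ℂ)) *ᵥ (P *ᵥ e))) +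
    ∑ i ∈ H, y i t • (π i *ᵥ e), fun ξ => ?_, ?_, fun ξ j => ?_⟩
  · have hsum : HasDerivAt (fun t => ∑ i ∈ H, y i t • (π i *ᵥ e))
        (∑ i ∈ H, (lam i * y i ξ + f ξ) • (π i *ᵥ e)) ξ :=
      HasDerivAt.fun_sum fun i hi => ((hy i hi).1 ξ).smul_const _
    refine ((S.hasDerivAt_chain hPe (hy₁ ξ) (hy₂ ξ)).add hsum).congr_deriv ?_
    beta_reduce
    rw [Matrix.mulVec_add _ _ (∑ i ∈ H, _), Matrix.mulVec_sum]
    have e1 : f ξ • e = f ξ • (P *ᵥ e) + ∑ i ∈ H, f ξ • (π i *ᵥ e) := by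
      rw [← Finset.smul_sum, ← smul_add, ← Matrix.sum_mulVec, ← Matrix.add_mulVec, S.sum_eq,
        Matrix.one_mulVec]
    have e2 : ∑ i ∈ H, M *ᵥ (y i ξ • (π i *ᵥ e)) = ∑ i ∈ H, (lam i * y i ξ) • (π i *ᵥ e) :=
      Finset.sum_congr rfl fun i hi => by
        rw [Matrix.mulVec_smul, Matrix.mulVec_mulVec, S.mul_proj i hi, Matrix.smul_mulVec,
          smul_smul, mul_comm]
    rw [e1, e2]
    simp only [add_smul, Finset.sum_add_distrib]
    abel
  · simp only [hy₁0, hy₂0, zero_smul, zero_add]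
    rw [Matrix.mulVec_sum]
    refine Finset.sum_eq_zero fun i hi => ?_
    rw [Matrix.mulVec_smul, Matrix.mulVec_mulVec, S.orth i hi, Matrix.zero_mulVec, smul_zero]
  · have hE := Real.exp_pos (η * |ξ|)
    have hβ : 0 ≤ β j := le_trans (by positivity) (S.central_bound j)
    have hinv : 2 / η ≤ 2 / θ := by gcongr
    have c1 : ‖y₁ ξ * (P *ᵥ e) j + y₂ ξ * ((M - l₁ • (1 : Matrix (Fin m) (Fin m) ℂ)) *ᵥ (P *ᵥ e)) j‖ ≤
        β j * D * Real.exp (η * |ξ|) := by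
      have a1 : ‖y₁ ξ‖ ≤ 2 / θ * D * Real.exp (η * |ξ|) := (hy₁b ξ).trans (by gcongr)
      have a2 : ‖y₂ ξ‖ ≤ (2 / θ) ^ 2 * D * Real.exp (η * |ξ|) := by
        refine (hy₂b ξ).trans ?_
        calc 2 / η * (2 / η * D) * Real.exp (η * |ξ|)
            ≤ 2 / θ * (2 / θ * D) * Real.exp (η * |ξ|) := by gcongr
          _ = _ := by ring
      have a3 := S.central_bound j
      rw [← Matrix.mulVec_mulVec] at a3
      refine (norm_add_le _ _).trans ?_
      rw [norm_mul, norm_mul]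
      calc _ ≤ (2 / θ * D * Real.exp (η * |ξ|)) * ‖(P *ᵥ e) j‖ + ((2 / θ) ^ 2 * D * Real.exp (η * |ξ|)) *
            ‖((M - l₁ • (1 : Matrix (Fin m) (Fin m) ℂ)) *ᵥ (P *ᵥ e)) j‖ := by gcongr
        _ = (2 / θ * ‖(P *ᵥ e) j‖ + (2 / θ) ^ 2 *
            ‖((M - l₁ • (1 : Matrix (Fin m) (Fin m) ℂ)) *ᵥ (P *ᵥ e)) j‖) * (D * Real.exp (η * |ξ|)) := by
            ring
        _ ≤ β j * (D * Real.exp (η * |ξ|)) := by gcongr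
        _ = _ := by ring
    have c2 : ∀ i ∈ H, ‖y i ξ * (π i *ᵥ e) j‖ ≤ 2 * (β j * D * Real.exp (η * |ξ|)) := fun i hi => by
      have hg := S.gap i hi
      have hpos : 0 < |(lam i).re| := by linarith
      rw [norm_mul]
      calc _ ≤ (2 / |(lam i).re| * D * Real.exp (η * |ξ|)) * (β j * |(lam i).re|) :=
            mul_le_mul ((hy i hi).2 ξ) (S.bound i hi j) (norm_nonneg _) (by positivity)
        _ = _ := by field_simp
    have c3 : ‖∑ i ∈ H, y i ξ * (π i *ᵥ e) j‖ ≤ 2 * m * (β j * D * Real.exp (η * |ξ|)) := by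
      refine (norm_sum_le_of_le H c2).trans ?_
      rw [Finset.sum_const, nsmul_eq_mul]
      have hcard : (H.card : ℝ) ≤ m := by
        exact_mod_cast (Finset.card_le_univ H).trans_eq (Fintype.card_fin m)
      have : 0 ≤ β j * D * Real.exp (η * |ξ|) := by positivity
      nlinarith
    simp only [Pi.add_apply, Pi.smul_apply, smul_eq_mul, Finset.sum_apply]
    refine (norm_add_le_of_le c1 c3).trans_eq ?_
    ring

/-- The cascade without forcing, with first component `exp (l₁ ξ)`. The constant need not be uniform
over the blocks, since only finitely many modes will carry central data. -/
theorem exists_central (hθ : 0 < θ) : ∃ C, 0 ≤ C ∧ ∀ x, P *ᵥ x = x → ∃ X : ℝ → Fin m → ℂ,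
    (∀ ξ, HasDerivAt X (M *ᵥ X ξ) ξ) ∧ X 0 = x ∧
    ∀ ξ j, ‖X ξ j‖ ≤ C * (∑ i, ‖x i‖) * Real.exp (θ * |ξ|) := by
  set A := M - l₁ • (1 : Matrix (Fin m) (Fin m) ℂ) with hA
  refine ⟨1 + 2 / θ * ∑ i, ∑ k, ‖A i k‖, by positivity, fun x hx => ?_⟩
  have hexp : ∀ ξ : ℝ, ‖Complex.exp (l₁ * ξ)‖ ≤ 1 * Real.exp (θ * |ξ|) := fun ξ => by
    rw [Complex.norm_exp, one_mul, Real.exp_le_exp]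
    have h1 : (l₁ * (ξ : ℂ)).re = l₁.re * ξ := by simp
    rw [h1]
    calc l₁.re * ξ ≤ |l₁.re * ξ| := le_abs_self _
      _ = |l₁.re| * |ξ| := abs_mul _ _
      _ ≤ θ * |ξ| := by
        gcongr
        exact (Complex.abs_re_le_norm _).trans (S.norm_l₁.trans (by linarith))
  obtain ⟨y₂, hy₂, hy₂0, hy₂b⟩ := exists_central_solution (l := l₂) hθ S.norm_l₂
    (f := fun ξ : ℝ => Complex.exp (l₁ * ξ)) (by fun_prop) hexp
  refine ⟨fun t : ℝ => Complex.exp (l₁ * t) • x + y₂ t • (A *ᵥ x), fun ξ => ?_, ?_, fun ξ j => ?_⟩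
  · have := S.hasDerivAt_chain (f := 0) (y₁ := fun t : ℝ => Complex.exp (l₁ * t)) hx
      (by simpa using hasDerivAt_cexp_mul l₁ ξ) (hy₂ ξ)
    simpa using this
  · simp [hy₂0]
  · have hx1 : ∀ i, ‖x i‖ ≤ ∑ i, ‖x i‖ := fun i =>
      Finset.single_le_sum (f := fun i => ‖x i‖) (fun _ _ => norm_nonneg _) (Finset.mem_univ i)
    have hAx : ‖(A *ᵥ x) j‖ ≤ (∑ i, ∑ k, ‖A i k‖) * ∑ i, ‖x i‖ := by
      calc ‖(A *ᵥ x) j‖ ≤ ∑ k, ‖A j k‖ * ‖x k‖ :=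
            (norm_sum_le Finset.univ fun k => A j k * x k).trans_eq
              (Finset.sum_congr rfl fun k _ => norm_mul _ _)
        _ ≤ ∑ k, ‖A j k‖ * ∑ i, ‖x i‖ := Finset.sum_le_sum fun k _ => by gcongr; exact hx1 k
        _ = (∑ k, ‖A j k‖) * ∑ i, ‖x i‖ := by rw [Finset.sum_mul]
        _ ≤ _ := by
          refine mul_le_mul_of_nonneg_right ?_ (Finset.sum_nonneg fun _ _ => norm_nonneg _)
          exact Finset.single_le_sum (f := fun i => ∑ k, ‖A i k‖)
            (fun _ _ => Finset.sum_nonneg fun _ _ => norm_nonneg _) (Finset.mem_univ j)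
    simp only [Pi.add_apply, Pi.smul_apply, smul_eq_mul]
    refine (norm_add_le _ _).trans ?_
    rw [norm_mul, norm_mul]
    calc _ ≤ (1 * Real.exp (θ * |ξ|)) * (∑ i, ‖x i‖) + (2 / θ * 1 * Real.exp (θ * |ξ|)) *
          ((∑ i, ∑ k, ‖A i k‖) * ∑ i, ‖x i‖) := by
          gcongr
          exacts [hexp ξ, hx1 j, hy₂b ξ]
      _ = _ := by ring

theorem solvable (hθ : 0 < θ) : Solvable M P e θ fun j => (2 * m + 1) * β j :=
  ⟨S.exists_forced hθ, S.unique hθ, S.exists_central hθ⟩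

end ModeSplit

open Polynomial in
theorem exists_roots_of_monic {p : Polynomial ℂ} (hp : p.Monic) {m : ℕ} (hm : p.natDegree = m) :
    ∃ lam : Fin m → ℂ, p = ∏ i, (X - C (lam i)) := by
  have hs := IsAlgClosed.splits p
  have hcard : p.roots.toList.length = m := by
    rw [Multiset.length_toList, ← hm, hs.natDegree_eq_card_roots]
  refine ⟨fun i => p.roots.toList.get (i.cast hcard.symm), ?_⟩
  have h1 := hs.eq_prod_roots_of_monic hp
  conv_lhs => rw [h1, ← Multiset.coe_toList p.roots, Multiset.map_coe, Multiset.prod_coe]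
  rw [← List.prod_ofFn]
  congr 1
  refine List.ext_get (by simp [hcard]) fun k h1 h2 => ?_
  simp

section Spectral

open Polynomial

variable {m : ℕ} (M : Matrix (Fin m) (Fin m) ℂ) (lam : Fin m → ℂ)

/-- The product of the differences of the root `lam i` with the other roots. -/
noncomputable def rootGap (i : Fin m) : ℂ := ∏ j ∈ Finset.univ.erase i, (lam i - lam j)

/-- The Lagrange polynomial that is `1` at the simple root `lam i` and `0` at the others. -/
noncomputable def rootPoly (i : Fin m) : ℂ[X] :=
  C (rootGap lam i)⁻¹ * ∏ j ∈ Finset.univ.erase i, (X - C (lam j))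

/-- The spectral projection for the simple eigenvalue `lam i` of `M`. -/
noncomputable def eigProj (i : Fin m) : Matrix (Fin m) (Fin m) ℂ := aeval M (rootPoly lam i)

theorem ne_of_rootGap_ne_zero {i : Fin m} (h : rootGap lam i ≠ 0) : ∀ j, j ≠ i → lam i ≠ lam j :=
  fun j hj => sub_ne_zero.1 (Finset.prod_ne_zero_iff.1 h j (Finset.mem_erase.2 ⟨hj, Finset.mem_univ _⟩))

/-- The gap is the derivative of the characteristic polynomial at the root, so the dispersion
relation gives it in closed form without knowledge of the other roots. -/
theorem rootGap_eq_derivative (i : Fin m) :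
    rootGap lam i = (derivative (∏ j, (X - C (lam j)))).eval (lam i) := by
  have := Lagrange.eval_nodal_derivative_eval_node_eq (v := lam) (Finset.mem_univ i)
  rw [Lagrange.nodal, Lagrange.nodal, eval_prod] at this
  rw [this, rootGap]
  simp

theorem eval_rootPoly_self {i : Fin m} (h : rootGap lam i ≠ 0) :
    (rootPoly lam i).eval (lam i) = 1 := by
  rw [rootPoly, eval_mul, eval_C, eval_prod]
  simp only [eval_sub, eval_X, eval_C]
  exact inv_mul_cancel₀ h

theorem eval_rootPoly_of_ne {i j : Fin m} (h : j ≠ i) : (rootPoly lam i).eval (lam j) = 0 := by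
  rw [rootPoly, eval_mul, eval_prod, Finset.prod_eq_zero (Finset.mem_erase.2 ⟨h, Finset.mem_univ j⟩)
    (by simp), mul_zero]

variable {M lam}
variable (hM : M.charpoly = ∏ i, (X - C (lam i)))
include hM

/-- Cayley–Hamilton: `(X - λᵢ)` times the Lagrange polynomial is a multiple of the characteristic
polynomial. Simplicity of the root plays no part here, as the polynomial is zero when the gap
vanishes. -/
theorem mul_eigProj (i : Fin m) : M * eigProj M lam i = lam i • eigProj M lam i := by
  have h1 : aeval M ((X - C (lam i)) * rootPoly lam i) = 0 := by
    have e : (X - C (lam i)) * rootPoly lam i = C (rootGap lam i)⁻¹ * M.charpoly := by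
      rw [hM, rootPoly, ← Finset.mul_prod_erase _ _ (Finset.mem_univ i)]; ring
    rw [e, map_mul, Matrix.aeval_self_charpoly, mul_zero]
  rw [map_mul, map_sub, aeval_X, aeval_C, Algebra.algebraMap_eq_smul_one, sub_mul, sub_eq_zero,
    smul_mul_assoc, one_mul] at h1
  exact h1

/-- Modulo `X - λᵢ` every polynomial equals its value at `λᵢ`, and `M - λᵢ` annihilates the
projection. -/
theorem eigProj_mul_aeval (i : Fin m) (q : ℂ[X]) :
    eigProj M lam i * aeval M q = q.eval (lam i) • eigProj M lam i := by
  have hc : ∀ q : ℂ[X], eigProj M lam i * aeval M q = aeval M q * eigProj M lam i := fun q => by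
    rw [eigProj, ← map_mul, mul_comm, map_mul]
  have h1 : (X - C (lam i)) ∣ q - C (q.eval (lam i)) := dvd_iff_isRoot.2 (by simp)
  obtain ⟨t, ht⟩ := h1
  have e : q = C (q.eval (lam i)) + t * (X - C (lam i)) := by rw [mul_comm t, ← ht]; ring
  have h0 : aeval M (X - C (lam i)) * eigProj M lam i = 0 := by
    rw [map_sub, aeval_X, aeval_C, Algebra.algebraMap_eq_smul_one, sub_mul, smul_mul_assoc, one_mul,
      mul_eigProj hM, sub_self]
  rw [hc]
  conv_lhs => rw [e, map_add, map_mul, add_mul, mul_assoc, h0, mul_zero, add_zero, aeval_C,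
    Algebra.algebraMap_eq_smul_one, smul_mul_assoc, one_mul]

theorem eigProj_mul (i : Fin m) : eigProj M lam i * M = lam i • eigProj M lam i := by
  have := eigProj_mul_aeval hM i X
  rwa [aeval_X, eval_X] at this

theorem mul_compl_comm (H : Finset (Fin m)) : M * (1 - ∑ j ∈ H, eigProj M lam j) =
    (1 - ∑ j ∈ H, eigProj M lam j) * M := by
  rw [mul_sub, sub_mul, mul_one, one_mul, Finset.mul_sum, Finset.sum_mul]
  simp only [mul_eigProj hM, eigProj_mul hM]

variable {H : Finset (Fin m)} (hH : ∀ i ∈ H, rootGap lam i ≠ 0)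
include hH

theorem eigProj_mul_eigProj {i j : Fin m} (hi : i ∈ H) :
    eigProj M lam i * eigProj M lam j = if i = j then eigProj M lam i else 0 := by
  rw [eigProj.eq_1 M lam j, eigProj_mul_aeval hM]
  split_ifs with h
  · subst h; rw [eval_rootPoly_self lam (hH i hi), one_smul]
  · rw [eval_rootPoly_of_ne lam h, zero_smul]

theorem compl_mul_eigProj {i : Fin m} (hi : i ∈ H) :
    (1 - ∑ j ∈ H, eigProj M lam j) * eigProj M lam i = 0 := by
  rw [sub_mul, one_mul, Finset.sum_mul, Finset.sum_congr rfl fun j hj =>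
    eigProj_mul_eigProj hM hH (j := i) hj]
  simp [hi]

theorem compl_idem : (1 - ∑ j ∈ H, eigProj M lam j) * (1 - ∑ j ∈ H, eigProj M lam j) =
    1 - ∑ j ∈ H, eigProj M lam j := by
  conv_lhs => rw [mul_sub, mul_one, Finset.mul_sum,
    Finset.sum_eq_zero fun i hi => compl_mul_eigProj hM hH hi, sub_zero]

/-- The polynomial `1 - ∑ rootPoly` vanishes at the simple roots in `H`, so multiplied by `q` it is
divisible by the characteristic polynomial, and Cayley–Hamilton applies. The roots outside `H` may
coincide. -/
theorem aeval_prod_compl_mul {q : ℂ[X]} (hq : ∏ j ∈ Hᶜ, (X - C (lam j)) ∣ q) :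
    aeval M q * (1 - ∑ j ∈ H, eigProj M lam j) = 0 := by
  have h1 : (1 - ∑ j ∈ H, eigProj M lam j) = aeval M (1 - ∑ j ∈ H, rootPoly lam j) := by
    rw [map_sub, map_one, map_sum]; rfl
  have h2 : ∏ i ∈ H, (X - C (lam i)) ∣ 1 - ∑ j ∈ H, rootPoly lam j := by
    refine Finset.prod_dvd_of_coprime (fun i hi j hj hij => ?_) fun i hi => ?_
    · exact isCoprime_X_sub_C_of_isUnit_sub
        (sub_ne_zero.2 (ne_of_rootGap_ne_zero lam (hH i hi) j hij.symm)).isUnit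
    · rw [dvd_iff_isRoot, IsRoot.def, eval_sub, eval_one, eval_finsetSum,
        Finset.sum_eq_single i (fun j _ hj => eval_rootPoly_of_ne lam hj.symm)
          (fun h => absurd hi h), eval_rootPoly_self lam (hH i hi), sub_self]
  have h3 : M.charpoly ∣ q * (1 - ∑ j ∈ H, rootPoly lam j) := by
    rw [hM, ← Finset.prod_compl_mul_prod H]
    exact mul_dvd_mul hq h2
  obtain ⟨t, ht⟩ := h3
  rw [h1, ← map_mul, ht, map_mul, Matrix.aeval_self_charpoly, zero_mul]

end Spectral

/-! ### The Dunford integral as a spectral projection -/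

section Dunford

variable {m : ℕ} {M : Matrix (Fin m) (Fin m) ℂ}

theorem continuousOn_resolvent {T : Type*} [TopologicalSpace T] {s : Set T}
    {A : T → Matrix (Fin m) (Fin m) ℂ} (hA : Continuous A) (hdet : ∀ z ∈ s, (A z).det ≠ 0)
    (i j : Fin m) : ContinuousOn (fun z => (A z)⁻¹ i j) s := by
  have h1 : ∀ z, (A z)⁻¹ i j = ((A z).det)⁻¹ * (A z).adjugate i j := fun z => by
    rw [Matrix.inv_def, Matrix.smul_apply, Ring.inverse_eq_inv', smul_eq_mul]
  simp only [h1]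
  refine ContinuousOn.mul (ContinuousOn.inv₀ hA.matrix_det.continuousOn hdet) ?_
  exact (hA.matrix_adjugate.matrix_elem i j).continuousOn

theorem continuous_smul_one_sub (M : Matrix (Fin m) (Fin m) ℂ) :
    Continuous fun z : ℂ => z • (1 : Matrix (Fin m) (Fin m) ℂ) - M :=
  (continuous_id.smul continuous_const).sub continuous_const

theorem det_smul_one_sub (M : Matrix (Fin m) (Fin m) ℂ) (z : ℂ) :
    (z • (1 : Matrix (Fin m) (Fin m) ℂ) - M).det = M.charpoly.eval z := by
  rw [Matrix.eval_charpoly]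
  congr 2
  ext i j; simp [Matrix.scalar_apply, Matrix.smul_apply, Matrix.one_apply, Matrix.diagonal_apply]

theorem centralProj_mul_apply
    (hdet : ∀ z ∈ Metric.sphere (0 : ℂ) (1 / 2), (z • (1 : Matrix (Fin m) (Fin m) ℂ) - M).det ≠ 0)
    (A : Matrix (Fin m) (Fin m) ℂ) (i j : Fin m) :
    (centralProj M * A) i j = (2 * (Real.pi : ℂ) * Complex.I)⁻¹ *
      ∮ z in C(0, 1 / 2), ((z • (1 : Matrix (Fin m) (Fin m) ℂ) - M)⁻¹ * A) i j := by
  have hint : ∀ k, CircleIntegrable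
      (fun z => ((z • (1 : Matrix (Fin m) (Fin m) ℂ) - M)⁻¹) i k * A k j) 0 (1 / 2) := fun k => by
    refine ContinuousOn.circleIntegrable (by norm_num) ?_
    exact (continuousOn_resolvent (continuous_smul_one_sub M) hdet i k).mul continuousOn_const
  have h1 : (∮ z in C(0, 1 / 2), ((z • (1 : Matrix (Fin m) (Fin m) ℂ) - M)⁻¹ * A) i j) =
      ∑ k, ∮ z in C(0, 1 / 2), ((z • (1 : Matrix (Fin m) (Fin m) ℂ) - M)⁻¹) i k * A k j := by
    simp only [Matrix.mul_apply]
    exact circleIntegral.integral_fun_sum fun k _ => hint k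
  rw [h1, Matrix.mul_apply, Finset.mul_sum]
  refine Finset.sum_congr rfl fun k _ => ?_
  have h2 : (∮ z in C(0, 1 / 2), ((z • (1 : Matrix (Fin m) (Fin m) ℂ) - M)⁻¹) i k * A k j) =
      (∮ z in C(0, 1 / 2), ((z • (1 : Matrix (Fin m) (Fin m) ℂ) - M)⁻¹) i k) * A k j := by
    have := circleIntegral.integral_smul_const
      (fun z => ((z • (1 : Matrix (Fin m) (Fin m) ℂ) - M)⁻¹) i k) (A k j) 0 (1 / 2)
    simpa only [smul_eq_mul] using this
  rw [h2, centralProj, Matrix.of_apply]; ring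

theorem circleIntegral_inv_of_lt {l : ℂ} (hl : 1 / 2 < ‖l‖) :
    (∮ z in C(0, 1 / 2), (z - l)⁻¹) = 0 := by
  have hne : ∀ z ∈ Metric.closedBall (0 : ℂ) (1 / 2), z - l ≠ 0 := fun z hz h => by
    rw [sub_eq_zero] at h; rw [mem_closedBall_zero_iff, h] at hz; linarith
  refine Complex.circleIntegral_eq_zero_of_differentiable_on_off_countable (by norm_num)
    countable_empty (ContinuousOn.inv₀ (by fun_prop) hne) fun z hz => ?_
  have hz' : z - l ≠ 0 := hne z (Metric.ball_subset_closedBall hz.1)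
  exact (differentiableAt_id.sub_const l).inv hz'

/-- For distinct poles the two residues cancel by partial fractions; a double pole has a
single-valued primitive. This removes the nilpotent part of a central block from the Dunford
integral. -/
theorem circleIntegral_inv_mul_inv {l₁ l₂ : ℂ} (h₁ : ‖l₁‖ < 1 / 2) (h₂ : ‖l₂‖ < 1 / 2) :
    (∮ z in C(0, 1 / 2), (z - l₁)⁻¹ * (z - l₂)⁻¹) = 0 := by
  by_cases h : l₁ = l₂
  · subst h
    have e : ∀ z : ℂ, (z - l₁)⁻¹ * (z - l₁)⁻¹ = (z - l₁) ^ (-2 : ℤ) := fun z => by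
      rw [_root_.zpow_neg, ← mul_inv, ← pow_two]; norm_cast
    simp only [e]
    exact circleIntegral.integral_sub_zpow_of_ne (by norm_num) _ _ _
  · have hne : ∀ l : ℂ, ‖l‖ < 1 / 2 → ∀ z ∈ Metric.sphere (0 : ℂ) (1 / 2), z - l ≠ 0 :=
      fun l hl z hz h => by
        rw [sub_eq_zero] at h; rw [mem_sphere_zero_iff_norm, h] at hz; linarith
    have hci : ∀ l : ℂ, ‖l‖ < 1 / 2 → CircleIntegrable (fun z => (z - l)⁻¹) 0 (1 / 2) :=
      fun l hl => ContinuousOn.circleIntegrable (by norm_num)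
        (ContinuousOn.inv₀ (by fun_prop) (hne l hl))
    have e : EqOn (fun z : ℂ => (z - l₁)⁻¹ * (z - l₂)⁻¹)
        (fun z => (l₁ - l₂)⁻¹ * ((z - l₁)⁻¹ - (z - l₂)⁻¹)) (Metric.sphere 0 (1 / 2)) :=
      fun z hz => by
        have a1 := hne l₁ h₁ z hz
        have a2 := hne l₂ h₂ z hz
        have a3 : l₁ - l₂ ≠ 0 := sub_ne_zero.2 h
        simp only
        field_simp; ring
    rw [circleIntegral.integral_congr (by norm_num) e, circleIntegral.integral_const_mul,
      circleIntegral.integral_sub (hci l₁ h₁) (hci l₂ h₂),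
      circleIntegral.integral_sub_inv_of_mem_ball (by simpa using h₁),
      circleIntegral.integral_sub_inv_of_mem_ball (by simpa using h₂), sub_self, mul_zero]

variable {lam : Fin m → ℂ} {H : Finset (Fin m)} {l₁ l₂ : ℂ}

open Polynomial in
/-- The Dunford integral over `|λ| = 1/2` is complementary to the spectral projections of simple
eigenvalues, if these are outside the circle and all the others (at most two) inside. -/
theorem centralProj_eq (hM : M.charpoly = ∏ i, (X - C (lam i)))
    (hH : ∀ i ∈ H, rootGap lam i ≠ 0) (hout : ∀ i ∈ H, 1 / 2 < ‖lam i‖)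
    (hq : ∏ j ∈ Hᶜ, (X - C (lam j)) ∣ (X - C l₂) * (X - C l₁))
    (h₁ : ‖l₁‖ < 1 / 2) (h₂ : ‖l₂‖ < 1 / 2) :
    centralProj M = 1 - ∑ i ∈ H, eigProj M lam i := by
  set P := 1 - ∑ i ∈ H, eigProj M lam i with hP
  have hne : ∀ l : ℂ, ‖l‖ ≠ 1 / 2 → ∀ z ∈ Metric.sphere (0 : ℂ) (1 / 2), z - l ≠ 0 :=
    fun l hl z hz h => by
      rw [sub_eq_zero] at h; rw [mem_sphere_zero_iff_norm, h] at hz; exact hl hz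
  -- No eigenvalue lies on the circle: those in `H` are outside, and the others are among `l₁`,
  -- `l₂`.
  have hlam : ∀ i, ‖lam i‖ ≠ 1 / 2 := fun i => by
    by_cases hi : i ∈ H
    · exact (hout i hi).ne'
    · have h3 : ((X - C l₂) * (X - C l₁)).eval (lam i) = 0 := by
        obtain ⟨t, ht⟩ := hq
        rw [ht, eval_mul, eval_prod, Finset.prod_eq_zero (Finset.mem_compl.2 hi) (by simp),
          zero_mul]
      simp only [eval_mul, eval_sub, eval_X, eval_C, mul_eq_zero, sub_eq_zero] at h3
      rcases h3 with h3 | h3 <;> rw [h3]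
      exacts [h₂.ne, h₁.ne]
  have hdet : ∀ z ∈ Metric.sphere (0 : ℂ) (1 / 2),
      (z • (1 : Matrix (Fin m) (Fin m) ℂ) - M).det ≠ 0 := fun z hz => by
    rw [det_smul_one_sub, hM, eval_prod]
    exact Finset.prod_ne_zero_iff.2 fun i _ => by simpa using hne _ (hlam i) z hz
  have hres : ∀ z ∈ Metric.sphere (0 : ℂ) (1 / 2), ∀ A B : Matrix (Fin m) (Fin m) ℂ,
      (z • (1 : Matrix (Fin m) (Fin m) ℂ) - M) * B = A →
      (z • (1 : Matrix (Fin m) (Fin m) ℂ) - M)⁻¹ * A = B := fun z hz A B h => by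
    rw [← h, ← Matrix.mul_assoc, Matrix.nonsing_inv_mul _ (hdet z hz).isUnit, Matrix.one_mul]
  -- On an eigenprojection the resolvent is the scalar `(z - λᵢ)⁻¹`, holomorphic inside the circle.
  have hπ : ∀ i ∈ H, centralProj M * eigProj M lam i = 0 := fun i hi => by
    ext a b
    rw [centralProj_mul_apply hdet, circleIntegral.integral_congr (by norm_num)
      (g := fun z => (z - lam i)⁻¹ * eigProj M lam i a b) fun z hz => ?_]
    · have := circleIntegral.integral_smul_const (fun z => (z - lam i)⁻¹)
        (eigProj M lam i a b) 0 (1 / 2)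
      simp only [smul_eq_mul] at this
      rw [this, circleIntegral_inv_of_lt (hout i hi)]; simp
    · have := hres z hz (eigProj M lam i) ((z - lam i)⁻¹ • eigProj M lam i) (by
        have hz' := hne _ (hlam i) z hz
        rw [Matrix.mul_smul, Matrix.sub_mul, mul_eigProj hM, Matrix.smul_mul, Matrix.one_mul,
          ← sub_smul, smul_smul, inv_mul_cancel₀ hz', one_smul])
      simp only [this, Matrix.smul_apply, smul_eq_mul]
  have hcent : (M - l₂ • (1 : Matrix (Fin m) (Fin m) ℂ)) *
      ((M - l₁ • (1 : Matrix (Fin m) (Fin m) ℂ)) * P) = 0 := by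
    have := aeval_prod_compl_mul hM hH hq
    simpa only [map_mul, map_sub, aeval_X, aeval_C, Algebra.algebraMap_eq_smul_one,
      Matrix.mul_assoc] using this
  set Q := (M - l₁ • (1 : Matrix (Fin m) (Fin m) ℂ)) * P with hQ
  have hMQ : M * Q = l₂ • Q := by
    rwa [Matrix.sub_mul, Matrix.smul_mul, Matrix.one_mul, sub_eq_zero] at hcent
  have hMP : M * P = Q + l₁ • P := by
    rw [hQ, Matrix.sub_mul, Matrix.smul_mul, Matrix.one_mul]; abel
  -- With `M P = Q + l₁ P` and `M Q = l₂ Q` the resolvent on `P` is `(z - l₁)⁻¹ P + (z - l₁)⁻¹ (z -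
  -- l₂)⁻¹ Q`; only the first term has a nonzero integral.
  have hPP : centralProj M * P = P := by
    ext a b
    rw [centralProj_mul_apply hdet, circleIntegral.integral_congr (by norm_num)
      (g := fun z => (z - l₁)⁻¹ * P a b + ((z - l₁)⁻¹ * (z - l₂)⁻¹) * Q a b) fun z hz => ?_]
    · have c1 : ContinuousOn (fun z : ℂ => (z - l₁)⁻¹) (Metric.sphere 0 (1 / 2)) :=
        ContinuousOn.inv₀ (by fun_prop) (hne l₁ h₁.ne)
      have c2 : ContinuousOn (fun z : ℂ => (z - l₂)⁻¹) (Metric.sphere 0 (1 / 2)) :=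
        ContinuousOn.inv₀ (by fun_prop) (hne l₂ h₂.ne)
      have e1 := circleIntegral.integral_smul_const (fun z => (z - l₁)⁻¹) (P a b) 0 (1 / 2)
      have e2 := circleIntegral.integral_smul_const (fun z => (z - l₁)⁻¹ * (z - l₂)⁻¹)
        (Q a b) 0 (1 / 2)
      simp only [smul_eq_mul] at e1 e2
      have i1 : CircleIntegrable (fun z => (z - l₁)⁻¹ * P a b) 0 (1 / 2) :=
        (c1.mul continuousOn_const).circleIntegrable (by norm_num)
      have i2 : CircleIntegrable (fun z => (z - l₁)⁻¹ * (z - l₂)⁻¹ * Q a b) 0 (1 / 2) :=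
        ((c1.mul c2).mul continuousOn_const).circleIntegrable (by norm_num)
      rw [circleIntegral.integral_add i1 i2, e1, e2,
        circleIntegral_inv_mul_inv h₁ h₂,
        circleIntegral.integral_sub_inv_of_mem_ball (by simpa using h₁)]
      have : (2 * (Real.pi : ℂ) * Complex.I) ≠ 0 := by simp [Real.pi_ne_zero]
      field_simp; ring
    · have := hres z hz P ((z - l₁)⁻¹ • P + ((z - l₁)⁻¹ * (z - l₂)⁻¹) • Q) (by
        have a1 := hne _ h₁.ne z hz
        have a2 := hne _ h₂.ne z hz
        rw [Matrix.mul_add, Matrix.mul_smul, Matrix.mul_smul, Matrix.sub_mul, Matrix.sub_mul, hMP,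
          hMQ, Matrix.smul_mul, Matrix.one_mul, Matrix.smul_mul, Matrix.one_mul]
        have e1 : (z - l₁)⁻¹ * (z - l₁) = 1 := inv_mul_cancel₀ a1
        have e2 : (z - l₂)⁻¹ * (z - l₂) = 1 := inv_mul_cancel₀ a2
        calc _ = ((z - l₁)⁻¹ * (z - l₁)) • P +
              ((z - l₁)⁻¹ * ((z - l₂)⁻¹ * (z - l₂)) - (z - l₁)⁻¹) • Q := by module
          _ = P := by rw [e1, e2]; simp)
      simp only [this, Matrix.add_apply, Matrix.smul_apply, smul_eq_mul]
  calc centralProj M = centralProj M * (P + ∑ i ∈ H, eigProj M lam i) := by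
        rw [hP, sub_add_cancel, Matrix.mul_one]
    _ = P := by
        rw [Matrix.mul_add, hPP, Finset.mul_sum, Finset.sum_eq_zero hπ, add_zero]

end Dunford

/-! ### Companion matrices -/

/-- All rows but the last are those of a companion matrix. -/
def IsCompanion {m : ℕ} (M : Matrix (Fin (m + 1)) (Fin (m + 1)) ℂ) : Prop :=
  ∀ (j : Fin m) (x : Fin (m + 1) → ℂ), (M *ᵥ x) j.castSucc = x j.succ

namespace IsCompanion

variable {m : ℕ} {M : Matrix (Fin (m + 1)) (Fin (m + 1)) ℂ} (hM : IsCompanion M)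
include hM

theorem pow_mulVec (k : ℕ) : ∀ (j : ℕ) (hj : j + k < m + 1) (x : Fin (m + 1) → ℂ),
    (M ^ k *ᵥ x) ⟨j, by omega⟩ = x ⟨j + k, hj⟩ := by
  induction k with
  | zero => intro j hj x; simp
  | succ k ih =>
    intro j hj x
    have h1 := ih j (by omega) (M *ᵥ x)
    rw [pow_succ, ← Matrix.mulVec_mulVec, h1]
    have h2 := hM ⟨j + k, by omega⟩ x
    exact h2

theorem eigenvector {l : ℂ} {y : Fin (m + 1) → ℂ} (hy : M *ᵥ y = l • y) (j : Fin (m + 1)) :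
    y j = l ^ (j : ℕ) * y 0 := by
  induction j using Fin.induction with
  | zero => simp
  | succ i ih =>
    have h1 := hM i y
    rw [hy, Pi.smul_apply, smul_eq_mul, ih] at h1
    rw [← h1, Fin.val_succ, Fin.val_castSucc]; ring

open Polynomial in
-- A companion matrix shifts components upwards by one, so among the powers up to `M ^ m` only `M ^
-- m` moves the last basis vector into the zeroth component, and the leading coefficient is 1.
theorem aeval_mulVec_last {r : ℂ[X]} (hr : r.Monic) (hdeg : r.natDegree = m) :
    (aeval M r *ᵥ Pi.single (Fin.last m) 1) 0 = 1 := by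
  rw [aeval_eq_sum_range, hdeg, Matrix.sum_mulVec, Finset.sum_apply]
  have h1 : ∀ k ∈ Finset.range (m + 1), ((r.coeff k • M ^ k) *ᵥ Pi.single (Fin.last m) 1) 0 =
      if k = m then 1 else 0 := fun k hk => by
    have hk' := Finset.mem_range.1 hk
    have h2 := hM.pow_mulVec k 0 (by omega) (Pi.single (Fin.last m) 1)
    rw [Matrix.smul_mulVec, Pi.smul_apply, smul_eq_mul]
    have h3 : (0 : Fin (m + 1)) = ⟨0, by omega⟩ := rfl
    rw [h3, h2]
    split_ifs with h
    · subst h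
      have : r.coeff k = 1 := by
        rw [← hdeg] ; exact hr
      rw [this, one_mul]
      have e : (⟨0 + k, by omega⟩ : Fin (k + 1)) = Fin.last k := by ext; simp
      rw [e, Pi.single_eq_same]
    · rw [Pi.single_eq_of_ne (by
        intro h4; apply h; have := congrArg Fin.val h4; simpa using this), mul_zero]
  rw [Finset.sum_congr rfl h1]
  simp

open Polynomial in
-- The image is an eigenvector, hence proportional to `(λ ^ j)`, and its zeroth component is the
-- normalisation `1 / rootGap` of the Lagrange polynomial. The response to the forcing is thus
-- controlled by two scalars, the root and its gap.
theorem eigProj_mulVec_last {lam : Fin (m + 1) → ℂ} (hchar : M.charpoly = ∏ i, (X - C (lam i)))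
    (i j : Fin (m + 1)) :
    (eigProj M lam i *ᵥ Pi.single (Fin.last m) 1) j = lam i ^ (j : ℕ) * (rootGap lam i)⁻¹ := by
  have h1 : M *ᵥ (eigProj M lam i *ᵥ Pi.single (Fin.last m) 1) =
      lam i • (eigProj M lam i *ᵥ Pi.single (Fin.last m) 1) := by
    rw [Matrix.mulVec_mulVec, mul_eigProj hchar, Matrix.smul_mulVec]
  rw [hM.eigenvector h1 j]
  congr 1
  rw [eigProj, rootPoly, map_mul, aeval_C, Algebra.algebraMap_eq_smul_one, smul_mul_assoc, one_mul,
    Matrix.smul_mulVec, Pi.smul_apply, hM.aeval_mulVec_last, smul_eq_mul, mul_one]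
  · exact monic_prod_of_monic _ _ fun j _ => monic_X_sub_C _
  · rw [natDegree_prod_of_monic _ _ fun j _ => monic_X_sub_C _]
    simp

end IsCompanion

/-! ### The dispersion relations -/

section RealEstimates

variable {a b n c α : ℝ}

/-- Here and below `a + i b` stands for `λ + i n`, and the equations are the real and imaginary
parts of the dispersion relation. If `b² ≤ 1/4`, the left side is at least `9/16` plus a multiple of
`a²`, too much for the small right side. -/
theorem sh_im_sq_gt (hc : 0 < c) (hc1 : c ≤ 1 / 1000) (hα1 : α ≤ 1 / 1000)
    (e1 : (1 + a ^ 2 - b ^ 2) ^ 2 - 4 * a ^ 2 * b ^ 2 = α + c * a) : 1 / 4 < b ^ 2 := by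
  by_contra hb
  push Not at hb
  have h1 : (3 / 4 + a ^ 2) ^ 2 ≤ (1 + a ^ 2 - b ^ 2) ^ 2 := by gcongr; linarith
  have h2 : 4 * a ^ 2 * b ^ 2 ≤ a ^ 2 := by nlinarith [sq_nonneg a]
  have h3 : c * a ≤ 1 / 1000 * (1 + a ^ 2) := by
    have : a ≤ 1 + a ^ 2 := by nlinarith [sq_nonneg (a - 1)]
    nlinarith [sq_nonneg a]
  nlinarith [sq_nonneg a, sq_nonneg (a ^ 2)]

/-- Squaring the imaginary part and inserting the real part eliminates `1 + a² - b²`. A lower bound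
of `|b - n|`, the imaginary part of the root, becomes one of `a² b²`. -/
theorem sh_key (e1 : (1 + a ^ 2 - b ^ 2) ^ 2 - 4 * a ^ 2 * b ^ 2 = α + c * a)
    (e2 : 4 * a * b * (1 + a ^ 2 - b ^ 2) = c * (b - n)) :
    4 * (4 * a ^ 2 * b ^ 2) * (4 * a ^ 2 * b ^ 2 + (α + c * a)) = c ^ 2 * (b - n) ^ 2 := by
  rw [← e1]
  calc _ = (4 * a * b * (1 + a ^ 2 - b ^ 2)) ^ 2 := by ring
    _ = _ := by rw [e2]; ring

theorem abs_mul_le_sq {c : ℝ} (h : c ≤ |a|) : c * |a| ≤ a ^ 2 := by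
  rw [← sq_abs a, pow_two]; gcongr

theorem neg_sq_le_mul {c : ℝ} (hc : 0 < c) (h : c ≤ |a|) : -(a ^ 2) ≤ c * a := by
  have := abs_mul_le_sq h
  have := neg_abs_le a
  nlinarith

/-- Otherwise `b` is close to `n`, so `b² ≥ 49/25`. By `sh_key` `a²` cannot reach `c`, and then the
real part forces `b²` to be near 1, a contradiction. -/
theorem sh_gap_large (hc : 0 < c) (hc1 : c ≤ 1 / 1000) (hα : 0 ≤ α) (hα1 : α ≤ c)
    (e1 : (1 + a ^ 2 - b ^ 2) ^ 2 - 4 * a ^ 2 * b ^ 2 = α + c * a)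
    (e2 : 4 * a * b * (1 + a ^ 2 - b ^ 2) = c * (b - n))
    (hn : 2 ≤ |n|) : (1 + |n|) / 5 ≤ |b - n| := by
  by_contra h
  push Not at h
  have hb : 7 / 10 * |n| ≤ |b| := by
    have := abs_sub_abs_le_abs_sub n b
    rw [abs_sub_comm] at this
    linarith
  have hb2 : 49 / 25 ≤ b ^ 2 := by
    have : (7 / 5) ^ 2 ≤ |b| ^ 2 := by gcongr; linarith
    rw [sq_abs] at this; linarith
  have hΔ : (b - n) ^ 2 ≤ b ^ 2 := by
    exact sq_le_sq.2 (by linarith)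
  have hk := sh_key e1 e2
  have hac : a ^ 2 < c := by
    by_contra h'
    push Not at h'
    have ha : c ≤ |a| := by
      by_contra h''
      push Not at h''
      nlinarith [sq_abs a, abs_nonneg a]
    have h2 := neg_sq_le_mul hc ha
    have h3 : a ^ 2 ≤ 4 * a ^ 2 * b ^ 2 + (α + c * a) := by nlinarith [sq_nonneg a]
    have h5 : 4 * (4 * c * b ^ 2) * c ≤
        4 * (4 * a ^ 2 * b ^ 2) * (4 * a ^ 2 * b ^ 2 + (α + c * a)) := by gcongr; linarith
    have h6 : c ^ 2 * (b - n) ^ 2 ≤ c ^ 2 * b ^ 2 := by gcongr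
    have h7 : 0 < c ^ 2 * b ^ 2 := by positivity
    linarith
  have ha1 : a ≤ 1 := by nlinarith
  have h1 : (1 + a ^ 2 - b ^ 2) ^ 2 ≤ 6 * c * b ^ 2 := by
    have h2 : 4 * a ^ 2 * b ^ 2 ≤ 4 * c * b ^ 2 := by gcongr
    have h3 : c * a ≤ c := by nlinarith
    nlinarith
  have h2 : 24 / 50 * b ^ 2 ≤ b ^ 2 - 1 - a ^ 2 := by linarith
  have h3 : (24 / 50 * b ^ 2) ^ 2 ≤ (b ^ 2 - 1 - a ^ 2) ^ 2 := by gcongr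
  nlinarith

/-- For `|a| < h / 16` the real part bounds `b²` by 4, whence `4 a² b² ≤ c / 16`. The left side of
`sh_key` is then about `c² / 64`, below the required `c² / 25`. -/
theorem sh_re_lower {h : ℝ} (hh : 0 < h) (hh1 : h ≤ 1 / 1000) (hc : c = h ^ 2)
    (hα1 : α ≤ c / 1000000)
    (e1 : (1 + a ^ 2 - b ^ 2) ^ 2 - 4 * a ^ 2 * b ^ 2 = α + c * a)
    (e2 : 4 * a * b * (1 + a ^ 2 - b ^ 2) = c * (b - n))
    (hΔ : 1 / 5 ≤ |b - n|) : h / 16 ≤ |a| := by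
  by_contra hlt
  push Not at hlt
  have ha2 : a ^ 2 ≤ h ^ 2 / 256 := by
    have : |a| ^ 2 ≤ (h / 16) ^ 2 := by gcongr
    rw [sq_abs] at this; linarith
  have ha := le_abs_self a
  have hcp : 0 < c := by rw [hc]; positivity
  have hca : c * a ≤ c / 16000 := by nlinarith
  have hhs : h ^ 2 ≤ 1 / 1000000 := by nlinarith
  have hb : b ^ 2 ≤ 4 := by
    by_contra hb
    push Not at hb
    have h1 : b ^ 2 / 2 ≤ b ^ 2 - 1 - a ^ 2 := by linarith
    have h2 : (b ^ 2 / 2) ^ 2 ≤ (b ^ 2 - 1 - a ^ 2) ^ 2 := by gcongr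
    have h3 : 4 * a ^ 2 * b ^ 2 ≤ 4 * (1 / 256) * b ^ 2 := by gcongr; linarith
    nlinarith
  have hB : 4 * a ^ 2 * b ^ 2 ≤ c / 16 := by
    have : 4 * a ^ 2 * b ^ 2 ≤ 4 * (h ^ 2 / 256) * 4 := by gcongr
    linarith
  have hk := sh_key e1 e2
  have h1 : c ^ 2 / 25 ≤ c ^ 2 * (b - n) ^ 2 := by
    have : (1 / 5) ^ 2 ≤ |b - n| ^ 2 := by gcongr
    rw [sq_abs] at this
    nlinarith [sq_nonneg c]
  have h0 : 0 ≤ 4 * a ^ 2 * b ^ 2 := by positivity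
  have hs : 0 ≤ 4 * a ^ 2 * b ^ 2 + (α + c * a) := by rw [← e1]; nlinarith [sq_nonneg (1 + a ^ 2 - b ^ 2)]
  have h2 : 4 * (4 * a ^ 2 * b ^ 2) * (4 * a ^ 2 * b ^ 2 + (α + c * a)) ≤
      4 * (c / 16) * (c / 16 + c / 1000000 + c / 16000) := by
    gcongr ?_ * ?_
    · linarith
    · linarith
  nlinarith [sq_pos_of_pos hcp]

/-- The common expression is `|1 + (λ + i n)²|²`. The last bound is the inequality of arithmetic and
geometric means in the imaginary part; the others say that `α + c a` is negligible beside `4 a² b²`.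
-/
theorem sh_sq_lower (hc : 0 < c) (hα1 : α ≤ c / 1000000)
    (e1 : (1 + a ^ 2 - b ^ 2) ^ 2 - 4 * a ^ 2 * b ^ 2 = α + c * a)
    (e2 : 4 * a * b * (1 + a ^ 2 - b ^ 2) = c * (b - n))
    (hb : 1 / 4 < b ^ 2) (hΔ : 1 / 5 ≤ |b - n|) (ha : 16 * c ≤ |a|) :
    (1 + a ^ 2 - b ^ 2) ^ 2 + 4 * a ^ 2 * b ^ 2 ≤ 4 * (4 * a ^ 2 * b ^ 2) ∧
    c * |a| ≤ ((1 + a ^ 2 - b ^ 2) ^ 2 + 4 * a ^ 2 * b ^ 2) / 16 ∧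
    c * |b - n| ≤ (1 + a ^ 2 - b ^ 2) ^ 2 + 4 * a ^ 2 * b ^ 2 := by
  have h1 : c * |b - n| ≤ (1 + a ^ 2 - b ^ 2) ^ 2 + 4 * a ^ 2 * b ^ 2 := by
    have : |c * (b - n)| = c * |b - n| := by rw [abs_mul, abs_of_pos hc]
    rw [← this, ← e2, abs_le]
    constructor
    · nlinarith [sq_nonneg ((1 + a ^ 2 - b ^ 2) + 2 * a * b)]
    · nlinarith [sq_nonneg ((1 + a ^ 2 - b ^ 2) - 2 * a * b)]
  have h2 : 16 * c * |a| ≤ a ^ 2 := abs_mul_le_sq ha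
  have h3 : a ^ 2 ≤ 4 * a ^ 2 * b ^ 2 := by nlinarith [sq_nonneg a]
  have h4 := sq_nonneg (1 + a ^ 2 - b ^ 2)
  have h5 : c * |a| ≤ ((1 + a ^ 2 - b ^ 2) ^ 2 + 4 * a ^ 2 * b ^ 2) / 16 := by linarith
  refine ⟨?_, h5, h1⟩
  have h6 : c * a ≤ c * |a| := by gcongr; exact le_abs_self a
  have h7 : c * (1 / 5) ≤ c * |b - n| := by gcongr
  linarith

/-- If `b² > n² / 9`, then `(b - n)² ≤ 20 b²`, and the imaginary part gives `a² ≤ 5 c²`. The real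
part makes `b²` of order `c²`, contradicting `|n| ≥ 1`. -/
theorem con_im_sq_le (hc : 0 < c) (hc1 : c ≤ 1 / 1000) (e1 : a ^ 2 - b ^ 2 = -(c * a))
    (e2 : 2 * a * b = -(c * (b - n))) (hn : 1 ≤ |n|) : b ^ 2 ≤ n ^ 2 / 9 := by
  by_contra h
  push Not at h
  have hn2 : 1 ≤ n ^ 2 := by rw [← sq_abs]; nlinarith
  have h1 : (b - n) ^ 2 ≤ 20 * b ^ 2 := by nlinarith [sq_nonneg (b + n)]
  have h2 : 4 * a ^ 2 * b ^ 2 ≤ 20 * c ^ 2 * b ^ 2 := by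
    calc 4 * a ^ 2 * b ^ 2 = (2 * a * b) ^ 2 := by ring
      _ = c ^ 2 * (b - n) ^ 2 := by rw [e2]; ring
      _ ≤ c ^ 2 * (20 * b ^ 2) := by gcongr
      _ = _ := by ring
  have hb : 0 < b ^ 2 := by linarith
  have h3 : a ^ 2 ≤ 5 * c ^ 2 := by
    have : (4 * a ^ 2) * b ^ 2 ≤ (20 * c ^ 2) * b ^ 2 := h2
    have := le_of_mul_le_mul_right this hb
    linarith
  have h4 : c * a ≤ (c ^ 2 + a ^ 2) / 2 := by nlinarith [sq_nonneg (c - a)]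
  nlinarith

/-- A smaller `|a|` makes both `a²` and `b² = a² + c a` small multiples of `c`, so that `4 a² b²`
falls below `c² (b - n)²`. -/
theorem con_re_lower {h : ℝ} (hh : 0 < h) (hh1 : h ≤ 1 / 1000) (hc : c = h ^ 2)
    (e1 : a ^ 2 - b ^ 2 = -(c * a)) (e2 : 2 * a * b = -(c * (b - n)))
    (hΔ : 2 / 3 ≤ |b - n|) : h / 16 ≤ |a| := by
  by_contra hlt
  push Not at hlt
  have hcp : 0 < c := by rw [hc]; positivity
  have ha2 : a ^ 2 ≤ c / 256 := by
    have : |a| ^ 2 ≤ (h / 16) ^ 2 := by gcongr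
    rw [sq_abs] at this; rw [hc]; linarith
  have hca : c * a ≤ c / 16000 := by nlinarith [le_abs_self a]
  have hb2 : b ^ 2 ≤ c / 200 := by linarith
  have h1 : c ^ 2 * (4 / 9) ≤ 4 * a ^ 2 * b ^ 2 := by
    calc c ^ 2 * (4 / 9) = c ^ 2 * (2 / 3) ^ 2 := by ring
      _ ≤ c ^ 2 * |b - n| ^ 2 := by gcongr
      _ = (-(c * (b - n))) ^ 2 := by rw [sq_abs]; ring
      _ = _ := by rw [← e2]; ring
  have h2 : 4 * a ^ 2 * b ^ 2 ≤ 4 * (c / 256) * (c / 200) := by gcongr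
  nlinarith [sq_pos_of_pos hcp]

end RealEstimates

theorem sh_root_real {α c : ℝ} {n : ℤ} {z : ℂ}
    (hz : (1 + (z + Complex.I * n) ^ 2) ^ 2 - α - c * z = 0) :
    (1 + z.re ^ 2 - (z.im + n) ^ 2) ^ 2 - 4 * z.re ^ 2 * (z.im + n) ^ 2 = α + c * z.re ∧
    4 * z.re * (z.im + n) * (1 + z.re ^ 2 - (z.im + n) ^ 2) = c * ((z.im + n) - n) := by
  have h1 := congrArg Complex.re hz
  have h2 := congrArg Complex.im hz
  simp [pow_two] at h1 h2
  constructor <;> linarith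

theorem norm_one_add_sq (z : ℂ) (n : ℤ) : ‖1 + (z + Complex.I * n) ^ 2‖ ^ 2 =
    (1 + z.re ^ 2 - (z.im + n) ^ 2) ^ 2 + 4 * z.re ^ 2 * (z.im + n) ^ 2 := by
  rw [Complex.sq_norm, Complex.normSq_apply]
  simp [pow_two]; ring

theorem abs_im_add_le (z : ℂ) (n : ℤ) : |z.im + n| ≤ ‖z + Complex.I * n‖ := by
  have := Complex.abs_im_le_norm (z + Complex.I * n)
  simpa using this

/-- For `‖μ‖ > 2 wt n` one has `‖1 + μ²‖ ≥ ‖μ‖`, so the quartic term exceeds the small linear one.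
-/
theorem sh_root_norm_le {α c : ℝ} {n : ℤ} {z : ℂ} (hc : 0 < c) (hc1 : c ≤ 1 / 1000)
    (hα : 0 ≤ α) (hα1 : α ≤ 1 / 1000)
    (hz : (1 + (z + Complex.I * n) ^ 2) ^ 2 - α - c * z = 0) : ‖z‖ ≤ 3 * wt n := by
  set μ := z + Complex.I * n with hμ
  have hzμ : z = μ - Complex.I * n := by rw [hμ]; ring
  have hn : ‖Complex.I * (n : ℂ)‖ = |(n : ℝ)| := by simp
  have hle : ‖z‖ ≤ ‖μ‖ + |(n : ℝ)| := by rw [hzμ, ← hn]; exact norm_sub_le _ _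
  have hw := one_le_wt n
  have hnw : |(n : ℝ)| ≤ wt n := by simp [wt]
  suffices ‖μ‖ ≤ 2 * wt n by linarith
  by_contra hlt
  push Not at hlt
  have h1 : ‖(1 + μ ^ 2) ^ 2‖ ≤ α + c * (‖μ‖ + |(n : ℝ)|) := by
    have : (1 + μ ^ 2) ^ 2 = (α : ℂ) + c * z := by linear_combination hz
    rw [this]
    refine (norm_add_le _ _).trans ?_
    rw [norm_mul, Complex.norm_real, Complex.norm_real, Real.norm_of_nonneg hα,
      Real.norm_of_nonneg hc.le]
    gcongr
  have h2 : ‖μ‖ ^ 2 - 1 ≤ ‖1 + μ ^ 2‖ := by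
    have := norm_sub_le (1 + μ ^ 2) 1
    rw [add_sub_cancel_left, norm_pow, norm_one] at this
    linarith
  rw [norm_pow] at h1
  have h3 : 2 < ‖μ‖ := by linarith
  have h4 : ‖μ‖ ≤ ‖μ‖ ^ 2 - 1 := by nlinarith
  have h5 : ‖μ‖ ^ 2 ≤ ‖1 + μ ^ 2‖ ^ 2 := by gcongr; linarith
  nlinarith

theorem im_add_sub_le (z : ℂ) (n : ℤ) : |z.im + n - n| ≤ ‖z‖ := by
  rw [add_sub_cancel_right]; exact Complex.abs_im_le_norm z

/-- For `n = ±1` the factor `1 + (z + i n)²` vanishes at `z = 0`. These are the critical modes, with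
a double root at 0 and one at `-2 i n` when `α = c = 0`. -/
theorem sh_root_factor {α c : ℝ} {n : ℤ} {z : ℂ} (hn : n = 1 ∨ n = -1)
    (hz : (1 + (z + Complex.I * n) ^ 2) ^ 2 - α - c * z = 0) :
    (z * (z + 2 * Complex.I * n)) ^ 2 = α + c * z := by
  have hn2 : (n : ℂ) ^ 2 = 1 := by rcases hn with rfl | rfl <;> simp
  have h1 : 1 + (z + Complex.I * n) ^ 2 = z * (z + 2 * Complex.I * n) := by
    have : (Complex.I * (n : ℂ)) ^ 2 = -1 := by rw [mul_pow, Complex.I_sq, hn2]; ring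
    linear_combination this
  rw [← h1]; linear_combination hz

theorem norm_two_I_mul {n : ℤ} (hn : n = 1 ∨ n = -1) : ‖2 * Complex.I * (n : ℂ)‖ = 2 := by
  rcases hn with rfl | rfl <;> simp

/-- One of the two factors is bounded below. For `‖z‖ ≤ 1` it remains that `‖z‖² ≤ α + h² ‖z‖`,
where the smallness of `α / h²` yields `h / 128`, half of the growth rate `θ = h / 64`. -/
theorem sh_root_near {h α : ℝ} {n : ℤ} {z : ℂ} (hh : 0 < h) (hh1 : h ≤ 1 / 1000)
    (hα : 0 ≤ α) (hα1 : α ≤ h ^ 2 / 1000000) (hn : n = 1 ∨ n = -1)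
    (hz : (1 + (z + Complex.I * n) ^ 2) ^ 2 - α - (h ^ 2 : ℝ) * z = 0) :
    ‖z‖ ≤ h / 128 ∨ (1 < ‖z‖ ∧ ‖z + 2 * Complex.I * n‖ ≤ 1 / 16) := by
  have h1 := congrArg norm (sh_root_factor hn hz)
  rw [norm_pow, norm_mul] at h1
  have h2 : ‖(α : ℂ) + ((h ^ 2 : ℝ) : ℂ) * z‖ ≤ α + h ^ 2 * ‖z‖ := by
    refine (norm_add_le _ _).trans ?_
    rw [norm_mul, Complex.norm_real, Complex.norm_real, Real.norm_of_nonneg hα,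
      Real.norm_of_nonneg (sq_nonneg h)]
  rw [← h1, mul_pow] at h2
  rcases le_or_gt ‖z‖ 1 with hle | hgt
  · left
    have h3 : 1 ≤ ‖z + 2 * Complex.I * n‖ := by
      have := norm_sub_le (z + 2 * Complex.I * n) z
      rw [add_sub_cancel_left, norm_two_I_mul hn] at this
      linarith
    have h4 : ‖z‖ ^ 2 ≤ α + h ^ 2 * ‖z‖ := by
      refine le_trans ?_ h2
      have : 1 ≤ ‖z + 2 * Complex.I * n‖ ^ 2 := by nlinarith
      nlinarith [sq_nonneg ‖z‖]
    by_contra hlt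
    push Not at hlt
    have h5 : h * (h * ‖z‖) ≤ 1 / 1000 * (h * ‖z‖) := by gcongr
    have h6 : h * h ≤ h * (128 * ‖z‖) := by gcongr; linarith
    have h7 : h / 128 * ‖z‖ ≤ ‖z‖ * ‖z‖ := by gcongr
    have h8 : 0 < h * ‖z‖ := by have : 0 < ‖z‖ := by linarith
                                positivity
    linarith
  · right
    refine ⟨hgt, ?_⟩
    by_contra hlt
    push Not at hlt
    have h3 : (1 / 16) ^ 2 ≤ ‖z + 2 * Complex.I * n‖ ^ 2 := by gcongr
    have h4 : ‖z‖ ^ 2 * (1 / 16) ^ 2 ≤ α + h ^ 2 * ‖z‖ := le_trans (by gcongr) h2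
    have h5 : h ^ 2 ≤ 1 / 1000000 := by nlinarith
    have h6 : h ^ 2 * ‖z‖ ≤ 1 / 1000000 * ‖z‖ := by gcongr
    nlinarith

/-- The roots of the dispersion relation of the Swift–Hohenberg block. -/
theorem sh_root_cases {h α : ℝ} {n : ℤ} {z : ℂ} (hh : 0 < h) (hh1 : h ≤ 1 / 1000)
    (hα : 0 ≤ α) (hα1 : α ≤ h ^ 2 / 1000000)
    (hz : (1 + (z + Complex.I * n) ^ 2) ^ 2 - α - (h ^ 2 : ℝ) * z = 0) :
    ((n = 1 ∨ n = -1) ∧ ‖z‖ ≤ h / 128) ∨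
    (1 / 2 < ‖z‖ ∧ h / 16 ≤ |z.re| ∧ h ^ 2 * wt n / 6 ≤ |z.re| *
      ‖4 * (z + Complex.I * n) * (1 + (z + Complex.I * n) ^ 2) - (h ^ 2 : ℝ)‖) := by
  have hc : 0 < h ^ 2 := by positivity
  have hc1 : h ^ 2 ≤ 1 / 1000 := by nlinarith
  obtain ⟨e1, e2⟩ := sh_root_real hz
  have hb := sh_im_sq_gt hc hc1 (by linarith) e1
  have hΔz := im_add_sub_le z n
  -- With `T = ‖1 + (z + i n)²‖` the derivative has norm at least `4 |b| T - c`. From `T ≤ 4 |a|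
  -- |b|` its product with `|a|` is at least `T² - c |a| ≥ (15/16) T²`, and `T² ≥ c |b - n|`
  -- finishes; `15/16 · 1/5` exceeds `1/6`.
  have key : wt n / 5 ≤ |z.im + n - n| → h / 16 ≤ |z.re| ∧ h ^ 2 * wt n / 6 ≤ |z.re| *
      ‖4 * (z + Complex.I * n) * (1 + (z + Complex.I * n) ^ 2) - (h ^ 2 : ℝ)‖ := fun hΔ => by
    have hw := one_le_wt n
    have ha := sh_re_lower hh hh1 rfl hα1 e1 e2 (by linarith)
    refine ⟨ha, ?_⟩
    obtain ⟨s1, s2, s3⟩ := sh_sq_lower hc hα1 e1 e2 hb (by linarith) (by nlinarith)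
    have hS := norm_one_add_sq z n
    set T := ‖1 + (z + Complex.I * n) ^ 2‖ with hT
    have hT0 : 0 ≤ T := norm_nonneg _
    rw [← hS] at s1 s2 s3
    have s4 : T ≤ 4 * |z.re| * |z.im + n| := by
      refine abs_le_of_sq_le_sq' ?_ (by positivity) |>.2
      rw [mul_pow, mul_pow, sq_abs, sq_abs]; linarith
    have s5 : 4 * |z.im + n| * T - h ^ 2 ≤
        ‖4 * (z + Complex.I * n) * (1 + (z + Complex.I * n) ^ 2) - (h ^ 2 : ℝ)‖ := by
      refine le_trans ?_ (norm_sub_norm_le _ _)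
      rw [norm_mul, norm_mul, Complex.norm_real, Real.norm_of_nonneg hc.le, ← hT]
      have := abs_im_add_le z n
      have h4 : ‖(4 : ℂ)‖ = 4 := by simp
      rw [h4]
      gcongr
    have s6 : |z.re| * (4 * |z.im + n| * T - h ^ 2) ≤ |z.re| *
      ‖4 * (z + Complex.I * n) * (1 + (z + Complex.I * n) ^ 2) - (h ^ 2 : ℝ)‖ := by gcongr
    have s7 : T ^ 2 ≤ 4 * |z.re| * |z.im + n| * T := by rw [pow_two]; gcongr
    have s8 : h ^ 2 * (wt n / 5) ≤ h ^ 2 * |z.im + n - n| := by gcongr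
    have s9 : 0 < h ^ 2 * wt n := by have := wt_pos n; positivity
    linarith
  rcases lt_or_ge |(n : ℝ)| 2 with hn2 | hn2
  · have hn2' : |n| < 2 := by exact_mod_cast hn2
    have hcases : n = 0 ∨ (n = 1 ∨ n = -1) := by
      rw [abs_lt] at hn2'; omega
    rcases hcases with rfl | hn
    · right
      have hΔ : 1 / 2 < |z.im + (0 : ℤ) - (0 : ℤ)| := by
        by_contra h'
        push Not at h'
        simp only [Int.cast_zero, sub_zero] at h' hb
        nlinarith [sq_abs (z.im + 0), abs_nonneg (z.im + 0)]
      refine ⟨lt_of_lt_of_le (by exact_mod_cast hΔ) hΔz, key ?_⟩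
      have hw0 : wt 0 / 5 ≤ 1 / 2 := by norm_num [wt]
      exact hw0.trans (by exact_mod_cast hΔ.le)
    · rcases sh_root_near hh hh1 hα hα1 hn hz with h1 | h1
      · exact Or.inl ⟨hn, h1⟩
      -- The root is near `-2 i n`, so the modulus of its imaginary part is close to 2.
      · right
        refine ⟨by linarith [h1.1], key ?_⟩
        have h2 := Complex.abs_im_le_norm (z + 2 * Complex.I * n)
        have hwn : wt n = 2 := by rcases hn with rfl | rfl <;> norm_num [wt]
        have h3 : |2 * (n : ℝ)| = 2 := by rcases hn with rfl | rfl <;> norm_num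
        have h4 : (z + 2 * Complex.I * n).im = z.im + 2 * n := by simp
        rw [h4] at h2
        have h5 := abs_sub_abs_le_abs_sub (2 * (n : ℝ)) (-z.im)
        rw [abs_neg, sub_neg_eq_add, add_comm (2 * (n : ℝ)), h3] at h5
        rw [hwn, add_sub_cancel_right]
        linarith [h1.2]
  · right
    have hΔ := sh_gap_large hc hc1 hα (by linarith) e1 e2 hn2
    refine ⟨by linarith, key hΔ⟩

/-- The roots of the dispersion relation of the conservation law. -/
theorem con_root_cases {h : ℝ} {n : ℤ} {z : ℂ} (hh : 0 < h) (hh1 : h ≤ 1 / 1000) (hn : n ≠ 0)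
    (hz : (z + Complex.I * n) ^ 2 + (h ^ 2 : ℝ) * z = 0) :
    1 / 2 < ‖z‖ ∧ h / 16 ≤ |z.re| ∧ ‖z‖ ≤ 3 * wt n ∧ h ^ 2 * wt n / 6 ≤ |z.re| *
      ‖2 * (z + Complex.I * n) + (h ^ 2 : ℝ)‖ := by
  have hc : 0 < h ^ 2 := by positivity
  have hc1 : h ^ 2 ≤ 1 / 1000 := by nlinarith
  have h1 := congrArg Complex.re hz
  have h2 := congrArg Complex.im hz
  simp only [pow_two, Complex.add_re, Complex.mul_re, Complex.mul_im, Complex.I_re, Complex.I_im,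
    Complex.intCast_re, Complex.intCast_im, Complex.add_im, Complex.ofReal_re, Complex.ofReal_im,
    Complex.zero_re, Complex.zero_im] at h1 h2
  have e1 : z.re ^ 2 - (z.im + n) ^ 2 = -(h ^ 2 * z.re) := by linarith
  have e2 : 2 * z.re * (z.im + n) = -(h ^ 2 * (z.im + n - n)) := by linarith
  have hn1 : 1 ≤ |(n : ℝ)| := by exact_mod_cast Int.one_le_abs hn
  have hb := con_im_sq_le hc hc1 e1 e2 hn1
  have hb1 : |z.im + n| ≤ |(n : ℝ)| / 3 := by
    refine abs_le_of_sq_le_sq ?_ (by positivity)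
    rw [div_pow, sq_abs]; linarith
  have hΔ : 2 / 3 * |(n : ℝ)| ≤ |z.im + n - n| := by
    have := abs_sub_abs_le_abs_sub (n : ℝ) (z.im + n)
    rw [abs_sub_comm] at this; linarith
  have hΔz := im_add_sub_le z n
  have hwn : wt n ≤ 2 * |(n : ℝ)| := by rw [wt]; linarith
  have ha := con_re_lower hh hh1 rfl e1 e2 (by linarith)
  refine ⟨by linarith, ha, ?_, ?_⟩
  · have ha2 : |z.re| ≤ |(n : ℝ)| := by
      by_contra hlt
      push Not at hlt
      have h3 := neg_sq_le_mul (a := z.re) (c := 1 / 1000) (by norm_num) (by linarith)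
      have h4 : h ^ 2 * |z.re| ≤ 1 / 1000 * |z.re| := by gcongr
      have h5 := neg_abs_le z.re
      have h6 : |(n : ℝ)| ^ 2 < |z.re| ^ 2 := by gcongr
      rw [sq_abs, sq_abs] at h6
      have h7 : |z.re| ≤ z.re ^ 2 := by rw [← sq_abs]; nlinarith
      nlinarith
    have h3 := Complex.norm_le_abs_re_add_abs_im z
    have h4 : |z.im| ≤ |z.im + n| + |(n : ℝ)| := by
      have := abs_sub (z.im + n) (n : ℝ)
      rw [add_sub_cancel_right] at this
      exact this
    rw [wt]; linarith
  · have h3 : 2 * |z.im + n| ≤ ‖2 * (z + Complex.I * n) + (h ^ 2 : ℝ)‖ := by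
      have := Complex.abs_im_le_norm (2 * (z + Complex.I * n) + (h ^ 2 : ℝ))
      have h4 : (2 * (z + Complex.I * n) + ((h ^ 2 : ℝ) : ℂ)).im = 2 * (z.im + n) := by
        simp only [Complex.add_im, Complex.mul_im, Complex.ofReal_im, Complex.I_re, Complex.I_im,
          Complex.intCast_re, Complex.intCast_im, Complex.re_ofNat, Complex.im_ofNat]
        ring
      rw [h4, abs_mul, abs_two] at this
      exact this
    -- For the conservation law the imaginary part of the dispersion relation already is the
    -- required product of real part and gap.
    have h4 : |z.re| * (2 * |z.im + n|) = h ^ 2 * |z.im + n - n| := by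
      have := congrArg abs e2
      rw [abs_neg, abs_mul, abs_mul, abs_mul, abs_two, abs_of_pos hc] at this
      linarith
    calc h ^ 2 * wt n / 6 ≤ h ^ 2 * (2 / 3 * |(n : ℝ)|) := by nlinarith
      _ ≤ h ^ 2 * |z.im + n - n| := by gcongr
      _ = _ := h4.symm
      _ ≤ _ := by gcongr

theorem isCompanion_LSH (α c : ℝ) (n : ℤ) : IsCompanion (m := 3) (LSH α c n) := by
  intro j x
  fin_cases j <;> simp [LSH, Matrix.mulVec, dotProduct, Fin.sum_univ_succ]

theorem isCompanion_Lcon (c : ℝ) (n : ℤ) : IsCompanion (m := 1) (Lcon c n) := by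
  intro j x
  fin_cases j
  simp [Lcon, Matrix.mulVec, dotProduct, Fin.sum_univ_succ]

open Polynomial in
theorem charpoly_LSH (α c : ℝ) (n : ℤ) : (LSH α c n).charpoly =
    (1 + (X + C (Complex.I * n)) ^ 2) ^ 2 - C (α : ℂ) - C (c : ℂ) * X := by
  refine Polynomial.funext fun t => ?_
  rw [← det_smul_one_sub]
  simp only [eval_sub, eval_pow, eval_add, eval_one, eval_X, eval_C, eval_mul]
  simp [LSH, Matrix.det_succ_row_zero, Fin.sum_univ_succ, Matrix.one_apply, Fin.succAbove]
  have h2 : Complex.I ^ 2 = -1 := Complex.I_sq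
  have h4 : Complex.I ^ 4 = 1 := Complex.I_pow_four
  have h3 : Complex.I ^ 3 = -Complex.I := Complex.I_pow_three
  ring_nf
  simp only [h2, h3, h4]
  ring

open Polynomial in
theorem charpoly_Lcon (c : ℝ) (n : ℤ) : (Lcon c n).charpoly =
    (X + C (Complex.I * n)) ^ 2 + C (c : ℂ) * X := by
  refine Polynomial.funext fun t => ?_
  rw [← det_smul_one_sub]
  simp only [eval_pow, eval_add, eval_X, eval_C, eval_mul]
  simp [Lcon, Matrix.det_succ_row_zero, Fin.sum_univ_succ, Matrix.one_apply]
  have h2 : Complex.I ^ 2 = -1 := Complex.I_sq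
  ring_nf
  simp only [h2]
  ring

open Polynomial in
-- Turns the spectral splitting of a block into inequalities between the scalars `λ`, `Re λ` and
-- `rootGap`; beyond these only the action of the central projection on the forcing direction is
-- needed.
theorem ModeSplit.of_roots {m : ℕ} {M : Matrix (Fin (m + 1)) (Fin (m + 1)) ℂ}
    {lam : Fin (m + 1) → ℂ} {H : Finset (Fin (m + 1))} {l₁ l₂ : ℂ} {θ : ℝ} {β : Fin (m + 1) → ℝ}
    (hcomp : IsCompanion M) (hM : M.charpoly = ∏ i, (X - C (lam i)))
    (hθ1 : θ < 1) (hH : ∀ i ∈ H, rootGap lam i ≠ 0) (hout : ∀ i ∈ H, 1 / 2 < ‖lam i‖)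
    (hq : ∏ j ∈ Hᶜ, (X - C (lam j)) ∣ (X - C l₂) * (X - C l₁))
    (h₁ : ‖l₁‖ ≤ θ / 2) (h₂ : ‖l₂‖ ≤ θ / 2) (hgap : ∀ i ∈ H, 4 * θ ≤ |(lam i).re|)
    (hbd : ∀ i ∈ H, ∀ j : Fin (m + 1),
      ‖lam i‖ ^ (j : ℕ) ≤ β j * (|(lam i).re| * ‖rootGap lam i‖))
    (hcb : ∀ j, 2 / θ * ‖(centralProj M *ᵥ Pi.single (Fin.last m) 1) j‖ +
      (2 / θ) ^ 2 * ‖(((M - l₁ • (1 : Matrix (Fin (m + 1)) (Fin (m + 1)) ℂ)) * centralProj M) *ᵥ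
        Pi.single (Fin.last m) 1) j‖ ≤ β j) :
    ModeSplit M (centralProj M) (Pi.single (Fin.last m) 1) θ β H lam (eigProj M lam) l₁ l₂ := by
  have hP := centralProj_eq hM hH hout hq (h₁.trans_lt (by linarith)) (h₂.trans_lt (by linarith))
  refine ⟨by rw [hP, sub_add_cancel], ?_, ?_, fun i _ => mul_eigProj hM i,
    fun i _ => eigProj_mul hM i, fun i hi => ?_, ?_, h₁, h₂, hgap, fun i hi j => ?_, hcb⟩
  · rw [hP]; exact mul_compl_comm hM H
  · rw [hP]; exact compl_idem hM hH
  · rw [hP]; exact compl_mul_eigProj hM hH hi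
  · rw [hP]
    have := aeval_prod_compl_mul hM hH hq
    simpa only [map_mul, map_sub, aeval_X, aeval_C, Algebra.algebraMap_eq_smul_one,
      Matrix.mul_assoc] using this
  · rw [hcomp.eigProj_mulVec_last hM, norm_mul, norm_pow, norm_inv]
    have h3 : 0 < ‖rootGap lam i‖ := norm_pos_iff.2 (hH i hi)
    rw [mul_inv_le_iff₀ h3, mul_assoc]
    exact hbd i hi j

open Polynomial in
-- With every root in `H` the complementary projection is annihilated by the empty product, which is
-- the identity.
theorem centralProj_eq_zero {m : ℕ} {M : Matrix (Fin m) (Fin m) ℂ} {lam : Fin m → ℂ}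
    (hM : M.charpoly = ∏ i, (X - C (lam i))) (hH : ∀ i, rootGap lam i ≠ 0)
    (hout : ∀ i, 1 / 2 < ‖lam i‖) : centralProj M = 0 := by
  have hq : ∏ j ∈ (Finset.univ : Finset (Fin m))ᶜ, (X - C (lam j)) ∣ (1 : ℂ[X]) := by simp
  have hP := centralProj_eq (H := Finset.univ) (l₁ := 0) (l₂ := 0) hM (fun i _ => hH i)
    (fun i _ => hout i) (hq.trans (one_dvd _)) (by norm_num) (by norm_num)
  have := aeval_prod_compl_mul hM (H := Finset.univ) (fun i _ => hH i) hq
  rwa [map_one, one_mul, ← hP] at this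

/-- What is used of the `n`-th block `M` of the linear part and its central projection. -/
structure BlockFacts {m : ℕ} (C h : ℝ) (n : ℤ) (M : Matrix (Fin (m + 1)) (Fin (m + 1)) ℂ) :
    Prop where
  solvable : Solvable M (centralProj M) (Pi.single (Fin.last m) 1) (h / 64)
    fun j => C * wt n ^ ((j : ℝ) - 1) / h ^ 2
  idem : centralProj M * centralProj M = centralProj M
  comm : M * centralProj M = centralProj M * M
  bound : ∀ i j, ‖centralProj M i j‖ ≤ C

theorem Solvable.mono {m : ℕ} {M P : Matrix (Fin m) (Fin m) ℂ} {e : Fin m → ℂ} {θ : ℝ}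
    {β β' : Fin m → ℝ} (h : Solvable M P e θ β) (hβ : ∀ j, β j ≤ β' j) : Solvable M P e θ β' where
  exists_forced η h₁ h₂ f D hf hb := by
    obtain ⟨X, hX, h0, hXb⟩ := h.exists_forced η h₁ h₂ f D hf hb
    have hD : 0 ≤ D := by simpa using (norm_nonneg _).trans (hb 0)
    exact ⟨X, hX, h0, fun ξ j => (hXb ξ j).trans (by gcongr; exact hβ j)⟩
  unique := h.unique
  exists_central := h.exists_central

theorem wt_rpow_sub_one (n : ℤ) (j : ℕ) : wt n ^ ((j : ℝ) - 1) = wt n ^ j / wt n := by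
  rw [Real.rpow_sub_one (wt_pos n).ne', Real.rpow_natCast]

/-- The constant 200 dominates `3³ · 6 = 162`; the division by `wt n` is the gain of one order of
decay. -/
theorem root_bound_of_le {h R g : ℝ} {n : ℤ} {z : ℂ} {j : ℕ} (hh : 0 < h) (hj : j ≤ 3)
    (hz : ‖z‖ ≤ 3 * wt n) (hg : h ^ 2 * wt n / 6 ≤ R * g) :
    ‖z‖ ^ j ≤ 200 * wt n ^ ((j : ℝ) - 1) / h ^ 2 * (R * g) := by
  have hw := wt_pos n
  have h1 : ‖z‖ ^ j ≤ 27 * wt n ^ j := by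
    calc ‖z‖ ^ j ≤ (3 * wt n) ^ j := by gcongr
      _ = 3 ^ j * wt n ^ j := mul_pow _ _ _
      _ ≤ 3 ^ 3 * wt n ^ j := by gcongr; norm_num
      _ = _ := by norm_num
  rw [wt_rpow_sub_one]
  calc ‖z‖ ^ j ≤ 27 * wt n ^ j := h1
    _ ≤ 200 * (wt n ^ j / wt n) / h ^ 2 * (h ^ 2 * wt n / 6) := by
      have : 200 * (wt n ^ j / wt n) / h ^ 2 * (h ^ 2 * wt n / 6) = 200 / 6 * wt n ^ j := by
        field_simp
      rw [this]
      have : 0 < wt n ^ j := by positivity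
      linarith
    _ ≤ _ := by gcongr

/-- Blocks without central eigenvalue. -/
theorem hyperbolic_block {m : ℕ} (hm : m ≤ 3) {M : Matrix (Fin (m + 1)) (Fin (m + 1)) ℂ}
    {lam : Fin (m + 1) → ℂ} (hcomp : IsCompanion M)
    (hM : M.charpoly = ∏ i, (Polynomial.X - Polynomial.C (lam i))) {h : ℝ} {n : ℤ} (hh : 0 < h)
    (hh1 : h ≤ 1 / 1000) (hout : ∀ i, 1 / 2 < ‖lam i‖) (hre : ∀ i, h / 16 ≤ |(lam i).re|)
    (hle : ∀ i, ‖lam i‖ ≤ 3 * wt n)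
    (hgap : ∀ i, h ^ 2 * wt n / 6 ≤ |(lam i).re| * ‖rootGap lam i‖) {C : ℝ} (hC : 2000 ≤ C) :
    centralProj M = 0 ∧ BlockFacts C h n M := by
  have hg : ∀ i, rootGap lam i ≠ 0 := fun i hi => by
    have := hgap i
    rw [hi, norm_zero, mul_zero] at this
    have : 0 < h ^ 2 * wt n := by have := wt_pos n; positivity
    linarith
  have hP := centralProj_eq_zero hM hg hout
  refine ⟨hP, ?_, by simp [hP], by simp [hP], fun i j => by simp [hP]; linarith⟩
  have hS := ModeSplit.of_roots (H := Finset.univ) (θ := h / 64) (l₁ := 0) (l₂ := 0)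
    (β := fun j => 200 * wt n ^ ((j : ℝ) - 1) / h ^ 2) hcomp hM (by linarith)
    (fun i _ => hg i) (fun i _ => hout i) (by simp) (by simp; positivity) (by simp; positivity)
    (fun i _ => by linarith [hre i])
    (fun i _ j => root_bound_of_le hh (by omega) (hle i) (hgap i)) (fun j => by
      have := wt_rpow_pos n ((j : ℝ) - 1)
      simp only [hP, Matrix.zero_mulVec, Pi.zero_apply, norm_zero, mul_zero,
        add_zero]
      positivity)
  -- At most four roots give the factor `2 · 4 + 1 = 9`, and `9 · 200 = 1800 ≤ 2000`.
  refine (hS.solvable (by positivity)).mono fun j => ?_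
  have h1 : ((m + 1 : ℕ) : ℝ) ≤ 4 := by exact_mod_cast (by omega : m + 1 ≤ 4)
  have h2 := wt_rpow_pos n ((j : ℝ) - 1)
  have h3 : (2 * ((m + 1 : ℕ) : ℝ) + 1) * 200 ≤ C := by linarith
  calc (2 * ((m + 1 : ℕ) : ℝ) + 1) * (200 * wt n ^ ((j : ℝ) - 1) / h ^ 2)
      = ((2 * ((m + 1 : ℕ) : ℝ) + 1) * 200) * wt n ^ ((j : ℝ) - 1) / h ^ 2 := by ring
    _ ≤ _ := by gcongr

open Polynomial in
theorem con_hyperbolic {h : ℝ} {n : ℤ} (hh : 0 < h) (hh1 : h ≤ 1 / 1000) (hn : n ≠ 0) {C' : ℝ}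
    (hC : 2000 ≤ C') :
    centralProj (Lcon (h ^ 2) n) = 0 ∧ BlockFacts (m := 1) C' h n (Lcon (h ^ 2) n) := by
  obtain ⟨lam, hlam⟩ := exists_roots_of_monic (Matrix.charpoly_monic (Lcon (h ^ 2) n))
    (m := 2) (by rw [Matrix.charpoly_natDegree_eq_dim]; simp)
  have hroot : ∀ i, (lam i + Complex.I * n) ^ 2 + (h ^ 2 : ℝ) * lam i = 0 := fun i => by
    have h1 : (Lcon (h ^ 2) n).charpoly.eval (lam i) = 0 := by
      rw [hlam, eval_prod, Finset.prod_eq_zero (Finset.mem_univ i) (by simp)]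
    rw [charpoly_Lcon] at h1
    simpa only [eval_sub, eval_pow, eval_add, eval_one, eval_X, eval_C, eval_mul] using h1
  have hgap : ∀ i, rootGap lam i = 2 * (lam i + Complex.I * n) + (h ^ 2 : ℝ) := fun i => by
    rw [rootGap_eq_derivative, ← hlam, charpoly_Lcon]
    simp [derivative_pow]
  have hc := fun i => con_root_cases hh hh1 hn (hroot i)
  exact hyperbolic_block (m := 1) (by norm_num) (isCompanion_Lcon _ _) hlam hh hh1
    (fun i => (hc i).1) (fun i => (hc i).2.1) (fun i => (hc i).2.2.1)
    (fun i => by rw [hgap]; exact (hc i).2.2.2) hC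

open Polynomial in
theorem sh_roots {h α : ℝ} {n : ℤ} (hh : 0 < h) (hh1 : h ≤ 1 / 1000)
    (hα : 0 ≤ α) (hα1 : α ≤ h ^ 2 / 1000000) : ∃ lam : Fin 4 → ℂ,
    (LSH α (h ^ 2) n).charpoly = ∏ i, (X - C (lam i)) ∧
    (∀ i, (1 + (lam i + Complex.I * n) ^ 2) ^ 2 - α - (h ^ 2 : ℝ) * lam i = 0) ∧
    (∀ i, ‖lam i‖ ≤ 3 * wt n) ∧
    ∀ i, ((n = 1 ∨ n = -1) ∧ ‖lam i‖ ≤ h / 128) ∨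
      (1 / 2 < ‖lam i‖ ∧ h / 16 ≤ |(lam i).re| ∧
        h ^ 2 * wt n / 6 ≤ |(lam i).re| * ‖rootGap lam i‖) := by
  obtain ⟨lam, hlam⟩ := exists_roots_of_monic (Matrix.charpoly_monic (LSH α (h ^ 2) n))
    (m := 4) (by rw [Matrix.charpoly_natDegree_eq_dim]; simp)
  have hroot : ∀ i, (1 + (lam i + Complex.I * n) ^ 2) ^ 2 - α - (h ^ 2 : ℝ) * lam i = 0 :=
    fun i => by
      have h1 : (LSH α (h ^ 2) n).charpoly.eval (lam i) = 0 := by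
        rw [hlam, eval_prod, Finset.prod_eq_zero (Finset.mem_univ i) (by simp)]
      rw [charpoly_LSH] at h1
      simpa only [eval_sub, eval_pow, eval_add, eval_one, eval_X, eval_C, eval_mul] using h1
  have hgap : ∀ i, rootGap lam i = 4 * (lam i + Complex.I * n) *
      (1 + (lam i + Complex.I * n) ^ 2) - (h ^ 2 : ℝ) := fun i => by
    rw [rootGap_eq_derivative, ← hlam, charpoly_LSH]
    simp [derivative_pow]
    ring
  refine ⟨lam, hlam, hroot, fun i => ?_, fun i => ?_⟩
  · exact sh_root_norm_le (by positivity) (by nlinarith) hα (by nlinarith) (hroot i)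
  · rw [hgap]; exact sh_root_cases hh hh1 hα hα1 (hroot i)

theorem sh_hyperbolic {h α : ℝ} {n : ℤ} (hh : 0 < h) (hh1 : h ≤ 1 / 1000)
    (hα : 0 ≤ α) (hα1 : α ≤ h ^ 2 / 1000000) (hn : n ≠ 1) (hn' : n ≠ -1) {C : ℝ}
    (hC : 2000 ≤ C) :
    centralProj (LSH α (h ^ 2) n) = 0 ∧ BlockFacts (m := 3) C h n (LSH α (h ^ 2) n) := by
  obtain ⟨lam, hlam, -, hle, hcases⟩ := sh_roots (n := n) hh hh1 hα hα1
  have hc := fun i => (hcases i).resolve_left fun h => h.1.elim hn hn'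
  exact hyperbolic_block (m := 3) le_rfl (isCompanion_LSH _ _ _) hlam hh hh1
    (fun i => (hc i).1) (fun i => (hc i).2.1) hle (fun i => (hc i).2.2) hC

/-! ### The central blocks -/

theorem continuous_LSH {T : Type*} [TopologicalSpace T] {α c : T → ℝ} (hα : Continuous α)
    (hc : Continuous c) (n : ℤ) : Continuous fun t => LSH (α t) (c t) n := by
  refine continuous_matrix fun i j => ?_
  fin_cases i <;> fin_cases j <;> simp [LSH] <;> fun_prop

/-- On the circle `‖z‖² ‖z + 2 i n‖² ≥ (1/2 · 3/2)²`, more than `α + c / 2`. -/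
theorem det_LSH_ne_zero {α c : ℝ} {n : ℤ} {z : ℂ} (hα : 0 ≤ α) (hα1 : α ≤ 1 / 100)
    (hc : 0 ≤ c) (hc1 : c ≤ 1 / 100) (hn : n = 1 ∨ n = -1) (hz : ‖z‖ = 1 / 2) :
    (z • (1 : Matrix (Fin 4) (Fin 4) ℂ) - LSH α c n).det ≠ 0 := by
  intro h0
  rw [det_smul_one_sub, charpoly_LSH] at h0
  simp only [Polynomial.eval_sub, Polynomial.eval_pow, Polynomial.eval_add, Polynomial.eval_one,
    Polynomial.eval_X, Polynomial.eval_C, Polynomial.eval_mul] at h0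
  have h1 := congrArg norm (sh_root_factor hn h0)
  rw [norm_pow, norm_mul, hz] at h1
  have h2 : ‖(α : ℂ) + (c : ℂ) * z‖ ≤ α + c * ‖z‖ := by
    refine (norm_add_le _ _).trans ?_
    rw [norm_mul, Complex.norm_real, Complex.norm_real, Real.norm_of_nonneg hα,
      Real.norm_of_nonneg hc]
  have h3 := norm_sub_le (z + 2 * Complex.I * n) z
  rw [add_sub_cancel_left, norm_two_I_mul hn, hz] at h3
  rw [hz] at h2
  nlinarith

/-- Compactness of the circle times the parameter square. The bound extends to `α = c = 0`, where
the two enclosed eigenvalues merge, because the contour stays away from all eigenvalues. -/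
theorem exists_bound_centralProj : ∃ C, ∀ n : ℤ, n = 1 ∨ n = -1 → ∀ α c : ℝ, 0 ≤ α → α ≤ 1 / 100 →
    0 ≤ c → c ≤ 1 / 100 → ∀ i j, ‖centralProj (LSH α c n) i j‖ ≤ C := by
  have key : ∀ (n : ℤ) (i j : Fin 4), ∃ C, n = 1 ∨ n = -1 → ∀ α c : ℝ, 0 ≤ α → α ≤ 1 / 100 →
      0 ≤ c → c ≤ 1 / 100 → ‖centralProj (LSH α c n) i j‖ ≤ C := fun n i j => by
    by_cases hn : n = 1 ∨ n = -1
    swap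
    · exact ⟨0, fun h => absurd h hn⟩
    let A : ℂ × ℝ × ℝ → Matrix (Fin 4) (Fin 4) ℂ :=
      fun t => t.1 • (1 : Matrix (Fin 4) (Fin 4) ℂ) - LSH t.2.1 t.2.2 n
    have hA : Continuous A := (continuous_fst.smul continuous_const).sub
      (continuous_LSH (continuous_fst.comp continuous_snd) (continuous_snd.comp continuous_snd) n)
    have hK : IsCompact (Metric.sphere (0 : ℂ) (1 / 2) ×ˢ (Icc (0 : ℝ) (1 / 100) ×ˢ
        Icc (0 : ℝ) (1 / 100))) := (isCompact_sphere _ _).prod (isCompact_Icc.prod isCompact_Icc)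
    obtain ⟨C, hC⟩ := hK.exists_bound_of_continuousOn (continuousOn_resolvent hA
      (fun t ht => det_LSH_ne_zero ht.2.1.1 ht.2.1.2 ht.2.2.1 ht.2.2.2 hn (by simpa using ht.1))
      i j)
    refine ⟨‖(2 * (Real.pi : ℂ) * Complex.I)⁻¹‖ * (2 * Real.pi * (1 / 2) * C),
      fun _ α c hα hα1 hc hc1 => ?_⟩
    rw [centralProj, Matrix.of_apply, norm_mul]
    gcongr
    exact circleIntegral.norm_integral_le_of_norm_le_const (by norm_num) fun z hz =>
      hC (z, α, c) ⟨hz, ⟨hα, hα1⟩, hc, hc1⟩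
  choose C hC using key
  refine ⟨∑ i, ∑ j, (|C 1 i j| + |C (-1) i j|), fun n hn α c hα hα1 hc hc1 i j => ?_⟩
  have h1 : ∀ i j, 0 ≤ |C 1 i j| + |C (-1) i j| := fun i j => by positivity
  calc _ ≤ C n i j := hC n i j hn α c hα hα1 hc hc1
    _ ≤ |C 1 i j| + |C (-1) i j| := by
      rcases hn with rfl | rfl
      · linarith [le_abs_self (C 1 i j), abs_nonneg (C (-1) i j)]
      · linarith [le_abs_self (C (-1) i j), abs_nonneg (C 1 i j)]
    _ ≤ ∑ j, (|C 1 i j| + |C (-1) i j|) :=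
      Finset.single_le_sum (f := fun j => |C 1 i j| + |C (-1) i j|) (fun j _ => h1 i j)
        (Finset.mem_univ j)
    _ ≤ _ := Finset.single_le_sum (f := fun i => ∑ j, (|C 1 i j| + |C (-1) i j|))
        (fun i _ => Finset.sum_nonneg fun j _ => h1 i j) (Finset.mem_univ i)

/-- The trace counts the roots: up to four errors of size `1/16`, the sum `-4 i n` is `-2 i n` times
the number of large roots. -/
theorem card_filter_roots {lam : Fin 4 → ℂ} {n : ℤ} (hn : n = 1 ∨ n = -1)
    (hsum : ∑ i, lam i = -4 * Complex.I * n) {H : Finset (Fin 4)}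
    (hH : ∀ i ∈ H, ‖lam i + 2 * Complex.I * n‖ ≤ 1 / 16) (hH' : ∀ i ∉ H, ‖lam i‖ ≤ 1 / 16) :
    H.card = 2 := by
  have h1 : ‖∑ i, (lam i + if i ∈ H then 2 * Complex.I * n else 0)‖ ≤ ∑ _i : Fin 4, (1 / 16 : ℝ) := by
    refine norm_sum_le_of_le _ fun i _ => ?_
    split_ifs with hi
    · exact hH i hi
    · rw [add_zero]; exact hH' i hi
  rw [Finset.sum_add_distrib, hsum, Finset.sum_ite_mem, Finset.univ_inter, Finset.sum_const,
    Finset.sum_const, Finset.card_univ, Fintype.card_fin] at h1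
  have h2 : -4 * Complex.I * (n : ℂ) + H.card • (2 * Complex.I * (n : ℂ)) =
      ((H.card : ℝ) - 2 : ℝ) • (2 * Complex.I * (n : ℂ)) := by
    simp only [nsmul_eq_mul, Complex.real_smul]; push_cast; ring
  rw [h2, norm_smul, norm_two_I_mul hn, Real.norm_eq_abs] at h1
  have h3 : |((H.card : ℤ) - 2 : ℤ)| < 1 := by
    have : |((H.card : ℝ) - 2)| < 1 := by norm_num at h1; linarith
    exact_mod_cast this
  have := Int.abs_lt_one_iff.1 h3
  omega

open Polynomial in
/-- The roots of the central Swift–Hohenberg blocks: two simple hyperbolic ones and two small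
ones. -/
theorem sh_central_roots {h α : ℝ} {n : ℤ} (hh : 0 < h) (hh1 : h ≤ 1 / 1000)
    (hα : 0 ≤ α) (hα1 : α ≤ h ^ 2 / 1000000) (hn : n = 1 ∨ n = -1) :
    ∃ (lam : Fin 4 → ℂ) (H : Finset (Fin 4)) (l₁ l₂ : ℂ), H.card = 2 ∧
    (LSH α (h ^ 2) n).charpoly = ∏ i, (X - C (lam i)) ∧ ‖l₁‖ ≤ h / 128 ∧ ‖l₂‖ ≤ h / 128 ∧
    ∏ j ∈ Hᶜ, (X - C (lam j)) = (X - C l₂) * (X - C l₁) ∧ (∀ i, ‖lam i‖ ≤ 3 * wt n) ∧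
    ∀ i ∈ H, 1 / 2 < ‖lam i‖ ∧ h / 16 ≤ |(lam i).re| ∧
        h ^ 2 * wt n / 6 ≤ |(lam i).re| * ‖rootGap lam i‖ := by
  obtain ⟨lam, hlam, hroot, hle, hcases⟩ := sh_roots (n := n) hh hh1 hα hα1
  let H : Finset (Fin 4) := Finset.univ.filter fun i => 1 / 2 < ‖lam i‖
  have hsum : ∑ i, lam i = -4 * Complex.I * n := by
    have h1 := Matrix.trace_eq_neg_charpoly_nextCoeff (LSH α (h ^ 2) n)
    rw [hlam, prod_X_sub_C_nextCoeff, neg_neg] at h1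
    rw [← h1]
    simp [Matrix.trace, LSH, Fin.sum_univ_succ]
  have hcard : H.card = 2 := by
    refine card_filter_roots hn hsum (fun i hi => ?_) (fun i hi => ?_)
    · have hi' : 1 / 2 < ‖lam i‖ := (Finset.mem_filter.1 hi).2
      rcases sh_root_near hh hh1 hα hα1 hn (hroot i) with h1 | h1
      · linarith
      · exact h1.2
    · have hi' : ‖lam i‖ ≤ 1 / 2 := by simpa [H] using hi
      rcases sh_root_near hh hh1 hα hα1 hn (hroot i) with h1 | h1
      · linarith
      · linarith [h1.1]
  have hc2 : (Hᶜ).card = 2 := by rw [Finset.card_compl, hcard]; simp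
  obtain ⟨a, b, hab, hHc⟩ := Finset.card_eq_two.1 hc2
  have hsmall : ∀ i ∈ Hᶜ, ‖lam i‖ ≤ h / 128 := fun i hi => by
    have hi' : ‖lam i‖ ≤ 1 / 2 := by simpa [H] using hi
    rcases hcases i with h1 | h1
    · exact h1.2
    · linarith [h1.1]
  refine ⟨lam, H, lam b, lam a, hcard, hlam, hsmall b (by simp [hHc]), hsmall a (by simp [hHc]),
    by rw [hHc, Finset.prod_pair hab], hle, fun i hi => ?_⟩
  have hi' : 1 / 2 < ‖lam i‖ := (Finset.mem_filter.1 hi).2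
  rcases hcases i with h1 | h1
  · linarith [h1.2]
  · exact h1

theorem norm_LSH_apply_le {α c : ℝ} {n : ℤ} (hα : 0 ≤ α) (hα1 : α ≤ 1) (hc : 0 ≤ c) (hc1 : c ≤ 1)
    (hn : n = 1 ∨ n = -1) (i j : Fin 4) : ‖LSH α c n i j‖ ≤ 10 := by
  have e1 : ‖(α : ℂ)‖ ≤ 1 := by rwa [Complex.norm_real, Real.norm_of_nonneg hα]
  have e2 : ‖(c : ℂ)‖ ≤ 1 := by rwa [Complex.norm_real, Real.norm_of_nonneg hc]
  rcases hn with rfl | rfl <;> fin_cases i <;> fin_cases j <;> simp [LSH] at * <;> norm_num <;>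
    linarith

theorem norm_mulVec_le {m : ℕ} {A : Matrix (Fin m) (Fin m) ℂ} {x : Fin m → ℂ} {a b : ℝ}
    (hA : ∀ i j, ‖A i j‖ ≤ a) (hx : ∀ j, ‖x j‖ ≤ b) (i : Fin m) : ‖(A *ᵥ x) i‖ ≤ m * (a * b) := by
  refine (norm_sum_le_of_le Finset.univ (f := fun j => A i j * x j) fun j _ =>
    (norm_mul_le _ _).trans (mul_le_mul (hA i j) (hx j) (norm_nonneg _)
      ((norm_nonneg _).trans (hA i j)))).trans_eq ?_
  simp

/-- The cascade costs `(2/θ)²` with `θ = h / 64`, where `128² · 41 = 671744`; the power of the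
weight costs a further factor 2 at most. -/
theorem central_bound_le {h C : ℝ} {n : ℤ} {m : ℕ} {M P : Matrix (Fin m) (Fin m) ℂ} {l : ℂ}
    {e : Fin m → ℂ} (hh : 0 < h) (hh1 : h ≤ 1) (hn : wt n ≤ 2) (hl : ‖l‖ ≤ 1) (hm : m ≤ 4)
    (hC : 0 ≤ C) (hM : ∀ i j, ‖M i j‖ ≤ 10) (hP : ∀ j, ‖(P *ᵥ e) j‖ ≤ C) (j : Fin m) :
    2 / (h / 64) * ‖(P *ᵥ e) j‖ + (2 / (h / 64)) ^ 2 *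
      ‖(((M - l • (1 : Matrix (Fin m) (Fin m) ℂ)) * P) *ᵥ e) j‖ ≤
      1500000 * C * wt n ^ ((j : ℝ) - 1) / h ^ 2 := by
  have h1 : ‖(((M - l • (1 : Matrix (Fin m) (Fin m) ℂ)) * P) *ᵥ e) j‖ ≤ 41 * C := by
    rw [← Matrix.mulVec_mulVec, Matrix.sub_mulVec, Matrix.smul_mulVec, Matrix.one_mulVec,
      Pi.sub_apply, Pi.smul_apply, smul_eq_mul]
    have a1 := norm_mulVec_le hM hP j
    have a2 : ‖l * (P *ᵥ e) j‖ ≤ 1 * C := by rw [norm_mul]; gcongr; exact hP j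
    have a3 : (m : ℝ) ≤ 4 := by exact_mod_cast hm
    calc _ ≤ m * (10 * C) + 1 * C := norm_sub_le_of_le a1 a2
      _ ≤ 4 * (10 * C) + 1 * C := by gcongr
      _ = _ := by ring
  have h2 : (1 / 2 : ℝ) ≤ wt n ^ ((j : ℝ) - 1) := by
    rw [wt_rpow_sub_one, le_div_iff₀ (wt_pos n)]
    have : 1 ≤ wt n ^ (j : ℕ) := one_le_pow₀ (one_le_wt n)
    linarith
  have h3 : 1 / h ≤ 1 / h ^ 2 := by gcongr; nlinarith
  calc _ ≤ 2 / (h / 64) * C + (2 / (h / 64)) ^ 2 * (41 * C) := by gcongr; exact hP j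
    _ = 128 * C * (1 / h) + 671744 * C * (1 / h ^ 2) := by field_simp; ring
    _ ≤ 128 * C * (1 / h ^ 2) + 671744 * C * (1 / h ^ 2) := by gcongr
    _ ≤ 1500000 * C * (1 / 2) * (1 / h ^ 2) := by
      have : 0 ≤ C * (1 / h ^ 2) := by positivity
      linarith
    _ ≤ 1500000 * C * wt n ^ ((j : ℝ) - 1) * (1 / h ^ 2) := by gcongr
    _ = _ := by ring

open Polynomial in
-- For `n = 0` the roots are `0` and `-c`, both central, so the splitting has no hyperbolic part.
theorem con_central {h : ℝ} (hh : 0 < h) (hh1 : h ≤ 1 / 1000) {C' : ℝ} (hC : 20000000 ≤ C') :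
    centralProj (Lcon (h ^ 2) 0) = 1 ∧ BlockFacts (m := 1) C' h 0 (Lcon (h ^ 2) 0) := by
  have hM : (Lcon (h ^ 2) 0).charpoly = ∏ i, (X - C ((![0, -((h ^ 2 : ℝ) : ℂ)] : Fin 2 → ℂ) i)) := by
    rw [charpoly_Lcon, Fin.prod_univ_two]
    simp; ring
  have hc : ‖-((h ^ 2 : ℝ) : ℂ)‖ ≤ h / 128 := by
    rw [norm_neg, Complex.norm_real, Real.norm_of_nonneg (sq_nonneg h)]; nlinarith
  have hq : ∏ j ∈ (∅ : Finset (Fin 2))ᶜ, (X - C ((![0, -((h ^ 2 : ℝ) : ℂ)] : Fin 2 → ℂ) j)) ∣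
      (X - C (-((h ^ 2 : ℝ) : ℂ))) * (X - C 0) := by
    rw [Finset.compl_empty, Fin.prod_univ_two]; simp [mul_comm]
  have hP : centralProj (Lcon (h ^ 2) 0) = 1 := by
    have := centralProj_eq (H := ∅) (l₁ := 0) (l₂ := -((h ^ 2 : ℝ) : ℂ)) hM (by simp) (by simp) hq
      (by norm_num) (hc.trans_lt (by linarith))
    simpa using this
  have hS := ModeSplit.of_roots (m := 1) (H := ∅) (θ := h / 64) (l₁ := 0) (l₂ := -((h ^ 2 : ℝ) : ℂ))
    (β := fun j => 1500000 * 1 * wt 0 ^ ((j : ℝ) - 1) / h ^ 2) (isCompanion_Lcon _ _) hM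
    (by linarith) (by simp) (by simp) hq (by simp; positivity) (by linarith) (by simp) (by simp)
    (fun j => by
      refine central_bound_le hh (by linarith) (by norm_num [wt]) (by simp) (by norm_num)
        (by norm_num) (fun i j => ?_) (fun j => ?_) j
      · have : ‖((h ^ 2 : ℝ) : ℂ)‖ ≤ 1 := by
          rw [Complex.norm_real, Real.norm_of_nonneg (sq_nonneg h)]; nlinarith
        fin_cases i <;> fin_cases j <;> simp [Lcon] at * <;> linarith
      · rw [hP, Matrix.one_mulVec]
        fin_cases j <;> simp)
  refine ⟨hP, (hS.solvable (by positivity)).mono fun j => ?_, by simp [hP], by simp [hP],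
    fun i j => ?_⟩
  · have h2 := wt_rpow_pos 0 ((j : ℝ) - 1)
    calc (2 * ((1 + 1 : ℕ) : ℝ) + 1) * (1500000 * 1 * wt 0 ^ ((j : ℝ) - 1) / h ^ 2)
        = 7500000 * wt 0 ^ ((j : ℝ) - 1) / h ^ 2 := by push_cast; ring
      _ ≤ _ := by gcongr; linarith
  · rw [hP, Matrix.one_apply]
    split_ifs <;> simp <;> linarith

theorem matrix_rank_add_le {m : ℕ} (A B : Matrix (Fin m) (Fin m) ℂ) :
    (A + B).rank ≤ A.rank + B.rank := by
  have h : LinearMap.range (A + B).mulVecLin ≤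
      LinearMap.range A.mulVecLin ⊔ LinearMap.range B.mulVecLin := by
    rintro _ ⟨x, rfl⟩
    rw [Matrix.mulVecLin_add]
    exact Submodule.add_mem_sup (LinearMap.mem_range_self _ x) (LinearMap.mem_range_self _ x)
  exact (Submodule.finrank_mono h).trans (Submodule.finrank_add_le_finrank_add_finrank _ _)

/-- A block with two small roots has a central subspace of dimension two. -/
theorem rank_eq_two {M P : Matrix (Fin 4) (Fin 4) ℂ} {e : Fin 4 → ℂ} {θ : ℝ} {β : Fin 4 → ℝ}
    {H : Finset (Fin 4)} {lam : Fin 4 → ℂ} {π : Fin 4 → Matrix (Fin 4) (Fin 4) ℂ} {l₁ l₂ : ℂ}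
    (hM : IsCompanion M) (hS : ModeSplit M P e θ β H lam π l₁ l₂) (hcard : H.card = 2) :
    P.rank = 2 := by
  refine le_antisymm ?_ ?_
  · have hrow : ∀ (A : Matrix (Fin 4) (Fin 4) ℂ) (k : Fin 4),
        (M * A) 0 k = A 1 k ∧ (M * A) 1 k = A 2 k ∧ (M * A) 2 k = A 3 k := fun A k => by
      have h1 := fun j => hM j (A.col k)
      exact ⟨h1 0, h1 1, h1 2⟩
    -- The quadratic relation on the range of `P`, read in the first two rows of a companion matrix,
    -- expresses rows 2 and 3 of `P` through rows 0 and 1. Thus the rank is at most 2.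
    have hq : M * (M * P) = (l₁ + l₂) • (M * P) - (l₁ * l₂) • P := by
      have := hS.central
      simp only [sub_mul, mul_sub, smul_mul_assoc, one_mul, mul_smul_comm] at this
      rw [← sub_eq_zero, ← this]
      module
    have h2 : ∀ k, P 2 k = (l₁ + l₂) * P 1 k - l₁ * l₂ * P 0 k := fun k => by
      have := congrFun (congrFun hq 0) k
      simpa [(hrow (M * P) k).1, (hrow P k).1, (hrow P k).2.1] using this
    have h3 : ∀ k, P 3 k = (l₁ + l₂) * P 2 k - l₁ * l₂ * P 1 k := fun k => by
      have := congrFun (congrFun hq 1) k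
      simpa [(hrow (M * P) k).2.1, (hrow P k).2.2, (hrow P k).2.1] using this
    have hfac : P = (!![1, 0; 0, 1; -(l₁ * l₂), l₁ + l₂;
        -((l₁ + l₂) * (l₁ * l₂)), (l₁ + l₂) ^ 2 - l₁ * l₂] : Matrix (Fin 4) (Fin 2) ℂ) *
        Matrix.of fun i k => P (![0, 1] i) k := by
      ext i k
      fin_cases i <;> simp [Matrix.mul_apply, Fin.sum_univ_two, h3, h2] <;> ring
    rw [hfac]
    exact (Matrix.rank_mul_le_left _ _).trans (Matrix.rank_le_width _)
  -- Eigenvectors of a companion matrix are multiples of `(λ ^ j)`, so two hyperbolic projections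
  -- remove at most two dimensions from the four of the identity.
  · have hπ : ∀ i ∈ H, (π i).rank ≤ 1 := fun i hi => by
      have : π i = Matrix.vecMulVec (fun j : Fin 4 => lam i ^ (j : ℕ)) (π i 0) := by
        ext j k
        have h1 : M *ᵥ (π i).col k = lam i • (π i).col k := by
          exact congrArg (fun A : Matrix (Fin 4) (Fin 4) ℂ => A.col k) (hS.mul_proj i hi)
        exact hM.eigenvector h1 j
      rw [this]
      exact Matrix.rank_vecMulVec_le _ _
    obtain ⟨a, b, hab, rfl⟩ := Finset.card_eq_two.1 hcard
    have h1 := hS.sum_eq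
    rw [Finset.sum_pair hab] at h1
    have h4 := Matrix.rank_one (R := ℂ) (n := Fin 4)
    rw [← h1, Fintype.card_fin] at h4
    have h5 := matrix_rank_add_le P (π a + π b)
    have h6 := matrix_rank_add_le (π a) (π b)
    have h7 := hπ a (by simp)
    have h8 := hπ b (by simp)
    omega

/-- The two constants are `9 · 200` for the hyperbolic roots and `9 · 1500000` for the central ones,
with 9 from `ModeSplit.solvable`. -/
theorem sh_central : ∃ C, 1 ≤ C ∧ ∀ (h α : ℝ) (n : ℤ), 0 < h → h ≤ 1 / 1000 → 0 ≤ α →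
    α ≤ h ^ 2 / 1000000 → n = 1 ∨ n = -1 → ∀ C', C ≤ C' →
    BlockFacts (m := 3) C' h n (LSH α (h ^ 2) n) ∧
    Module.finrank ℂ (LinearMap.range (centralProj (LSH α (h ^ 2) n)).mulVecLin) = 2 := by
  obtain ⟨C, hC⟩ := exists_bound_centralProj
  have hC0 : 0 ≤ C := (norm_nonneg _).trans
    (hC 1 (Or.inl rfl) 0 0 le_rfl (by norm_num) le_rfl (by norm_num) 0 0)
  refine ⟨1800 + 13500000 * C, by linarith, fun h α n hh hh1 hα hα1 hn C' hC' => ?_⟩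
  have hh2 : h ^ 2 ≤ 1 / 100 := by nlinarith
  obtain ⟨lam, H, l₁, l₂, hcard, hM, hl₁, hl₂, hprod, hle, hroots⟩ :=
    sh_central_roots hh hh1 hα hα1 hn
  have hPb := hC n hn α (h ^ 2) hα (by linarith) (by positivity) hh2
  have hwn : wt n = 2 := by rcases hn with rfl | rfl <;> norm_num [wt]
  have hg : ∀ i ∈ H, rootGap lam i ≠ 0 := fun i hi h0 => by
    have := (hroots i hi).2.2
    rw [h0, norm_zero, mul_zero] at this
    have : 0 < h ^ 2 * wt n := by have := wt_pos n; positivity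
    linarith
  have hS := ModeSplit.of_roots (m := 3) (H := H) (θ := h / 64) (l₁ := l₁) (l₂ := l₂)
    (β := fun j => (200 + 1500000 * C) * wt n ^ ((j : ℝ) - 1) / h ^ 2)
    (isCompanion_LSH _ _ _) hM (by linarith) hg (fun i hi => (hroots i hi).1) (dvd_of_eq hprod)
    (by linarith) (by linarith) (fun i hi => by linarith [(hroots i hi).2.1])
    (fun i hi j => (root_bound_of_le hh (by omega) (hle i) (hroots i hi).2.2).trans (by
      have := wt_rpow_pos n ((j : ℝ) - 1)
      gcongr; linarith))
    (fun j => (central_bound_le (C := C) hh (by linarith) hwn.le (by linarith) (by norm_num)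
      hC0 (norm_LSH_apply_le hα (by linarith) (by positivity) (by linarith) hn) (fun j => by
        rw [Matrix.mulVec_single_one]; exact hPb j _) j).trans (by
      have := wt_rpow_pos n ((j : ℝ) - 1)
      gcongr; linarith))
  refine ⟨⟨(hS.solvable (by positivity)).mono fun j => ?_, hS.idem, hS.comm,
    fun i j => (hPb i j).trans (by linarith)⟩, ?_⟩
  · have := wt_rpow_pos n ((j : ℝ) - 1)
    calc (2 * ((3 + 1 : ℕ) : ℝ) + 1) * ((200 + 1500000 * C) * wt n ^ ((j : ℝ) - 1) / h ^ 2)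
        = (1800 + 13500000 * C) * wt n ^ ((j : ℝ) - 1) / h ^ 2 := by push_cast; ring
      _ ≤ _ := by gcongr
  · exact rank_eq_two (isCompanion_LSH _ _ _) hS hcard

/-! ### The Lyapunov–Perron construction for a system of modes -/

section BoundedFunctions

open BoundedContinuousFunction

variable {V T : Type*} [NormedAddCommGroup V] [NormedSpace ℝ V] [TopologicalSpace T]

/-- A linear family of bounded continuous functions. -/
noncomputable def bcfLinear (f : V → T → ℂ) (hadd : ∀ v w t, f (v + w) t = f v t + f w t)
    (hsmul : ∀ (a : ℝ) v t, f (a • v) t = a * f v t) (hcont : ∀ v, Continuous (f v))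
    (hb : ∀ v, ∃ C, ∀ t, ‖f v t‖ ≤ C) : V →ₗ[ℝ] (T →ᵇ ℂ) where
  toFun v := ofNormedAddCommGroup (f v) (hcont v) (hb v).choose (hb v).choose_spec
  map_add' v w := by ext t; exact hadd v w t
  map_smul' a v := by
    ext t
    change f (a • v) t = a • f v t
    rw [hsmul, Complex.real_smul]

theorem bcf_norm_le {f : T →ᵇ ℂ} {C : ℝ} (hC : 0 ≤ C) (h : ∀ t, ‖f t‖ ≤ C) : ‖f‖ ≤ C :=
  (norm_le hC).2 h

/-- A bounded linear family of bounded continuous functions. -/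
noncomputable def bcfCLM (f : V → T → ℂ) (hadd : ∀ v w t, f (v + w) t = f v t + f w t)
    (hsmul : ∀ (a : ℝ) v t, f (a • v) t = a * f v t) (hcont : ∀ v, Continuous (f v)) (C : ℝ)
    (hC : 0 ≤ C) (hb : ∀ v t, ‖f v t‖ ≤ C * ‖v‖) : V →L[ℝ] (T →ᵇ ℂ) :=
  (bcfLinear f hadd hsmul hcont fun v => ⟨_, hb v⟩).mkContinuous C fun v =>
    bcf_norm_le (by positivity) (hb v)

end BoundedFunctions

/-- Countably many finite-dimensional linear systems with central projections `P k`, coupled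
through a smooth forcing `Φ` of the scaled unknowns, in the directions `e k`. -/
structure ModeSystem (𝔫 : Type*) where
  m : 𝔫 → ℕ
  M : ∀ k, Matrix (Fin (m k)) (Fin (m k)) ℂ
  P : ∀ k, Matrix (Fin (m k)) (Fin (m k)) ℂ
  e : ∀ k, Fin (m k) → ℂ
  θ : ℝ
  κ : ℝ
  L : ℝ
  ω : (Σ k, Fin (m k)) → ℝ
  φ : 𝔫 → ℝ
  Φ : ((Σ k, Fin (m k)) → ℂ) → 𝔫 → ℂ
  D : ((Σ k, Fin (m k)) → ℂ) → ((Σ k, Fin (m k)) → ℂ) → 𝔫 → ℂ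
  θ_pos : 0 < θ
  κ_nonneg : 0 ≤ κ
  L_nonneg : 0 ≤ L
  κL_le : κ * L ≤ 1 / 2
  ω_pos : ∀ i, 0 < ω i
  φ_pos : ∀ k, 0 < φ k
  solvable : ∀ k, Solvable (M k) (P k) (e k) θ fun j => κ * ω ⟨k, j⟩ / φ k
  smooth : SmoothSeq L φ Φ D

namespace ModeSystem

open BoundedContinuousFunction

variable {𝔫 : Type*} (𝒮 : ModeSystem 𝔫)

/-- Indices of the scalar unknowns. -/
abbrev Idx : Type _ := Σ k, Fin (𝒮.m k)

/-- The phase space of all mode sequences. -/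
abbrev State : Type _ := ∀ k, Fin (𝒮.m k) → ℂ

/-- The scaled unknowns. -/
noncomputable def scaled (X : 𝒮.State) (i : 𝒮.Idx) : ℂ := X i.1 i.2 / 𝒮.ω i

/-- `X` solves every mode equation. -/
def IsModeSolution (X : ℝ → 𝒮.State) : Prop :=
  ∀ k ξ, HasDerivAt (fun t => X t k)
    (𝒮.M k *ᵥ X ξ k + 𝒮.Φ (𝒮.scaled (X ξ)) k • 𝒮.e k) ξ

/-- `X` solves the `k`-th linear system with forcing `f`, central part `x` at zero, and controlled
growth. -/
structure IsSol (k : 𝔫) (f : ℝ → ℂ) (x : Fin (𝒮.m k) → ℂ) (X : ℝ → Fin (𝒮.m k) → ℂ) : Prop where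
  deriv : ∀ ξ, HasDerivAt X (𝒮.M k *ᵥ X ξ + f ξ • 𝒮.e k) ξ
  init : 𝒮.P k *ᵥ X 0 = x
  growth : ∃ C : Fin (𝒮.m k) → ℝ, ∀ ξ j, ‖X ξ j‖ ≤ C j * Real.exp (2 * 𝒮.θ * |ξ|)

variable {𝒮}

theorem IsSol.add {k : 𝔫} {f f' : ℝ → ℂ} {x x' : Fin (𝒮.m k) → ℂ} {X X' : ℝ → Fin (𝒮.m k) → ℂ}
    (h : 𝒮.IsSol k f x X) (h' : 𝒮.IsSol k f' x' X') :
    𝒮.IsSol k (fun t => f t + f' t) (x + x') (X + X') where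
  deriv ξ := ((h.deriv ξ).add (h'.deriv ξ)).congr_deriv (by
    rw [Pi.add_apply, Matrix.mulVec_add, add_smul]; abel)
  init := by rw [Pi.add_apply, Matrix.mulVec_add, h.init, h'.init]
  growth := by
    obtain ⟨C, hC⟩ := h.growth
    obtain ⟨C', hC'⟩ := h'.growth
    exact ⟨C + C', fun ξ j => (norm_add_le_of_le (hC ξ j) (hC' ξ j)).trans_eq
      (by rw [Pi.add_apply]; ring)⟩

theorem IsSol.smul {k : 𝔫} {f : ℝ → ℂ} {x : Fin (𝒮.m k) → ℂ} {X : ℝ → Fin (𝒮.m k) → ℂ}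
    (h : 𝒮.IsSol k f x X) (a : ℂ) : 𝒮.IsSol k (fun t => a * f t) (a • x) (a • X) where
  deriv ξ := ((h.deriv ξ).const_smul a).congr_deriv (by
    rw [Pi.smul_apply, Matrix.mulVec_smul, smul_add, smul_smul])
  init := by rw [Pi.smul_apply, Matrix.mulVec_smul, h.init]
  growth := by
    obtain ⟨C, hC⟩ := h.growth
    refine ⟨fun j => ‖a‖ * C j, fun ξ j => ?_⟩
    rw [Pi.smul_apply, Pi.smul_apply, norm_smul, mul_assoc]
    exact mul_le_mul_of_nonneg_left (hC ξ j) (norm_nonneg _)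

/-- Uniqueness makes the chosen solution `sol` linear in its data and independent of the exponential
weight. -/
theorem IsSol.unique {k : 𝔫} {f : ℝ → ℂ} {x : Fin (𝒮.m k) → ℂ} {X X' : ℝ → Fin (𝒮.m k) → ℂ}
    (h : 𝒮.IsSol k f x X) (h' : 𝒮.IsSol k f x X') : X = X' := by
  have h1 := h.add (h'.smul (-1))
  obtain ⟨C, hC⟩ := h1.growth
  funext ξ
  have h2 := (𝒮.solvable k).unique (X + (-1 : ℂ) • X') C
    (fun ξ => (h1.deriv ξ).congr_deriv (by simp)) (by rw [h1.init]; simp) hC ξ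
  simpa [add_neg_eq_zero] using h2

variable (𝒮) in
open Classical in
/-- The solution of the `k`-th linear system. -/
noncomputable def sol (k : 𝔫) (f : ℝ → ℂ) (x : Fin (𝒮.m k) → ℂ) : ℝ → Fin (𝒮.m k) → ℂ :=
  if h : ∃ X, 𝒮.IsSol k f x X then h.choose else 0

theorem IsSol.sol_eq {k : 𝔫} {f : ℝ → ℂ} {x : Fin (𝒮.m k) → ℂ} {X : ℝ → Fin (𝒮.m k) → ℂ}
    (h : 𝒮.IsSol k f x X) : 𝒮.sol k f x = X := by
  have h' : ∃ X, 𝒮.IsSol k f x X := ⟨X, h⟩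
  rw [sol, dif_pos h']
  exact h'.choose_spec.unique h

/-- The bound `κ ω / φ` in `ModeSystem` is designed so that the scales of forcing and unknown
cancel, leaving the norm `κ` for all modes and all weights between `θ` and `2θ`. -/
theorem exists_isSol_forced {η : ℝ} (h₁ : 𝒮.θ ≤ η) (h₂ : η ≤ 2 * 𝒮.θ) (k : 𝔫) {f : ℝ → ℂ} {D : ℝ}
    (hf : Continuous f) (hb : ∀ ξ, ‖f ξ‖ ≤ 𝒮.φ k * D * Real.exp (η * |ξ|)) :
    𝒮.IsSol k f 0 (𝒮.sol k f 0) ∧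
      ∀ ξ j, ‖𝒮.sol k f 0 ξ j‖ ≤ 𝒮.κ * 𝒮.ω ⟨k, j⟩ * D * Real.exp (η * |ξ|) := by
  obtain ⟨X, hX, h0, hXb⟩ := (𝒮.solvable k).exists_forced η h₁ h₂ f _ hf hb
  have hb' : ∀ ξ j, ‖X ξ j‖ ≤ 𝒮.κ * 𝒮.ω ⟨k, j⟩ * D * Real.exp (η * |ξ|) := fun ξ j =>
    (hXb ξ j).trans_eq (by have := (𝒮.φ_pos k).ne'; field_simp)
  have hφD : 0 ≤ 𝒮.φ k * D := by simpa using (norm_nonneg _).trans (hb 0)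
  have hD : 0 ≤ D := nonneg_of_mul_nonneg_right hφD (𝒮.φ_pos k)
  have hs : 𝒮.IsSol k f 0 X := ⟨hX, h0, fun j => 𝒮.κ * 𝒮.ω ⟨k, j⟩ * D, fun ξ j =>
    (hb' ξ j).trans (by
      have := 𝒮.κ_nonneg
      have := (𝒮.ω_pos ⟨k, j⟩).le
      gcongr)⟩
  rw [hs.sol_eq]
  exact ⟨hs, hb'⟩

theorem exists_isSol_central (k : 𝔫) : ∃ C, 0 ≤ C ∧ ∀ x, 𝒮.P k *ᵥ x = x →
    𝒮.IsSol k (fun _ => 0) x (𝒮.sol k (fun _ => 0) x) ∧ 𝒮.sol k (fun _ => 0) x 0 = x ∧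
      ∀ ξ j, ‖𝒮.sol k (fun _ => 0) x ξ j‖ ≤ C * (∑ i, ‖x i‖) * Real.exp (𝒮.θ * |ξ|) := by
  obtain ⟨C, hC, h⟩ := (𝒮.solvable k).exists_central
  refine ⟨C, hC, fun x hx => ?_⟩
  obtain ⟨X, hX, h0, hb⟩ := h x hx
  have hθ := 𝒮.θ_pos
  have hs : 𝒮.IsSol k (fun _ => 0) x X := ⟨fun ξ => (hX ξ).congr_deriv (by simp), by rw [h0, hx],
    fun _ => C * ∑ i, ‖x i‖, fun ξ j => (hb ξ j).trans (by gcongr; linarith)⟩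
  rw [hs.sol_eq]
  exact ⟨hs, h0, hb⟩

theorem IsSol.continuous {k : 𝔫} {f : ℝ → ℂ} {x : Fin (𝒮.m k) → ℂ} {X : ℝ → Fin (𝒮.m k) → ℂ}
    (h : 𝒮.IsSol k f x X) (j : Fin (𝒮.m k)) : Continuous fun ξ => X ξ j :=
  (continuous_apply j).comp (continuous_iff_continuousAt.2 fun ξ => (h.deriv ξ).continuousAt)

/-- Scaled paths with exponential weight removed. -/
abbrev Path (𝒮 : ModeSystem 𝔫) : Type _ := (𝒮.Idx × ℝ) →ᵇ ℂ

theorem continuous_of_idx {f : 𝒮.Idx × ℝ → ℂ} (h : ∀ i, Continuous fun ξ => f (i, ξ)) :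
    Continuous f := continuous_prod_of_discrete_left.2 h

theorem norm_exp_mul (t : ℝ) (z : ℂ) : ‖(Real.exp t : ℂ) * z‖ = Real.exp t * ‖z‖ := by
  rw [norm_mul, Complex.norm_real, Real.norm_of_nonneg (Real.exp_pos _).le]

theorem norm_mul_exp_neg_le {z : ℂ} {C w t : ℝ} (hw : 0 < w) (hz : ‖z‖ ≤ C * w * Real.exp t) :
    ‖(Real.exp (-t) : ℂ) * (z / w)‖ ≤ C := by
  rw [norm_exp_mul, norm_div, Complex.norm_real, Real.norm_of_nonneg hw.le, Real.exp_neg,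
    inv_mul_le_iff₀ (Real.exp_pos _), div_le_iff₀ hw]
  linarith

theorem continuous_exp_abs (η : ℝ) : Continuous fun ξ : ℝ => (Real.exp (η * |ξ|) : ℂ) := by
  fun_prop

set_option linter.unusedSectionVars false

variable [TopologicalSpace 𝔫] [DiscreteTopology 𝔫]

/-- Scaled forcings with exponential weight removed. -/
abbrev Forcing (_ : ModeSystem 𝔫) : Type _ := (𝔫 × ℝ) →ᵇ ℂ

/-- The forcing of the `k`-th mode. -/
noncomputable def force (η : ℝ) (g : 𝒮.Forcing) (k : 𝔫) (ξ : ℝ) : ℂ :=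
  (Real.exp (η * |ξ|) : ℂ) * ((𝒮.φ k : ℂ) * g (k, ξ))

theorem continuous_force (η : ℝ) (g : 𝒮.Forcing) (k : 𝔫) : Continuous (force η g k) :=
  (continuous_exp_abs η).mul (continuous_const.mul (g.continuous.comp (by fun_prop)))

theorem norm_force_le (η : ℝ) (g : 𝒮.Forcing) (k : 𝔫) (ξ : ℝ) :
    ‖force η g k ξ‖ ≤ 𝒮.φ k * ‖g‖ * Real.exp (η * |ξ|) := by
  rw [force, norm_exp_mul, norm_mul, Complex.norm_real, Real.norm_of_nonneg (𝒮.φ_pos k).le,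
    mul_comm]
  have := (𝒮.φ_pos k).le
  gcongr
  exact g.norm_coe_le_norm _

theorem isSol_force {η : ℝ} (h₁ : 𝒮.θ ≤ η) (h₂ : η ≤ 2 * 𝒮.θ) (g : 𝒮.Forcing) (k : 𝔫) :
    𝒮.IsSol k (force η g k) 0 (𝒮.sol k (force η g k) 0) :=
  (exists_isSol_forced h₁ h₂ k (continuous_force η g k) (norm_force_le η g k)).1

/-- The solution operator of the linear systems, on paths of growth `η`. -/
noncomputable def solveCLM {η : ℝ} (h₁ : 𝒮.θ ≤ η) (h₂ : η ≤ 2 * 𝒮.θ) : 𝒮.Forcing →L[ℝ] 𝒮.Path :=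
  bcfCLM (fun g t => (Real.exp (-(η * |t.2|)) : ℂ) *
      (𝒮.sol t.1.1 (force η g t.1.1) 0 t.2 t.1.2 / 𝒮.ω t.1))
    (fun g g' t => by
      have h := (isSol_force h₁ h₂ g t.1.1).add (isSol_force h₁ h₂ g' t.1.1)
      have hf : (fun s => force η g t.1.1 s + force η g' t.1.1 s) = force η (g + g') t.1.1 := by
        funext s
        simp only [force, BoundedContinuousFunction.add_apply]
        ring
      rw [hf, add_zero] at h
      rw [h.sol_eq, Pi.add_apply, Pi.add_apply]
      ring)
    (fun a g t => by
      have h := (isSol_force h₁ h₂ g t.1.1).smul (a : ℂ)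
      have hf : (fun s => (a : ℂ) * force η g t.1.1 s) = force η (a • g) t.1.1 := by
        funext s
        simp only [force, BoundedContinuousFunction.smul_apply, Complex.real_smul]
        ring
      rw [hf, smul_zero] at h
      rw [h.sol_eq, Pi.smul_apply, Pi.smul_apply, smul_eq_mul]
      ring)
    (fun g => continuous_of_idx fun i => by
      have h := (isSol_force h₁ h₂ g i.1).continuous i.2
      have := continuous_exp_abs (-η)
      simp only [neg_mul] at this
      exact this.mul (h.div_const (𝒮.ω i : ℂ)))
    𝒮.κ 𝒮.κ_nonneg (fun g t => norm_mul_exp_neg_le (𝒮.ω_pos _)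
      (((exists_isSol_forced h₁ h₂ t.1.1 (continuous_force η g t.1.1)
        (norm_force_le η g t.1.1)).2 t.2 t.1.2).trans_eq (by ring)))

theorem solveCLM_apply {η : ℝ} (h₁ : 𝒮.θ ≤ η) (h₂ : η ≤ 2 * 𝒮.θ) (g : 𝒮.Forcing) (i : 𝒮.Idx)
    (ξ : ℝ) : solveCLM h₁ h₂ g (i, ξ) = (Real.exp (-(η * |ξ|)) : ℂ) *
      (𝒮.sol i.1 (force η g i.1) 0 ξ i.2 / 𝒮.ω i) := rfl

theorem norm_solveCLM_apply_le {η : ℝ} (h₁ : 𝒮.θ ≤ η) (h₂ : η ≤ 2 * 𝒮.θ) (g : 𝒮.Forcing) :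
    ‖solveCLM h₁ h₂ g‖ ≤ 𝒮.κ * ‖g‖ :=
  bcf_norm_le (mul_nonneg 𝒮.κ_nonneg (norm_nonneg _)) fun t => norm_mul_exp_neg_le (𝒮.ω_pos _)
      (((exists_isSol_forced h₁ h₂ t.1.1 (continuous_force η g t.1.1)
        (norm_force_le η g t.1.1)).2 t.2 t.1.2).trans_eq (by ring))

/-- Multiplication by a decaying exponential. -/
noncomputable def decayCLM {A : Type*} [TopologicalSpace A] {θ : ℝ} (hθ : 0 ≤ θ) :
    ((A × ℝ) →ᵇ ℂ) →L[ℝ] ((A × ℝ) →ᵇ ℂ) :=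
  bcfCLM (fun g t => (Real.exp (-(θ * |t.2|)) : ℂ) * g t) (fun g g' t => mul_add _ _ _)
    (fun a g t => by
      rw [BoundedContinuousFunction.smul_apply, Complex.real_smul]; ring)
    (fun g => by fun_prop) 1 zero_le_one
    (fun g t => by
      rw [norm_exp_mul]
      gcongr
      · rw [Real.exp_le_one_iff]
        have := abs_nonneg t.2
        nlinarith
      · exact g.norm_coe_le_norm t)

theorem decayCLM_apply {A : Type*} [TopologicalSpace A] {θ : ℝ} (hθ : 0 ≤ θ) (g : (A × ℝ) →ᵇ ℂ)
    (a : A) (ξ : ℝ) : decayCLM hθ g (a, ξ) = (Real.exp (-(θ * |ξ|)) : ℂ) * g (a, ξ) := rfl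

theorem exp_mul_exp_neg (t : ℝ) (z : ℂ) : (Real.exp t : ℂ) * ((Real.exp (-t) : ℂ) * z) = z := by
  rw [← mul_assoc, ← Complex.ofReal_mul, ← Real.exp_add, add_neg_cancel, Real.exp_zero,
    Complex.ofReal_one, one_mul]

theorem force_decayCLM {θ η : ℝ} (hθ : 0 ≤ θ) (g : 𝒮.Forcing) (k : 𝔫) :
    force (𝒮 := 𝒮) (η + θ) (decayCLM hθ g) k = force (𝒮 := 𝒮) η g k := by
  funext ξ
  rw [force, decayCLM_apply, force, add_mul, Real.exp_add, Complex.ofReal_mul, mul_assoc,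
    mul_left_comm _ (𝒮.φ k : ℂ), exp_mul_exp_neg]

/-- The solutions are determined by the forcing itself, so changing the weight on both sides yields
the same ones. -/
theorem decayCLM_solveCLM {η η' θ : ℝ} (hθ : 0 ≤ θ) (hη : η + θ = η') (h₁ : 𝒮.θ ≤ η)
    (h₂ : η ≤ 2 * 𝒮.θ) (h₁' : 𝒮.θ ≤ η') (h₂' : η' ≤ 2 * 𝒮.θ) (g : 𝒮.Forcing) :
    decayCLM hθ (solveCLM h₁ h₂ g) = solveCLM h₁' h₂' (decayCLM hθ g) := by
  subst hη
  ext ⟨i, ξ⟩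
  rw [decayCLM_apply, solveCLM_apply, solveCLM_apply, force_decayCLM, ← mul_assoc,
    ← Complex.ofReal_mul, ← Real.exp_add]
  congr 3
  ring_nf

/-- The actual scaled unknowns of a path with exponential weight removed. -/
noncomputable def grown (z : 𝒮.Path) (ξ : ℝ) (i : 𝒮.Idx) : ℂ :=
  (Real.exp (𝒮.θ * |ξ|) : ℂ) * z (i, ξ)

theorem continuous_grown (z : 𝒮.Path) (i : 𝒮.Idx) : Continuous fun ξ => grown z ξ i :=
  (continuous_exp_abs _).mul (z.continuous.comp (by fun_prop))

theorem norm_grown_le (z : 𝒮.Path) (ξ : ℝ) (i : 𝒮.Idx) :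
    ‖grown z ξ i‖ ≤ Real.exp (𝒮.θ * |ξ|) * ‖z‖ := by
  rw [grown, norm_exp_mul]
  gcongr
  exact z.norm_coe_le_norm _

theorem grown_add (z v : 𝒮.Path) (ξ : ℝ) : grown (z + v) ξ = grown z ξ + grown v ξ := by
  funext i; exact mul_add _ _ _

theorem grown_smul (a : ℝ) (z : 𝒮.Path) (ξ : ℝ) : grown (a • z) ξ = (a : ℂ) • grown z ξ := by
  funext i
  rw [grown, BoundedContinuousFunction.smul_apply, Complex.real_smul, Pi.smul_apply, smul_eq_mul,
    grown]
  ring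

theorem norm_grown_sub_le (z z' : 𝒮.Path) (ξ : ℝ) (i : 𝒮.Idx) :
    ‖grown z ξ i - grown z' ξ i‖ ≤ Real.exp (𝒮.θ * |ξ|) * ‖z - z'‖ := by
  have h := norm_grown_le (z - z') ξ i
  rwa [grown, BoundedContinuousFunction.sub_apply, mul_sub] at h

theorem norm_decay_div_le {η : ℝ} {z : ℂ} {C : ℝ} {k : 𝔫} {ξ : ℝ}
    (h : ‖z‖ ≤ C * Real.exp (η * |ξ|) * 𝒮.φ k) :
    ‖(Real.exp (-(η * |ξ|)) : ℂ) * (z / 𝒮.φ k)‖ ≤ C :=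
  norm_mul_exp_neg_le (𝒮.φ_pos k) (h.trans_eq (by ring))

theorem one_le_exp_abs (ξ : ℝ) : 1 ≤ Real.exp (𝒮.θ * |ξ|) :=
  Real.one_le_exp (mul_nonneg 𝒮.θ_pos.le (abs_nonneg _))

theorem continuous_of_mode {f : 𝔫 × ℝ → ℂ} (h : ∀ k, Continuous fun ξ => f (k, ξ)) :
    Continuous f := continuous_prod_of_discrete_left.2 h

/-- The superposition operator of `Φ`. -/
noncomputable def nemytskii (z : 𝒮.Path) : 𝒮.Forcing :=
  ofNormedAddCommGroup
    (fun t => (Real.exp (-(𝒮.θ * |t.2|)) : ℂ) * (𝒮.Φ (grown z t.2) t.1 / 𝒮.φ t.1))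
    (continuous_of_mode fun k => by
      have := continuous_exp_abs (-𝒮.θ)
      simp only [neg_mul] at this
      exact this.mul ((𝒮.smooth.cont _ (continuous_grown z) k).div_const (𝒮.φ k : ℂ)))
    𝒮.L (fun t => norm_decay_div_le ((𝒮.smooth.bound _ _).trans (by
      have := (𝒮.φ_pos t.1).le
      have := 𝒮.L_nonneg
      gcongr
      exact le_mul_of_one_le_right this (one_le_exp_abs _))))

theorem nemytskii_apply (z : 𝒮.Path) (k : 𝔫) (ξ : ℝ) : nemytskii z (k, ξ) =
    (Real.exp (-(𝒮.θ * |ξ|)) : ℂ) * (𝒮.Φ (grown z ξ) k / 𝒮.φ k) := rfl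

theorem norm_nemytskii_le (z : 𝒮.Path) : ‖nemytskii z‖ ≤ 𝒮.L :=
  norm_ofNormedAddCommGroup_le _ 𝒮.L_nonneg _

theorem force_nemytskii (z : 𝒮.Path) (k : 𝔫) :
    force 𝒮.θ (nemytskii z) k = fun ξ => 𝒮.Φ (grown z ξ) k := by
  funext ξ
  have := (𝒮.φ_pos k).ne'
  rw [force, nemytskii_apply, mul_left_comm (𝒮.φ k : ℂ), exp_mul_exp_neg, mul_div_cancel₀]
  exact_mod_cast this

theorem norm_nemytskii_sub_le (z z' : 𝒮.Path) : ‖nemytskii z - nemytskii z'‖ ≤ 𝒮.L * ‖z - z'‖ := by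
  refine bcf_norm_le (mul_nonneg 𝒮.L_nonneg (norm_nonneg _)) fun ⟨k, ξ⟩ => ?_
  rw [BoundedContinuousFunction.sub_apply, nemytskii_apply, nemytskii_apply, ← mul_sub, ← sub_div]
  exact norm_decay_div_le ((𝒮.smooth.lip _ _ _ (by positivity) (norm_grown_sub_le z z' ξ) k).trans_eq
    (by ring))

/-- The derivative of the superposition operator. -/
noncomputable def nemytskiiDeriv (z : 𝒮.Path) : 𝒮.Path →L[ℝ] 𝒮.Forcing :=
  bcfCLM (fun v t => (Real.exp (-(𝒮.θ * |t.2|)) : ℂ) *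
      (𝒮.D (grown z t.2) (grown v t.2) t.1 / 𝒮.φ t.1))
    (fun v w t => by
      rw [grown_add, 𝒮.smooth.add _ _ _ _ _ (by positivity) (by positivity)
        (norm_grown_le v t.2) (norm_grown_le w t.2)]
      ring)
    (fun a v t => by rw [grown_smul, 𝒮.smooth.smul]; ring)
    (fun v => continuous_of_mode fun k => by
      -- By linearity the growing exponential is taken out of `grown v`, since the continuity
      -- hypothesis on `D` requires a bounded direction.
      have h1 : ∀ ξ, (Real.exp (-(𝒮.θ * |ξ|)) : ℂ) * (𝒮.D (grown z ξ) (grown v ξ) k / 𝒮.φ k) =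
          𝒮.D (grown z ξ) (fun i => v (i, ξ)) k / 𝒮.φ k := fun ξ => by
        have h2 : grown v ξ = (Real.exp (𝒮.θ * |ξ|) : ℂ) • fun i => v (i, ξ) := rfl
        have h3 := exp_mul_exp_neg (𝒮.θ * |ξ|) (𝒮.D (grown z ξ) (fun i => v (i, ξ)) k / 𝒮.φ k)
        rw [h2, 𝒮.smooth.smul, mul_div_assoc, mul_left_comm, h3]
      refine Continuous.congr ?_ fun ξ => (h1 ξ).symm
      exact (𝒮.smooth.dcont _ (fun ξ i => v (i, ξ)) ‖v‖ (norm_nonneg _) (continuous_grown z)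
        (fun i => v.continuous.comp (by fun_prop)) (fun ξ i => v.norm_coe_le_norm _)
        k).div_const (𝒮.φ k : ℂ))
    𝒮.L 𝒮.L_nonneg (fun v t => norm_decay_div_le
      ((𝒮.smooth.dbound _ _ _ (by positivity) (norm_grown_le v t.2) _).trans_eq (by ring)))

theorem nemytskiiDeriv_apply (z v : 𝒮.Path) (k : 𝔫) (ξ : ℝ) : nemytskiiDeriv z v (k, ξ) =
    (Real.exp (-(𝒮.θ * |ξ|)) : ℂ) * (𝒮.D (grown z ξ) (grown v ξ) k / 𝒮.φ k) := rfl

theorem norm_nemytskiiDeriv_apply_le (z v : 𝒮.Path) : ‖nemytskiiDeriv z v‖ ≤ 𝒮.L * ‖v‖ :=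
  bcf_norm_le (mul_nonneg 𝒮.L_nonneg (norm_nonneg _)) fun t => norm_decay_div_le
    ((𝒮.smooth.dbound _ _ _ (by positivity) (norm_grown_le v t.2) _).trans_eq (by ring))

theorem decayCLM_nemytskiiDeriv {θ : ℝ} (hθ : 0 ≤ θ) (z v : 𝒮.Path) :
    decayCLM hθ (nemytskiiDeriv z v) = nemytskiiDeriv z (decayCLM hθ v) := by
  ext ⟨k, ξ⟩
  have h : grown (decayCLM hθ v) ξ = (Real.exp (-(θ * |ξ|)) : ℂ) • grown v ξ := by
    funext i
    rw [grown, decayCLM_apply, mul_left_comm]; rfl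
  rw [decayCLM_apply, nemytskiiDeriv_apply, nemytskiiDeriv_apply, h, 𝒮.smooth.smul]
  ring

/-- The quadratic remainder grows like `exp (2 θ |ξ|)`, so it is small only after a second
exponential weight. This is why two norms are used. -/
theorem norm_decay_nemytskii_rem_le (z v : 𝒮.Path) :
    ‖decayCLM 𝒮.θ_pos.le (nemytskii (z + v) - nemytskii z - nemytskiiDeriv z v)‖ ≤
      𝒮.L * ‖v‖ ^ 2 := by
  refine bcf_norm_le (mul_nonneg 𝒮.L_nonneg (by positivity)) fun ⟨k, ξ⟩ => ?_
  have h := 𝒮.smooth.rem (grown z ξ) (grown v ξ) _ (by positivity) (norm_grown_le v ξ) k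
  rw [← grown_add] at h
  have h2 := norm_decay_div_le (η := 2 * 𝒮.θ) (ξ := ξ) (C := 𝒮.L * ‖v‖ ^ 2) (h.trans_eq (by
    rw [mul_assoc 2, two_mul, Real.exp_add]; ring))
  refine (congrArg norm ?_).trans_le h2
  rw [decayCLM_apply, BoundedContinuousFunction.sub_apply, BoundedContinuousFunction.sub_apply,
    nemytskii_apply, nemytskii_apply, nemytskiiDeriv_apply, mul_assoc 2, two_mul, neg_add,
    Real.exp_add, Complex.ofReal_mul]
  ring

theorem norm_decay_nemytskiiDeriv_sub_le (z z' v : 𝒮.Path) :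
    ‖decayCLM 𝒮.θ_pos.le (nemytskiiDeriv z v - nemytskiiDeriv z' v)‖ ≤
      𝒮.L * ‖z - z'‖ * ‖v‖ := by
  refine bcf_norm_le (by have := 𝒮.L_nonneg; positivity) fun ⟨k, ξ⟩ => ?_
  have h := 𝒮.smooth.dlip (grown z ξ) (grown z' ξ) (grown v ξ) _ _ (by positivity)
    (by positivity) (norm_grown_sub_le z z' ξ) (norm_grown_le v ξ) k
  have h2 := norm_decay_div_le (η := 2 * 𝒮.θ) (ξ := ξ) (C := 𝒮.L * ‖z - z'‖ * ‖v‖)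
    (h.trans_eq (by rw [mul_assoc 2, two_mul, Real.exp_add]; ring))
  refine (congrArg norm ?_).trans_le h2
  rw [decayCLM_apply, BoundedContinuousFunction.sub_apply,
    nemytskiiDeriv_apply, nemytskiiDeriv_apply, mul_assoc 2, two_mul, neg_add,
    Real.exp_add, Complex.ofReal_mul]
  ring

section Central

variable {E : Type*} [NormedAddCommGroup E] [NormedSpace ℝ E] [FiniteDimensional ℝ E]

variable (𝒮) in
/-- A finite-dimensional parametrisation of central data. -/
structure CentralData (c : E →ₗ[ℝ] 𝒮.State) (T : Finset 𝔫) : Prop where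
  mem_range : ∀ x k, 𝒮.P k *ᵥ c x k = c x k
  support : ∀ x, ∀ k ∉ T, c x k = 0

variable {c : E →ₗ[ℝ] 𝒮.State} {T : Finset 𝔫}

theorem CentralData.isSol (hc : 𝒮.CentralData c T) (x : E) (k : 𝔫) :
    𝒮.IsSol k (fun _ => 0) (c x k) (𝒮.sol k (fun _ => 0) (c x k)) :=
  ((exists_isSol_central k).choose_spec.2 _ (hc.mem_range x k)).1

/-- Central data live on the finite set `T`, so constants depending on the mode can be summed. -/
theorem CentralData.exists_bound (hc : 𝒮.CentralData c T) (x : E) : ∃ C, ∀ t : 𝒮.Idx × ℝ,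
    ‖(Real.exp (-(𝒮.θ * |t.2|)) : ℂ) *
      (𝒮.sol t.1.1 (fun _ => 0) (c x t.1.1) t.2 t.1.2 / 𝒮.ω t.1)‖ ≤ C := by
  choose C hC h using fun k => exists_isSol_central (𝒮 := 𝒮) k
  let B : 𝔫 → ℝ := fun k => ∑ j, C k * (∑ i, ‖c x k i‖) / 𝒮.ω ⟨k, j⟩
  have hB : ∀ k j, C k * (∑ i, ‖c x k i‖) / 𝒮.ω ⟨k, j⟩ ≤ B k := fun k j =>
    Finset.single_le_sum (f := fun j => C k * (∑ i, ‖c x k i‖) / 𝒮.ω ⟨k, j⟩) (fun j _ => by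
      have := hC k
      have := (𝒮.ω_pos ⟨k, j⟩).le
      positivity) (Finset.mem_univ j)
  have hB0 : ∀ k, 0 ≤ B k := fun k => Finset.sum_nonneg fun j _ => by
    have := hC k
    have := (𝒮.ω_pos ⟨k, j⟩).le
    positivity
  refine ⟨∑ k ∈ T, B k, fun ⟨⟨k, j⟩, ξ⟩ => ?_⟩
  have hk : ‖(Real.exp (-(𝒮.θ * |ξ|)) : ℂ) *
      (𝒮.sol k (fun _ => 0) (c x k) ξ j / 𝒮.ω ⟨k, j⟩)‖ ≤ B k := by
    refine norm_mul_exp_neg_le (𝒮.ω_pos _) (((h k _ (hc.mem_range x k)).2.2 ξ j).trans ?_)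
    exact mul_le_mul_of_nonneg_right ((div_le_iff₀ (𝒮.ω_pos _)).1 (hB k j)) (Real.exp_pos _).le
  by_cases hT : k ∈ T
  · exact hk.trans (Finset.single_le_sum (fun k _ => hB0 k) hT)
  · have h0 : B k = 0 := by simp [B, hc.support x k hT]
    rw [h0] at hk
    exact hk.trans (Finset.sum_nonneg fun k _ => hB0 k)

/-- The solutions of the linear systems with given central data. -/
noncomputable def CentralData.path (hc : 𝒮.CentralData c T) : E →L[ℝ] 𝒮.Path :=
  (bcfLinear (fun x t => (Real.exp (-(𝒮.θ * |t.2|)) : ℂ) *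
      (𝒮.sol t.1.1 (fun _ => 0) (c x t.1.1) t.2 t.1.2 / 𝒮.ω t.1))
    (fun x x' t => by
      have h := (hc.isSol x t.1.1).add (hc.isSol x' t.1.1)
      simp only [add_zero] at h
      rw [map_add, Pi.add_apply, h.sol_eq, Pi.add_apply, Pi.add_apply]
      ring)
    (fun a x t => by
      have h := (hc.isSol x t.1.1).smul (a : ℂ)
      have h2 : c (a • x) t.1.1 = (a : ℂ) • c x t.1.1 := by
        rw [map_smul, Pi.smul_apply]
        funext j
        simp
      simp only [mul_zero] at h
      rw [h2, h.sol_eq, Pi.smul_apply, Pi.smul_apply, smul_eq_mul]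
      ring)
    (fun x => continuous_of_idx fun i => by
      have h := (hc.isSol x i.1).continuous i.2
      have := continuous_exp_abs (-𝒮.θ)
      simp only [neg_mul] at this
      exact this.mul (h.div_const (𝒮.ω i : ℂ)))
    hc.exists_bound).toContinuousLinearMap

theorem CentralData.path_apply (hc : 𝒮.CentralData c T) (x : E) (i : 𝒮.Idx) (ξ : ℝ) :
    hc.path x (i, ξ) = (Real.exp (-(𝒮.θ * |ξ|)) : ℂ) *
      (𝒮.sol i.1 (fun _ => 0) (c x i.1) ξ i.2 / 𝒮.ω i) := rfl

/-- The fixed point equation says that the path consists of solutions of the forced systems. -/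
theorem CentralData.grown_eq (hc : 𝒮.CentralData c T) {x : E} {z z' : 𝒮.Path} (h₂ : 𝒮.θ ≤ 2 * 𝒮.θ)
    (hz : z = hc.path x + solveCLM le_rfl h₂ (nemytskii z')) :
    ∀ k, ∃ X, 𝒮.IsSol k (fun ξ => 𝒮.Φ (grown z' ξ) k) (c x k) X ∧
      ∀ ξ j, grown z ξ ⟨k, j⟩ = X ξ j / 𝒮.ω ⟨k, j⟩ := fun k => by
  have h1 := (hc.isSol x k).add (isSol_force le_rfl h₂ (nemytskii z') k)
  simp only [zero_add, add_zero, force_nemytskii] at h1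
  refine ⟨_, h1, fun ξ j => ?_⟩
  rw [grown, hz, BoundedContinuousFunction.add_apply, hc.path_apply, solveCLM_apply, ← mul_add,
    exp_mul_exp_neg, force_nemytskii, Pi.add_apply, Pi.add_apply, add_div]

end Central

end ModeSystem

/-! ### The invariant graph of a mode system -/

namespace ModeSystem

open BoundedContinuousFunction

variable {𝔫 : Type*} {𝒮 : ModeSystem 𝔫}

variable (𝒮) in
/-- Controlled growth of a path. -/
def GrowthBounded (X : ℝ → 𝒮.State) : Prop :=
  ∃ C, ∀ ξ i, ‖𝒮.scaled (X ξ) i‖ ≤ C * Real.exp (𝒮.θ * |ξ|)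

set_option linter.unusedSectionVars false

variable [TopologicalSpace 𝔫] [DiscreteTopology 𝔫] {E : Type*} [NormedAddCommGroup E]
  [NormedSpace ℝ E] [FiniteDimensional ℝ E] {c : E →ₗ[ℝ] 𝒮.State} {T : Finset 𝔫}

/-- A growth bounded solution is a fixed point. -/
theorem IsModeSolution.exists_path (hc : 𝒮.CentralData c T) (h₂ : 𝒮.θ ≤ 2 * 𝒮.θ)
    {X : ℝ → 𝒮.State} (hX : 𝒮.IsModeSolution X) (hb : 𝒮.GrowthBounded X) {x : E}
    (hx : ∀ k, c x k = 𝒮.P k *ᵥ X 0 k) :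
    ∃ z : 𝒮.Path, z = hc.path x + solveCLM le_rfl h₂ (nemytskii z) ∧
      ∀ i, z (i, 0) = 𝒮.scaled (X 0) i := by
  obtain ⟨C, hC⟩ := hb
  have hcont : ∀ i : 𝒮.Idx, Continuous fun ξ => 𝒮.scaled (X ξ) i := fun i =>
    ((continuous_apply i.2).comp (continuous_iff_continuousAt.2
      fun ξ => (hX i.1 ξ).continuousAt)).div_const _
  let z : 𝒮.Path := ofNormedAddCommGroup
    (fun t => (Real.exp (-(𝒮.θ * |t.2|)) : ℂ) * 𝒮.scaled (X t.2) t.1)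
    (continuous_of_idx fun i => by
      have := continuous_exp_abs (-𝒮.θ)
      simp only [neg_mul] at this
      exact this.mul (hcont i)) C (fun t => by
        rw [norm_exp_mul, Real.exp_neg, inv_mul_le_iff₀ (Real.exp_pos _), mul_comm]
        exact hC _ _)
  have hz : ∀ ξ, grown z ξ = 𝒮.scaled (X ξ) := fun ξ => by
    funext i
    exact exp_mul_exp_neg _ _
  refine ⟨z, ?_, fun i => ?_⟩
  · ext ⟨⟨k, j⟩, ξ⟩
    obtain ⟨Y, hY, hYz⟩ := hc.grown_eq (x := x) (z' := z) h₂ rfl k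
    have hXs : 𝒮.IsSol k (fun ξ => 𝒮.Φ (grown z ξ) k) (c x k) (fun t => X t k) :=
      ⟨fun ξ => by rw [hz]; exact hX k ξ, (hx k).symm, fun j => C * 𝒮.ω ⟨k, j⟩, fun ξ j => by
        have h1 := hC ξ ⟨k, j⟩
        have hω := 𝒮.ω_pos ⟨k, j⟩
        rw [scaled, norm_div, Complex.norm_real, Real.norm_of_nonneg hω.le, div_le_iff₀ hω] at h1
        have hC0 : 0 ≤ C := by
          have := (norm_nonneg _).trans (hC 0 ⟨k, j⟩)
          simpa using this
        calc _ ≤ C * Real.exp (𝒮.θ * |ξ|) * 𝒮.ω ⟨k, j⟩ := h1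
          _ ≤ C * Real.exp (2 * 𝒮.θ * |ξ|) * 𝒮.ω ⟨k, j⟩ := by gcongr
          _ = _ := by ring⟩
    have h3 := hYz ξ j
    rw [← hXs.unique hY] at h3
    have h4 : grown z ξ ⟨k, j⟩ = X ξ k j / 𝒮.ω ⟨k, j⟩ := by rw [hz]; rfl
    rw [← h4, grown, grown] at h3
    have hne : (Real.exp (𝒮.θ * |ξ|) : ℂ) ≠ 0 := by exact_mod_cast (Real.exp_pos _).ne'
    exact (mul_left_cancel₀ hne h3).symm
  · have := congrFun (hz 0) i
    simpa [grown] using this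

theorem IsModeSolution.translate {X : ℝ → 𝒮.State} (hX : 𝒮.IsModeSolution X) (ξ₀ : ℝ) :
    𝒮.IsModeSolution fun t => X (t + ξ₀) := fun k ξ => (hX k (ξ + ξ₀)).comp_add_const ξ ξ₀

theorem GrowthBounded.translate {X : ℝ → 𝒮.State} (hX : 𝒮.GrowthBounded X) (ξ₀ : ℝ) :
    𝒮.GrowthBounded fun t => X (t + ξ₀) := by
  obtain ⟨C, hC⟩ := hX
  refine ⟨|C| * Real.exp (𝒮.θ * |ξ₀|), fun ξ i => (hC _ i).trans ?_⟩
  have := 𝒮.θ_pos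
  calc C * Real.exp (𝒮.θ * |ξ + ξ₀|) ≤ |C| * Real.exp (𝒮.θ * (|ξ₀| + |ξ|)) := by
        gcongr
        · exact le_abs_self C
        · rw [add_comm]; exact abs_add_le _ _
    _ = _ := by rw [mul_add, Real.exp_add]; ring

/-- Evaluation of a path at zero. -/
noncomputable def evalZero : 𝒮.Path →L[ℝ] (𝒮.Idx →ᵇ ℂ) :=
  bcfCLM (fun z i => z (i, 0)) (fun _ _ _ => rfl)
    (fun a z i => by rw [BoundedContinuousFunction.smul_apply, Complex.real_smul])
    (fun z => z.continuous.comp (by fun_prop)) 1 zero_le_one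
    (fun z i => by rw [one_mul]; exact z.norm_coe_le_norm _)

theorem evalZero_apply (z : 𝒮.Path) (i : 𝒮.Idx) : evalZero z i = z (i, 0) := rfl

/-- The graph of the map `Z` over the central data is the set of initial values of the solutions of
controlled growth. -/
theorem exists_invariant_graph (hc : 𝒮.CentralData c T) :
    ∃ Z : E → 𝒮.Idx →ᵇ ℂ, ContDiff ℝ 1 Z ∧ (∃ Λ, 0 ≤ Λ ∧ ∀ x x', ‖Z x - Z x'‖ ≤ Λ * ‖x - x'‖) ∧
      (∀ x i, ‖Z x i - 𝒮.scaled (c x) i‖ ≤ 𝒮.κ * 𝒮.L) ∧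
      (∀ x, ∃ X, 𝒮.IsModeSolution X ∧ 𝒮.GrowthBounded X ∧ (∀ i, 𝒮.scaled (X 0) i = Z x i) ∧
        ∀ k, 𝒮.P k *ᵥ X 0 k = c x k) ∧
      (∀ X, 𝒮.IsModeSolution X → 𝒮.GrowthBounded X → ∀ ξ x, (∀ k, c x k = 𝒮.P k *ᵥ X ξ k) →
        ∀ i, 𝒮.scaled (X ξ) i = Z x i) ∧
      ((∀ k, 𝒮.Φ 0 k = 0) → (∀ v k, 𝒮.D 0 v k = 0) → Z 0 = 0 ∧
        ∃ Z' : E →L[ℝ] (𝒮.Idx →ᵇ ℂ), HasFDerivAt Z Z' 0 ∧ ∀ x i, Z' x i = 𝒮.scaled (c x) i) := by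
  have hθ := 𝒮.θ_pos
  have h₂ : 𝒮.θ ≤ 2 * 𝒮.θ := by linarith
  obtain ⟨Z, hZ, huniq, hLip, hdiff, hderiv⟩ := exists_fixedPoint_family hc.path
    (solveCLM le_rfl h₂) (solveCLM h₂ le_rfl) (decayCLM hθ.le) (decayCLM hθ.le) nemytskii
    nemytskiiDeriv (L := 𝒮.L) 𝒮.κ_nonneg 𝒮.L_nonneg 𝒮.κL_le (norm_solveCLM_apply_le _ _)
    (norm_solveCLM_apply_le _ _) (decayCLM_solveCLM hθ.le (by ring) _ _ _ _)
    (decayCLM_nemytskiiDeriv hθ.le) norm_nemytskii_sub_le norm_nemytskiiDeriv_apply_le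
    norm_decay_nemytskii_rem_le norm_decay_nemytskiiDeriv_sub_le
  -- Exponential weights equal 1 at `ξ = 0`, so differentiability in the weak norm suffices for the
  -- initial values.
  have hev : ∀ z : 𝒮.Path, evalZero (decayCLM hθ.le z) = evalZero z := fun z => by
    ext i
    rw [evalZero_apply, decayCLM_apply, evalZero_apply]
    simp
  have hsc : ∀ (x : E) (i : 𝒮.Idx), hc.path x (i, 0) = 𝒮.scaled (c x) i := fun x i => by
    obtain ⟨_, _, h⟩ := exists_isSol_central (𝒮 := 𝒮) i.1
    rw [hc.path_apply, (h _ (hc.mem_range x i.1)).2.1]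
    simp [scaled]
  refine ⟨fun x => evalZero (Z x), ?_, ⟨2 * ‖hc.path‖, by positivity, fun x x' => ?_⟩,
    fun x i => ?_, fun x => ?_, fun X hX hb ξ x hx i => ?_, fun h0 hD0 => ?_⟩
  · have h1 : (fun x => evalZero (Z x)) = fun x => evalZero (decayCLM hθ.le (Z x)) :=
      funext fun x => (hev _).symm
    rw [h1]
    exact evalZero.contDiff.comp hdiff
  · rw [← map_sub]
    refine bcf_norm_le (by positivity) fun i => ?_
    exact ((Z x - Z x').norm_coe_le_norm _).trans (hLip x x')
  · have h1 : Z x (i, 0) - 𝒮.scaled (c x) i = solveCLM le_rfl h₂ (nemytskii (Z x)) (i, 0) := by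
      conv_lhs => rw [hZ x]
      rw [BoundedContinuousFunction.add_apply, hsc, add_sub_cancel_left]
    rw [evalZero_apply, h1]
    refine (norm_coe_le_norm _ _).trans ((norm_solveCLM_apply_le _ _ _).trans ?_)
    exact mul_le_mul_of_nonneg_left (norm_nemytskii_le _) 𝒮.κ_nonneg
  · choose Y hY hYz using hc.grown_eq (x := x) (z' := Z x) h₂ (hZ x)
    have hs : ∀ ξ, 𝒮.scaled (fun k => Y k ξ) = grown (Z x) ξ := fun ξ => by
      funext i
      exact (hYz i.1 ξ i.2).symm
    refine ⟨fun ξ k => Y k ξ, fun k ξ => ?_, ⟨‖Z x‖, fun ξ i => ?_⟩, fun i => ?_,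
      fun k => (hY k).init⟩
    · rw [hs]; exact (hY k).deriv ξ
    · rw [hs, mul_comm]; exact norm_grown_le _ _ _
    · rw [hs, evalZero_apply]; simp [grown]
  -- The system is autonomous: shifting `ξ` to the origin turns the claim into uniqueness of the
  -- fixed point.
  · obtain ⟨z, hz, hz0⟩ := IsModeSolution.exists_path hc h₂ (hX.translate ξ) (hb.translate ξ)
      (x := x) (by simpa using hx)
    have := hz0 i
    rw [zero_add] at this
    rw [evalZero_apply, ← huniq x z hz, this]
  · have hF0 : nemytskii (0 : 𝒮.Path) = 0 := by
      ext ⟨k, ξ⟩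
      have : grown (0 : 𝒮.Path) ξ = 0 := by funext i; simp [grown]
      rw [nemytskii_apply, this, h0]; simp
    have hZ0 : Z 0 = 0 := (huniq 0 0 (by rw [hF0, map_zero, map_zero, add_zero])).symm
    refine ⟨(congrArg evalZero hZ0).trans (map_zero _), evalZero ∘L hc.path, ?_, fun x i => hsc x i⟩
    have hDZ : nemytskiiDeriv (Z 0) = 0 := by
      ext v ⟨k, ξ⟩
      have : grown (0 : 𝒮.Path) ξ = 0 := by funext i; simp [grown]
      rw [hZ0, nemytskiiDeriv_apply, this, hD0]; simp
    have h1 := (evalZero (𝒮 := 𝒮)).hasFDerivAt.comp (0 : E) (hderiv 0 hDZ)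
    refine (h1.congr_fderiv ?_).congr_of_eventuallyEq (Eventually.of_forall fun x => (hev _).symm)
    ext1 x
    exact hev _

end ModeSystem

/-! ### The modulated front problem as a system of modes -/

/-- The scales of the problem with control parameter `α` and speed `h ^ 2`: amplitudes `σU`, `σW`,
decay `s` of the modes, together with the constants in the estimates. -/
structure FrontData where
  α : ℝ
  h : ℝ
  γ : ℝ
  σU : ℝ
  σW : ℝ
  s : ℝ
  C : ℝ
  L : ℝ
  K : ℝ
  μ : ℝ
  ρ : ℂ → ℂ
  h_pos : 0 < h
  σU_pos : 0 < σU
  σW_pos : 0 < σW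
  C_nonneg : 0 ≤ C
  L_nonneg : 0 ≤ L
  K_nonneg : 0 ≤ K
  shBlock : ∀ n, BlockFacts (m := 3) C h n (LSH α (h ^ 2) n)
  conBlock : ∀ n, BlockFacts (m := 1) C h n (Lcon (h ^ 2) n)
  shProj : ∀ n, n ≠ 1 → n ≠ -1 → centralProj (LSH α (h ^ 2) n) = 0
  conProj : ∀ n, n ≠ 0 → centralProj (Lcon (h ^ 2) n) = 0
  cutoff : Cutoff μ ρ
  conv : ConvWeight K (fun n => wt n ^ (-s)) (fun n => wt n ^ (-s)) (fun n => wt n ^ (-s))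
  conv' : ConvWeight K (fun n => wt n ^ (-s)) (fun n => wt n ^ (1 - s)) (fun n => wt n ^ (1 - s))
  smallU : 4 * (μ * σU) * (μ * σW) * K +
    ‖-(1 + (γ : ℂ))‖ * (4 * (4 * (μ * σU) * (μ * σU) * K) * (μ * σU) * K) ≤ L * (h ^ 2 * σU)
  smallW : ‖2 * ((h ^ 2 : ℝ) : ℂ) * (γ : ℂ)‖ * (4 * (μ * σU) * (μ * σU) * K) ≤ L * (h ^ 2 * σW)
  CL_le : C * L ≤ 1 / 2

namespace FrontData

variable (d : FrontData)

/-- The number of derivatives in each mode. -/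
abbrev size : ℤ ⊕ ℤ → ℕ
  | .inl _ => 4
  | .inr _ => 2

/-- The matrices of the modes. -/
def mat : ∀ k, Matrix (Fin (size k)) (Fin (size k)) ℂ
  | .inl n => LSH d.α (d.h ^ 2) n
  | .inr n => Lcon (d.h ^ 2) n

/-- The central projections of the modes. -/
noncomputable def proj : ∀ k, Matrix (Fin (size k)) (Fin (size k)) ℂ
  | .inl n => centralProj (LSH d.α (d.h ^ 2) n)
  | .inr n => centralProj (Lcon (d.h ^ 2) n)

/-- The direction of the forcing. -/
def dir : ∀ k, Fin (size k) → ℂ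
  | .inl _ => Pi.single (Fin.last 3) 1
  | .inr _ => Pi.single (Fin.last 1) 1

/-- The scales of the unknowns. -/
noncomputable def scale : (Σ k, Fin (size k)) → ℝ
  | ⟨.inl n, j⟩ => d.σU * wt n ^ ((j : ℝ) - d.s)
  | ⟨.inr n, j⟩ => d.σW * wt n ^ ((j : ℝ) - d.s)

/-- The scales of the forcings. -/
noncomputable def forceScale : ℤ ⊕ ℤ → ℝ :=
  Sum.elim (fun n => d.h ^ 2 * d.σU * wt n ^ (-d.s)) fun n => d.h ^ 2 * d.σW * wt n ^ (1 - d.s)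

/-- The index of the `j`-th derivative in the `n`-th Swift–Hohenberg mode. -/
def idxU (j : Fin 4) (n : ℤ) : Σ k, Fin (size k) := ⟨.inl n, j⟩

/-- The index of the `j`-th derivative in the `n`-th conservation law mode. -/
def idxW (j : Fin 2) (n : ℤ) : Σ k, Fin (size k) := ⟨.inr n, j⟩

/-- The unknowns with indices `i n`, after cutoff. -/
noncomputable def cut (σ a : ℝ) (i : ℤ → Σ k, Fin (size k)) (y : (Σ k, Fin (size k)) → ℂ) (n : ℤ) :
    ℂ := ((σ * wt n ^ a : ℝ) : ℂ) * d.ρ (y (i n))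

/-- The derivative of `cut`. -/
noncomputable def dcut (σ a : ℝ) (i : ℤ → Σ k, Fin (size k)) (y v : (Σ k, Fin (size k)) → ℂ)
    (n : ℤ) : ℂ := ((σ * wt n ^ a : ℝ) : ℂ) * fderiv ℝ d.ρ (y (i n)) (v (i n))

variable {d} in
theorem smooth_cut {σ : ℝ} (hσ : 0 ≤ σ) (a : ℝ) (i : ℤ → Σ k, Fin (size k)) :
    SmoothSeq (d.μ * σ) (fun n => wt n ^ a) (d.cut σ a i) (d.dcut σ a i) :=
  (d.cutoff.smoothSeq i (τ := fun n => σ * wt n ^ a)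
    fun n => mul_nonneg hσ (wt_rpow_pos n a).le).mono fun _ => (mul_assoc _ _ _).ge

-- The weight of the `W` forcing is `1 - s` because `U₁` decays one order less than `U₀`. The fields
-- `smallU` and `smallW` are the constants that the product rule for convolutions produces.
variable {d} in
theorem exists_smooth : ∃ D, SmoothSeq d.L d.forceScale
    (fun y => Sum.elim
      (fun n => convol (d.cut d.σU (-d.s) (idxU 0) y) (d.cut d.σW (-d.s) (idxW 0) y) n +
        -(1 + (d.γ : ℂ)) * convol (convol (d.cut d.σU (-d.s) (idxU 0) y)
          (d.cut d.σU (-d.s) (idxU 0) y)) (d.cut d.σU (-d.s) (idxU 0) y) n)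
      (fun n => 2 * ((d.h ^ 2 : ℝ) : ℂ) * (d.γ : ℂ) * convol (d.cut d.σU (-d.s) (idxU 0) y)
          (d.cut d.σU (1 - d.s) (idxU 1) y) n)) D ∧ ∀ v k, D 0 v k = 0 := by
  have hU := smooth_cut (d := d) d.σU_pos.le (-d.s) (idxU 0)
  have hU1 := smooth_cut (d := d) d.σU_pos.le (1 - d.s) (idxU 1)
  have hW := smooth_cut (d := d) d.σW_pos.le (-d.s) (idxW 0)
  have hmU : 0 ≤ d.μ * d.σU := mul_nonneg d.cutoff.pos.le d.σU_pos.le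
  have hmW : 0 ≤ d.μ * d.σW := mul_nonneg d.cutoff.pos.le d.σW_pos.le
  have hτ : ∀ n, 0 ≤ d.K * wt n ^ (-d.s) := fun n => mul_nonneg d.K_nonneg (wt_rpow_pos n _).le
  have hτ' : ∀ n, 0 ≤ d.K * wt n ^ (1 - d.s) := fun n => mul_nonneg d.K_nonneg (wt_rpow_pos n _).le
  have h2 := hU.convol_map hmU hmU d.conv hτ hU
  have hm2 : 0 ≤ 4 * (d.μ * d.σU) * (d.μ * d.σU) * d.K := by
    have := d.K_nonneg
    positivity
  have h3 := (h2.convol_map hm2 hmU d.conv hτ hU).const_mul (-(1 + (d.γ : ℂ)))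
  have hA := ((hU.convol_map hmU hmW d.conv hτ hW).add_map h3).mono
    (m' := d.L) (τ' := fun n => d.h ^ 2 * d.σU * wt n ^ (-d.s)) fun n => by
      rw [← mul_assoc d.L]
      exact mul_le_mul_of_nonneg_right d.smallU (wt_rpow_pos n _).le
  have hB := ((hU.convol_map hmU hmU d.conv' hτ' hU1).const_mul
    (2 * ((d.h ^ 2 : ℝ) : ℂ) * (d.γ : ℂ))).mono
    (m' := d.L) (τ' := fun n => d.h ^ 2 * d.σW * wt n ^ (1 - d.s)) fun n => by
      rw [← mul_assoc d.L]
      exact mul_le_mul_of_nonneg_right d.smallW (wt_rpow_pos n _).le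
  refine ⟨_, hA.sum_elim hB, fun v k => ?_⟩
  have h0 : ∀ σ a i, d.cut σ a i 0 = 0 := fun σ a i => by
    funext n
    simp [cut, d.cutoff.eq_self 0]
  have hr : ∀ a : ℤ → ℂ, convol a 0 = 0 := fun a => by funext n; simp [convol]
  have hl : ∀ a : ℤ → ℂ, convol 0 a = 0 := fun a => by funext n; simp [convol]
  rcases k with n | n <;> simp [h0, hr, hl]

/-- The nonlinearity after cutoff. -/
noncomputable def nonlin (y : (Σ k, Fin (size k)) → ℂ) : ℤ ⊕ ℤ → ℂ :=
  Sum.elim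
    (fun n => convol (d.cut d.σU (-d.s) (idxU 0) y) (d.cut d.σW (-d.s) (idxW 0) y) n +
      -(1 + (d.γ : ℂ)) * convol (convol (d.cut d.σU (-d.s) (idxU 0) y)
        (d.cut d.σU (-d.s) (idxU 0) y)) (d.cut d.σU (-d.s) (idxU 0) y) n)
    (fun n => 2 * ((d.h ^ 2 : ℝ) : ℂ) * (d.γ : ℂ) * convol (d.cut d.σU (-d.s) (idxU 0) y)
        (d.cut d.σU (1 - d.s) (idxU 1) y) n)

/-- The Swift–Hohenberg blocks can waste their gain of one order. The conservation law blocks spend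
it on restoring the order lost in `U₀ U₁`. -/
theorem solvable_mat : ∀ k, Solvable (d.mat k) (d.proj k) (dir k) (d.h / 64)
    fun j => d.C * d.scale ⟨k, j⟩ / d.forceScale k
  | .inl n => (d.shBlock n).solvable.mono fun j => by
      have h1 := d.h_pos
      have h2 := d.σU_pos
      have h3 := wt_rpow_pos n (-d.s)
      have h4 := wt_rpow_anti n (show (j : ℝ) - 1 ≤ j by linarith)
      have h5 := d.C_nonneg
      have e : d.scale ⟨.inl n, j⟩ = d.σU * (wt n ^ (j : ℝ) * wt n ^ (-d.s)) := by
        rw [← Real.rpow_add (wt_pos n)]; rfl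
      calc d.C * wt n ^ ((j : ℝ) - 1) / d.h ^ 2 ≤ d.C * wt n ^ (j : ℝ) / d.h ^ 2 := by gcongr
        _ = d.C * d.scale ⟨.inl n, j⟩ / d.forceScale (.inl n) := by
          rw [e, forceScale, Sum.elim_inl]; field_simp
  | .inr n => (d.conBlock n).solvable.mono fun j => by
      have h1 := d.h_pos
      have h2 := d.σW_pos
      have h3 := wt_rpow_pos n (1 - d.s)
      have e : d.scale ⟨.inr n, j⟩ = d.σW * (wt n ^ ((j : ℝ) - 1) * wt n ^ (1 - d.s)) := by
        rw [← Real.rpow_add (wt_pos n), sub_add_sub_cancel]; rfl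
      rw [e, forceScale, Sum.elim_inr]
      apply le_of_eq
      field_simp

theorem scale_pos : ∀ i, 0 < d.scale i
  | ⟨.inl n, _⟩ => mul_pos d.σU_pos (wt_rpow_pos n _)
  | ⟨.inr n, _⟩ => mul_pos d.σW_pos (wt_rpow_pos n _)

theorem forceScale_pos : ∀ k, 0 < d.forceScale k
  | .inl n => mul_pos (mul_pos (pow_pos d.h_pos 2) d.σU_pos) (wt_rpow_pos n _)
  | .inr n => mul_pos (mul_pos (pow_pos d.h_pos 2) d.σW_pos) (wt_rpow_pos n _)

/-- The system of modes of the modulated front problem, with cutoff. -/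
noncomputable abbrev system : ModeSystem (ℤ ⊕ ℤ) where
  m := size
  M := d.mat
  P := d.proj
  e := dir
  θ := d.h / 64
  κ := d.C
  L := d.L
  ω := d.scale
  φ := d.forceScale
  Φ := d.nonlin
  D := d.exists_smooth.choose
  θ_pos := by have := d.h_pos; positivity
  κ_nonneg := d.C_nonneg
  L_nonneg := d.L_nonneg
  κL_le := d.CL_le
  ω_pos := d.scale_pos
  φ_pos := d.forceScale_pos
  solvable := d.solvable_mat
  smooth := d.exists_smooth.choose_spec.1

theorem system_deriv_zero (v k) : d.system.D 0 v k = 0 := d.exists_smooth.choose_spec.2 v k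

theorem system_nonlin_zero (k) : d.system.Φ 0 k = 0 := by
  have h0 : ∀ σ a i, d.cut σ a i 0 = 0 := fun σ a i => by
    funext n
    simp [cut, d.cutoff.eq_self 0]
  have hr : ∀ a : ℤ → ℂ, convol a 0 = 0 := fun a => by funext n; simp [convol]
  change d.nonlin 0 k = 0
  rcases k with n | n <;> simp [nonlin, h0, hr]

/-- The components of a state. -/
def compU (X : d.system.State) (j : Fin 4) (n : ℤ) : ℂ := X (.inl n) j

/-- The components of a state. -/
def compW (X : d.system.State) (j : Fin 2) (n : ℤ) : ℂ := X (.inr n) j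

variable {d}

/-- Where all scaled modes are at most 1 the cutoff is the identity, so the system with cutoff
agrees with the original one there. -/
theorem cut_eq {σ a : ℝ} {i : ℤ → Σ k, Fin (size k)} {X : d.system.State}
    (hi : ∀ n, d.scale (i n) = σ * wt n ^ a) (hX : ∀ i, ‖d.system.scaled X i‖ ≤ 1) (n : ℤ) :
    d.cut σ a i (d.system.scaled X) n = X (i n).1 (i n).2 := by
  have h1 : ((d.scale (i n) : ℝ) : ℂ) ≠ 0 := by exact_mod_cast (d.scale_pos (i n)).ne'
  change ((σ * wt n ^ a : ℝ) : ℂ) * d.ρ (d.system.scaled X (i n)) = _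
  rw [d.cutoff.eq_self _ (hX _), ← hi n]
  exact mul_div_cancel₀ _ h1

theorem nonlin_inl {X : d.system.State} (hX : ∀ i, ‖d.system.scaled X i‖ ≤ 1) (n : ℤ) :
    d.nonlin (d.system.scaled X) (.inl n) = convol (d.compU X 0) (d.compW X 0) n
      - (1 + (d.γ : ℂ)) * convol (convol (d.compU X 0) (d.compU X 0)) (d.compU X 0) n := by
  have hU : d.cut d.σU (-d.s) (idxU 0) (d.system.scaled X) = d.compU X 0 :=
    funext fun n => cut_eq (fun n => by simp [idxU, scale]) hX n
  have hW : d.cut d.σW (-d.s) (idxW 0) (d.system.scaled X) = d.compW X 0 :=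
    funext fun n => cut_eq (fun n => by simp [idxW, scale]) hX n
  change convol (d.cut d.σU (-d.s) (idxU 0) (d.system.scaled X))
    (d.cut d.σW (-d.s) (idxW 0) (d.system.scaled X)) n + -(1 + (d.γ : ℂ)) * convol
      (convol (d.cut d.σU (-d.s) (idxU 0) (d.system.scaled X))
        (d.cut d.σU (-d.s) (idxU 0) (d.system.scaled X)))
      (d.cut d.σU (-d.s) (idxU 0) (d.system.scaled X)) n = _
  rw [hU, hW]
  ring

theorem nonlin_inr {X : d.system.State} (hX : ∀ i, ‖d.system.scaled X i‖ ≤ 1) (n : ℤ) :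
    d.nonlin (d.system.scaled X) (.inr n) =
      2 * ((d.h ^ 2 : ℝ) : ℂ) * (d.γ : ℂ) * convol (d.compU X 0) (d.compU X 1) n := by
  have hU : d.cut d.σU (-d.s) (idxU 0) (d.system.scaled X) = d.compU X 0 :=
    funext fun n => cut_eq (fun n => by simp [idxU, scale]) hX n
  have hU1 : d.cut d.σU (1 - d.s) (idxU 1) (d.system.scaled X) = d.compU X 1 :=
    funext fun n => cut_eq (fun n => by simp [idxU, scale]) hX n
  change 2 * ((d.h ^ 2 : ℝ) : ℂ) * (d.γ : ℂ) *
    convol (d.cut d.σU (-d.s) (idxU 0) (d.system.scaled X))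
      (d.cut d.σU (1 - d.s) (idxU 1) (d.system.scaled X)) n = _
  rw [hU, hU1]

end FrontData

/-! ### Fourier coefficients of elements of `H^l` -/

theorem wt_sq_le (n : ℤ) : wt n ^ 2 ≤ 2 * (1 + (n : ℝ) ^ 2) := by
  rw [wt, ← sq_abs (n : ℝ)]
  nlinarith [sq_nonneg (1 - |(n : ℝ)|)]

theorem one_add_sq_le (n : ℤ) : 1 + (n : ℝ) ^ 2 ≤ wt n ^ 2 := by
  rw [wt, ← sq_abs (n : ℝ)]
  nlinarith [abs_nonneg (n : ℝ)]

theorem one_add_sq_rpow_le {l : ℝ} (hl : 0 ≤ l) (n : ℤ) : (1 + (n : ℝ) ^ 2) ^ l ≤ wt n ^ (2 * l) := by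
  rw [Real.rpow_mul (wt_pos n).le, Real.rpow_two]
  exact Real.rpow_le_rpow (by positivity) (one_add_sq_le n) hl

theorem wt_rpow_le {l : ℝ} (hl : 0 ≤ l) (n : ℤ) :
    wt n ^ (2 * l) ≤ 2 ^ l * (1 + (n : ℝ) ^ 2) ^ l := by
  rw [Real.rpow_mul (wt_pos n).le, Real.rpow_two, ← Real.mul_rpow (by norm_num) (by positivity)]
  exact Real.rpow_le_rpow (sq_nonneg _) (wt_sq_le n) hl

theorem norm_apply_le {m : ℕ} (v : EuclideanSpace ℂ (Fin m)) (j : Fin m) : ‖v j‖ ≤ ‖v‖ :=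
  PiLp.norm_apply_le v j

theorem euclidean_norm_le {m : ℕ} {v : EuclideanSpace ℂ (Fin m)} {B : ℝ} (h : ∀ j, ‖v j‖ ≤ B) :
    ‖v‖ ≤ m * B := by
  have h1 : ‖v‖ ≤ ∑ j, ‖v j‖ := by
    rw [EuclideanSpace.norm_eq]
    refine Real.sqrt_le_iff.2 ⟨Finset.sum_nonneg fun j _ => norm_nonneg _, ?_⟩
    exact Finset.sum_sq_le_sq_sum_of_nonneg fun j _ => norm_nonneg _
  exact h1.trans ((Finset.sum_le_sum fun j _ => h j).trans_eq (by simp))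

theorem norm_act_le {m : ℕ} {M : Matrix (Fin m) (Fin m) ℂ} {C : ℝ} (hM : ∀ i j, ‖M i j‖ ≤ C)
    (v : EuclideanSpace ℂ (Fin m)) : ‖act M v‖ ≤ m * (m * (C * ‖v‖)) :=
  euclidean_norm_le fun i => norm_mulVec_le hM (norm_apply_le v) i

/-- The sum of the weights `(1 + |n|)^(-a)`. -/
noncomputable def wtSum (a : ℝ) : ℝ := ∑' n : ℤ, wt n ^ (-a)

theorem wtSum_nonneg (a : ℝ) : 0 ≤ wtSum a := tsum_nonneg fun n => (wt_rpow_pos n _).le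

namespace Hs

variable {l : ℝ} {m : ℕ}

/-- The element of `H^l` with given coefficients. -/
def ofCoeffs (u : Coeffs m) (hu : MemH l u) : Hs l m := (⟨u, hu⟩ : hsSubmodule l m)

theorem ext_coeff {u v : Hs l m} (h : ∀ n, u.coeff n = v.coeff n) : u = v :=
  Subtype.ext (funext h)

theorem coeff_sub (u v : Hs l m) : (u - v).coeff = u.coeff - v.coeff := rfl

theorem coeff_real_smul (a : ℝ) (u : Hs l m) : (a • u).coeff = a • u.coeff := rfl

theorem memH (u : Hs l m) : MemH l u.coeff := u.2

theorem wt_mul_sq_le (hl : 0 ≤ l) (u : Hs l m) (n : ℤ) :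
    (wt n ^ l * ‖u.coeff n‖) ^ 2 ≤ 2 ^ l * ((1 + (n : ℝ) ^ 2) ^ l * ‖u.coeff n‖ ^ 2) := by
  have h := wt_rpow_le hl n
  rw [mul_comm 2 l, Real.rpow_mul (wt_pos n).le, Real.rpow_two] at h
  rw [mul_pow, ← mul_assoc]
  gcongr

theorem summable_wt_mul_sq (hl : 0 ≤ l) (u : Hs l m) :
    Summable fun n => (wt n ^ l * ‖u.coeff n‖) ^ 2 :=
  Summable.of_nonneg_of_le (fun _ => sq_nonneg _) (wt_mul_sq_le hl u) (u.memH.mul_left _)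

theorem tsum_wt_mul_sq_le (hl : 0 ≤ l) (u : Hs l m) :
    ∑' n, (wt n ^ l * ‖u.coeff n‖) ^ 2 ≤ 2 ^ l * ‖u‖ ^ 2 := by
  rw [norm_sq, ← tsum_mul_left]
  exact (summable_wt_mul_sq hl u).tsum_le_tsum (wt_mul_sq_le hl u) (u.memH.mul_left _)

theorem norm_coeff_le (hl : 0 ≤ l) (u : Hs l m) (n : ℤ) :
    ‖u.coeff n‖ ≤ 2 ^ l * ‖u‖ * wt n ^ (-l) := by
  have h1 := ((summable_wt_mul_sq hl u).le_tsum n fun _ _ => sq_nonneg _).trans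
    (tsum_wt_mul_sq_le hl u)
  have h2 : (1 : ℝ) ≤ 2 ^ l := Real.one_le_rpow (by norm_num) hl
  have h3 : (wt n ^ l * ‖u.coeff n‖) ^ 2 ≤ (2 ^ l * ‖u‖) ^ 2 := by
    rw [mul_pow (2 ^ l)]
    refine h1.trans ?_
    gcongr
    nlinarith
  have h4 := abs_le_of_sq_le_sq h3 (by positivity)
  have h5 := wt_rpow_pos n l
  rw [abs_of_nonneg (by positivity)] at h4
  rw [Real.rpow_neg (wt_pos n).le, ← div_eq_mul_inv, le_div_iff₀ h5]
  linarith

end Hs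

theorem memH_term_le {l q B : ℝ} (hl : 0 ≤ l) {m : ℕ} {u : Coeffs m}
    (hu : ∀ n, ‖u n‖ ≤ B * wt n ^ (-q)) (n : ℤ) :
    (1 + (n : ℝ) ^ 2) ^ l * ‖u n‖ ^ 2 ≤ B ^ 2 * wt n ^ (-(2 * q - 2 * l)) := by
  have h1 : wt n ^ (-(2 * q - 2 * l)) = wt n ^ (2 * l) * (wt n ^ (-q)) ^ 2 := by
    rw [← Real.rpow_natCast, ← Real.rpow_mul (wt_pos n).le, ← Real.rpow_add (wt_pos n)]
    congr 1; push_cast; ring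
  rw [h1]
  calc _ ≤ wt n ^ (2 * l) * (B * wt n ^ (-q)) ^ 2 := by
        have := wt_rpow_pos n (2 * l)
        gcongr
        · exact one_add_sq_rpow_le hl n
        · exact hu n
    _ = _ := by ring

theorem memH_of_bound {l q B : ℝ} (hl : 0 ≤ l) (hq : 1 < 2 * q - 2 * l) {m : ℕ} {u : Coeffs m}
    (hu : ∀ n, ‖u n‖ ≤ B * wt n ^ (-q)) : MemH l u :=
  Summable.of_nonneg_of_le (fun n => by positivity) (memH_term_le hl hu)
    ((summable_wt_rpow hq).mul_left _)

theorem Hs.norm_le_of_bound {l q B : ℝ} (hl : 0 ≤ l) (hq : 1 < 2 * q - 2 * l) (hB : 0 ≤ B) {m : ℕ}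
    {u : Hs l m} (hu : ∀ n, ‖u.coeff n‖ ≤ B * wt n ^ (-q)) :
    ‖u‖ ≤ √(wtSum (2 * q - 2 * l)) * B := by
  refine le_of_sq_le_sq ?_ (by positivity)
  rw [Hs.norm_sq, mul_pow, Real.sq_sqrt (wtSum_nonneg _), mul_comm, wtSum, ← tsum_mul_left]
  exact u.memH.tsum_le_tsum (memH_term_le hl hu) ((summable_wt_rpow hq).mul_left _)

/-- The convolution of a sequence with weighted bounds and a sequence with weighted square
sums. -/
theorem exists_convol_sq {l : ℝ} (hl : 1 / 2 < l) : ∃ K, 0 < K ∧ ∀ (a b : ℤ → ℂ) (A B : ℝ),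
    0 ≤ A → 0 < B → (∀ n, ‖a n‖ ≤ A * wt n ^ (-l)) → Summable (fun n => (wt n ^ l * ‖b n‖) ^ 2) →
    ∑' n, (wt n ^ l * ‖b n‖) ^ 2 ≤ B ^ 2 → ∀ n, ‖convol a b n‖ ≤ K * A * B * wt n ^ (-l) := by
  have hs := summable_wt_rpow (show 1 < 2 * l by linarith)
  have hS := wtSum_nonneg (2 * l)
  refine ⟨2 ^ l * (wtSum (2 * l) + 1), by positivity, fun a b A B hA hB ha hb hbB n => ?_⟩
  have hsq : ∀ p : ℤ, (wt p ^ (-l)) ^ 2 = wt p ^ (-(2 * l)) := fun p => by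
    rw [← Real.rpow_natCast, ← Real.rpow_mul (wt_pos p).le]
    congr 1; push_cast; ring
  -- Cauchy–Schwarz in pointwise form: after division by `B`, each product is at most half the sum
  -- of squares, and these squares are summable since `2 l > 1`.
  have hle : ∀ p, ‖a p * b (n - p)‖ ≤ A * B * 2 ^ l * wt n ^ (-l) *
      ((1 / 2) * wt p ^ (-(2 * l)) + (1 / 2) * wt (n - p) ^ (-(2 * l)) +
        (wt (n - p) ^ l * ‖b (n - p)‖) ^ 2 / B ^ 2) := fun p => by
    have h1 := wt_mul_wt_le (show 0 ≤ l by linarith) le_rfl p (n - p)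
    rw [add_sub_cancel] at h1
    set q := n - p
    have hp := wt_rpow_pos p (-l)
    have hq := wt_rpow_pos q (-l)
    have hq' := wt_rpow_pos q l
    have hn := wt_rpow_pos n (-l)
    set β := wt q ^ l * ‖b q‖ / B with hβ
    have hβ0 : 0 ≤ β := by positivity
    have hbq : ‖b q‖ = B * (wt q ^ (-l) * β) := by
      rw [hβ, Real.rpow_neg (wt_pos q).le]
      field_simp
    have h2 : (wt q ^ l * ‖b q‖) ^ 2 / B ^ 2 = β ^ 2 := by rw [hβ, div_pow]
    rw [norm_mul, h2, ← hsq, ← hsq]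
    calc ‖a p‖ * ‖b q‖ ≤ (A * wt p ^ (-l)) * ‖b q‖ := by gcongr; exact ha p
      _ = A * B * β * (wt p ^ (-l) * wt q ^ (-l)) := by rw [hbq]; ring
      _ ≤ A * B * β * (2 ^ l * wt n ^ (-l) * (wt p ^ (-l) + wt q ^ (-l))) := by gcongr
      _ = A * B * 2 ^ l * wt n ^ (-l) * (wt p ^ (-l) * β + wt q ^ (-l) * β) := by ring
      _ ≤ _ := by
        refine mul_le_mul_of_nonneg_left ?_ (by positivity)
        linarith [sq_nonneg (wt p ^ (-l) - β), sq_nonneg (wt q ^ (-l) - β)]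
  have hs2 : Summable fun p : ℤ => wt (n - p) ^ (-(2 * l)) :=
    ((Equiv.subLeft n).summable_iff (f := fun p : ℤ => wt p ^ (-(2 * l)))).2 hs
  have hs3 : Summable fun p : ℤ => (wt (n - p) ^ l * ‖b (n - p)‖) ^ 2 :=
    ((Equiv.subLeft n).summable_iff (f := fun p : ℤ => (wt p ^ l * ‖b p‖) ^ 2)).2 hb
  have e2 : ∑' p : ℤ, wt (n - p) ^ (-(2 * l)) = wtSum (2 * l) :=
    (Equiv.subLeft n).tsum_eq (fun p : ℤ => wt p ^ (-(2 * l)))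
  have e3 : ∑' p : ℤ, (wt (n - p) ^ l * ‖b (n - p)‖) ^ 2 = ∑' p, (wt p ^ l * ‖b p‖) ^ 2 :=
    (Equiv.subLeft n).tsum_eq (fun p : ℤ => (wt p ^ l * ‖b p‖) ^ 2)
  have hs4 := (((hs.mul_left (1 / 2)).add (hs2.mul_left (1 / 2))).add (hs3.div_const (B ^ 2)))
  have hs5 := hs4.mul_left (A * B * 2 ^ l * wt n ^ (-l))
  have hn := wt_rpow_pos n (-l)
  calc ‖convol a b n‖ ≤ _ := tsum_of_norm_bounded hs5.hasSum hle
    _ = A * B * 2 ^ l * wt n ^ (-l) * (wtSum (2 * l) + (∑' p, (wt p ^ l * ‖b p‖) ^ 2) / B ^ 2) := by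
      rw [tsum_mul_left, ((hs.mul_left (1 / 2)).add (hs2.mul_left (1 / 2))).tsum_add
        (hs3.div_const (B ^ 2)), (hs.mul_left (1 / 2)).tsum_add (hs2.mul_left (1 / 2)),
        tsum_mul_left, tsum_mul_left, tsum_div_const, e2, e3, wtSum]
      ring
    _ ≤ A * B * 2 ^ l * wt n ^ (-l) * (wtSum (2 * l) + 1) := by
      gcongr
      exact (div_le_one (by positivity)).2 hbB
    _ = _ := by ring

/-! ### Linear maps into and out of `H^l`, and differentiation in `H^l` -/

namespace Hs

open BoundedContinuousFunction

variable {l : ℝ} {m : ℕ}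

/-- The `n`-th Fourier coefficient. -/
noncomputable def coeffCLM (hl : 0 ≤ l) (n : ℤ) : Hs l m →L[ℝ] (Fin m → ℂ) :=
  LinearMap.mkContinuous
    { toFun := fun u j => u.coeff n j
      map_add' := fun _ _ => rfl
      map_smul' := fun _ _ => rfl } (2 ^ l * wt n ^ (-l)) fun u => by
    have := wt_rpow_pos n (-l)
    refine (pi_norm_le_iff_of_nonneg (by positivity)).2 fun j => ?_
    exact ((norm_apply_le _ j).trans (norm_coeff_le hl u n)).trans_eq (by ring)

theorem norm_scaled_coeff_le {T : Type*} [TopologicalSpace T] {q B : ℝ} {w : ℤ → Fin m → ℝ}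
    (hw : ∀ n j, ‖w n j‖ ≤ B * wt n ^ (-q)) (i : ℤ → Fin m → T) (y : T →ᵇ ℂ) (n : ℤ) :
    ‖(WithLp.toLp 2 fun j => (w n j : ℂ) * y (i n j) : EuclideanSpace ℂ (Fin m))‖ ≤
      m * B * ‖y‖ * wt n ^ (-q) := by
  refine (euclidean_norm_le (B := B * wt n ^ (-q) * ‖y‖) fun j => ?_).trans_eq (by ring)
  change ‖(w n j : ℂ) * y (i n j)‖ ≤ _
  rw [norm_mul, Complex.norm_real]
  exact mul_le_mul (hw n j) (y.norm_coe_le_norm _) (norm_nonneg _)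
    ((norm_nonneg _).trans (hw n j))

/-- The element of `H^l` with the coefficients `w n j * y (i n j)`. -/
noncomputable def ofBounded {T : Type*} [TopologicalSpace T] {q B : ℝ} (hl : 0 ≤ l)
    (hq : 1 < 2 * q - 2 * l) (hB : 0 ≤ B) (w : ℤ → Fin m → ℝ)
    (hw : ∀ n j, ‖w n j‖ ≤ B * wt n ^ (-q)) (i : ℤ → Fin m → T) : (T →ᵇ ℂ) →L[ℝ] Hs l m :=
  LinearMap.mkContinuous
    { toFun := fun y => ofCoeffs (fun n => WithLp.toLp 2 fun j => (w n j : ℂ) * y (i n j))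
        (memH_of_bound hl hq (norm_scaled_coeff_le hw i y))
      map_add' := fun y y' => ext_coeff fun n => by
        ext j; exact mul_add _ _ _
      map_smul' := fun a y => ext_coeff fun n => by
        ext j
        change (w n j : ℂ) * (a • y) (i n j) = a • ((w n j : ℂ) * y (i n j))
        rw [BoundedContinuousFunction.smul_apply, Complex.real_smul, Complex.real_smul]
        ring } (√(wtSum (2 * q - 2 * l)) * (m * B)) fun y => by
    have h := norm_le_of_bound (u := ofCoeffs _ (memH_of_bound hl hq (norm_scaled_coeff_le hw i y)))
      hl hq (by positivity) (norm_scaled_coeff_le hw i y)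
    rw [mul_assoc]
    exact h

theorem memH_act {Q : ℤ → Matrix (Fin m) (Fin m) ℂ} {C : ℝ} (hQ : ∀ n i j, ‖Q n i j‖ ≤ C)
    (u : Hs l m) : MemH l fun n => act (Q n) (u.coeff n) := by
  refine Summable.of_nonneg_of_le (fun n => by positivity) (fun n => ?_)
    (u.memH.mul_left ((m * (m * C)) ^ 2))
  have h := norm_act_le (hQ n) (u.coeff n)
  calc _ ≤ (1 + (n : ℝ) ^ 2) ^ l * (m * (m * (C * ‖u.coeff n‖))) ^ 2 := by gcongr
    _ = _ := by ring

/-- The multiplier `u_n ↦ Q_n u_n` with bounded matrices. -/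
noncomputable def multiplier {Q : ℤ → Matrix (Fin m) (Fin m) ℂ} {C : ℝ} (hC : 0 ≤ C)
    (hQ : ∀ n i j, ‖Q n i j‖ ≤ C) : Hs l m →L[ℝ] multiplierRange l Q :=
  LinearMap.mkContinuous
    { toFun := fun u => ⟨ofCoeffs _ (memH_act hQ u), u, fun _ => rfl⟩
      map_add' := fun u v => Subtype.ext <| ext_coeff fun n => by
        change act (Q n) (u.coeff n + v.coeff n) = act (Q n) (u.coeff n) + act (Q n) (v.coeff n)
        simp [act, Matrix.mulVec_add]
      map_smul' := fun a u => Subtype.ext <| ext_coeff fun n => by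
        change act (Q n) (a • u.coeff n) = a • act (Q n) (u.coeff n)
        simp [act, Matrix.mulVec_smul] } (m * (m * C)) fun u => by
    refine le_of_sq_le_sq ?_ (by positivity)
    change ‖ofCoeffs _ (memH_act hQ u)‖ ^ 2 ≤ _
    rw [norm_sq, mul_pow, norm_sq, ← tsum_mul_left]
    refine (memH_act hQ u).tsum_le_tsum (fun n => ?_) (u.memH.mul_left _)
    have h := norm_act_le (hQ n) (u.coeff n)
    calc _ ≤ (1 + (n : ℝ) ^ 2) ^ l * (m * (m * (C * ‖u.coeff n‖))) ^ 2 := by gcongr; exact h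
      _ = _ := by ring

theorem norm_multiplier_le {Q : ℤ → Matrix (Fin m) (Fin m) ℂ} {C : ℝ} (hC : 0 ≤ C)
    (hQ : ∀ n i j, ‖Q n i j‖ ≤ C) (u : Hs l m) : ‖multiplier hC hQ u‖ ≤ m * (m * C) * ‖u‖ :=
  (multiplier hC hQ).le_of_opNorm_le (LinearMap.mkContinuous_norm_le _ (by positivity) _) u

/-- A path in `H^l` is differentiable if its coefficients are, with uniformly decaying
derivatives. -/
theorem hasDerivWithinAt_of_coeff {q B : ℝ} (hl : 0 ≤ l) (hq : 1 < 2 * q - 2 * l) {I : Set ℝ}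
    (hI : I.OrdConnected) {A : ℝ → Hs l m} {Y : Hs l m} {a a' : ℝ → Coeffs m}
    (ha : ∀ n ξ, HasDerivAt (fun t => a t n) (a' ξ n) ξ)
    (hb : ∀ ξ ∈ I, ∀ n, ‖a' ξ n‖ ≤ B * wt n ^ (-q)) (hA : ∀ ξ ∈ I, (A ξ).coeff = a ξ) {ξ : ℝ}
    (hξ : ξ ∈ I) (hY : Y.coeff = a' ξ) : HasDerivWithinAt A Y I ξ := by
  rw [hasDerivWithinAt_iff_tendsto_slope, tendsto_iff_norm_sub_tendsto_zero]
  have hcoeff : ∀ t ∈ I, ∀ n, (slope A ξ t - Y).coeff n = slope (fun t => a t n) ξ t - a' ξ n :=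
    fun t ht n => by
      rw [slope, slope, vsub_eq_sub, vsub_eq_sub, coeff_sub, coeff_real_smul, coeff_sub, hA t ht,
        hA ξ hξ, hY]
      rfl
  -- The mean value inequality bounds the difference quotients by the same decaying sequence, which
  -- dominates the sum of squares as `t → ξ`.
  have hbound : ∀ t ∈ I \ {ξ}, ∀ n, ‖(slope A ξ t - Y).coeff n‖ ≤ 2 * B * wt n ^ (-q) := by
    rintro t ⟨ht, hne⟩ n
    have h1 : ‖a t n - a ξ n‖ ≤ B * wt n ^ (-q) * ‖t - ξ‖ :=
      (convex_uIcc ξ t).norm_image_sub_le_of_norm_hasDerivWithin_le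
        (f := fun t => a t n) (f' := fun t => a' t n)
        (fun x _ => (ha n x).hasDerivWithinAt) (fun x hx => hb x (hI.uIcc_subset hξ ht hx) n)
        left_mem_uIcc right_mem_uIcc
    have h2 : 0 < ‖t - ξ‖ := norm_pos_iff.2 (sub_ne_zero.2 hne)
    rw [hcoeff t ht n]
    refine (norm_sub_le_of_le (r₁ := B * wt n ^ (-q)) ?_ (hb ξ hξ n)).trans_eq (by ring)
    rw [slope, vsub_eq_sub, norm_smul, norm_inv, inv_mul_le_iff₀ h2, mul_comm]
    exact h1
  have hlim : Tendsto (fun t => ∑' n : ℤ, (1 + (n : ℝ) ^ 2) ^ l * ‖(slope A ξ t - Y).coeff n‖ ^ 2)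
      (𝓝[I \ {ξ}] ξ) (𝓝 (∑' n : ℤ, (0 : ℝ))) := by
    refine tendsto_tsum_of_dominated_convergence
      (bound := fun n => (2 * B) ^ 2 * wt n ^ (-(2 * q - 2 * l)))
      ((summable_wt_rpow hq).mul_left _) (fun n => ?_) ?_
    · have h1 : Tendsto (fun t => slope (fun t => a t n) ξ t - a' ξ n) (𝓝[I \ {ξ}] ξ) (𝓝 0) := by
        have := hasDerivWithinAt_iff_tendsto_slope.1 ((ha n ξ).hasDerivWithinAt (s := I))
        simpa using this.sub_const (a' ξ n)
      have h2 := (h1.norm.pow 2).const_mul ((1 + (n : ℝ) ^ 2) ^ l)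
      rw [norm_zero, zero_pow two_ne_zero, mul_zero] at h2
      refine h2.congr' ?_
      filter_upwards [self_mem_nhdsWithin] with t ht
      rw [hcoeff t ht.1 n]
    · filter_upwards [self_mem_nhdsWithin] with t ht n
      rw [Real.norm_of_nonneg (by positivity)]
      exact memH_term_le hl (hbound t ht) n
  simp only [← norm_sq, tsum_zero] at hlim
  have h3 := hlim.sqrt
  rw [Real.sqrt_zero] at h3
  refine h3.congr fun t => ?_
  rw [Real.sqrt_sq (norm_nonneg _)]

end Hs

/-! ### Regularity of small bounded solutions -/

/-- Bounded solutions of a hyperbolic block are controlled by the forcing. -/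
theorem Solvable.norm_le_of_bounded {m : ℕ} {M P : Matrix (Fin m) (Fin m) ℂ} {e : Fin m → ℂ}
    {θ : ℝ} {β : Fin m → ℝ} (hS : Solvable M P e θ β) (hθ : 0 < θ) (hP : P = 0) {X : ℝ → Fin m → ℂ}
    {f : ℝ → ℂ} {A D : ℝ} (hX : ∀ ξ, HasDerivAt X (M *ᵥ X ξ + f ξ • e) ξ) (hf : Continuous f)
    (hfb : ∀ ξ, ‖f ξ‖ ≤ D) (hXb : ∀ ξ j, ‖X ξ j‖ ≤ A) (ξ : ℝ) (j : Fin m) : ‖X ξ j‖ ≤ β j * D := by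
  have hD : 0 ≤ D := (norm_nonneg _).trans (hfb 0)
  have hA : 0 ≤ A := (norm_nonneg _).trans (hXb 0 j)
  have hexp : ∀ η : ℝ, 0 ≤ η → ∀ t : ℝ, 1 ≤ Real.exp (η * |t|) := fun η hη t =>
    Real.one_le_exp (mul_nonneg hη (abs_nonneg t))
  -- Time is shifted so that the estimate is read at 0, where the exponential weight is 1; there it
  -- gives the bound in terms of `D` alone.
  obtain ⟨Y, hY, -, hYb⟩ := hS.exists_forced θ le_rfl (by linarith) (fun t => f (t + ξ)) D
    (hf.comp (by fun_prop)) fun t => (hfb _).trans (le_mul_of_one_le_right hD (hexp θ hθ.le t))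
  have h0 := hS.unique (fun t => X (t + ξ) - Y t) (fun j => A + β j * D)
    (fun t => (((hX (t + ξ)).comp_add_const t ξ).sub (hY t)).congr_deriv (by
      rw [Matrix.mulVec_sub]; abel)) (by rw [hP, Matrix.zero_mulVec]) (fun t i => by
      have h1 : ‖Y t i‖ ≤ β i * D * Real.exp (2 * θ * |t|) := by
        have hβD : 0 ≤ β i * D := by
          have := (norm_nonneg _).trans (hYb 0 i)
          simpa using this
        refine (hYb t i).trans ?_
        gcongr
        linarith
      have h2 : ‖X (t + ξ) i‖ ≤ A * Real.exp (2 * θ * |t|) :=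
        (hXb _ i).trans (le_mul_of_one_le_right hA (hexp _ (by linarith) t))
      exact (norm_sub_le_of_le h2 h1).trans_eq (by ring)) 0
  have h1 : X ξ = Y 0 := by simpa [sub_eq_zero] using h0
  rw [h1]
  simpa using hYb 0 j

theorem continuous_convol {l A B : ℝ} (hl : 1 / 2 < l) {a b : ℝ → ℤ → ℂ}
    (ha : ∀ n, Continuous fun ξ => a ξ n) (hb : ∀ n, Continuous fun ξ => b ξ n)
    (hA : ∀ ξ n, ‖a ξ n‖ ≤ A * wt n ^ (-l)) (hB : ∀ ξ n, ‖b ξ n‖ ≤ B * wt n ^ (-l)) (n : ℤ) :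
    Continuous fun ξ => convol (a ξ) (b ξ) n := by
  have hs := summable_wt_rpow (show 1 < 2 * l by linarith)
  have hs2 : Summable fun p : ℤ => wt (n - p) ^ (-(2 * l)) :=
    ((Equiv.subLeft n).summable_iff (f := fun p : ℤ => wt p ^ (-(2 * l)))).2 hs
  have hsq : ∀ p : ℤ, wt p ^ (-(2 * l)) = (wt p ^ (-l)) ^ 2 := fun p => by
    rw [← Real.rpow_natCast, ← Real.rpow_mul (wt_pos p).le]
    congr 1; push_cast; ring
  refine continuous_tsum (fun p => (ha p).mul (hb (n - p)))
    ((hs.mul_left (A ^ 2)).add (hs2.mul_left (B ^ 2))) fun p ξ => ?_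
  rw [norm_mul, hsq, hsq]
  calc _ ≤ (A * wt p ^ (-l)) * (B * wt (n - p) ^ (-l)) :=
        mul_le_mul (hA ξ p) (hB ξ _) (norm_nonneg _) ((norm_nonneg _).trans (hA ξ p))
    _ ≤ _ := by nlinarith [sq_nonneg (A * wt p ^ (-l) - B * wt (n - p) ^ (-l)),
        sq_nonneg (A * wt p ^ (-l)), sq_nonneg (B * wt (n - p) ^ (-l))]

/-- The forcing of the Swift–Hohenberg modes. -/
noncomputable def forceU (γ : ℝ) (U : ℤ → Fin 4 → ℂ) (W : ℤ → Fin 2 → ℂ) (n : ℤ) : ℂ :=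
  convol (fun n => U n 0) (fun n => W n 0) n -
    (1 + (γ : ℂ)) * convol (convol (fun n => U n 0) (fun n => U n 0)) (fun n => U n 0) n

/-- The forcing of the conservation law modes. -/
noncomputable def forceW (c γ : ℝ) (U : ℤ → Fin 4 → ℂ) (n : ℤ) : ℂ :=
  2 * (c : ℂ) * (γ : ℂ) * convol (fun n => U n 0) (fun n => U n 1) n

/-- Solutions of the mode equations on the whole line with small weighted square sums. -/
structure SmallModes (l γ C α h u w : ℝ) (U : ℝ → ℤ → Fin 4 → ℂ) (W : ℝ → ℤ → Fin 2 → ℂ) :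
    Prop where
  h_pos : 0 < h
  u_pos : 0 < u
  u_sq_le : u ^ 2 ≤ w
  w_le : w ≤ h ^ 2
  shBlock : ∀ n, BlockFacts (m := 3) C h n (LSH α (h ^ 2) n)
  conBlock : ∀ n, BlockFacts (m := 1) C h n (Lcon (h ^ 2) n)
  shProj : ∀ n, n ≠ 1 → n ≠ -1 → centralProj (LSH α (h ^ 2) n) = 0
  conProj : ∀ n, n ≠ 0 → centralProj (Lcon (h ^ 2) n) = 0
  derivU : ∀ n ξ, HasDerivAt (fun t => U t n)
    (LSH α (h ^ 2) n *ᵥ U ξ n + forceU γ (U ξ) (W ξ) n • Pi.single (Fin.last 3) 1) ξ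
  derivW : ∀ n ξ, HasDerivAt (fun t => W t n)
    (Lcon (h ^ 2) n *ᵥ W ξ n + forceW (h ^ 2) γ (U ξ) n • Pi.single (Fin.last 1) 1) ξ
  sqU : ∀ ξ j, Summable (fun n => (wt n ^ l * ‖U ξ n j‖) ^ 2) ∧
    ∑' n, (wt n ^ l * ‖U ξ n j‖) ^ 2 ≤ u ^ 2
  sqW : ∀ ξ j, Summable (fun n => (wt n ^ l * ‖W ξ n j‖) ^ 2) ∧
    ∑' n, (wt n ^ l * ‖W ξ n j‖) ^ 2 ≤ w ^ 2

theorem norm_le_of_tsum_sq {l u : ℝ} (hu : 0 ≤ u) {b : ℤ → ℂ}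
    (hb : Summable (fun n => (wt n ^ l * ‖b n‖) ^ 2) ∧ ∑' n, (wt n ^ l * ‖b n‖) ^ 2 ≤ u ^ 2)
    (n : ℤ) : ‖b n‖ ≤ u * wt n ^ (-l) := by
  have h1 := (hb.1.le_tsum n fun _ _ => sq_nonneg _).trans hb.2
  have h2 := le_of_sq_le_sq h1 hu
  rw [Real.rpow_neg (wt_pos n).le, ← div_eq_mul_inv, le_div_iff₀ (wt_rpow_pos n l)]
  linarith

/-- Bounds of all modes with a given decay. -/
def ModeBound {m : ℕ} (X : ℝ → ℤ → Fin m → ℂ) (A t : ℝ) : Prop :=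
  ∀ ξ n j, ‖X ξ n j‖ ≤ A * wt n ^ ((j : ℝ) - t)

/-- Forcing bounds give one more order of decay. -/
theorem modeBound_of_forcing {m : ℕ} {C h F A B t : ℝ} (hC : 0 ≤ C) (hh : 0 < h) (hF : 0 ≤ F)
    (hA : 0 ≤ A) (hB : 0 ≤ B) (ht : 0 ≤ t)
    {M : ℤ → Matrix (Fin (m + 1)) (Fin (m + 1)) ℂ} (hM : ∀ n, BlockFacts C h n (M n))
    (hP : ∀ n, wt n ≤ 2 ∨ centralProj (M n) = 0) {X : ℝ → ℤ → Fin (m + 1) → ℂ} {f : ℝ → ℤ → ℂ}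
    (hX : ∀ n ξ, HasDerivAt (fun t => X t n)
      (M n *ᵥ X ξ n + f ξ n • Pi.single (Fin.last m) 1) ξ)
    (hf : ∀ n, Continuous fun ξ => f ξ n) (hfb : ∀ ξ n, ‖f ξ n‖ ≤ F * (h ^ 2 * A) * wt n ^ (-t))
    (hXb : ∀ ξ n j, ‖X ξ n j‖ ≤ B * A) :
    ModeBound X ((C * F + 2 ^ (t + 1) * B) * A) (t + 1) := fun ξ n j => by
  have hw := wt_rpow_pos n ((j : ℝ) - (t + 1))
  -- Modes that may be central have weight at most 2, so any decay rate costs them only a constant.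
  rcases hP n with h2 | h0
  · have h3 : (2 : ℝ) ^ (-(t + 1)) ≤ wt n ^ ((j : ℝ) - (t + 1)) :=
      calc (2 : ℝ) ^ (-(t + 1)) ≤ wt n ^ (-(t + 1)) :=
            Real.rpow_le_rpow_of_nonpos (wt_pos n) h2 (by linarith)
        _ ≤ _ := wt_rpow_anti n (by have : (0 : ℝ) ≤ j := by positivity
                                    linarith)
    have h4 : (2 : ℝ) ^ (t + 1) * 2 ^ (-(t + 1)) = 1 := by
      rw [← Real.rpow_add (by norm_num), add_neg_cancel, Real.rpow_zero]
    calc ‖X ξ n j‖ ≤ B * A := hXb ξ n j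
      _ = B * A * (2 ^ (t + 1) * 2 ^ (-(t + 1))) := by rw [h4, mul_one]
      _ = (2 ^ (t + 1) * B) * A * 2 ^ (-(t + 1)) := by ring
      _ ≤ (C * F + 2 ^ (t + 1) * B) * A * wt n ^ ((j : ℝ) - (t + 1)) := by
        gcongr
        linarith [mul_nonneg hC hF]
  · have h1 := (hM n).solvable.norm_le_of_bounded (by positivity) h0 (hX n) (hf n)
      (fun ξ => hfb ξ n) (fun ξ j => hXb ξ n j) ξ j
    have e : wt n ^ ((j : ℝ) - (t + 1)) = wt n ^ ((j : ℝ) - 1) * wt n ^ (-t) := by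
      rw [← Real.rpow_add (wt_pos n)]; congr 1; ring
    refine h1.trans ?_
    calc _ = C * F * A * wt n ^ ((j : ℝ) - (t + 1)) := by rw [e]; field_simp
      _ ≤ _ := by
        gcongr
        have : (0 : ℝ) ≤ 2 ^ (t + 1) * B := by positivity
        linarith

/-- Since `u² ≤ w ≤ h²`, both terms carry a factor `h² u`; this `h²` cancels the `1 / h²` of the
linear bound. -/
theorem norm_forceU_le {K γ D h u w t : ℝ} {U : ℤ → Fin 4 → ℂ} {W : ℤ → Fin 2 → ℂ} (hD : 0 ≤ D)
    (hK : 0 ≤ K) (hu : 0 ≤ u) (hw : w ≤ h ^ 2) (huw : u ^ 2 ≤ w)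
    (hUW : ∀ n, ‖convol (fun n => U n 0) (fun n => W n 0) n‖ ≤ D ^ 2 * K * u * w * wt n ^ (-t))
    (hUUU : ∀ n, ‖convol (convol (fun n => U n 0) (fun n => U n 0)) (fun n => U n 0) n‖ ≤
      D ^ 3 * K ^ 2 * u ^ 3 * wt n ^ (-t)) (n : ℤ) :
    ‖forceU γ U W n‖ ≤
      (D ^ 2 * K + ‖1 + (γ : ℂ)‖ * (D ^ 3 * K ^ 2)) * (h ^ 2 * u) * wt n ^ (-t) := by
  have hn := wt_rpow_pos n (-t)
  have h1 : ‖(1 + (γ : ℂ)) *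
      convol (convol (fun n => U n 0) (fun n => U n 0)) (fun n => U n 0) n‖ ≤
      ‖1 + (γ : ℂ)‖ * (D ^ 3 * K ^ 2 * u ^ 3 * wt n ^ (-t)) := by
    rw [norm_mul]
    exact mul_le_mul_of_nonneg_left (hUUU n) (norm_nonneg _)
  calc _ ≤ D ^ 2 * K * u * w * wt n ^ (-t) +
        ‖1 + (γ : ℂ)‖ * (D ^ 3 * K ^ 2 * u ^ 3 * wt n ^ (-t)) := norm_sub_le_of_le (hUW n) h1
    _ = D ^ 2 * K * u * wt n ^ (-t) * w +
        ‖1 + (γ : ℂ)‖ * (D ^ 3 * K ^ 2) * u * wt n ^ (-t) * u ^ 2 := by ring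
    _ ≤ D ^ 2 * K * u * wt n ^ (-t) * h ^ 2 +
        ‖1 + (γ : ℂ)‖ * (D ^ 3 * K ^ 2) * u * wt n ^ (-t) * h ^ 2 := by
      refine add_le_add (mul_le_mul_of_nonneg_left hw (by positivity))
        (mul_le_mul_of_nonneg_left (huw.trans hw) (by positivity))
    _ = _ := by ring

theorem norm_forceW_le {K γ D h u w t : ℝ} {U : ℤ → Fin 4 → ℂ} (hK : 0 ≤ K) (huw : u ^ 2 ≤ w)
    (hUU : ∀ n, ‖convol (fun n => U n 0) (fun n => U n 1) n‖ ≤ D ^ 2 * K * u ^ 2 * wt n ^ (-t))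
    (n : ℤ) : ‖forceW (h ^ 2) γ U n‖ ≤ 2 * |γ| * (D ^ 2 * K) * (h ^ 2 * w) * wt n ^ (-t) := by
  have hn := wt_rpow_pos n (-t)
  have h1 : ‖2 * ((h ^ 2 : ℝ) : ℂ) * (γ : ℂ)‖ = 2 * h ^ 2 * |γ| := by
    rw [norm_mul, norm_mul, Complex.norm_real, Complex.norm_real, Real.norm_eq_abs,
      Real.norm_eq_abs, abs_of_nonneg (sq_nonneg h), Complex.norm_ofNat]
  rw [forceW, norm_mul, h1]
  calc _ ≤ 2 * h ^ 2 * |γ| * (D ^ 2 * K * u ^ 2 * wt n ^ (-t)) := by gcongr; exact hUU n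
    _ ≤ 2 * h ^ 2 * |γ| * (D ^ 2 * K * w * wt n ^ (-t)) := by gcongr
    _ = _ := by ring

namespace SmallModes

variable {l γ C α h u w : ℝ} {U : ℝ → ℤ → Fin 4 → ℂ} {W : ℝ → ℤ → Fin 2 → ℂ}

theorem w_nonneg (H : SmallModes l γ C α h u w U W) : 0 ≤ w := (sq_nonneg u).trans H.u_sq_le

theorem C_nonneg (H : SmallModes l γ C α h u w U W) : 0 ≤ C :=
  (norm_nonneg _).trans ((H.shBlock 0).bound 0 0)

theorem norm_U_le (H : SmallModes l γ C α h u w U W) (ξ : ℝ) (j : Fin 4) (n : ℤ) :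
    ‖U ξ n j‖ ≤ u * wt n ^ (-l) :=
  norm_le_of_tsum_sq (b := fun n => U ξ n j) H.u_pos.le (H.sqU ξ j) n

theorem norm_W_le (H : SmallModes l γ C α h u w U W) (ξ : ℝ) (j : Fin 2) (n : ℤ) :
    ‖W ξ n j‖ ≤ w * wt n ^ (-l) :=
  norm_le_of_tsum_sq (b := fun n => W ξ n j) H.w_nonneg (H.sqW ξ j) n

theorem continuous_U (H : SmallModes l γ C α h u w U W) (n : ℤ) (j : Fin 4) :
    Continuous fun ξ => U ξ n j :=
  (continuous_apply j).comp (continuous_iff_continuousAt.2 fun ξ => (H.derivU n ξ).continuousAt)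

theorem continuous_W (H : SmallModes l γ C α h u w U W) (n : ℤ) (j : Fin 2) :
    Continuous fun ξ => W ξ n j :=
  (continuous_apply j).comp (continuous_iff_continuousAt.2 fun ξ => (H.derivW n ξ).continuousAt)

theorem continuous_forceW (H : SmallModes l γ C α h u w U W) (hl : 1 / 2 < l) (n : ℤ) :
    Continuous fun ξ => forceW (h ^ 2) γ (U ξ) n :=
  continuous_const.mul (continuous_convol hl (fun n => H.continuous_U n 0)
    (fun n => H.continuous_U n 1) (fun ξ => H.norm_U_le ξ 0) (fun ξ => H.norm_U_le ξ 1) n)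

theorem wt_rpow_neg_le_one {l : ℝ} (hl : 0 ≤ l) (n : ℤ) : wt n ^ (-l) ≤ 1 :=
  Real.rpow_le_one_of_one_le_of_nonpos (one_le_wt n) (by linarith)

theorem sh_or (H : SmallModes l γ C α h u w U W) (n : ℤ) :
    wt n ≤ 2 ∨ centralProj (LSH α (h ^ 2) n) = 0 := by
  by_cases h1 : n = 1
  · exact Or.inl (by subst h1; norm_num [wt])
  by_cases h2 : n = -1
  · exact Or.inl (by subst h2; norm_num [wt])
  exact Or.inr (H.shProj n h1 h2)

theorem con_or (H : SmallModes l γ C α h u w U W) (n : ℤ) :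
    wt n ≤ 2 ∨ centralProj (Lcon (h ^ 2) n) = 0 := by
  by_cases h1 : n = 0
  · exact Or.inl (by subst h1; norm_num [wt])
  exact Or.inr (H.conProj n h1)

/-- The forcing of the Swift–Hohenberg modes is continuous and controlled in the base space. -/
theorem exists_forceU_bound (hl : 1 / 2 < l) (γ : ℝ) : ∃ F, 0 ≤ F ∧ ∀ {C α h u w U W},
    SmallModes l γ C α h u w U W → (∀ n, Continuous fun ξ => forceU γ (U ξ) (W ξ) n) ∧
      ∀ ξ n, ‖forceU γ (U ξ) (W ξ) n‖ ≤ F * (h ^ 2 * u) * wt n ^ (-l) := by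
  obtain ⟨K, hK, hconv⟩ := exists_convol_sq hl
  refine ⟨_, by positivity, fun {C α h u w U W} H => ⟨fun n => ?_, fun ξ n => norm_forceU_le
    (D := 1) (K := K) zero_le_one hK.le H.u_pos.le H.w_le H.u_sq_le (fun n => ?_) (fun n => ?_) n⟩⟩
  · have h2 : ∀ ξ n, ‖convol (fun n => U ξ n 0) (fun n => U ξ n 0) n‖ ≤
        K * u * u * wt n ^ (-l) := fun ξ n =>
      hconv (fun n => U ξ n 0) (fun n => U ξ n 0) u u H.u_pos.le H.u_pos (H.norm_U_le ξ 0)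
        (H.sqU ξ 0).1 (H.sqU ξ 0).2 n
    exact (continuous_convol hl (fun n => H.continuous_U n 0) (fun n => H.continuous_W n 0)
      (fun ξ => H.norm_U_le ξ 0) (fun ξ => H.norm_W_le ξ 0) n).sub (continuous_const.mul
      (continuous_convol hl (fun n => continuous_convol hl (fun n => H.continuous_U n 0)
        (fun n => H.continuous_U n 0) (fun ξ => H.norm_U_le ξ 0) (fun ξ => H.norm_U_le ξ 0) n)
        (fun n => H.continuous_U n 0) h2 (fun ξ => H.norm_U_le ξ 0) n))
  · have hw : 0 < w := (pow_pos H.u_pos 2).trans_le H.u_sq_le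
    exact (hconv (fun n => U ξ n 0) (fun n => W ξ n 0) u w H.u_pos.le hw (H.norm_U_le ξ 0)
      (H.sqW ξ 0).1 (H.sqW ξ 0).2 n).trans_eq (by ring)
  · have h2 : ∀ n, ‖convol (fun n => U ξ n 0) (fun n => U ξ n 0) n‖ ≤
        K * u * u * wt n ^ (-l) := fun n =>
      hconv (fun n => U ξ n 0) (fun n => U ξ n 0) u u H.u_pos.le H.u_pos (H.norm_U_le ξ 0)
        (H.sqU ξ 0).1 (H.sqU ξ 0).2 n
    have hu := H.u_pos
    exact (hconv _ (fun n => U ξ n 0) (K * u * u) u (by positivity) H.u_pos h2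
      (H.sqU ξ 0).1 (H.sqU ξ 0).2 n).trans_eq (by ring)

theorem exists_modeBound_U (hl : 1 / 2 < l) (γ C F t : ℝ) (hF : 0 ≤ F) (ht : 0 ≤ t) :
    ∃ D, 0 ≤ D ∧ ∀ {α h u w U W}, SmallModes l γ C α h u w U W →
      (∀ ξ n, ‖forceU γ (U ξ) (W ξ) n‖ ≤ F * (h ^ 2 * u) * wt n ^ (-t)) →
      ModeBound U (D * u) (t + 1) := by
  obtain ⟨_, _, hf⟩ := exists_forceU_bound hl γ
  refine ⟨|C * F + 2 ^ (t + 1) * 1|, abs_nonneg _, fun {α h u w U W} H hb => ?_⟩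
  have hC := H.C_nonneg
  rw [abs_of_nonneg (by positivity)]
  exact modeBound_of_forcing hC H.h_pos hF H.u_pos.le zero_le_one ht H.shBlock H.sh_or
    H.derivU (hf H).1 hb fun ξ n j => (H.norm_U_le ξ j n).trans (by
      rw [one_mul]
      exact mul_le_of_le_one_right H.u_pos.le (wt_rpow_neg_le_one (by linarith) n))

/-- `U` has to be improved first: once it has order `t + 1`, the product with `U₁` decays with order
`t`, and the block gives `W` the order `t + 1`. -/
theorem exists_modeBound_W (hl : 1 / 2 < l) (γ C D t : ℝ) (hD : 0 ≤ D) (ht : 0 < t) :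
    ∃ D', 0 ≤ D' ∧ ∀ {α h u w U W}, SmallModes l γ C α h u w U W →
      ModeBound U (D * u) (t + 1) → ModeBound W (D' * w) (t + 1) := by
  obtain ⟨K, hK, hconv⟩ := exists_convWeight (a := t + 1) (b := t) (by linarith) ht.le (by linarith)
  refine ⟨|C * (2 * |γ| * (D ^ 2 * K)) + 2 ^ (t + 1) * 1|, abs_nonneg _,
    fun {α h u w U W} H hb => ?_⟩
  have hC := H.C_nonneg
  have hu := H.u_pos
  rw [abs_of_nonneg (by positivity)]
  refine modeBound_of_forcing hC H.h_pos (by positivity) H.w_nonneg zero_le_one ht.le H.conBlock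
    H.con_or H.derivW (H.continuous_forceW hl) (fun ξ => norm_forceW_le hK.le H.u_sq_le fun n => ?_)
    fun ξ n j => (H.norm_W_le ξ j n).trans (by
      rw [one_mul]
      exact mul_le_of_le_one_right H.w_nonneg (wt_rpow_neg_le_one (by linarith) n))
  refine (hconv.norm_convol_le (A := D * u) (B := D * u) (by positivity) (by positivity)
    (fun n => ?_) (fun n => ?_) n).trans_eq (by ring)
  · simpa using hb ξ n 0
  · have := hb ξ n 1
    have e : ((1 : Fin 4) : ℝ) - (t + 1) = -t := by simp
    rwa [e] at this

/-- One round of the bootstrap. The condition `t > 1` makes the pointwise bounds convolve. -/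
theorem exists_modeBound_step (hl : 1 / 2 < l) (γ C D t : ℝ) (hD : 0 ≤ D) (ht : 1 < t) :
    ∃ D', 0 ≤ D' ∧ ∀ {α h u w U W}, SmallModes l γ C α h u w U W →
      ModeBound U (D * u) t ∧ ModeBound W (D * w) t →
      ModeBound U (D' * u) (t + 1) ∧ ModeBound W (D' * w) (t + 1) := by
  obtain ⟨K, hK, hconv⟩ := exists_convWeight (a := t) (b := t) ht (by linarith) le_rfl
  obtain ⟨D₁, hD₁, h₁⟩ := exists_modeBound_U hl γ C
    (D ^ 2 * K + ‖1 + (γ : ℂ)‖ * (D ^ 3 * K ^ 2)) t (by positivity) (by linarith)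
  obtain ⟨D₂, hD₂, h₂⟩ := exists_modeBound_W hl γ C D₁ t hD₁ (by linarith)
  refine ⟨D₁ + D₂, by positivity, fun {α h u w U W} H hb => ?_⟩
  have hu := H.u_pos
  have hw := H.w_nonneg
  have hU : ∀ ξ n, ‖U ξ n 0‖ ≤ D * u * wt n ^ (-t) := fun ξ n => by simpa using hb.1 ξ n 0
  have hW : ∀ ξ n, ‖W ξ n 0‖ ≤ D * w * wt n ^ (-t) := fun ξ n => by simpa using hb.2 ξ n 0
  have hU' := h₁ H fun ξ => norm_forceU_le hD hK.le hu.le H.w_le H.u_sq_le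
    (fun n => (hconv.norm_convol_le (by positivity) (by positivity) (hU ξ) (hW ξ) n).trans_eq
      (by ring))
    (fun n => (hconv.norm_convol_le (A := D * u * (D * u) * K) (by positivity) (by positivity)
      (fun n => (hconv.norm_convol_le (by positivity) (by positivity) (hU ξ) (hU ξ) n).trans_eq
        (by ring)) (hU ξ) n).trans_eq (by ring))
  refine ⟨fun ξ n j => (hU' ξ n j).trans ?_, fun ξ n j => (h₂ H hU' ξ n j).trans ?_⟩
  · have := wt_rpow_pos n ((j : ℝ) - (t + 1))
    gcongr
    linarith
  · have := wt_rpow_pos n ((j : ℝ) - (t + 1))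
    gcongr
    linarith

/-- Small bounded solutions have decay of any order. -/
theorem exists_modeBound (hl : 1 / 2 < l) (γ C : ℝ) (k : ℕ) :
    ∃ D, 0 ≤ D ∧ ∀ {α h u w U W}, SmallModes l γ C α h u w U W →
      ModeBound U (D * u) (l + (k + 1 : ℕ)) ∧ ModeBound W (D * w) (l + (k + 1 : ℕ)) := by
  induction k with
  | zero =>
    -- The first round uses the weighted square sums of `H^l`: the pointwise decay `wt n ^ (-l)`
    -- need not be summable for `l > 1/2`.
    obtain ⟨F, hF, hf⟩ := exists_forceU_bound hl γ
    obtain ⟨D₁, hD₁, h₁⟩ := exists_modeBound_U hl γ C F l hF (by linarith)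
    obtain ⟨D₂, hD₂, h₂⟩ := exists_modeBound_W hl γ C D₁ l hD₁ (by linarith)
    refine ⟨D₁ + D₂, by positivity, fun {α h u w U W} H => ?_⟩
    have hU' := h₁ H (hf H).2
    have hu := H.u_pos
    have hw := H.w_nonneg
    rw [zero_add, Nat.cast_one]
    refine ⟨fun ξ n j => (hU' ξ n j).trans ?_, fun ξ n j => (h₂ H hU' ξ n j).trans ?_⟩
    · have := wt_rpow_pos n ((j : ℝ) - (l + 1))
      gcongr
      linarith
    · have := wt_rpow_pos n ((j : ℝ) - (l + 1))
      gcongr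
      linarith
  | succ k ih =>
    obtain ⟨D, hD, hb⟩ := ih
    obtain ⟨D', hD', h'⟩ := exists_modeBound_step hl γ C D (l + (k + 1 : ℕ)) hD (by
      push_cast
      have : (0 : ℝ) ≤ k := by positivity
      linarith)
    refine ⟨D', hD', fun {α h u w U W} H => ?_⟩
    have := h' H (hb H)
    rwa [add_assoc, ← Nat.cast_succ] at this

end SmallModes

/-! ### The central coordinates -/

theorem memH_of_finite {l : ℝ} {m : ℕ} {u : Coeffs m} (T : Finset ℤ) (hu : ∀ n ∉ T, u n = 0) :
    MemH l u :=
  summable_of_ne_finset_zero (s := T) fun n hn => by simp [hu n hn]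

/-- The coefficients in finitely many modes of an element of the range of a multiplier. -/
def multiplierRangeCoeffs {m : ℕ} (l : ℝ) (Q : ℤ → Matrix (Fin m) (Fin m) ℂ) (T : Finset ℤ) :
    multiplierRange l Q →ₗ[ℂ] ∀ n : T, LinearMap.range (Q n).mulVecLin where
  toFun x n := ⟨((x : Hs l m).coeff n).ofLp, by
    obtain ⟨y, hy⟩ := x.2
    exact ⟨(y.coeff n).ofLp, by rw [hy]; rfl⟩⟩
  map_add' _ _ := rfl
  map_smul' _ _ := rfl

theorem multiplierRangeCoeffs_bijective {m : ℕ} {l : ℝ} {Q : ℤ → Matrix (Fin m) (Fin m) ℂ}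
    {T : Finset ℤ} (hT : ∀ n ∉ T, Q n = 0) :
    Function.Bijective (multiplierRangeCoeffs l Q T) := by
  constructor
  · intro x x' hxx
    refine Subtype.ext (Hs.ext_coeff fun n => ?_)
    by_cases hn : n ∈ T
    · have := congrArg Subtype.val (congrFun hxx ⟨n, hn⟩)
      exact WithLp.ofLp_injective 2 this
    · obtain ⟨y, hy⟩ := x.2
      obtain ⟨y', hy'⟩ := x'.2
      rw [hy, hy', hT n hn]
      simp [act]
  · intro z
    choose y hy using fun n => (z n).2
    let u : Coeffs m := fun n => if hn : n ∈ T then WithLp.toLp 2 (y ⟨n, hn⟩) else 0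
    have hu : MemH l u := memH_of_finite T fun n hn => dif_neg hn
    have hQ : MemH l fun n => act (Q n) (u n) := memH_of_finite T fun n hn => by
      simp [hT n hn, act]
    refine ⟨⟨Hs.ofCoeffs _ hQ, Hs.ofCoeffs u hu, fun n => rfl⟩, ?_⟩
    funext n
    refine Subtype.ext ?_
    change (act (Q n) (u n)).ofLp = z n
    rw [← hy n]
    simp [u, act]

/-- Elements of the range are supported in `T`, and finitely many modes may be prescribed freely
within the ranges of the matrices. -/
theorem finrank_multiplierRange {m : ℕ} {l : ℝ} {Q : ℤ → Matrix (Fin m) (Fin m) ℂ}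
    (T : Finset ℤ) (hT : ∀ n ∉ T, Q n = 0) :
    FiniteDimensional ℂ (multiplierRange l Q) ∧
      Module.finrank ℂ (multiplierRange l Q) = ∑ n ∈ T, (Q n).rank := by
  let e := LinearEquiv.ofBijective _ (multiplierRangeCoeffs_bijective (l := l) hT)
  refine ⟨e.symm.finiteDimensional, ?_⟩
  rw [e.finrank_eq, Module.finrank_pi_fintype]
  exact Finset.sum_coe_sort T fun n => (Q n).rank

theorem finrank_cent {l α c : ℝ} (h1 : (centralProj (LSH α c 1)).rank = 2)
    (h2 : (centralProj (LSH α c (-1))).rank = 2) (h3 : centralProj (Lcon c 0) = 1)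
    (hU : ∀ n, n ≠ 1 → n ≠ -1 → centralProj (LSH α c n) = 0)
    (hW : ∀ n, n ≠ 0 → centralProj (Lcon c n) = 0) : Module.finrank ℂ (Cent l α c) = 6 := by
  obtain ⟨_, hu⟩ := finrank_multiplierRange (l := l) (Q := fun n => centralProj (LSH α c n)) {1, -1}
    fun n hn => hU n (fun h => hn (by simp [h])) (fun h => hn (by simp [h]))
  obtain ⟨_, hw⟩ := finrank_multiplierRange (l := l) (Q := fun n => centralProj (Lcon c n)) {0}
    fun n hn => hW n (fun h => hn (by simp [h]))
  rw [Module.finrank_prod, hu, hw, Finset.sum_pair (by norm_num), Finset.sum_singleton, h1, h2, h3,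
    Matrix.rank_one, Fintype.card_fin]

theorem nonlinU_ofLp (γ : ℝ) (u : Coeffs 4) (v : Coeffs 2) (n : ℤ) : (nonlinU γ u v n).ofLp =
    forceU γ (fun n => (u n).ofLp) (fun n => (v n).ofLp) n • Pi.single (Fin.last 3) 1 := by
  funext j
  have h : (Fin.last 3 : Fin 4) = 3 := rfl
  fin_cases j <;> simp [nonlinU, h]; rfl

theorem nonlinW_ofLp (c γ : ℝ) (u : Coeffs 4) (n : ℤ) : (nonlinW c γ u n).ofLp =
    forceW c γ (fun n => (u n).ofLp) n • Pi.single (Fin.last 1) 1 := by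
  funext j
  have h : (Fin.last 1 : Fin 2) = 1 := rfl
  fin_cases j <;> simp [nonlinW, h]; rfl

namespace FrontData

/-- The coefficients in the three central modes. -/
abbrev Coord : Type := (Fin 4 → ℂ) × (Fin 4 → ℂ) × (Fin 2 → ℂ)

variable (d : FrontData)

/-- The central state with given coefficients. -/
noncomputable def centralState (x : Coord) : d.system.State
  | .inl n => if n = 1 then centralProj (LSH d.α (d.h ^ 2) n) *ᵥ x.1
      else if n = -1 then centralProj (LSH d.α (d.h ^ 2) n) *ᵥ x.2.1 else 0
  | .inr n => if n = 0 then centralProj (Lcon (d.h ^ 2) n) *ᵥ x.2.2 else 0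

/-- The central state depends linearly on the coefficients. -/
noncomputable def central : Coord →ₗ[ℝ] d.system.State where
  toFun := d.centralState
  map_add' x y := by
    funext k
    rcases k with n | n
    · change d.centralState (x + y) (.inl n) =
        d.centralState x (.inl n) + d.centralState y (.inl n)
      simp only [centralState]
      split_ifs <;> first | exact Matrix.mulVec_add _ _ _ | exact (add_zero _).symm
    · change d.centralState (x + y) (.inr n) =
        d.centralState x (.inr n) + d.centralState y (.inr n)
      simp only [centralState]
      split_ifs <;> first | exact Matrix.mulVec_add _ _ _ | exact (add_zero _).symm
  map_smul' a x := by
    funext k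
    rcases k with n | n
    · change d.centralState (a • x) (.inl n) = a • d.centralState x (.inl n)
      simp only [centralState]
      split_ifs <;> first | exact Matrix.mulVec_smul _ _ _ | exact (smul_zero _).symm
    · change d.centralState (a • x) (.inr n) = a • d.centralState x (.inr n)
      simp only [centralState]
      split_ifs <;> first | exact Matrix.mulVec_smul _ _ _ | exact (smul_zero _).symm

theorem central_inl (x : Coord) (n : ℤ) : d.central x (.inl n) =
    if n = 1 then centralProj (LSH d.α (d.h ^ 2) n) *ᵥ x.1
      else if n = -1 then centralProj (LSH d.α (d.h ^ 2) n) *ᵥ x.2.1 else 0 := rfl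

theorem central_inr (x : Coord) (n : ℤ) : d.central x (.inr n) =
    if n = 0 then centralProj (Lcon (d.h ^ 2) n) *ᵥ x.2.2 else 0 := rfl

/-- Projecting inside `central` lets the parameters range over a fixed coordinate space that does
not vary with `α` and `h`. -/
theorem centralData : d.system.CentralData d.central {.inl 1, .inl (-1), .inr 0} where
  mem_range x k := by
    rcases k with n | n
    · rw [central_inl]
      change centralProj (LSH d.α (d.h ^ 2) n) *ᵥ _ = _
      split_ifs
      · rw [Matrix.mulVec_mulVec, (d.shBlock n).idem]
      · rw [Matrix.mulVec_mulVec, (d.shBlock n).idem]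
      · exact Matrix.mulVec_zero _
    · rw [central_inr]
      change centralProj (Lcon (d.h ^ 2) n) *ᵥ _ = _
      split_ifs
      · rw [Matrix.mulVec_mulVec, (d.conBlock n).idem]
      · exact Matrix.mulVec_zero _
  support x k hk := by
    rcases k with n | n
    · rw [central_inl, if_neg (fun h => hk (by simp [h])), if_neg (fun h => hk (by simp [h]))]
    · rw [central_inr, if_neg (fun h => hk (by simp [h]))]

/-- A state is central up to its projection. -/
theorem central_eq (X : d.system.State) (k : ℤ ⊕ ℤ) :
    d.central (X (.inl 1), X (.inl (-1)), X (.inr 0)) k = d.proj k *ᵥ X k := by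
  rcases k with n | n
  · rw [central_inl]
    change _ = centralProj (LSH d.α (d.h ^ 2) n) *ᵥ X (.inl n)
    split_ifs with h1 h2
    · subst h1; rfl
    · subst h2; rfl
    · rw [d.shProj n h1 h2]; exact (Matrix.zero_mulVec _).symm
  · rw [central_inr]
    change _ = centralProj (Lcon (d.h ^ 2) n) *ᵥ X (.inr n)
    split_ifs with h1
    · subst h1; rfl
    · rw [d.conProj n h1]; exact (Matrix.zero_mulVec _).symm

variable {l : ℝ}

/-- The state of a point of the phase space. -/
def state (u : Phase l) : d.system.State
  | .inl n => (u.1.coeff n).ofLp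
  | .inr n => (u.2.coeff n).ofLp

/-- The central coefficients of a central point. -/
noncomputable def coord (hl : 0 ≤ l) : Cent l d.α (d.h ^ 2) →L[ℝ] Coord :=
  (((Hs.coeffCLM hl 1).comp ((CentU l d.α (d.h ^ 2)).subtypeL.restrictScalars ℝ)).comp
    (ContinuousLinearMap.fst ℝ _ _)).prod
  ((((Hs.coeffCLM hl (-1)).comp ((CentU l d.α (d.h ^ 2)).subtypeL.restrictScalars ℝ)).comp
    (ContinuousLinearMap.fst ℝ _ _)).prod
  (((Hs.coeffCLM hl 0).comp ((CentW l (d.h ^ 2)).subtypeL.restrictScalars ℝ)).comp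
    (ContinuousLinearMap.snd ℝ _ _)))

theorem coord_apply (hl : 0 ≤ l) (x : Cent l d.α (d.h ^ 2)) : d.coord hl x =
    (d.state ((x.1 : Hs l 4), (x.2 : Hs l 2)) (.inl 1),
      d.state ((x.1 : Hs l 4), (x.2 : Hs l 2)) (.inl (-1)),
      d.state ((x.1 : Hs l 4), (x.2 : Hs l 2)) (.inr 0)) := rfl

/-- Central points are determined by their central coefficients. -/
theorem central_coord (hl : 0 ≤ l) (x : Cent l d.α (d.h ^ 2)) (k : ℤ ⊕ ℤ) :
    d.central (d.coord hl x) k = d.state ((x.1 : Hs l 4), (x.2 : Hs l 2)) k := by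
  rw [coord_apply, central_eq]
  rcases k with n | n
  · obtain ⟨y, hy⟩ := x.1.2
    change centralProj (LSH d.α (d.h ^ 2) n) *ᵥ ((x.1 : Hs l 4).coeff n).ofLp =
      ((x.1 : Hs l 4).coeff n).ofLp
    rw [hy]
    simp only [act, Matrix.mulVec_mulVec, (d.shBlock n).idem]
  · obtain ⟨y, hy⟩ := x.2.2
    change centralProj (Lcon (d.h ^ 2) n) *ᵥ ((x.2 : Hs l 2).coeff n).ofLp =
      ((x.2 : Hs l 2).coeff n).ofLp
    rw [hy]
    simp only [act, Matrix.mulVec_mulVec, (d.conBlock n).idem]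

theorem scale_idxU_le (n : ℤ) (j : Fin 4) :
    ‖d.scale (idxU j n)‖ ≤ (d.σU + d.σW) * wt n ^ (-(d.s - 3)) := by
  have h1 := d.σU_pos
  have h2 := d.σW_pos
  rw [Real.norm_of_nonneg (d.scale_pos _).le]
  change d.σU * wt n ^ ((j : ℝ) - d.s) ≤ _
  have hj : ((j : ℕ) : ℝ) ≤ 3 := by exact_mod_cast Fin.is_le j
  have h3 := wt_rpow_pos n ((j : ℝ) - d.s)
  exact mul_le_mul (by linarith) (wt_rpow_anti n (by linarith)) h3.le (by linarith)

theorem scale_idxW_le (n : ℤ) (j : Fin 2) :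
    ‖d.scale (idxW j n)‖ ≤ (d.σU + d.σW) * wt n ^ (-(d.s - 3)) := by
  have h1 := d.σU_pos
  have h2 := d.σW_pos
  rw [Real.norm_of_nonneg (d.scale_pos _).le]
  change d.σW * wt n ^ ((j : ℝ) - d.s) ≤ _
  have hj : ((j : ℕ) : ℝ) ≤ 1 := by exact_mod_cast Fin.is_le j
  have h3 := wt_rpow_pos n ((j : ℝ) - d.s)
  exact mul_le_mul (by linarith) (wt_rpow_anti n (by linarith)) h3.le (by linarith)

open BoundedContinuousFunction in
/-- The point of the phase space with given scaled modes. -/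
noncomputable def toPhase (hl : 0 ≤ l) (hs : 4 + l ≤ d.s) : (d.system.Idx →ᵇ ℂ) →L[ℝ] Phase l :=
  (Hs.ofBounded (m := 4) (q := d.s - 3) (B := d.σU + d.σW) hl (by linarith)
    (by linarith [d.σU_pos, d.σW_pos]) (fun n j => d.scale (idxU j n)) d.scale_idxU_le
    (fun n j => idxU j n)).prod
  (Hs.ofBounded (m := 2) (q := d.s - 3) (B := d.σU + d.σW) hl (by linarith)
    (by linarith [d.σU_pos, d.σW_pos]) (fun n j => d.scale (idxW j n)) d.scale_idxW_le
    (fun n j => idxW j n))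

open BoundedContinuousFunction in
theorem state_toPhase (hl : 0 ≤ l) (hs : 4 + l ≤ d.s) (y : d.system.Idx →ᵇ ℂ) {X : d.system.State}
    (hy : ∀ i, d.system.scaled X i = y i) : d.state (d.toPhase hl hs y) = X := by
  have h : ∀ i : d.system.Idx, (d.scale i : ℂ) * y i = X i.1 i.2 := fun i => by
    have h1 : (d.scale i : ℂ) ≠ 0 := by exact_mod_cast (d.scale_pos i).ne'
    rw [← hy]
    exact mul_div_cancel₀ _ h1
  funext k
  rcases k with n | n
  · funext j
    exact h ⟨.inl n, j⟩
  · funext j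
    exact h ⟨.inr n, j⟩

theorem state_injective : Function.Injective (d.state (l := l)) := fun _ _ h =>
  Prod.ext (Hs.ext_coeff fun n => WithLp.ofLp_injective 2 (congrFun h (.inl n)))
    (Hs.ext_coeff fun n => WithLp.ofLp_injective 2 (congrFun h (.inr n)))

end FrontData

/-! ### The reduction function as the hyperbolic part of the graph -/

namespace FrontData

open BoundedContinuousFunction

variable (d : FrontData) {l : ℝ}

/-- The properties of the graph of scaled modes over the central coefficients. -/
structure IsGraph (Z : Coord → d.system.Idx →ᵇ ℂ) : Prop where
  contDiff : ContDiff ℝ 1 Z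
  lipschitz : ∃ Λ, 0 ≤ Λ ∧ ∀ x x', ‖Z x - Z x'‖ ≤ Λ * ‖x - x'‖
  close : ∀ x i, ‖Z x i - d.system.scaled (d.central x) i‖ ≤ 1 / 2
  exists_solution : ∀ x, ∃ X, d.system.IsModeSolution X ∧ d.system.GrowthBounded X ∧
    (∀ i, d.system.scaled (X 0) i = Z x i) ∧ ∀ k, d.proj k *ᵥ X 0 k = d.central x k
  unique : ∀ X, d.system.IsModeSolution X → d.system.GrowthBounded X → ∀ ξ x,
    (∀ k, d.central x k = d.proj k *ᵥ X ξ k) → ∀ i, d.system.scaled (X ξ) i = Z x i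
  zero : Z 0 = 0
  deriv : ∃ Z' : Coord →L[ℝ] (d.system.Idx →ᵇ ℂ), HasFDerivAt Z Z' 0 ∧
    ∀ x i, Z' x i = d.system.scaled (d.central x) i

/-- The distance `1/2` from the central data is the bound `κ L` of the forced part, here `C L ≤
1/2`. -/
theorem exists_isGraph : ∃ Z, d.IsGraph Z := by
  obtain ⟨Z, h1, h2, h3, h4, h5, h6⟩ := ModeSystem.exists_invariant_graph d.centralData
  obtain ⟨h7, h8⟩ := h6 d.system_nonlin_zero d.system_deriv_zero
  exact ⟨Z, h1, h2, fun x i => (h3 x i).trans d.CL_le, h4, h5, h7, h8⟩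

theorem norm_one_sub_le {m : ℕ} {A : Matrix (Fin m) (Fin m) ℂ} {C : ℝ} (hA : ∀ i j, ‖A i j‖ ≤ C)
    (i j : Fin m) : ‖(1 - A) i j‖ ≤ 1 + C := by
  rw [Matrix.sub_apply]
  refine norm_sub_le_of_le ?_ (hA i j)
  rw [Matrix.one_apply]
  split_ifs <;> simp

/-- The projection to the hyperbolic subspace. -/
noncomputable def hypProj : Phase l →L[ℝ] Hyp l d.α (d.h ^ 2) :=
  (Hs.multiplier (Q := fun n => 1 - centralProj (LSH d.α (d.h ^ 2) n)) (C := 1 + d.C)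
    (by linarith [d.C_nonneg]) fun n => norm_one_sub_le (d.shBlock n).bound).prodMap
  (Hs.multiplier (Q := fun n => 1 - centralProj (Lcon (d.h ^ 2) n)) (C := 1 + d.C)
    (by linarith [d.C_nonneg]) fun n => norm_one_sub_le (d.conBlock n).bound)

/-- The projection to the central subspace. -/
noncomputable def centProj : Phase l →L[ℝ] Cent l d.α (d.h ^ 2) :=
  (Hs.multiplier (Q := fun n => centralProj (LSH d.α (d.h ^ 2) n)) d.C_nonneg
    fun n => (d.shBlock n).bound).prodMap
  (Hs.multiplier (Q := fun n => centralProj (Lcon (d.h ^ 2) n)) d.C_nonneg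
    fun n => (d.conBlock n).bound)

theorem state_add (u v : Phase l) (k : ℤ ⊕ ℤ) : d.state (u + v) k = d.state u k + d.state v k := by
  rcases k with n | n <;> rfl

/-- The point of the phase space in the subspace. -/
def inclC (x : Cent l d.α (d.h ^ 2)) : Phase l := ((x.1 : Hs l 4), (x.2 : Hs l 2))

/-- The point of the phase space in the subspace. -/
def inclH (x : Hyp l d.α (d.h ^ 2)) : Phase l := ((x.1 : Hs l 4), (x.2 : Hs l 2))

theorem state_hypProj (u : Phase l) (k : ℤ ⊕ ℤ) :
    d.state (d.inclH (d.hypProj u)) k = d.state u k - d.proj k *ᵥ d.state u k := by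
  rcases k with n | n
  · change (1 - centralProj (LSH d.α (d.h ^ 2) n)) *ᵥ (u.1.coeff n).ofLp = (u.1.coeff n).ofLp -
      centralProj (LSH d.α (d.h ^ 2) n) *ᵥ (u.1.coeff n).ofLp
    rw [Matrix.sub_mulVec, Matrix.one_mulVec]
  · change (1 - centralProj (Lcon (d.h ^ 2) n)) *ᵥ (u.2.coeff n).ofLp = (u.2.coeff n).ofLp -
      centralProj (Lcon (d.h ^ 2) n) *ᵥ (u.2.coeff n).ofLp
    rw [Matrix.sub_mulVec, Matrix.one_mulVec]

theorem state_centProj (u : Phase l) (k : ℤ ⊕ ℤ) :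
    d.state (d.inclC (d.centProj u)) k = d.proj k *ᵥ d.state u k := by
  rcases k with n | n <;> rfl

theorem inclH_injective : Function.Injective (d.inclH (l := l)) := fun _ _ h =>
  Prod.ext (Subtype.ext (congrArg Prod.fst h)) (Subtype.ext (congrArg Prod.snd h))

theorem state_zero (k : ℤ ⊕ ℤ) : d.state (0 : Phase l) k = 0 := by
  rcases k with n | n <;> rfl

variable {Z : Coord → d.system.Idx →ᵇ ℂ} (hl : 0 ≤ l) (hs : 4 + l ≤ d.s)

/-- The reduction function, given by the hyperbolic parts of the graph. -/
noncomputable def reduction (Z : Coord → d.system.Idx →ᵇ ℂ) (x : Cent l d.α (d.h ^ 2)) :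
    Hyp l d.α (d.h ^ 2) := d.hypProj (d.toPhase hl hs (Z (d.coord hl x)))

variable {d}

/-- The solution through the graph has central part `x` by construction, so adding its hyperbolic
part to `x` recovers it. -/
theorem IsGraph.state_graphPt (hZ : d.IsGraph Z) {x : Cent l d.α (d.h ^ 2)} {X : d.system.State}
    (hX : ∀ i, d.system.scaled X i = Z (d.coord hl x) i) :
    d.state (graphPt (d.reduction hl hs Z) x) = X := by
  obtain ⟨Y, hY, hYb, hYZ, hYP⟩ := hZ.exists_solution (d.coord hl x)
  have hXY : X = Y 0 := by
    rw [← d.state_toPhase hl hs _ hX, d.state_toPhase hl hs _ hYZ]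
  subst hXY
  funext k
  have h1 : graphPt (d.reduction hl hs Z) x =
    d.inclC x + d.inclH (d.hypProj (d.toPhase hl hs (Z (d.coord hl x)))) := rfl
  rw [h1, state_add, state_hypProj, d.state_toPhase hl hs _ hYZ, hYP,
    show d.state (d.inclC x) k = d.central (d.coord hl x) k from (d.central_coord hl x k).symm,
    add_sub_cancel]

theorem IsGraph.scaled_state_graphPt (hZ : d.IsGraph Z) (x : Cent l d.α (d.h ^ 2))
    (i : d.system.Idx) : d.system.scaled (d.state (graphPt (d.reduction hl hs Z) x)) i =
      Z (d.coord hl x) i := by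
  obtain ⟨Y, -, -, hYZ, -⟩ := hZ.exists_solution (d.coord hl x)
  rw [hZ.state_graphPt hl hs hYZ, hYZ]

theorem IsGraph.contDiff_reduction (hZ : d.IsGraph Z) : ContDiff ℝ 1 (d.reduction hl hs Z) :=
  d.hypProj.contDiff.comp ((d.toPhase hl hs).contDiff.comp
    (hZ.contDiff.comp (d.coord hl).contDiff))

theorem IsGraph.reduction_zero (hZ : d.IsGraph Z) : d.reduction hl hs Z 0 = 0 := by
  rw [reduction, map_zero, hZ.zero, map_zero, map_zero]

/-- At the origin the derivative of the graph is the inclusion of the central data, which the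
hyperbolic projection annihilates. -/
theorem IsGraph.fderiv_reduction_zero (hZ : d.IsGraph Z) :
    fderiv ℝ (d.reduction hl hs Z) 0 = 0 := by
  obtain ⟨Z', hZ', hZ's⟩ := hZ.deriv
  have h1 : HasFDerivAt Z Z' (d.coord hl 0) := by rwa [map_zero]
  have h2 : HasFDerivAt (d.reduction hl hs Z)
      (d.hypProj ∘L (d.toPhase hl hs ∘L (Z' ∘L d.coord hl))) 0 :=
    d.hypProj.hasFDerivAt.comp 0 ((d.toPhase hl hs).hasFDerivAt.comp 0
      (h1.comp 0 (d.coord hl).hasFDerivAt))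
  rw [h2.fderiv]
  refine ContinuousLinearMap.ext fun x => ?_
  refine d.inclH_injective (d.state_injective (funext fun k => ?_))
  change d.state (d.inclH (d.hypProj (d.toPhase hl hs (Z' (d.coord hl x))))) k =
    d.state (0 : Phase l) k
  rw [state_hypProj, d.state_toPhase hl hs _ fun i => (hZ's (d.coord hl x) i).symm,
    show d.proj k *ᵥ d.central (d.coord hl x) k = d.central (d.coord hl x) k from
      d.centralData.mem_range _ k, sub_self, state_zero]

end FrontData

/-! ### From mode solutions to solutions in `H^l` -/

theorem norm_intCast_le_wt (n : ℤ) : ‖(n : ℂ)‖ ≤ wt n := by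
  rw [Complex.norm_intCast, wt]; linarith

theorem norm_LSH_le (α c : ℝ) (n : ℤ) (i j : Fin 4) :
    ‖LSH α c n i j‖ ≤ (20 + |α| + |c|) * wt n ^ 4 := by
  have h0 := one_le_wt n
  have h1 : (1 : ℝ) ≤ wt n ^ 4 := one_le_pow₀ h0
  have hn := norm_intCast_le_wt n
  have hα := abs_nonneg α
  have hc := abs_nonneg c
  have hz : (0 : ℝ) ≤ (20 + |α| + |c|) * wt n ^ 4 := by positivity
  have ho : (1 : ℝ) ≤ (20 + |α| + |c|) * wt n ^ 4 := by nlinarith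
  have hn2 : ‖(n : ℂ) ^ 2‖ ≤ wt n ^ 2 := by
    rw [norm_pow]; exact pow_le_pow_left₀ (norm_nonneg _) hn 2
  have h12 : (1 : ℝ) ≤ wt n ^ 2 := one_le_pow₀ h0
  have hb : ‖1 - (n : ℂ) ^ 2‖ ≤ 2 * wt n ^ 2 := by
    refine (norm_sub_le _ _).trans ?_
    rw [norm_one]; linarith
  have a0 : ‖-(1 - (n : ℂ) ^ 2) ^ 2 + (α : ℂ)‖ ≤ (20 + |α| + |c|) * wt n ^ 4 := by
    have : ‖(1 - (n : ℂ) ^ 2) ^ 2‖ ≤ (2 * wt n ^ 2) ^ 2 := by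
      rw [norm_pow]; exact pow_le_pow_left₀ (norm_nonneg _) hb 2
    refine (norm_add_le _ _).trans ?_
    rw [norm_neg, Complex.norm_real, Real.norm_eq_abs]
    nlinarith
  have h3 : wt n ^ 3 ≤ wt n ^ 4 := pow_le_pow_right₀ h0 (by norm_num)
  have h2 : wt n ^ 2 ≤ wt n ^ 4 := pow_le_pow_right₀ h0 (by norm_num)
  have h1' : wt n ≤ wt n ^ 4 := by simpa using pow_le_pow_right₀ h0 (show 1 ≤ 4 by norm_num)
  have a1 : ‖-4 * Complex.I * n * (1 - (n : ℂ) ^ 2) + (c : ℂ)‖ ≤ (20 + |α| + |c|) * wt n ^ 4 := by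
    have e : ‖-4 * Complex.I * n * (1 - (n : ℂ) ^ 2)‖ ≤ 4 * wt n * (2 * wt n ^ 2) := by
      rw [norm_mul, norm_mul, norm_mul, norm_neg, Complex.norm_I, Complex.norm_ofNat, mul_one]
      gcongr
    refine (norm_add_le _ _).trans ?_
    rw [Complex.norm_real, Real.norm_eq_abs]
    nlinarith
  have a2 : ‖6 * (n : ℂ) ^ 2 - 2‖ ≤ (20 + |α| + |c|) * wt n ^ 4 := by
    refine (norm_sub_le _ _).trans ?_
    rw [norm_mul, Complex.norm_ofNat, Complex.norm_ofNat]
    nlinarith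
  have a3 : ‖-4 * Complex.I * (n : ℂ)‖ ≤ (20 + |α| + |c|) * wt n ^ 4 := by
    rw [norm_mul, norm_mul, norm_neg, Complex.norm_I, Complex.norm_ofNat, mul_one]
    nlinarith
  fin_cases i <;> fin_cases j <;> simp only [LSH] <;>
    first
    | exact a0
    | exact a1
    | exact a2
    | exact a3
    | simpa using hz
    | simpa using ho

theorem norm_Lcon_le (c : ℝ) (n : ℤ) (i j : Fin 2) :
    ‖Lcon c n i j‖ ≤ (20 + |c|) * wt n ^ 4 := by
  have h0 := one_le_wt n
  have h1 : (1 : ℝ) ≤ wt n ^ 4 := one_le_pow₀ h0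
  have hn := norm_intCast_le_wt n
  have hc := abs_nonneg c
  have hz : (0 : ℝ) ≤ (20 + |c|) * wt n ^ 4 := by positivity
  have ho : (1 : ℝ) ≤ (20 + |c|) * wt n ^ 4 := by nlinarith
  have h2 : wt n ^ 2 ≤ wt n ^ 4 := pow_le_pow_right₀ h0 (by norm_num)
  have h1' : wt n ≤ wt n ^ 4 := by simpa using pow_le_pow_right₀ h0 (show 1 ≤ 4 by norm_num)
  have a0 : ‖(n : ℂ) ^ 2‖ ≤ (20 + |c|) * wt n ^ 4 := by
    have : ‖(n : ℂ) ^ 2‖ ≤ wt n ^ 2 := by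
      rw [norm_pow]; exact pow_le_pow_left₀ (norm_nonneg _) hn 2
    nlinarith
  have a1 : ‖-2 * Complex.I * n - (c : ℂ)‖ ≤ (20 + |c|) * wt n ^ 4 := by
    refine (norm_sub_le _ _).trans ?_
    rw [norm_mul, norm_mul, norm_neg, Complex.norm_I, Complex.norm_ofNat, mul_one,
      Complex.norm_real, Real.norm_eq_abs]
    nlinarith
  fin_cases i <;> fin_cases j <;> simp only [Lcon] <;>
    first
    | exact a0
    | exact a1
    | simpa using hz
    | simpa using ho

theorem hasDerivAt_toLp {m : ℕ} {X : ℝ → Fin m → ℂ} {X' : Fin m → ℂ} {ξ : ℝ}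
    (h : HasDerivAt X X' ξ) : HasDerivAt (fun t => (WithLp.toLp 2 (X t) : EuclideanSpace ℂ (Fin m)))
      (WithLp.toLp 2 X') ξ :=
  (PiLp.continuousLinearEquiv 2 ℝ (fun _ : Fin m => ℂ)).symm.hasFDerivAt.comp_hasDerivAt ξ h

namespace FrontData

variable {d : FrontData} {l : ℝ}

theorem norm_state_le {X : d.system.State} (hX : ∀ i, ‖d.system.scaled X i‖ ≤ 1)
    (i : d.system.Idx) : ‖X i.1 i.2‖ ≤ d.scale i := by
  have h := hX i
  rwa [ModeSystem.scaled, norm_div, Complex.norm_real, Real.norm_of_nonneg (d.scale_pos i).le,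
    div_le_one (d.scale_pos i)] at h

theorem norm_inl_le {X : d.system.State} (hX : ∀ i, ‖d.system.scaled X i‖ ≤ 1) (n : ℤ)
    (j : Fin 4) : ‖X (.inl n) j‖ ≤ (d.σU + d.σW) * wt n ^ (-(d.s - 3)) :=
  (norm_state_le hX ⟨.inl n, j⟩).trans ((le_abs_self _).trans (d.scale_idxU_le n j))

theorem norm_inr_le {X : d.system.State} (hX : ∀ i, ‖d.system.scaled X i‖ ≤ 1) (n : ℤ)
    (j : Fin 2) : ‖X (.inr n) j‖ ≤ (d.σU + d.σW) * wt n ^ (-(d.s - 3)) :=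
  (norm_state_le hX ⟨.inr n, j⟩).trans ((le_abs_self _).trans (d.scale_idxW_le n j))

theorem forceScale_le (k : ℤ ⊕ ℤ) : d.forceScale k ≤
    d.h ^ 2 * (d.σU + d.σW) * wt (Sum.elim id id k) ^ (-(d.s - 7)) := by
  have h1 := d.σU_pos
  have h2 := d.σW_pos
  rcases k with n | n
  · exact mul_le_mul (mul_le_mul_of_nonneg_left (by linarith) (sq_nonneg _))
      (wt_rpow_anti n (by linarith)) (wt_rpow_pos n _).le (by positivity)
  · exact mul_le_mul (mul_le_mul_of_nonneg_left (by linarith) (sq_nonneg _))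
      (wt_rpow_anti n (by linarith)) (wt_rpow_pos n _).le (by positivity)

theorem norm_vectorField_le {m : ℕ} {M : Matrix (Fin m) (Fin m) ℂ} {C A L B s : ℝ} {n : ℤ}
    (hM : ∀ i j, ‖M i j‖ ≤ C * wt n ^ 4) {x : Fin m → ℂ}
    (hx : ∀ j, ‖x j‖ ≤ A * wt n ^ (-(s - 3))) {f : ℂ} (hf : ‖f‖ ≤ L * (B * wt n ^ (-(s - 7))))
    {j₀ : Fin m} : ‖(WithLp.toLp 2 (M *ᵥ x + f • Pi.single j₀ 1) : EuclideanSpace ℂ (Fin m))‖ ≤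
      m * (m * C * A + L * B) * wt n ^ (-(s - 7)) := by
  have e : wt n ^ (-(s - 7)) = wt n ^ 4 * wt n ^ (-(s - 3)) := by
    rw [← Real.rpow_natCast, ← Real.rpow_add (wt_pos n)]; congr 1; push_cast; ring
  refine (euclidean_norm_le (B := (m * C * A + L * B) * wt n ^ (-(s - 7))) fun j => ?_).trans_eq
    (by ring)
  have h1 := norm_mulVec_le hM hx j
  have h2 : ‖(f • Pi.single j₀ 1 : Fin m → ℂ) j‖ ≤ L * (B * wt n ^ (-(s - 7))) := by
    rw [Pi.smul_apply, norm_smul]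
    refine (mul_le_of_le_one_right (norm_nonneg _) ?_).trans hf
    rw [Pi.single_apply]
    split_ifs <;> simp
  refine (norm_add_le_of_le h1 h2).trans_eq ?_
  rw [e]
  ring

/-- The choice `s = l + 9` pays for everything: states decay with order `s - 3 = l + 6`, enough for
`H^(l+4)`, and applying the linear part costs four more, leaving `l + 2`, enough to differentiate in
`H^l`. -/
theorem isSolutionOn_of_state (hl : 0 ≤ l) (hs : d.s = l + 9) {X : ℝ → d.system.State}
    (hX : d.system.IsModeSolution X) {I : Set ℝ} (hI : I.OrdConnected)
    (hXb : ∀ ξ ∈ I, ∀ i, ‖d.system.scaled (X ξ) i‖ ≤ 1) {G : ℝ → Phase l}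
    (hG : ∀ ξ ∈ I, d.state (G ξ) = X ξ) : IsSolutionOn d.α (d.h ^ 2) d.γ I G := by
  let aU : ℝ → Coeffs 4 := fun ξ n => WithLp.toLp 2 (X ξ (.inl n))
  let aW : ℝ → Coeffs 2 := fun ξ n => WithLp.toLp 2 (X ξ (.inr n))
  let bU : ℝ → Coeffs 4 := fun ξ n => WithLp.toLp 2 (LSH d.α (d.h ^ 2) n *ᵥ X ξ (.inl n) +
    d.nonlin (d.system.scaled (X ξ)) (.inl n) • Pi.single (Fin.last 3) 1)
  let bW : ℝ → Coeffs 2 := fun ξ n => WithLp.toLp 2 (Lcon (d.h ^ 2) n *ᵥ X ξ (.inr n) +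
    d.nonlin (d.system.scaled (X ξ)) (.inr n) • Pi.single (Fin.last 1) 1)
  have hGU : ∀ ξ ∈ I, (G ξ).1.coeff = aU ξ := fun ξ hξ => funext fun n =>
    WithLp.ofLp_injective 2 (congrFun (hG ξ hξ) (.inl n))
  have hGW : ∀ ξ ∈ I, (G ξ).2.coeff = aW ξ := fun ξ hξ => funext fun n =>
    WithLp.ofLp_injective 2 (congrFun (hG ξ hξ) (.inr n))
  have hf : ∀ ξ k, ‖d.nonlin (d.system.scaled (X ξ)) k‖ ≤
      d.L * (d.h ^ 2 * (d.σU + d.σW) * wt (Sum.elim id id k) ^ (-(d.s - 7))) := fun ξ k =>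
    (d.system.smooth.bound _ k).trans (mul_le_mul_of_nonneg_left (forceScale_le k) d.L_nonneg)
  have hbU : ∀ ξ ∈ I, ∀ n, ‖bU ξ n‖ ≤ _ * wt n ^ (-(d.s - 7)) := fun ξ hξ n =>
    norm_vectorField_le (norm_LSH_le d.α (d.h ^ 2) n) (norm_inl_le (hXb ξ hξ) n) (hf ξ (.inl n))
  have hbW : ∀ ξ ∈ I, ∀ n, ‖bW ξ n‖ ≤ _ * wt n ^ (-(d.s - 7)) := fun ξ hξ n =>
    norm_vectorField_le (norm_Lcon_le (d.h ^ 2) n) (norm_inr_le (hXb ξ hξ) n) (hf ξ (.inr n))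
  have hq : 1 < 2 * (d.s - 7) - 2 * l := by linarith
  intro ξ hξ
  have hYU := memH_of_bound hl hq (hbU ξ hξ)
  have hYW := memH_of_bound hl hq (hbW ξ hξ)
  refine ⟨?_, ?_, (Hs.ofCoeffs _ hYU, Hs.ofCoeffs _ hYW), fun n => ?_, fun n => ?_, ?_⟩
  · rw [hGU ξ hξ]
    exact memH_of_bound (q := d.s - 3) (by linarith) (by linarith) fun n =>
      (euclidean_norm_le (norm_inl_le (hXb ξ hξ) n)).trans_eq (mul_assoc _ _ _).symm
  · rw [hGW ξ hξ]
    exact memH_of_bound (q := d.s - 3) (by linarith) (by linarith) fun n =>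
      (euclidean_norm_le (norm_inr_le (hXb ξ hξ) n)).trans_eq (mul_assoc _ _ _).symm
  · refine WithLp.ofLp_injective 2 ?_
    rw [hGU ξ hξ, hGW ξ hξ, WithLp.ofLp_add, nonlinU_ofLp]
    change LSH d.α (d.h ^ 2) n *ᵥ X ξ (.inl n) +
      d.nonlin (d.system.scaled (X ξ)) (.inl n) • Pi.single (Fin.last 3) 1 = _
    rw [nonlin_inl (hXb ξ hξ)]
    rfl
  · refine WithLp.ofLp_injective 2 ?_
    rw [hGU ξ hξ, hGW ξ hξ, WithLp.ofLp_add, nonlinW_ofLp]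
    change Lcon (d.h ^ 2) n *ᵥ X ξ (.inr n) +
      d.nonlin (d.system.scaled (X ξ)) (.inr n) • Pi.single (Fin.last 1) 1 = _
    rw [nonlin_inr (hXb ξ hξ)]
    rfl
  · exact (Hs.hasDerivWithinAt_of_coeff hl hq hI (a := aU) (a' := bU)
      (fun n ξ => hasDerivAt_toLp (hX (.inl n) ξ)) hbU hGU hξ rfl).prodMk
      (Hs.hasDerivWithinAt_of_coeff hl hq hI (a := aW) (a' := bW)
      (fun n ξ => hasDerivAt_toLp (hX (.inr n) ξ)) hbW hGW hξ rfl)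

end FrontData

/-- Two solutions of an ordinary differential equation on an interval that agree at one point are
equal. -/
theorem ode_unique_of_ordConnected {F : Type*} [NormedAddCommGroup F] [NormedSpace ℝ F] {V : F → F}
    {K : NNReal} (hV : LipschitzWith K V) {I : Set ℝ} (hI : I.OrdConnected) {f g : ℝ → F}
    (hf : ∀ t ∈ I, HasDerivWithinAt f (V (f t)) I t)
    (hg : ∀ t ∈ I, HasDerivWithinAt g (V (g t)) I t) {a : ℝ} (ha : a ∈ I) (h : f a = g a) :
    EqOn f g I := by
  have key : ∀ {f : ℝ → F}, (∀ t ∈ I, HasDerivWithinAt f (V (f t)) I t) → ∀ {p q : ℝ}, p ∈ I →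
      q ∈ I → ContinuousOn f (Icc p q) ∧
        (∀ t ∈ Ico p q, HasDerivWithinAt f (V (f t)) (Ici t) t) ∧
        ∀ t ∈ Ioc p q, HasDerivWithinAt f (V (f t)) (Iic t) t := by
    intro f hf p q hp hq
    have hpq : Icc p q ⊆ I := hI.out hp hq
    refine ⟨fun t ht => ((hf t (hpq ht)).mono hpq).continuousWithinAt, fun t ht => ?_,
      fun t ht => ?_⟩
    · exact ((hf t (hpq ⟨ht.1, ht.2.le⟩)).mono hpq).mono_of_mem_nhdsWithin
        (Icc_mem_nhdsGE_of_mem ht)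
    · exact ((hf t (hpq ⟨ht.1.le, ht.2⟩)).mono hpq).mono_of_mem_nhdsWithin
        (Icc_mem_nhdsLE_of_mem ht)
  intro t ht
  rcases le_total a t with h1 | h1
  · obtain ⟨f1, f2, -⟩ := key hf ha ht
    obtain ⟨g1, g2, -⟩ := key hg ha ht
    exact ODE_solution_unique_of_mem_Icc_right (v := fun _ => V) (s := fun _ => univ)
      (fun _ _ => hV.lipschitzOnWith) f1 f2 (fun _ _ => mem_univ _) g1 g2 (fun _ _ => mem_univ _) h
      ⟨h1, le_rfl⟩
  · obtain ⟨f1, -, f2⟩ := key hf ht ha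
    obtain ⟨g1, -, g2⟩ := key hg ht ha
    exact ODE_solution_unique_of_mem_Icc_left (v := fun _ => V) (s := fun _ => univ)
      (fun _ _ => hV.lipschitzOnWith) f1 f2 (fun _ _ => mem_univ _) g1 g2 (fun _ _ => mem_univ _) h
      ⟨le_rfl, h1⟩

/-! ### The reduced system and its lift -/

namespace FrontData

open BoundedContinuousFunction

variable {d : FrontData} {l : ℝ} {Z : Coord → d.system.Idx →ᵇ ℂ}

variable (d) in
/-- The `k`-th mode of the reduced vector field. -/
noncomputable def reducedField (Z : Coord → d.system.Idx →ᵇ ℂ) (k : ℤ ⊕ ℤ) (x : Fin (size k) → ℂ)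
    (a : Coord) : Fin (size k) → ℂ :=
  d.proj k *ᵥ (d.mat k *ᵥ x) + d.nonlin (Z a) k • (d.proj k *ᵥ dir k)

/-- Both the graph and the nonlinearity after cutoff are globally Lipschitz, so no restriction to a
neighbourhood is required. -/
theorem IsGraph.lipschitz_reducedField (hZ : d.IsGraph Z) (k : ℤ ⊕ ℤ)
    (π : Coord →L[ℝ] (Fin (size k) → ℂ)) :
    ∃ K, LipschitzWith K fun a => d.reducedField Z k (π a) a := by
  obtain ⟨Λ, hΛ, hlip⟩ := hZ.lipschitz
  let A : (Fin (size k) → ℂ) →L[ℝ] (Fin (size k) → ℂ) :=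
    ((d.proj k * d.mat k).mulVecLin.restrictScalars ℝ).toContinuousLinearMap
  have h1 : LipschitzWith _ fun a => A (π a) := (A.comp π).lipschitz
  have hφ := (d.forceScale_pos k).le
  have hL := d.L_nonneg
  have h2 : LipschitzWith ⟨d.L * Λ * d.forceScale k * ‖d.proj k *ᵥ dir k‖, by positivity⟩
      fun a => d.nonlin (Z a) k • (d.proj k *ᵥ dir k) := by
    refine LipschitzWith.of_dist_le_mul fun a a' => ?_
    rw [dist_eq_norm, dist_eq_norm, ← sub_smul, norm_smul]
    have h3 := d.system.smooth.lip (Z a) (Z a') (Λ * ‖a - a'‖) (by positivity) (fun i =>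
      ((Z a - Z a').norm_coe_le_norm i).trans (hlip a a')) k
    calc _ ≤ d.L * (Λ * ‖a - a'‖) * d.forceScale k * ‖d.proj k *ᵥ dir k‖ := by
          gcongr
      _ = (d.L * Λ * d.forceScale k * ‖d.proj k *ᵥ dir k‖) * ‖a - a'‖ := by ring
  have e : (fun a => d.reducedField Z k (π a) a) =
      fun a => A (π a) + d.nonlin (Z a) k • (d.proj k *ᵥ dir k) := funext fun a => by
    rw [reducedField, Matrix.mulVec_mulVec]; rfl
  rw [e]
  exact ⟨_, h1.add h2⟩

theorem proj_idem (k : ℤ ⊕ ℤ) (x : Fin (size k) → ℂ) :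
    d.proj k *ᵥ (d.proj k *ᵥ x) = d.proj k *ᵥ x := by
  rcases k with n | n
  · rw [Matrix.mulVec_mulVec]; exact congrArg (· *ᵥ x) (d.shBlock n).idem
  · rw [Matrix.mulVec_mulVec]; exact congrArg (· *ᵥ x) (d.conBlock n).idem

theorem proj_mat_proj (k : ℤ ⊕ ℤ) (x : Fin (size k) → ℂ) :
    d.proj k *ᵥ (d.mat k *ᵥ (d.proj k *ᵥ x)) = d.proj k *ᵥ (d.mat k *ᵥ x) := by
  have h : d.mat k * d.proj k = d.proj k * d.mat k := by
    rcases k with n | n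
    · exact (d.shBlock n).comm
    · exact (d.conBlock n).comm
  rw [Matrix.mulVec_mulVec x (d.mat k), h, ← Matrix.mulVec_mulVec, proj_idem]

variable (d) in
/-- The reduced vector field in central coordinates. -/
noncomputable def reducedCoordField (Z : Coord → d.system.Idx →ᵇ ℂ) (a : Coord) : Coord :=
  (d.reducedField Z (.inl 1) a.1 a, d.reducedField Z (.inl (-1)) a.2.1 a,
    d.reducedField Z (.inr 0) a.2.2 a)

theorem IsGraph.lipschitz_reducedCoordField (hZ : d.IsGraph Z) :
    ∃ K, LipschitzWith K (d.reducedCoordField Z) := by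
  obtain ⟨K₁, h₁⟩ := hZ.lipschitz_reducedField (.inl 1) (ContinuousLinearMap.fst ℝ _ _)
  obtain ⟨K₂, h₂⟩ := hZ.lipschitz_reducedField (.inl (-1))
    ((ContinuousLinearMap.fst ℝ _ _).comp (ContinuousLinearMap.snd ℝ _ _))
  obtain ⟨K₃, h₃⟩ := hZ.lipschitz_reducedField (.inr 0)
    ((ContinuousLinearMap.snd ℝ _ _).comp (ContinuousLinearMap.snd ℝ _ _))
  exact ⟨_, h₁.prodMk (h₂.prodMk h₃)⟩

/-- The central coordinates of a mode solution on the graph solve the reduced system. -/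
theorem IsGraph.hasDerivAt_coord (hZ : d.IsGraph Z) {X : ℝ → d.system.State}
    (hX : d.system.IsModeSolution X) (hb : d.system.GrowthBounded X) :
    ∃ y : ℝ → Coord, (∀ ξ, y ξ = (d.proj (.inl 1) *ᵥ X ξ (.inl 1),
        d.proj (.inl (-1)) *ᵥ X ξ (.inl (-1)), d.proj (.inr 0) *ᵥ X ξ (.inr 0))) ∧
      (∀ ξ k, d.central (y ξ) k = d.proj k *ᵥ X ξ k) ∧
      ∀ ξ, HasDerivAt y (d.reducedCoordField Z (y ξ)) ξ := by
  let y : ℝ → Coord := fun ξ => (d.proj (.inl 1) *ᵥ X ξ (.inl 1),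
    d.proj (.inl (-1)) *ᵥ X ξ (.inl (-1)), d.proj (.inr 0) *ᵥ X ξ (.inr 0))
  have hy : ∀ ξ k, d.central (y ξ) k = d.proj k *ᵥ X ξ k := fun ξ k =>
    (d.central_eq (fun k => d.proj k *ᵥ X ξ k) k).trans (proj_idem k _)
  have hZy : ∀ ξ, d.system.scaled (X ξ) = Z (y ξ) := fun ξ =>
    funext fun i => hZ.unique X hX hb ξ (y ξ) (hy ξ) i
  have hd : ∀ k ξ, HasDerivAt (fun t => d.proj k *ᵥ X t k)
      (d.reducedField Z k (d.proj k *ᵥ X ξ k) (y ξ)) ξ := fun k ξ => by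
    refine (hasDerivAt_mulVec (d.proj k) (hX k ξ)).congr_deriv ?_
    rw [Matrix.mulVec_add, Matrix.mulVec_smul, hZy, reducedField, proj_mat_proj]
  exact ⟨y, fun _ => rfl, hy, fun ξ => (hd _ ξ).prodMk ((hd _ ξ).prodMk (hd _ ξ))⟩

/-- Central data of scaled size `1/2` and a forced part of size `1/2` add up to 1, the radius within
which the cutoff is inactive. -/
theorem IsGraph.norm_le_one (hZ : d.IsGraph Z) (hl : 0 ≤ l) {x : Cent l d.α (d.h ^ 2)}
    (hx : ∀ i, ‖d.system.scaled (d.state (d.inclC x)) i‖ ≤ 1 / 2) (i : d.system.Idx) :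
    ‖Z (d.coord hl x) i‖ ≤ 1 := by
  have h1 := hZ.close (d.coord hl x) i
  have h2 : d.central (d.coord hl x) = d.state (d.inclC x) := funext fun k => d.central_coord hl x k
  rw [h2] at h1
  calc _ = ‖(Z (d.coord hl x) i - d.system.scaled (d.state (d.inclC x)) i) +
        d.system.scaled (d.state (d.inclC x)) i‖ := by rw [sub_add_cancel]
    _ ≤ 1 / 2 + 1 / 2 := norm_add_le_of_le h1 (hx i)
    _ = 1 := by norm_num

theorem IsGraph.reduced_deriv (hZ : d.IsGraph Z) (hl : 0 ≤ l) (hs : 4 + l ≤ d.s)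
    {x y : Cent l d.α (d.h ^ 2)}
    (hx : ∀ i, ‖d.system.scaled (d.state (d.inclC x)) i‖ ≤ 1 / 2)
    (h1 : ∀ n, (y.1 : Hs l 4).coeff n
      = act (centralProj (LSH d.α (d.h ^ 2) n)) (act (LSH d.α (d.h ^ 2) n) ((x.1 : Hs l 4).coeff n))
        + act (centralProj (LSH d.α (d.h ^ 2) n))
            (nonlinU d.γ (graphPt (d.reduction hl hs Z) x).1.coeff
              (graphPt (d.reduction hl hs Z) x).2.coeff n))
    (h2 : ∀ n, (y.2 : Hs l 2).coeff n
      = act (centralProj (Lcon (d.h ^ 2) n)) (act (Lcon (d.h ^ 2) n) ((x.2 : Hs l 2).coeff n))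
        + act (centralProj (Lcon (d.h ^ 2) n))
            (nonlinW (d.h ^ 2) d.γ (graphPt (d.reduction hl hs Z) x).1.coeff n)) :
    d.coord hl y = d.reducedCoordField Z (d.coord hl x) := by
  have hb := hZ.norm_le_one hl hx
  have hsc := hZ.scaled_state_graphPt hl hs x
  have hsc' : d.system.scaled (d.state (graphPt (d.reduction hl hs Z) x)) = Z (d.coord hl x) :=
    funext hsc
  have hone : ∀ i, ‖d.system.scaled (d.state (graphPt (d.reduction hl hs Z) x)) i‖ ≤ 1 :=
    fun i => by rw [hsc]; exact hb i
  have key : ∀ k, d.state (d.inclC y) k =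
      d.reducedField Z k (d.state (d.inclC x) k) (d.coord hl x) := fun k => by
    rcases k with n | n
    · rw [reducedField, ← hsc', nonlin_inl hone]
      have e := congrArg WithLp.ofLp (h1 n)
      rw [WithLp.ofLp_add, act, act, act, nonlinU_ofLp, Matrix.mulVec_smul] at e
      exact e
    · rw [reducedField, ← hsc', nonlin_inr hone]
      have e := congrArg WithLp.ofLp (h2 n)
      rw [WithLp.ofLp_add, act, act, act, nonlinW_ofLp, Matrix.mulVec_smul] at e
      exact e
  exact Prod.ext (key (.inl 1)) (Prod.ext (key (.inl (-1))) (key (.inr 0)))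

/-- Solutions of the reduced system lift to solutions of the full system. -/
theorem IsGraph.isSolutionOn_graphPt (hZ : d.IsGraph Z) (hl : 0 ≤ l) (hs : 4 + l ≤ d.s)
    (hs' : d.s = l + 9) {I : Set ℝ} (hI : I.OrdConnected) {x : ℝ → Cent l d.α (d.h ^ 2)}
    (hx : ∀ ξ ∈ I, ∀ i, ‖d.system.scaled (d.state (d.inclC (x ξ))) i‖ ≤ 1 / 2)
    (hred : IsReducedSolutionOn d.γ (d.reduction hl hs Z) I x) :
    IsSolutionOn d.α (d.h ^ 2) d.γ I fun ξ => graphPt (d.reduction hl hs Z) (x ξ) := by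
  rcases I.eq_empty_or_nonempty with rfl | ⟨ξ₀, hξ₀⟩
  · intro ξ hξ; exact absurd hξ (notMem_empty ξ)
  -- A global solution of the system with cutoff through the graph point at `ξ₀`. Its central
  -- coordinates obey the same Lipschitz equation as the given reduced solution, with the same value
  -- at `ξ₀`.
  obtain ⟨Y, hY, hYb, hYZ, hYP⟩ := hZ.exists_solution (d.coord hl (x ξ₀))
  have hX := hY.translate (-ξ₀)
  have hXb := hYb.translate (-ξ₀)
  obtain ⟨y, hy0, hy, hyd⟩ := hZ.hasDerivAt_coord hX hXb
  obtain ⟨K, hK⟩ := hZ.lipschitz_reducedCoordField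
  have hxd : ∀ t ∈ I, HasDerivWithinAt (fun t => d.coord hl (x t))
      (d.reducedCoordField Z (d.coord hl (x t))) I t := fun t ht => by
    obtain ⟨z, h1, h2, h3⟩ := hred t ht
    rw [← hZ.reduced_deriv hl hs (hx t ht) h1 h2]
    exact (d.coord hl).hasFDerivAt.comp_hasDerivWithinAt t h3
  have h0 : d.coord hl (x ξ₀) = y ξ₀ := by
    have h1 : ∀ k, d.state (d.inclC (x ξ₀)) k = d.proj k *ᵥ Y (ξ₀ + -ξ₀) k := fun k => by
      rw [add_neg_cancel, hYP]
      exact (d.central_coord hl (x ξ₀) k).symm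
    rw [hy0, ← h1, ← h1, ← h1]
    rfl
  have heq := ode_unique_of_ordConnected hK hI hxd (fun t _ => (hyd t).hasDerivWithinAt) hξ₀ h0
  have hsc : ∀ ξ ∈ I, ∀ i, d.system.scaled (Y (ξ + -ξ₀)) i = Z (d.coord hl (x ξ)) i :=
    fun ξ hξ i => by
      rw [show d.coord hl (x ξ) = y ξ from heq hξ]
      exact hZ.unique _ hX hXb ξ (y ξ) (hy ξ) i
  exact isSolutionOn_of_state hl hs' hX hI
    (fun ξ hξ i => by rw [hsc ξ hξ]; exact hZ.norm_le_one hl (hx ξ hξ) i)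
    (fun ξ hξ => hZ.state_graphPt hl hs (hsc ξ hξ))

end FrontData

/-! ### Small bounded solutions lie on the graph -/

theorem Hs.sq_sum_le {l b : ℝ} {m : ℕ} (hl : 0 ≤ l) {v : Hs l m} (hv : ‖v‖ ≤ b) (j : Fin m) :
    Summable (fun n => (wt n ^ l * ‖v.coeff n j‖) ^ 2) ∧
      ∑' n, (wt n ^ l * ‖v.coeff n j‖) ^ 2 ≤ (2 ^ l * b) ^ 2 := by
  have hle : ∀ n, (wt n ^ l * ‖v.coeff n j‖) ^ 2 ≤ (wt n ^ l * ‖v.coeff n‖) ^ 2 := fun n => by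
    have := wt_rpow_pos n l
    gcongr
    exact norm_apply_le _ _
  have hs := Hs.summable_wt_mul_sq hl v
  have hs' := Summable.of_nonneg_of_le (fun _ => sq_nonneg _) hle hs
  have h2 : (1 : ℝ) ≤ 2 ^ l := Real.one_le_rpow (by norm_num) hl
  refine ⟨hs', (hs'.tsum_le_tsum hle hs).trans ((Hs.tsum_wt_mul_sq_le hl v).trans ?_)⟩
  have h3 : ‖v‖ ^ 2 ≤ b ^ 2 := pow_le_pow_left₀ (norm_nonneg _) hv 2
  rw [mul_pow]
  calc (2 : ℝ) ^ l * ‖v‖ ^ 2 ≤ 2 ^ l * b ^ 2 := by gcongr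
    _ ≤ (2 ^ l) ^ 2 * b ^ 2 := by
      refine mul_le_mul_of_nonneg_right ?_ (sq_nonneg b)
      nlinarith

/-- The mode equations of a solution on the whole line. -/
theorem IsSolutionOn.hasDerivAt_coeff {α c γ l : ℝ} (hl : 0 ≤ l) {X : ℝ → Phase l}
    (hX : IsSolutionOn α c γ univ X) (n : ℤ) (ξ : ℝ) :
    HasDerivAt (fun t => ((X t).1.coeff n).ofLp) (LSH α c n *ᵥ ((X ξ).1.coeff n).ofLp +
      forceU γ (fun n => ((X ξ).1.coeff n).ofLp) (fun n => ((X ξ).2.coeff n).ofLp) n •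
        Pi.single (Fin.last 3) 1) ξ ∧
    HasDerivAt (fun t => ((X t).2.coeff n).ofLp) (Lcon c n *ᵥ ((X ξ).2.coeff n).ofLp +
      forceW c γ (fun n => ((X ξ).1.coeff n).ofLp) n • Pi.single (Fin.last 1) 1) ξ := by
  obtain ⟨-, -, Y, h1, h2, h3⟩ := hX ξ (mem_univ ξ)
  rw [hasDerivWithinAt_univ] at h3
  have a1 := ((Hs.coeffCLM hl n).comp (ContinuousLinearMap.fst ℝ (Hs l 4)
    (Hs l 2))).hasFDerivAt.comp_hasDerivAt ξ h3
  have a2 := ((Hs.coeffCLM hl n).comp (ContinuousLinearMap.snd ℝ (Hs l 4)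
    (Hs l 2))).hasFDerivAt.comp_hasDerivAt ξ h3
  have e1 := congrArg WithLp.ofLp (h1 n)
  have e2 := congrArg WithLp.ofLp (h2 n)
  rw [WithLp.ofLp_add, nonlinU_ofLp] at e1
  rw [WithLp.ofLp_add, nonlinW_ofLp] at e2
  exact ⟨a1.congr_deriv e1, a2.congr_deriv e2⟩

namespace FrontData

open BoundedContinuousFunction

variable {d : FrontData} {l : ℝ} {Z : Coord → d.system.Idx →ᵇ ℂ}

/-- Small solutions lie on the graph. -/
theorem IsGraph.graphPt_centProj (hZ : d.IsGraph Z) (hl : 0 ≤ l) (hs : 4 + l ≤ d.s)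
    {X : ℝ → Phase l} (hX : IsSolutionOn d.α (d.h ^ 2) d.γ univ X)
    (hb : ∀ ξ i, ‖d.system.scaled (d.state (X ξ)) i‖ ≤ 1) (ξ : ℝ) :
    graphPt (d.reduction hl hs Z) (d.centProj (X ξ)) = X ξ := by
  have hmode : d.system.IsModeSolution fun t => d.state (X t) := fun k ξ => by
    rcases k with n | n
    · refine (hX.hasDerivAt_coeff hl n ξ).1.congr_deriv ?_
      change _ = LSH d.α (d.h ^ 2) n *ᵥ ((X ξ).1.coeff n).ofLp +
        d.nonlin (d.system.scaled (d.state (X ξ))) (.inl n) • Pi.single (Fin.last 3) 1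
      rw [nonlin_inl (hb ξ)]
      rfl
    · refine (hX.hasDerivAt_coeff hl n ξ).2.congr_deriv ?_
      change _ = Lcon (d.h ^ 2) n *ᵥ ((X ξ).2.coeff n).ofLp +
        d.nonlin (d.system.scaled (d.state (X ξ))) (.inr n) • Pi.single (Fin.last 1) 1
      rw [nonlin_inr (hb ξ)]
      rfl
  have hgrow : d.system.GrowthBounded fun t => d.state (X t) := ⟨1, fun ξ i => by
    rw [one_mul]
    exact (hb ξ i).trans (ModeSystem.one_le_exp_abs (𝒮 := d.system) ξ)⟩
  refine d.state_injective (hZ.state_graphPt hl hs ?_)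
  refine hZ.unique _ hmode hgrow ξ _ fun k => ?_
  rw [← d.state_centProj]
  exact d.central_coord hl _ k

/-- Scaled bounds of a state from bounds of its modes. -/
theorem norm_scaled_le {u : Phase l} {b : ℝ}
    (hU : ∀ n (j : Fin 4), ‖u.1.coeff n j‖ ≤ b * (d.σU * wt n ^ ((j : ℝ) - d.s)))
    (hW : ∀ n (j : Fin 2), ‖u.2.coeff n j‖ ≤ b * (d.σW * wt n ^ ((j : ℝ) - d.s)))
    (i : d.system.Idx) : ‖d.system.scaled (d.state u) i‖ ≤ b := by
  have h : ‖d.state u i.1 i.2‖ ≤ b * d.scale i := by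
    obtain ⟨n | n, j⟩ := i
    · exact hU n j
    · exact hW n j
  rw [ModeSystem.scaled, norm_div, Complex.norm_real, Real.norm_of_nonneg (d.scale_pos i).le]
  exact (div_le_iff₀ (d.scale_pos i)).2 h

/-- Bounds of the scaled modes of small central points. -/
theorem norm_scaled_inclC_le (hl : 0 ≤ l) (hs : 0 ≤ d.s) {x : Cent l d.α (d.h ^ 2)}
    (hU : ‖x.1‖ ≤ 2 ^ (-(d.s + l + 1)) * d.σU) (hW : ‖x.2‖ ≤ 2 ^ (-(d.s + l + 1)) * d.σW)
    (i : d.system.Idx) : ‖d.system.scaled (d.state (d.inclC x)) i‖ ≤ 1 / 2 := by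
  -- Of the exponent `s + l + 1`, the part `l` covers the passage from the `H^l` norm to
  -- coefficients, `s` the weight of the central modes, which is at most 2, and 1 leaves the bound
  -- `1/2`.
  have h2 : (2 : ℝ) ^ l * 2 ^ (-(d.s + l + 1)) = 1 / 2 * 2 ^ (-d.s) := by
    rw [← Real.rpow_add (by norm_num), show l + -(d.s + l + 1) = -1 + -d.s by ring,
      Real.rpow_add (by norm_num), Real.rpow_neg_one]
    norm_num
  have key : ∀ {m : ℕ} (v : Hs l m) (σ : ℝ), 0 < σ → ‖v‖ ≤ 2 ^ (-(d.s + l + 1)) * σ →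
      ∀ n (j : Fin m), wt n ≤ 2 ∨ v.coeff n = 0 →
      ‖v.coeff n j‖ ≤ 1 / 2 * (σ * wt n ^ ((j : ℝ) - d.s)) := by
    intro m v σ hσ hv n j hn
    have hw := wt_rpow_pos n ((j : ℝ) - d.s)
    rcases hn with hn | hn
    · have h3 : (2 : ℝ) ^ (-d.s) ≤ wt n ^ ((j : ℝ) - d.s) :=
        (Real.rpow_le_rpow_of_nonpos (wt_pos n) hn (by linarith)).trans
          (wt_rpow_anti n (by have : (0 : ℝ) ≤ j := by positivity
                              linarith))
      calc ‖v.coeff n j‖ ≤ 2 ^ l * ‖v‖ * wt n ^ (-l) :=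
            (norm_apply_le _ _).trans (Hs.norm_coeff_le hl v n)
        _ ≤ 2 ^ l * ‖v‖ * 1 := by
          gcongr
          exact SmallModes.wt_rpow_neg_le_one hl n
        _ ≤ 2 ^ l * (2 ^ (-(d.s + l + 1)) * σ) * 1 := by gcongr
        _ = 1 / 2 * (σ * 2 ^ (-d.s)) := by rw [mul_one, ← mul_assoc, h2]; ring
        _ ≤ _ := by gcongr
    · rw [hn, PiLp.zero_apply, norm_zero]
      positivity
  refine norm_scaled_le (fun n j => key _ _ d.σU_pos hU n j ?_)
    (fun n j => key _ _ d.σW_pos hW n j ?_) i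
  · by_cases h1 : n = 1
    · exact Or.inl (by subst h1; norm_num [wt])
    by_cases h2 : n = -1
    · exact Or.inl (by subst h2; norm_num [wt])
    obtain ⟨y, hy⟩ := x.1.2
    exact Or.inr (by
      change (x.1 : Hs l 4).coeff n = 0
      rw [hy]
      change act (centralProj (LSH d.α (d.h ^ 2) n)) _ = 0
      rw [d.shProj n h1 h2]
      simp [act])
  · by_cases h1 : n = 0
    · exact Or.inl (by subst h1; norm_num [wt])
    obtain ⟨y, hy⟩ := x.2.2
    exact Or.inr (by
      change (x.2 : Hs l 2).coeff n = 0
      rw [hy]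
      change act (centralProj (Lcon (d.h ^ 2) n)) _ = 0
      rw [d.conProj n h1]
      simp [act])

/-- A small bounded solution has small scaled modes. -/
theorem norm_scaled_solution_le (hl : 1 / 2 < l) (hs : d.s = l + 9) {D r : ℝ} (hr : 0 < r)
    (hD : ∀ {u w U W}, SmallModes l d.γ d.C d.α d.h u w U W →
      ModeBound U (D * u) (l + (8 + 1 : ℕ)) ∧ ModeBound W (D * w) (l + (8 + 1 : ℕ)))
    (hr1 : 2 ^ l * r ≤ 1) (hrD : D * (2 ^ l * r) ≤ 1) (hUW : d.σU ^ 2 ≤ d.σW)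
    (hW : d.σW ≤ d.h ^ 2) {X : ℝ → Phase l} (hX : IsSolutionOn d.α (d.h ^ 2) d.γ univ X)
    (hb : ∀ ξ, ‖(X ξ).1‖ < r * d.σU ∧ ‖(X ξ).2‖ < r * d.σW) (ξ : ℝ) (i : d.system.Idx) :
    ‖d.system.scaled (d.state (X ξ)) i‖ ≤ 1 := by
  have hσU := d.σU_pos
  have hσW := d.σW_pos
  have hl0 : 0 ≤ l := by linarith
  have h2 : (0 : ℝ) < 2 ^ l := Real.rpow_pos_of_pos (by norm_num) l
  -- The factor `2 ^ l` converts the weight `1 + n²` of the norm into `wt n ^ 2`; `2 ^ l * r ≤ 1`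
  -- preserves the relations between the amplitudes and `h²`.
  have H : SmallModes l d.γ d.C d.α d.h (2 ^ l * (r * d.σU)) (2 ^ l * (r * d.σW))
      (fun ξ n => ((X ξ).1.coeff n).ofLp) (fun ξ n => ((X ξ).2.coeff n).ofLp) :=
    { h_pos := d.h_pos
      u_pos := by positivity
      u_sq_le := by
        calc (2 ^ l * (r * d.σU)) ^ 2 = (2 ^ l * r) * (2 ^ l * r * d.σU ^ 2) := by ring
          _ ≤ 1 * (2 ^ l * r * d.σW) := by gcongr
          _ = _ := by ring
      w_le := by
        calc 2 ^ l * (r * d.σW) = (2 ^ l * r) * d.σW := by ring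
          _ ≤ 1 * d.h ^ 2 := by gcongr
          _ = _ := by ring
      shBlock := d.shBlock
      conBlock := d.conBlock
      shProj := d.shProj
      conProj := d.conProj
      derivU := fun n ξ => (hX.hasDerivAt_coeff hl0 n ξ).1
      derivW := fun n ξ => (hX.hasDerivAt_coeff hl0 n ξ).2
      sqU := fun ξ j => Hs.sq_sum_le hl0 (hb ξ).1.le j
      sqW := fun ξ j => Hs.sq_sum_le hl0 (hb ξ).2.le j }
  obtain ⟨h1, h1'⟩ := hD H
  have e : l + ((8 + 1 : ℕ) : ℝ) = d.s := by rw [hs]; norm_num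
  rw [e] at h1 h1'
  refine norm_scaled_le (fun n j => (h1 ξ n j).trans ?_) (fun n j => (h1' ξ n j).trans ?_) i
  · have := wt_rpow_pos n ((j : ℝ) - d.s)
    calc D * (2 ^ l * (r * d.σU)) * wt n ^ ((j : ℝ) - d.s)
        = D * (2 ^ l * r) * (d.σU * wt n ^ ((j : ℝ) - d.s)) := by ring
      _ ≤ _ := by gcongr
  · have := wt_rpow_pos n ((j : ℝ) - d.s)
    calc D * (2 ^ l * (r * d.σW)) * wt n ^ ((j : ℝ) - d.s)
        = D * (2 ^ l * r) * (d.σW * wt n ^ ((j : ℝ) - d.s)) := by ring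
      _ ≤ _ := by gcongr

end FrontData

/-! ### Choice of constants and conclusion -/

theorem ConvWeight.mono {K K' : ℝ} {τ₁ τ₂ τ₃ : ℤ → ℝ} (h : ConvWeight K τ₁ τ₂ τ₃) (hK : K ≤ K')
    (hτ : ∀ n, 0 ≤ τ₃ n) : ConvWeight K' τ₁ τ₂ τ₃ :=
  ⟨h.nonneg₁, h.nonneg₂, h.summable, fun n =>
    (h.tsum_le n).trans (mul_le_mul_of_nonneg_right hK (hτ n))⟩

namespace FrontData

variable {d : FrontData} {l : ℝ}

theorem norm_centProj_lt {b σ τ : ℝ} (hC : 0 < d.C) {u : Phase l} (hU : ‖u.1‖ < b * σ)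
    (hW : ‖u.2‖ < b * τ) {R : ℝ} (hR : 16 * d.C * b = R) :
    ‖(d.centProj u).1‖ < R * σ ∧ ‖(d.centProj u).2‖ < R * τ := by
  have hbτ : 0 < b * τ := (norm_nonneg _).trans_lt hW
  constructor
  · calc ‖(d.centProj u).1‖ ≤ (4 : ℕ) * ((4 : ℕ) * d.C) * ‖u.1‖ :=
          Hs.norm_multiplier_le d.C_nonneg (fun n => (d.shBlock n).bound) u.1
      _ = 16 * d.C * ‖u.1‖ := by push_cast; ring
      _ < 16 * d.C * (b * σ) := by gcongr
      _ = R * σ := by rw [← hR]; ring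
  · calc ‖(d.centProj u).2‖ ≤ (2 : ℕ) * ((2 : ℕ) * d.C) * ‖u.2‖ :=
          Hs.norm_multiplier_le d.C_nonneg (fun n => (d.conBlock n).bound) u.2
      _ = 4 * d.C * ‖u.2‖ := by push_cast; ring
      _ ≤ 4 * d.C * (b * τ) := by gcongr
      _ < 16 * d.C * (b * τ) := by nlinarith [mul_pos hC hbτ]
      _ = R * τ := by rw [← hR]; ring

/-- Both neighbourhoods are balls whose factor `R` makes central points have scaled size at most
`1/2`. The smaller factor `r` keeps solutions below the cutoff after the bootstrap and their central
projections inside these balls. -/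
theorem exists_center_manifold (hl : 1 / 2 < l) (hs : d.s = l + 9) {D r R : ℝ} (hr : 0 < r)
    (hD : ∀ {u w U W}, SmallModes l d.γ d.C d.α d.h u w U W →
      ModeBound U (D * u) (l + (8 + 1 : ℕ)) ∧ ModeBound W (D * w) (l + (8 + 1 : ℕ)))
    (hr1 : 2 ^ l * r ≤ 1) (hrD : D * (2 ^ l * r) ≤ 1) (hUW : d.σU ^ 2 ≤ d.σW)
    (hW : d.σW ≤ d.h ^ 2) (hrR : r ≤ R) (hC : 0 < d.C) (hCR : 16 * d.C * r ≤ R)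
    (hR : R = 2 ^ (-(d.s + l + 1))) :
    ∃ (Ou : Set (CentU l d.α (d.h ^ 2))) (Ow : Set (CentW l (d.h ^ 2)))
      (h : Cent l d.α (d.h ^ 2) → Hyp l d.α (d.h ^ 2)),
      IsOpen Ou ∧ IsOpen Ow ∧
      Metric.ball 0 (r * d.σU) ⊆ Ou ∧ Ou ⊆ Metric.ball 0 (R * d.σU) ∧
      Metric.ball 0 (r * d.σW) ⊆ Ow ∧ Ow ⊆ Metric.ball 0 (R * d.σW) ∧
      ContDiffOn ℝ 1 h (Ou ×ˢ Ow) ∧ h 0 = 0 ∧ fderiv ℝ h 0 = 0 ∧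
      (∀ X : ℝ → Phase l, IsSolutionOn d.α (d.h ^ 2) d.γ univ X →
        (∀ ξ, ‖(X ξ).1‖ < r * d.σU ∧ ‖(X ξ).2‖ < r * d.σW) →
        ∀ ξ, X ξ ∈ graphPt h '' (Ou ×ˢ Ow)) ∧
      (∀ (I : Set ℝ) (x : ℝ → Cent l d.α (d.h ^ 2)), I.OrdConnected →
        (∀ ξ ∈ I, x ξ ∈ Ou ×ˢ Ow) → IsReducedSolutionOn d.γ h I x →
        IsSolutionOn d.α (d.h ^ 2) d.γ I (fun ξ => graphPt h (x ξ))) := by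
  have hσU := d.σU_pos
  have hσW := d.σW_pos
  have hl0 : 0 ≤ l := by linarith
  have hs4 : 4 + l ≤ d.s := by linarith
  obtain ⟨Z, hZ⟩ := d.exists_isGraph
  refine ⟨Metric.ball 0 (R * d.σU), Metric.ball 0 (R * d.σW), d.reduction hl0 hs4 Z,
    Metric.isOpen_ball, Metric.isOpen_ball,
    Metric.ball_subset_ball (by gcongr), Subset.rfl, Metric.ball_subset_ball (by gcongr), Subset.rfl,
    (hZ.contDiff_reduction hl0 hs4).contDiffOn, hZ.reduction_zero hl0 hs4,
    hZ.fderiv_reduction_zero hl0 hs4, fun X hX hb ξ => ⟨d.centProj (X ξ), ?_, ?_⟩,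
    fun I x hI hx hred => ?_⟩
  · obtain ⟨h1, h2⟩ := norm_centProj_lt hC (hb ξ).1 (hb ξ).2 rfl
    refine ⟨mem_ball_zero_iff.2 (h1.trans_le ?_), mem_ball_zero_iff.2 (h2.trans_le ?_)⟩ <;> gcongr
  · exact hZ.graphPt_centProj hl0 hs4 hX
      (norm_scaled_solution_le hl hs hr hD hr1 hrD hUW hW hX hb) ξ
  · refine hZ.isSolutionOn_graphPt hl0 hs4 hs hI (fun ξ hξ i => ?_) hred
    obtain ⟨h1, h2⟩ := hx ξ hξ
    rw [mem_ball_zero_iff, hR] at h1 h2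
    exact norm_scaled_inclC_le hl0 (by linarith) h1.le h2.le i

/-- The data of the modulation system exist, for all sufficiently small scales, with constants that
do not depend on the scales. -/
theorem exists_frontData (γ : ℝ) {s : ℝ} (hs : 2 < s) : ∃ C A : ℝ, 1 ≤ C ∧ 1 ≤ A ∧
    ∀ α h u w : ℝ, 0 < h → h ≤ 1 / 1000 → 0 ≤ α → α ≤ h ^ 2 / 1000000 → 0 < u → 0 < w →
      A * w ≤ h ^ 2 → A * u ^ 2 ≤ w →
      (∀ l, Module.finrank ℂ (Cent l α (h ^ 2)) = 6) ∧
      ∃ d : FrontData, d.α = α ∧ d.h = h ∧ d.γ = γ ∧ d.σU = u ∧ d.σW = w ∧ d.s = s ∧ d.C = C := by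
  obtain ⟨μ, ρ, hρ⟩ := exists_cutoff
  obtain ⟨K₁, hK₁, hconv₁⟩ := exists_convWeight (a := s) (b := s) (by linarith) (by linarith) le_rfl
  obtain ⟨K₂, hK₂, hconv₂⟩ := exists_convWeight (a := s) (b := s - 1) (by linarith)
    (by linarith) (by linarith)
  rw [neg_sub] at hconv₂
  obtain ⟨C₁, hC₁, hsh⟩ := sh_central
  obtain ⟨K, hK, hKK₁, hKK₂⟩ : ∃ K, 0 ≤ K ∧ K₁ ≤ K ∧ K₂ ≤ K :=
    ⟨K₁ + K₂, by linarith, by linarith, by linarith⟩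
  obtain ⟨C, hCC₁, hC⟩ : ∃ C, C₁ ≤ C ∧ 20000000 ≤ C :=
    ⟨max C₁ 20000000, le_max_left _ _, le_max_right _ _⟩
  have hC0 : 0 < C := by linarith
  have hμ := hρ.pos
  -- The coefficients of `w` and `u²` in the two smallness conditions, once `u²` is replaced by `w`
  -- in the cubic term.
  set A₁ : ℝ := 4 * μ ^ 2 * K + ‖-(1 + (γ : ℂ))‖ * (16 * μ ^ 3 * K ^ 2) with hA₁
  set A₂ : ℝ := 8 * |γ| * μ ^ 2 * K with hA₂
  have hA₁0 : 0 ≤ A₁ := by positivity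
  have hA₂0 : 0 ≤ A₂ := by positivity
  refine ⟨C, 1 + 2 * C * (A₁ + A₂), by linarith, ?_, fun α h u w hh hh1 hα hα1 hu hw hwh huw => ?_⟩
  · have : 0 ≤ 2 * C * (A₁ + A₂) := by positivity
    linarith
  have hCw : 0 ≤ 2 * C * (A₁ * w) := by positivity
  have hCw' : 0 ≤ 2 * C * (A₂ * w) := by positivity
  have hCu : 0 ≤ 2 * C * (A₁ * u ^ 2) := by positivity
  have hCu' : 0 ≤ 2 * C * (A₂ * u ^ 2) := by positivity
  have huw' : u ^ 2 ≤ w := by linarith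
  have hL : ∀ {x y : ℝ}, 2 * C * x ≤ y → x ≤ 1 / (2 * C) * y := fun {x y} hxy => by
    rw [one_div, inv_mul_eq_div, le_div_iff₀ (by positivity)]
    linarith
  -- With `L = 1 / (2 C)`, the largest value allowed by `C L ≤ 1/2`, the smallness conditions become
  -- `2 C A₁ w ≤ h²` and `2 C A₂ u² ≤ w`, both covered by the choice of `A`.
  have hsmallU : A₁ * w ≤ 1 / (2 * C) * h ^ 2 := hL (by linarith)
  have hsmallW : A₂ * u ^ 2 ≤ 1 / (2 * C) * w := hL (by linarith [sq_nonneg u])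
  have hcon := con_central hh hh1 hC
  have hshP : ∀ n : ℤ, n ≠ 1 → n ≠ -1 → centralProj (LSH α (h ^ 2) n) = 0 := fun n h1 h2 =>
    (sh_hyperbolic hh hh1 hα hα1 h1 h2 le_rfl).1
  have hconP : ∀ n : ℤ, n ≠ 0 → centralProj (Lcon (h ^ 2) n) = 0 := fun n hn =>
    (con_hyperbolic hh hh1 hn le_rfl).1
  refine ⟨fun l => finrank_cent (hsh h _ 1 hh hh1 hα hα1 (Or.inl rfl) C hCC₁).2
    (hsh h _ (-1) hh hh1 hα hα1 (Or.inr rfl) C hCC₁).2 hcon.1 hshP hconP,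
    { α := α, h := h, γ := γ, σU := u, σW := w, s := s, C := C, L := 1 / (2 * C), K := K, μ := μ
      ρ := ρ, h_pos := hh, σU_pos := hu, σW_pos := hw, C_nonneg := hC0.le
      L_nonneg := by positivity
      K_nonneg := hK
      shBlock := fun n => by
        by_cases hn : n = 1 ∨ n = -1
        · exact (hsh h _ n hh hh1 hα hα1 hn C hCC₁).1
        · rw [not_or] at hn
          exact (sh_hyperbolic hh hh1 hα hα1 hn.1 hn.2 (by linarith)).2
      conBlock := fun n => by
        by_cases hn : n = 0
        · subst hn; exact hcon.2
        · exact (con_hyperbolic hh hh1 hn (by linarith)).2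
      shProj := hshP
      conProj := hconP
      cutoff := hρ
      conv := hconv₁.mono hKK₁ fun n => (wt_rpow_pos n _).le
      conv' := hconv₂.mono hKK₂ fun n => (wt_rpow_pos n _).le
      smallU := ?_
      smallW := ?_
      CL_le := by field_simp; rfl }, rfl, rfl, rfl, rfl, rfl, rfl, rfl⟩
  · calc _ = u * (4 * μ ^ 2 * K * w + ‖-(1 + (γ : ℂ))‖ * (16 * μ ^ 3 * K ^ 2) * u ^ 2) := by ring
      _ ≤ u * (4 * μ ^ 2 * K * w + ‖-(1 + (γ : ℂ))‖ * (16 * μ ^ 3 * K ^ 2) * w) := by gcongr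
      _ = u * (A₁ * w) := by rw [hA₁]; ring
      _ ≤ u * (1 / (2 * C) * h ^ 2) := by gcongr
      _ = _ := by ring
  · rw [norm_mul, norm_mul, Complex.norm_ofNat, Complex.norm_real, Complex.norm_real,
      Real.norm_eq_abs, Real.norm_eq_abs, abs_of_nonneg (sq_nonneg h)]
    calc _ = h ^ 2 * (A₂ * u ^ 2) := by rw [hA₂]; ring
      _ ≤ h ^ 2 * (1 / (2 * C) * w) := by gcongr
      _ = _ := by ring

end FrontData

/-- All dependence on ε enters through the inequalities between `α`, `k²`, `u` and `w`; the
constants `r`, `R`, `A` depend only on `γ` and `l`. -/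
theorem exists_center_manifold_of_scales (γ : ℝ) {l : ℝ} (hl : 1 / 2 < l) :
    ∃ r R A : ℝ, 0 < r ∧ 0 < R ∧ 1 ≤ A ∧
    ∀ α k u w : ℝ, 0 < k → k ≤ 1 / 1000 → 0 ≤ α → α ≤ k ^ 2 / 1000000 → 0 < u → 0 < w →
      A * w ≤ k ^ 2 → A * u ^ 2 ≤ w →
      Module.finrank ℂ (Cent l α (k ^ 2)) = 6 ∧
      ∃ (Ou : Set (CentU l α (k ^ 2))) (Ow : Set (CentW l (k ^ 2)))
        (h : Cent l α (k ^ 2) → Hyp l α (k ^ 2)),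
        IsOpen Ou ∧ IsOpen Ow ∧
        Metric.ball 0 (r * u) ⊆ Ou ∧ Ou ⊆ Metric.ball 0 (R * u) ∧
        Metric.ball 0 (r * w) ⊆ Ow ∧ Ow ⊆ Metric.ball 0 (R * w) ∧
        ContDiffOn ℝ 1 h (Ou ×ˢ Ow) ∧ h 0 = 0 ∧ fderiv ℝ h 0 = 0 ∧
        (∀ X : ℝ → Phase l, IsSolutionOn α (k ^ 2) γ univ X →
          (∀ ξ, ‖(X ξ).1‖ < r * u ∧ ‖(X ξ).2‖ < r * w) →
          ∀ ξ, X ξ ∈ graphPt h '' (Ou ×ˢ Ow)) ∧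
        (∀ (I : Set ℝ) (x : ℝ → Cent l α (k ^ 2)), I.OrdConnected →
          (∀ ξ ∈ I, x ξ ∈ Ou ×ˢ Ow) → IsReducedSolutionOn γ h I x →
          IsSolutionOn α (k ^ 2) γ I (fun ξ => graphPt h (x ξ))) := by
  obtain ⟨C, A, hC, hA, hd⟩ := FrontData.exists_frontData γ (s := l + 9) (by linarith)
  have hC0 : 0 < C := by linarith
  obtain ⟨D, hD0, hD⟩ := SmallModes.exists_modeBound hl γ C 8
  have h2l : (1 : ℝ) ≤ 2 ^ l := Real.one_le_rpow (by norm_num) (by linarith)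
  obtain ⟨R, hR⟩ : ∃ R : ℝ, R = 2 ^ (-(l + 9 + l + 1)) := ⟨_, rfl⟩
  have hR0 : 0 < R := hR ▸ Real.rpow_pos_of_pos (by norm_num) _
  have hR1 : R ≤ 1 := hR ▸ Real.rpow_le_one_of_one_le_of_nonpos (by norm_num) (by linarith)
  -- The divisor collects `16 C` for the norm of the central projection, `2 ^ l` for the passage to
  -- weighted modes and `D + 1` for the bootstrap.
  obtain ⟨r, hr⟩ : ∃ r : ℝ, r = R / (16 * C * 2 ^ l * (D + 1)) := ⟨_, rfl⟩
  have hr0 : 0 < r := hr ▸ by positivity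
  have hrM : 16 * C * 2 ^ l * (D + 1) * r = R := by rw [hr]; field_simp
  have hr16 : 16 * C * r ≤ R := by
    calc 16 * C * r = 16 * C * 1 * (0 + 1) * r := by ring
      _ ≤ 16 * C * 2 ^ l * (D + 1) * r := by gcongr
      _ = R := hrM
  have hrD : (D + 1) * (2 ^ l * r) ≤ 1 := by
    calc (D + 1) * (2 ^ l * r) = 1 * ((D + 1) * (2 ^ l * r)) := by ring
      _ ≤ 16 * C * ((D + 1) * (2 ^ l * r)) := by gcongr; linarith
      _ = 16 * C * 2 ^ l * (D + 1) * r := by ring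
      _ ≤ 1 := hrM ▸ hR1
  have h2r : 0 < 2 ^ l * r := by positivity
  have hrR : r ≤ R := by nlinarith
  refine ⟨r, R, A, hr0, hR0, hA, fun α k u w hk hk1 hα hα1 hu hw hwk huw => ?_⟩
  have huw' : u ^ 2 ≤ w := by nlinarith
  have hwk' : w ≤ k ^ 2 := by nlinarith
  obtain ⟨hdim, d, rfl, rfl, rfl, rfl, rfl, hs, rfl⟩ := hd α k u w hk hk1 hα hα1 hu hw hwk huw
  exact ⟨hdim l, d.exists_center_manifold hl hs hr0 hD (by nlinarith) (by nlinarith) huw' hwk' hrR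
    hC0 hr16 (by rw [hs, hR])⟩

theorem eventually_rpow_le {a b : ℝ} (ha : 0 < a) (hb : 0 < b) :
    ∀ᶠ ε : ℝ in 𝓝[>] 0, ε ^ a ≤ b := by
  have h : Tendsto (fun ε : ℝ => ε ^ a) (𝓝[>] 0) (𝓝 0) := by
    have := (Real.continuousAt_rpow_const 0 a (Or.inr ha.le)).tendsto
    rw [Real.zero_rpow ha.ne'] at this
    exact this.mono_left nhdsWithin_le_nhds
  exact (h.eventually (gt_mem_nhds hb)).mono fun _ h => h.le

end ModFront

theorem theorem3p4 (α₀ c₀ : ℝ) (hα₀ : 0 < α₀) (hc₀ : 0 < c₀) (l δ γ : ℝ) (hl : 1 / 2 < l)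
    (hδ₀ : 0 < δ) (hδ₁ : δ < 1 / 3) :
    ∃ r R ε₀ : ℝ, 0 < r ∧ 0 < R ∧ 0 < ε₀ ∧ ∀ ε : ℝ, 0 < ε → ε < ε₀ →
      Module.finrank ℂ (Cent l (ε ^ 2 * α₀) (ε * c₀)) = 6 ∧
      ∃ (Ou : Set (CentU l (ε ^ 2 * α₀) (ε * c₀))) (Ow : Set (CentW l (ε * c₀)))
        (h : Cent l (ε ^ 2 * α₀) (ε * c₀) → Hyp l (ε ^ 2 * α₀) (ε * c₀)),
        -- `O_u`, `O_w` are open neighbourhoods of the origin of the asserted size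
        IsOpen Ou ∧ IsOpen Ow ∧
        Metric.ball 0 (r * ε ^ (2 / 3 + δ)) ⊆ Ou ∧ Ou ⊆ Metric.ball 0 (R * ε ^ (2 / 3 + δ)) ∧
        Metric.ball 0 (r * ε ^ (4 / 3 : ℝ)) ⊆ Ow ∧ Ow ⊆ Metric.ball 0 (R * ε ^ (4 / 3 : ℝ)) ∧
        -- the graph of `h` is a manifold tangent to the central subspace at the origin
        ContDiffOn ℝ 1 h (Ou ×ˢ Ow) ∧ h 0 = 0 ∧ fderiv ℝ h 0 = 0 ∧
        -- the graph contains all small bounded solutions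
        (∀ X : ℝ → Phase l, IsSolutionOn (ε ^ 2 * α₀) (ε * c₀) γ univ X →
          (∀ ξ, ‖(X ξ).1‖ < r * ε ^ (2 / 3 + δ) ∧ ‖(X ξ).2‖ < r * ε ^ (4 / 3 : ℝ)) →
          ∀ ξ, X ξ ∈ graphPt h '' (Ou ×ˢ Ow)) ∧
        -- solutions of the reduced system give solutions of the full system
        (∀ (I : Set ℝ) (x : ℝ → Cent l (ε ^ 2 * α₀) (ε * c₀)), I.OrdConnected →
          (∀ ξ ∈ I, x ξ ∈ Ou ×ˢ Ow) → IsReducedSolutionOn γ h I x →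
          IsSolutionOn (ε ^ 2 * α₀) (ε * c₀) γ I (fun ξ => graphPt h (x ξ))) := by
  obtain ⟨r, R, A, hr, hR, hA, H⟩ := exists_center_manifold_of_scales γ hl
  -- In this order: `k ≤ 1/1000`, `α ≤ k² / 10⁶`, `A w ≤ k²` and `A u² ≤ w`. The last one is where
  -- `δ > 0` is used.
  have e1 := eventually_rpow_le one_pos (b := 1 / (1000000 * c₀)) (by positivity)
  have e2 := eventually_rpow_le one_pos (b := c₀ / (1000000 * α₀)) (by positivity)
  have e3 := eventually_rpow_le (a := 1 / 3) (by norm_num) (b := c₀ / A) (by positivity)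
  have e4 := eventually_rpow_le (a := 2 * δ) (by linarith) (b := 1 / A) (by positivity)
  obtain ⟨ε₀, hε₀, hev⟩ := mem_nhdsGT_iff_exists_Ioo_subset.1 (e1.and (e2.and (e3.and e4)))
  refine ⟨r, R, ε₀, hr, hR, hε₀, fun ε hε hεε₀ => ?_⟩
  obtain ⟨h1, h2, h3, h4⟩ := hev ⟨hε, hεε₀⟩
  rw [Real.rpow_one] at h1 h2
  rw [le_div_iff₀ (by positivity)] at h1 h2 h3 h4
  have hσU : 0 < ε ^ (2 / 3 + δ) := Real.rpow_pos_of_pos hε _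
  have hσW : 0 < ε ^ (4 / 3 : ℝ) := Real.rpow_pos_of_pos hε _
  have hWa : ε ^ (4 / 3 : ℝ) = ε * ε ^ (1 / 3 : ℝ) := by
    rw [← Real.rpow_one_add' hε.le (by norm_num)]; norm_num
  have hUb : (ε ^ (2 / 3 + δ)) ^ 2 = ε ^ (4 / 3 : ℝ) * ε ^ (2 * δ) := by
    rw [← Real.rpow_natCast, ← Real.rpow_mul hε.le, ← Real.rpow_add hε]
    congr 1; push_cast; ring
  -- The square root of the speed is the natural scale of the hyperbolic real parts.
  obtain ⟨k, hk0, hk⟩ : ∃ k : ℝ, 0 < k ∧ ε * c₀ = k ^ 2 :=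
    ⟨√(ε * c₀), by positivity, (Real.sq_sqrt (by positivity)).symm⟩
  have hk1 : k ≤ 1 / 1000 := le_of_sq_le_sq (by rw [← hk]; linarith) (by norm_num)
  rw [hk]
  refine H _ k _ _ hk0 hk1 (by positivity) ?_ hσU hσW ?_ ?_
  · rw [← hk]
    nlinarith
  · rw [← hk, hWa]
    nlinarith
  · rw [hUb]
    nlinarith
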